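/- Let $m\ge 1$ be an integer, $T>0$, let $a_1,\dots,a_m:[0,T]\to\mathbb R$ be real-analytic functions on $[0,T]$ (analytic up to the endpoints), and let $f(u)=\sum_{\nu\ge 0}c_\nu u^\nu$ ($c_\nu\in\mathbb R$) be a power series converging for every $u\in\mathbb R$. Consider the equation $$\partial_t^m u+a_1(t)\,\partial_t^{m-1}\partial_x u+\cdots+a_m(t)\,\partial_x^m u=f(u)\qquad\text{on }[0,T]\times\mathbb R. \tag{1}$$ Assume that for every $t\in[0,T]$ the roots $\lambda_1(t),\dots,\lambda_m(t)$ (counted with multiplicity) of the characteristic polynomial $X^m+a_1(t)X^{m-1}+\cdots+a_m(t)$ are real, and that for some constant $M$ $$\lambda_i(t)^2+\lambda_j(t)^2\le M\,(\lambda_i(t)-\lambda_j(t))^2\qquad\forall\,t\in[0,T],\ \forall\, i\ne j .$$ Let $\mathcal A_{L^2}$ be the class of all $\varphi\in C^\infty(\mathbb R)$ for which there are constants $C,\Lambda$ with $\|\varphi^{(j)}\|_{L^2(\mathbb R)}\le C\Lambda^j j!$ for all $j\in\mathbb N$; it is the union over $\Lambda>0$ of the Banach spaces $\mathcal A_{L^2,\Lambda}$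 with norms $\sup_j \|\varphi^{(j)}\|_{L^2}/(\Lambda^j j!)$. The notation $u\in C^{k}([0,T],\mathcal A_{L^2})$ means that, for some $\Lambda>0$, the map $t\mapsto u(t,\cdot)$ is $k$ times continuously differentiable from $[0,T]$ to $\mathcal A_{L^2,\Lambda}$. Let $u:[0,T]\times\mathbb R\to\mathbb R$ be a solution of (1), of class $C^m$ in $t$, whose derivatives $\partial_t^h\partial_x^j u$ with $0\le h\le m-1$, $j\in\mathbb N$, exist and are continuous on $[0,T]\times\mathbb R$, and suppose that for $h=0,1,\dots,m-1$ $$\sup_{0\le t\le T}\int_{\mathbb R}|\partial_t^h\partial_x^j u(t,x)|\,dx<\infty\quad\forall\,j\in\mathbb N,\qquad\text{and}\qquad \partial_t^h u(0,\cdot)\in\mathcal A_{L^2}.$$ Then $$u\in C^{m-1}([0,T],\mathcal A_{L^2}),$$ and moreover $u$ is real-analytic on $[0,T]\times\mathbb R$ (near each point of this set $u$ is given there by a convergent power series in $(t,x)$). -/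

import Mathlib

open Set Filter Topology MeasureTheory
open scoped ENNReal NNReal ContDiff Nat

noncomputable section

namespace SemilinearHyperbolic

/-- `f` is the sum on `ℝ` of an everywhere convergent power series with real coefficients,
i.e. the restriction to `ℝ` of an entire function which is real on `ℝ`. -/
def IsRealEntire (f : ℝ → ℝ) : Prop :=
  ∃ c : ℕ → ℝ, ∀ y : ℝ, HasSum (fun ν : ℕ => c ν * y ^ ν) (f y)

/-- The time derivative `∂_t^h u (t, x)` of a function on `[0,T] × ℝ` (one-sided at `t = 0, T`). -/
def timeDeriv (T : ℝ) (u : ℝ → ℝ → ℝ) (h : ℕ) (t x : ℝ) : ℝ :=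
  iteratedDerivWithin h (fun s => u s x) (Icc 0 T) t

/-- The mixed derivative `∂_x^j ∂_t^h u (t, x)` of a function on `[0,T] × ℝ`. -/
def mixedDeriv (T : ℝ) (u : ℝ → ℝ → ℝ) (h j : ℕ) (t x : ℝ) : ℝ :=
  iteratedDeriv j (timeDeriv T u h t) x

/-- `u` is a classical solution on `[0,T] × ℝ` of
`∂_t^m u + a₁(t) ∂_t^{m-1} ∂_x u + ⋯ + a_m(t) ∂_x^m u = f(u)`:
it is `m` times continuously differentiable in time, the derivatives `∂_x^j ∂_t^h u` with `h < m`
and `j` arbitrary exist and are continuous on `[0,T] × ℝ` (so that the order of differentiation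
is immaterial), and the equation holds at every point. -/
structure IsSolution (m : ℕ) (T : ℝ) (a : ℕ → ℝ → ℝ) (f : ℝ → ℝ) (u : ℝ → ℝ → ℝ) : Prop where
  contDiff_time : ∀ x : ℝ, ContDiffOn ℝ m (fun t => u t x) (Icc 0 T)
  contDiff_space : ∀ h < m, ∀ t ∈ Icc 0 T, ContDiff ℝ ∞ (timeDeriv T u h t)
  continuous_mixed : ∀ h < m, ∀ j : ℕ,
    ContinuousOn (fun p : ℝ × ℝ => mixedDeriv T u h j p.1 p.2) (Icc 0 T ×ˢ univ)
  equation : ∀ t ∈ Icc 0 T, ∀ x : ℝ,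
    timeDeriv T u m t x + ∑ k ∈ Finset.Icc 1 m, a k t * mixedDeriv T u (m - k) k t x = f (u t x)

/-- For each `t ∈ [0,T]` the numbers `lam i t` are the roots, with multiplicity, of the
characteristic polynomial `X^m + a₁(t) X^{m-1} + ⋯ + a_m(t)`. -/
def AreCharRoots (m : ℕ) (T : ℝ) (a : ℕ → ℝ → ℝ) (lam : Fin m → ℝ → ℝ) : Prop :=
  ∀ t ∈ Icc 0 T,
    (Polynomial.X ^ m + ∑ k ∈ Finset.Icc 1 m, Polynomial.C (a k t) * Polynomial.X ^ (m - k) :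
      Polynomial ℝ) = ∏ i : Fin m, (Polynomial.X - Polynomial.C (lam i t))

/-- The class `A_{L²}`: smooth `g` with `‖g^{(j)}‖_{L²} ≤ C Λ^j j!` for all `j`. -/
def InAL2 (g : ℝ → ℝ) : Prop :=
  ContDiff ℝ ∞ g ∧ ∃ C Λ : ℝ≥0, ∀ j : ℕ,
    eLpNorm (iteratedDeriv j g) 2 volume ≤ ((C * Λ ^ j * (j ! : ℝ≥0) : ℝ≥0) : ℝ≥0∞)

/-- The norm `sup_j ‖g^{(j)}‖_{L²} / (Λ^j j!)` of the Banach space `A_{L²,Λ}`;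
`A_{L²}` is the union of these spaces over `Λ > 0`, with the inductive limit topology. -/
def stepNorm (Λ : ℝ≥0) (g : ℝ → ℝ) : ℝ≥0∞ :=
  ⨆ j : ℕ, eLpNorm (iteratedDeriv j g) 2 volume / ((Λ ^ j * (j ! : ℝ≥0) : ℝ≥0) : ℝ≥0∞)

/-- `u ∈ C^k([0,T], A_{L²})`: for some `Λ > 0`, `t ↦ u(t,·)` is `k` times continuously
differentiable on `[0,T]` with values in the Banach space `A_{L²,Λ}`, that is, for `h ≤ k` the
functions `∂_t^h u(t,·)` belong to `A_{L²,Λ}` and depend continuously on `t` in its norm, and for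
`h < k` the difference quotients of `t ↦ ∂_t^h u(t,·)` converge in that norm to
`∂_t^{h+1} u(t,·)`. -/
def IsCkAL2 (k : ℕ) (T : ℝ) (u : ℝ → ℝ → ℝ) : Prop :=
  ∃ Λ : ℝ≥0, 0 < Λ ∧
    (∀ h ≤ k, ∀ t ∈ Icc 0 T,
      ContDiff ℝ ∞ (timeDeriv T u h t) ∧ stepNorm Λ (timeDeriv T u h t) < ⊤ ∧
      Tendsto (fun s => stepNorm Λ (fun x => timeDeriv T u h s x - timeDeriv T u h t x))
        (𝓝[Icc 0 T] t) (𝓝 0)) ∧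
    (∀ h < k, ∀ t ∈ Icc 0 T,
      Tendsto (fun s => stepNorm Λ (fun x =>
          (timeDeriv T u h s x - timeDeriv T u h t x) / (s - t) - timeDeriv T u (h + 1) t x))
        (𝓝[Icc 0 T \ {t}] t) (𝓝 0))

end SemilinearHyperbolic

end

/-! After a Fourier transform in `x`, each frequency `ξ` gives an ordinary differential equation of
order `m` in `t`, with source the transform of `f(u)`. Everything reduces to one estimate,
`ExpDecayAt`: for some `ρ > 0` the integrals of `exp (ρ |ξ|) |∂_t^h û(t, ξ)|`, `h < m`, are bounded
uniformly in `t`. The data satisfy it by `InAL2.exists_exp_decay`, and it must be propagated over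
`[0,T]`.

Linear part. The hypothesis on the roots says that nonzero roots are simple and separated in
proportion to their size. Near any `t₀` an analytic coefficient satisfies `|a_k'| ≤ K |a_k| / |t -
t₀|`, because a logarithmic derivative has only simple poles. Together these give `|λ_i'| ≤ C |λ_i -
λ_j| / |t - t₀|` for all `j ≠ i`, for a suitable local labelling of the roots
(`exists_rootsRegularAt`). The energy is built from the partial products of the factors `∂_t - i η
λ_j`. When a root inside such a product is differentiated, the resulting term carries `η λ_i'`. The
separation bound turns it into a difference of two other terms of the energy, so the energy grows at
rate `N / |t - t₀|`, independently of `η` (`hasDerivAt_energy`). With `y = 1 + |ξ|`, integrating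
this rate over `|t - t₀| ≥ 1/y` costs only a power of `y`. On the remaining interval, of length
`1/y`, the crude companion-system bound costs a constant. This yields `mode_estimate_left` and
`mode_estimate_right`.

A polynomial loss in the Duhamel integral could not be iterated in a nonlinear problem. The loss is
therefore stored in a weight `Ω(t, ξ)` that multiplies both the mode and the source. This weight is
submultiplicative in `ξ`, so weighted `L¹` of the Fourier side is a convolution algebra. In this
algebra an entire function vanishing at `0` acts with a bound that is linear in the first moment
(`lintegral_enorm_ft_comp_le`). Here `f 0 = 0` is forced by integrability of the solution.

Nonlinear part. The generating function of the weighted moments with parameter `ρ` satisfies an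
inequality that loses one `ρ`-derivative. Letting `ρ` decrease exponentially in time absorbs that
loss, the rate being fixed in advance by the level of a barrier (`exists_moment_bound`). Since
truncated sums are used, finiteness of the full sum is never assumed.

Globalization. At each time there is a one-sided neighbourhood whose length does not depend on `ρ`
or on the bound, so a supremum argument reaches `T` (`Setting.exists_expDecayAt`).

Conclusions. Plancherel and the bound of a Fourier transform by the `L¹` norm convert exponential
decay into the norms of `A_{L²}`. For joint analyticity, the decay bounds all spatial derivatives of
the first `m` time derivatives. The equation then determines the higher time derivatives
recursively, and a Cauchy–Kovalevskaya majorant stable under Cauchy products controls them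
(`JetConstants.abs_rhsJet_le`). Taylor expansion in `x` and then in `t` completes the proof. -/

namespace SemilinearHyperbolic

/-! ### Differentiable choice of the characteristic roots -/

section Roots

open Polynomial

/-- The characteristic polynomial `X^m + a₁(t) X^{m-1} + ⋯ + a_m(t)`. -/
noncomputable def charPoly (m : ℕ) (a : ℕ → ℝ → ℝ) (t : ℝ) : ℝ[X] :=
  X ^ m + ∑ k ∈ Finset.Icc 1 m, C (a k t) * X ^ (m - k)

theorem charPoly_coeff {m : ℕ} (a : ℕ → ℝ → ℝ) (t : ℝ) {k : ℕ} (hk : k ∈ Finset.Icc 1 m) :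
    (charPoly m a t).coeff (m - k) = a k t := by
  rw [Finset.mem_Icc] at hk
  simp only [charPoly, coeff_add, coeff_X_pow, finsetSum_coeff, coeff_C_mul]
  rw [if_neg (by omega), zero_add, Finset.sum_eq_single k]
  · simp
  · intro b hb hbk
    rw [Finset.mem_Icc] at hb
    rw [if_neg (by omega), mul_zero]
  · intro h
    exact absurd (Finset.mem_Icc.2 hk) h

theorem charPoly_eval (m : ℕ) (a : ℕ → ℝ → ℝ) (t x : ℝ) :
    (charPoly m a t).eval x = x ^ m + ∑ k ∈ Finset.Icc 1 m, a k t * x ^ (m - k) := by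
  simp [charPoly, eval_finsetSum]

/-- The coefficients are dominated by those of the product of the `X + C |lam j|`, whose value at
`r` is the right side. Later only single terms are used, at `r = |lam i|`: root separation then
compares the product with the derivative of the characteristic polynomial at `lam i`. -/
theorem sum_abs_coeff_prod_le {ι : Type*} (s : Finset ι) (lam : ι → ℝ) {r : ℝ} (hr : 0 ≤ r)
    (n : ℕ) :
    ∑ i ∈ Finset.range n, |(∏ j ∈ s, (X - C (lam j)) : ℝ[X]).coeff i| * r ^ i
      ≤ ∏ j ∈ s, (r + |lam j|) := by
  classical
  induction s using Finset.induction_on generalizing n with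
  | empty =>
    simp only [Finset.prod_empty]
    rcases n with _ | n
    · simp
    · rw [Finset.sum_range_succ']
      simp [coeff_one]
  | insert j s hj ih =>
    rw [Finset.prod_insert hj, Finset.prod_insert hj]
    set Q : ℝ[X] := ∏ j ∈ s, (X - C (lam j)) with hQ
    have h0 : ∀ n, ∑ i ∈ Finset.range n, |(X * Q).coeff i| * r ^ i
        ≤ r * ∏ j ∈ s, (r + |lam j|) := by
      intro n
      rcases n with _ | n
      · simp only [Finset.range_zero, Finset.sum_empty]
        exact mul_nonneg hr (Finset.prod_nonneg fun i _ => by positivity)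
      · rw [Finset.sum_range_succ']
        simp only [coeff_X_mul, coeff_X_mul_zero, abs_zero, zero_mul, add_zero]
        calc _ = r * ∑ i ∈ Finset.range n, |Q.coeff i| * r ^ i := by
              rw [Finset.mul_sum]
              exact Finset.sum_congr rfl fun i _ => by ring
          _ ≤ _ := mul_le_mul_of_nonneg_left (ih n) hr
    calc _ ≤ ∑ i ∈ Finset.range n, (|(X * Q).coeff i| * r ^ i
            + |lam j| * (|Q.coeff i| * r ^ i)) := by
          refine Finset.sum_le_sum fun i _ => ?_
          rw [sub_mul, coeff_sub, coeff_C_mul, ← mul_assoc, ← add_mul, ← abs_mul]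
          exact mul_le_mul_of_nonneg_right (abs_sub _ _) (by positivity)
      _ ≤ _ := by
          rw [Finset.sum_add_distrib, ← Finset.mul_sum, add_mul]
          exact add_le_add (h0 n) (mul_le_mul_of_nonneg_left (ih n) (abs_nonneg _))

theorem abs_coeff_mul_pow_le {m : ℕ} {a : ℕ → ℝ → ℝ} {lam : Fin m → ℝ} {t : ℝ}
    (hlam : charPoly m a t = ∏ i, (X - C (lam i))) {k : ℕ} (hk : k ∈ Finset.Icc 1 m)
    {r : ℝ} (hr : 0 ≤ r) : |a k t| * r ^ (m - k) ≤ ∏ j, (r + |lam j|) := by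
  refine le_trans ?_ (sum_abs_coeff_prod_le Finset.univ lam hr (m + 1))
  rw [← hlam, ← charPoly_coeff a t hk]
  exact Finset.single_le_sum (f := fun i => |(charPoly m a t).coeff i| * r ^ i)
    (fun i _ => by positivity) (Finset.mem_range.2 (by omega))

theorem eval_derivative_prod_X_sub_C {ι : Type*} [DecidableEq ι] (s : Finset ι) (lam : ι → ℝ)
    {i : ι} (hi : i ∈ s) :
    (derivative (∏ j ∈ s, (X - C (lam j)) : ℝ[X])).eval (lam i)
      = ∏ j ∈ s.erase i, (lam i - lam j) := by
  rw [← Finset.mul_prod_erase s _ hi]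
  simp [derivative_mul, eval_prod]

/-- The two families have the same multiset of values, so sorting both aligns them index by index.
-/
theorem perm_of_prod_X_sub_C_eq {m : ℕ} {μ ν : Fin m → ℝ}
    (h : (∏ i, (X - C (μ i)) : ℝ[X]) = ∏ i, (X - C (ν i))) :
    ∃ σ : Equiv.Perm (Fin m), ∀ i, μ i = ν (σ i) := by
  have key : Finset.univ.val.map μ = Finset.univ.val.map ν := by
    have h1 : ∀ μ : Fin m → ℝ, (∏ i, (X - C (μ i)) : ℝ[X]).roots = Finset.univ.val.map μ := by
      intro μ
      have : (∏ i, (X - C (μ i)) : ℝ[X])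
          = ((Finset.univ.val.map μ).map fun a => X - C a).prod := by
        rw [Multiset.map_map]; rfl
      rw [this, roots_multiset_prod_X_sub_C]
    rw [← h1, ← h1, h]
  have h2 : (List.ofFn μ).Perm (List.ofFn ν) := by
    rw [← Multiset.coe_eq_coe]
    simpa [Fin.univ_def, List.ofFn_eq_map] using key
  have h3 : μ ∘ Tuple.sort μ = ν ∘ Tuple.sort ν := by
    refine List.ofFn_injective (List.Perm.eq_of_pairwise' (r := (· ≤ ·))
      (Tuple.monotone_sort μ).sortedLE_ofFn.pairwise
      (Tuple.monotone_sort ν).sortedLE_ofFn.pairwise ?_)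
    exact ((Tuple.sort μ).ofFn_comp_perm μ).trans (h2.trans ((Tuple.sort ν).ofFn_comp_perm ν).symm)
  refine ⟨(Tuple.sort μ).symm.trans (Tuple.sort ν), fun i => ?_⟩
  simpa using congrFun h3 ((Tuple.sort μ).symm i)

/-- A simple root persists by the implicit function theorem. Its derivative comes from
differentiating the identity `P_s(ψ s) = 0` at `s = t`. -/
theorem exists_implicit_root {m : ℕ} {a : ℕ → ℝ → ℝ} {t x : ℝ}
    (ha : ∀ k ∈ Finset.Icc 1 m, AnalyticAt ℝ (a k) t)
    (hx : (charPoly m a t).eval x = 0) (hx' : (derivative (charPoly m a t)).eval x ≠ 0) :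
    ∃ ψ : ℝ → ℝ, ψ t = x ∧ (∀ᶠ s in 𝓝 t, (charPoly m a s).eval (ψ s) = 0) ∧
      HasDerivAt ψ (-(∑ k ∈ Finset.Icc 1 m, deriv (a k) t * x ^ (m - k))
        / (derivative (charPoly m a t)).eval x) t := by
  set f : ℝ × ℝ → ℝ := fun p => p.2 ^ m + ∑ k ∈ Finset.Icc 1 m, a k p.1 * p.2 ^ (m - k) with hf
  have hfe : ∀ s x, f (s, x) = (charPoly m a s).eval x := fun s x => by rw [charPoly_eval]
  have hfan : AnalyticAt ℝ f (t, x) := by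
    refine (analyticAt_snd.pow m).add (Finset.analyticAt_fun_sum _ fun k hk => ?_)
    exact (AnalyticAt.fun_comp (g := a k) (f := Prod.fst) (ha k hk) analyticAt_fst).mul
      (analyticAt_snd.pow _)
  have hstrict : HasStrictFDerivAt f (fderiv ℝ f (t, x)) (t, x) := hfan.hasStrictFDerivAt
  set L := fderiv ℝ f (t, x) with hL
  have hL2 : L (0, 1) = (derivative (charPoly m a t)).eval x := by
    have h1 : HasDerivAt (fun s : ℝ => f (t, s)) (L (0, 1)) x :=
      hstrict.hasFDerivAt.comp_hasDerivAt x ((hasDerivAt_const x t).prodMk (hasDerivAt_id x))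
    have h2 : HasDerivAt (fun s : ℝ => f (t, s)) ((derivative (charPoly m a t)).eval x) x := by
      simp only [hfe]
      exact (charPoly m a t).hasDerivAt x
    exact h1.unique h2
  have hL1 : L (1, 0) = ∑ k ∈ Finset.Icc 1 m, deriv (a k) t * x ^ (m - k) := by
    have h1 : HasDerivAt (fun s : ℝ => f (s, x)) (L (1, 0)) t :=
      HasFDerivAt.comp_hasDerivAt (f := fun s : ℝ => (s, x)) t hstrict.hasFDerivAt
        ((hasDerivAt_id t).prodMk (hasDerivAt_const t x))
    have h2 : HasDerivAt (fun s : ℝ => f (s, x))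
        (∑ k ∈ Finset.Icc 1 m, deriv (a k) t * x ^ (m - k)) t := by
      have := (hasDerivAt_const t (x ^ m)).add (HasDerivAt.fun_sum (u := Finset.Icc 1 m)
        fun k hk => ((ha k hk).differentiableAt.hasDerivAt.mul_const (x ^ (m - k))))
      refine (this.congr_deriv (by simp)).congr_of_eventuallyEq (Eventually.of_forall fun s => ?_)
      simp [hf]
    exact h1.unique h2
  have hinv : (L ∘SL ContinuousLinearMap.inr ℝ ℝ ℝ).IsInvertible := by
    have h0 : L (0, 1) ≠ 0 := by rw [hL2]; exact hx'
    refine ⟨ContinuousLinearEquiv.unitsEquivAut ℝ (Units.mk0 _ h0), ?_⟩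
    ext
    simp
  set ψ := hstrict.implicitFunctionOfProdDomain hinv with hψ
  have hψt : ψ t = x := by
    exact (hstrict.eventually_apply_eq_iff_implicitFunctionOfProdDomain hinv).self_of_nhds.mp rfl
  obtain ⟨d, hψd⟩ : ∃ d, HasDerivAt ψ d t :=
    ⟨_, (hstrict.hasStrictFDerivAt_implicitFunctionOfProdDomain hinv).hasFDerivAt.hasDerivAt⟩
  have hψe : ∀ᶠ s in 𝓝 t, f (s, ψ s) = 0 := by
    have := hstrict.eventually_apply_implicitFunctionOfProdDomain hinv
    filter_upwards [this] with s hs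
    rw [hs, hfe, hx]
  refine ⟨ψ, hψt, ?_, ?_⟩
  · filter_upwards [hψe] with s hs
    rw [← hfe, hs]
  · have h1 : HasDerivAt (fun s : ℝ => f (s, ψ s)) (L (1, d)) t := by
      have hf' : HasFDerivAt f L (t, ψ t) := by rw [hψt]; exact hstrict.hasFDerivAt
      exact HasFDerivAt.comp_hasDerivAt (f := fun s : ℝ => (s, ψ s)) t hf'
        ((hasDerivAt_id t).prodMk hψd)
    have h2 : HasDerivAt (fun s : ℝ => f (s, ψ s)) 0 t :=
      (hasDerivAt_const t (0 : ℝ)).congr_of_eventuallyEq hψe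
    have h3 : L (1, d) = L (1, 0) + d * L (0, 1) := by
      have : ((1 : ℝ), d) = (1, 0) + d • (0, 1) := by simp
      rw [this, map_add, map_smul, smul_eq_mul]
    have h4 := h1.unique h2
    rw [h3, hL1, hL2] at h4
    have h5 : d = -(∑ k ∈ Finset.Icc 1 m, deriv (a k) t * x ^ (m - k))
        / (derivative (charPoly m a t)).eval x := by
      rw [eq_div_iff hx']; linarith
    rw [← h5]; exact hψd

/-- By separation a nonzero root is simple, so it continues differentiably. Zero roots, possibly
multiple, are continued by the constant `0`. This is legitimate because the coefficients responsible
for the multiplicity of `0` vanish identically near `t`. The numerator of the derivative formula is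
at most `κ` times the sum of the `|a_k| |λ_i|^(m-k)`, which separation bounds by a multiple of
`|λ_i| |P'(λ_i)|`. -/
theorem exists_differentiable_roots {m : ℕ} {a : ℕ → ℝ → ℝ} {lam : Fin m → ℝ → ℝ}
    {t κ D : ℝ} (hκ : 0 ≤ κ)
    (ha : ∀ k ∈ Finset.Icc 1 m, AnalyticAt ℝ (a k) t)
    (hz : ∀ k ∈ Finset.Icc 1 m, a k t = 0 → ∀ᶠ s in 𝓝 t, a k s = 0)
    (hder : ∀ k ∈ Finset.Icc 1 m, |deriv (a k) t| ≤ κ * |a k t|)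
    (hlam : ∀ᶠ s in 𝓝 t, charPoly m a s = ∏ i, (X - C (lam i s)))
    (hsep : ∀ i j, i ≠ j → |lam i t| + |lam j t| ≤ D * |lam i t - lam j t|) :
    ∃ (ψ : Fin m → ℝ → ℝ) (ψ' : Fin m → ℝ),
      (∀ i, ψ i t = lam i t) ∧ (∀ i, HasDerivAt (ψ i) (ψ' i) t) ∧
      (∀ i, |ψ' i| ≤ κ * (m * 2 * D ^ (m - 1)) * |lam i t|) ∧
      ∀ᶠ s in 𝓝 t, ∃ σ : Equiv.Perm (Fin m), ∀ i, ψ i s = lam (σ i) s := by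
  classical
  have hlamt : charPoly m a t = ∏ i, (X - C (lam i t)) := hlam.self_of_nhds
  have hroot : ∀ i, (charPoly m a t).eval (lam i t) = 0 := fun i => by
    rw [hlamt, eval_prod]
    exact Finset.prod_eq_zero (Finset.mem_univ i) (by simp)
  have hdroot : ∀ i, (derivative (charPoly m a t)).eval (lam i t)
      = ∏ j ∈ Finset.univ.erase i, (lam i t - lam j t) := fun i => by
    rw [hlamt, eval_derivative_prod_X_sub_C _ (fun i => lam i t) (Finset.mem_univ i)]
  have hne : ∀ i, lam i t ≠ 0 → ∀ j, j ≠ i → lam i t - lam j t ≠ 0 := by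
    intro i hi j hj h0
    have := hsep i j hj.symm
    rw [h0, abs_zero, mul_zero] at this
    have h1 : 0 < |lam i t| := abs_pos.2 hi
    linarith [abs_nonneg (lam j t)]
  have hdne : ∀ i, lam i t ≠ 0 → (derivative (charPoly m a t)).eval (lam i t) ≠ 0 := by
    intro i hi
    rw [hdroot]
    exact Finset.prod_ne_zero_iff.2 fun j hj => hne i hi j (Finset.ne_of_mem_erase hj)
  have hex : ∀ i, ∃ (ψ : ℝ → ℝ) (ψ' : ℝ), ψ t = lam i t ∧ HasDerivAt ψ ψ' t ∧
      |ψ'| ≤ κ * (m * 2 * D ^ (m - 1)) * |lam i t| ∧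
      (lam i t ≠ 0 → ∀ᶠ s in 𝓝 t, (charPoly m a s).eval (ψ s) = 0) ∧
      (lam i t = 0 → ∀ s, ψ s = 0) := by
    intro i
    by_cases hi : lam i t = 0
    · exact ⟨fun _ => 0, 0, hi.symm, hasDerivAt_const t 0, by simp [hi], fun h => absurd hi h,
        fun _ _ => rfl⟩
    · obtain ⟨ψ, h1, h2, h3⟩ := exists_implicit_root ha (hroot i) (hdne i hi)
      refine ⟨ψ, _, h1, h3, ?_, fun _ => h2, fun h => absurd h hi⟩
      rw [abs_div, abs_neg, div_le_iff₀ (abs_pos.2 (hdne i hi))]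
      set P := ∏ j, (|lam i t| + |lam j t|) with hP
      -- The factor `j = i` equals `2 |lam i t|`. Each of the other `m - 1` factors is at most `D`
      -- times a factor of `P'(lam i t)`.
      have hPle : P ≤ 2 * |lam i t| * (D ^ (m - 1) *
          |(derivative (charPoly m a t)).eval (lam i t)|) := by
        rw [hP, ← Finset.mul_prod_erase _ _ (Finset.mem_univ i), ← two_mul, hdroot,
          Finset.abs_prod]
        refine mul_le_mul_of_nonneg_left ?_ (by positivity)
        have : D ^ (m - 1) = ∏ j ∈ Finset.univ.erase i, D := by
          simp [Finset.card_erase_of_mem]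
        rw [this, ← Finset.prod_mul_distrib]
        exact Finset.prod_le_prod (fun j _ => by positivity)
          fun j hj => hsep i j (Finset.ne_of_mem_erase hj).symm
      calc |∑ k ∈ Finset.Icc 1 m, deriv (a k) t * lam i t ^ (m - k)|
          ≤ ∑ k ∈ Finset.Icc 1 m, |deriv (a k) t * lam i t ^ (m - k)| :=
            Finset.abs_sum_le_sum_abs _ _
        _ ≤ ∑ k ∈ Finset.Icc 1 m, κ * P := by
            refine Finset.sum_le_sum fun k hk => ?_
            rw [abs_mul, abs_pow]
            calc |deriv (a k) t| * |lam i t| ^ (m - k)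
                ≤ (κ * |a k t|) * |lam i t| ^ (m - k) :=
                  mul_le_mul_of_nonneg_right (hder k hk) (by positivity)
              _ = κ * (|a k t| * |lam i t| ^ (m - k)) := by ring
              _ ≤ κ * P := mul_le_mul_of_nonneg_left
                  (abs_coeff_mul_pow_le hlamt hk (abs_nonneg _)) hκ
        _ = m * κ * P := by simp; ring
        _ ≤ m * κ * (2 * |lam i t| * (D ^ (m - 1) *
              |(derivative (charPoly m a t)).eval (lam i t)|)) :=
            mul_le_mul_of_nonneg_left hPle (by positivity)
        _ = _ := by ring
  choose ψ ψ' h1 h2 h3 h4 h5 using hex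
  refine ⟨ψ, ψ', h1, h2, h3, ?_⟩
  set J : Finset (Fin m) := Finset.univ.filter fun i => lam i t ≠ 0 with hJ
  have hJmem : ∀ i, i ∈ J ↔ lam i t ≠ 0 := fun i => by simp [hJ]
  have hcont : ∀ i, ContinuousAt (ψ i) t := fun i => (h2 i).continuousAt
  have e1 : ∀ᶠ s in 𝓝 t, ∀ i ∈ J, (charPoly m a s).eval (ψ i s) = 0 :=
    (Filter.eventually_all_finset J).2 fun i hi => h4 i ((hJmem i).1 hi)
  have e2 : ∀ᶠ s in 𝓝 t, ∀ i ∈ J, ψ i s ≠ 0 :=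
    (Filter.eventually_all_finset J).2 fun i hi =>
      (hcont i).eventually_ne (by rw [h1]; exact (hJmem i).1 hi)
  have e3 : ∀ᶠ s in 𝓝 t, ∀ i ∈ J, ∀ j ∈ J, i ≠ j → ψ i s ≠ ψ j s := by
    refine (Filter.eventually_all_finset J).2 fun i hi =>
      (Filter.eventually_all_finset J).2 fun j _ => ?_
    by_cases hij : i = j
    · exact Eventually.of_forall fun s h => absurd hij h
    · have h0 : ψ i t - ψ j t ≠ 0 := by
        rw [h1, h1]; exact hne i ((hJmem i).1 hi) j (Ne.symm hij)
      filter_upwards [((hcont i).sub (hcont j)).eventually_ne h0] with s hs _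
      exact sub_ne_zero.1 hs
  have e4 : ∀ᶠ s in 𝓝 t, ∀ k ∈ Finset.Icc 1 m, a k t = 0 → a k s = 0 := by
    refine (Filter.eventually_all_finset _).2 fun k hk => ?_
    by_cases h0 : a k t = 0
    · filter_upwards [hz k hk h0] with s hs _ using hs
    · exact Eventually.of_forall fun s h => absurd h h0
  filter_upwards [e1, e2, e3, e4, hlam] with s s1 s2 s3 s4 s5
  refine perm_of_prod_X_sub_C_eq (ν := fun i => lam i s) (μ := fun i => ψ i s) ?_
  -- The exponent is the multiplicity of the root `0` at time `t`. Divisibility by this power of `X`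
  -- is the vanishing of low-order coefficients, which persists for nearby `s`.
  have hXt : (X : ℝ[X]) ^ (Finset.univ \ J).card ∣ charPoly m a t := by
    rw [hlamt, ← Finset.prod_sdiff (Finset.subset_univ J)]
    refine Dvd.dvd.mul_right ?_ _
    rw [← Finset.prod_const]
    refine (Finset.prod_congr rfl fun i hi => ?_).dvd
    have : lam i t = 0 := by simpa [hJ] using hi
    simp [this]
  have hcard : (Finset.univ \ J).card ≤ m := by
    simpa using Finset.card_le_univ (Finset.univ \ J)
  have hXs : (X : ℝ[X]) ^ (Finset.univ \ J).card ∣ charPoly m a s := by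
    rw [X_pow_dvd_iff] at hXt ⊢
    intro d hd
    have hk : m - d ∈ Finset.Icc 1 m := Finset.mem_Icc.2 (by omega)
    have hc := fun r => charPoly_coeff a r hk
    rw [show m - (m - d) = d by omega] at hc
    rw [hc]
    exact s4 _ hk (by rw [← hc]; exact hXt d hd)
  have hprodψ : (∏ i, (X - C (ψ i s)) : ℝ[X])
      = X ^ (Finset.univ \ J).card * ∏ i ∈ J, (X - C (ψ i s)) := by
    rw [← Finset.prod_sdiff (Finset.subset_univ J)]
    congr 1
    rw [← Finset.prod_const]
    refine Finset.prod_congr rfl fun i hi => ?_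
    have : lam i t = 0 := by simpa [hJ] using hi
    simp [h5 i this]
  -- The continued nonzero roots remain distinct and nonzero, so the linear factors and the power of
  -- `X` are pairwise coprime divisors. Their product divides a monic polynomial of the same degree,
  -- hence equals it.
  have hdvd : (∏ i, (X - C (ψ i s)) : ℝ[X]) ∣ charPoly m a s := by
    rw [hprodψ]
    refine IsCoprime.mul_dvd ?_ hXs ?_
    · refine IsCoprime.pow_left (IsCoprime.prod_right fun i hi => ?_)
      have := isCoprime_X_sub_C_of_isUnit_sub (R := ℝ) (a := 0) (b := ψ i s)
        (by simpa using s2 i hi)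
      simpa using this
    · refine Finset.prod_dvd_of_coprime (fun i hi j hj hij => ?_) fun i hi => ?_
      · exact isCoprime_X_sub_C_of_isUnit_sub (sub_ne_zero.2 (s3 i hi j hj hij)).isUnit
      · exact dvd_iff_isRoot.2 (s1 i hi)
  rw [s5] at hdvd
  exact (eq_of_monic_of_dvd_of_natDegree_le (monic_prod_X_sub_C _ _) (monic_prod_X_sub_C _ _) hdvd
    (by simp [natDegree_prod_of_monic, monic_X_sub_C])).symm

theorem abs_root_le {m : ℕ} (hm : 1 ≤ m) {a : ℕ → ℝ → ℝ} {t x A : ℝ}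
    (hA : ∀ k ∈ Finset.Icc 1 m, |a k t| ≤ A) (hx : (charPoly m a t).eval x = 0) :
    |x| ≤ 1 + m * A := by
  have hA0 : 0 ≤ A := (abs_nonneg _).trans (hA 1 (Finset.mem_Icc.2 ⟨le_rfl, hm⟩))
  by_contra! hlt
  have h1 : 1 ≤ |x| := by nlinarith [mul_nonneg (Nat.cast_nonneg (α := ℝ) m) hA0]
  rw [charPoly_eval] at hx
  have h2 : |x| ^ m ≤ m * A * |x| ^ (m - 1) := by
    calc |x| ^ m = |∑ k ∈ Finset.Icc 1 m, a k t * x ^ (m - k)| := by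
          rw [← abs_pow, eq_neg_of_add_eq_zero_left hx, abs_neg]
      _ ≤ ∑ k ∈ Finset.Icc 1 m, |a k t * x ^ (m - k)| := Finset.abs_sum_le_sum_abs _ _
      _ ≤ ∑ k ∈ Finset.Icc 1 m, A * |x| ^ (m - 1) := by
          refine Finset.sum_le_sum fun k hk => ?_
          rw [abs_mul, abs_pow]
          refine mul_le_mul (hA k hk) (pow_le_pow_right₀ h1 ?_) (by positivity) hA0
          have := (Finset.mem_Icc.1 hk).1
          omega
      _ = _ := by simp; ring
  have h3 : |x| ^ m = |x| * |x| ^ (m - 1) := by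
    rw [← pow_succ', Nat.sub_add_cancel hm]
  rw [h3] at h2
  have := le_of_mul_le_mul_right h2 (by positivity)
  linarith

end Roots

/-! ### Energy estimates for the Fourier-transformed equation -/

section Energy

open Polynomial

/-- Formally `(√E)' ≤ K √E + g`, and `Θ` is the integrating factor. Since `√E` may fail to be
differentiable where `E = 0`, the argument runs with `√(E + ε)` and lets `ε → 0`. -/
theorem mul_sqrt_le_of_deriv_le {E E' K g Θ : ℝ → ℝ} {s₁ s₂ : ℝ} (h12 : s₁ ≤ s₂)
    (hE0 : ∀ t ∈ Icc s₁ s₂, 0 ≤ E t) (hEc : ContinuousOn E (Icc s₁ s₂))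
    (hE : ∀ t ∈ Ioo s₁ s₂, HasDerivAt E (E' t) t)
    (hΘc : ContinuousOn Θ (Icc s₁ s₂)) (hΘ0 : ∀ t ∈ Icc s₁ s₂, 0 ≤ Θ t)
    (hΘ : ∀ t ∈ Ioo s₁ s₂, HasDerivAt Θ (-(K t * Θ t)) t) (hK : ∀ t ∈ Ioo s₁ s₂, 0 ≤ K t)
    (hgc : ContinuousOn g (Icc s₁ s₂)) (hg0 : ∀ t ∈ Icc s₁ s₂, 0 ≤ g t)
    (hineq : ∀ t ∈ Ioo s₁ s₂, E' t ≤ 2 * K t * E t + 2 * g t * √(E t)) :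
    Θ s₂ * √(E s₂) ≤ Θ s₁ * √(E s₁) + ∫ t in s₁..s₂, Θ t * g t := by
  have key : ∀ ε > 0, Θ s₂ * √(E s₂ + ε) - Θ s₁ * √(E s₁ + ε) ≤ ∫ t in s₁..s₂, Θ t * g t := by
    intro ε hε
    refine intervalIntegral.sub_le_integral_of_hasDeriv_right_of_le
      (g := fun t => Θ t * √(E t + ε))
      (g' := fun t => -(K t * Θ t) * √(E t + ε) + Θ t * (E' t / (2 * √(E t + ε)))) h12
      (hΘc.mul (hEc.add continuousOn_const).sqrt) (fun t ht => ?_)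
      (hΘc.mul hgc).integrableOn_Icc fun t ht => ?_
    · have h0 := hE0 t (Ioo_subset_Icc_self ht)
      have h1 : HasDerivAt (fun t => E t + ε) (E' t) t := (hE t ht).add_const ε
      exact ((hΘ t ht).mul (h1.sqrt (by positivity))).hasDerivWithinAt
    · have h0 := hE0 t (Ioo_subset_Icc_self ht)
      have h1 := hg0 t (Ioo_subset_Icc_self ht)
      have h2 := hΘ0 t (Ioo_subset_Icc_self ht)
      have hpos : 0 < √(E t + ε) := Real.sqrt_pos.2 (by positivity)
      have hsq : √(E t + ε) * √(E t + ε) = E t + ε := Real.mul_self_sqrt (by positivity)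
      have hle : √(E t) ≤ √(E t + ε) := Real.sqrt_le_sqrt (by linarith)
      have h3 : E' t / (2 * √(E t + ε)) ≤ K t * √(E t + ε) + g t := by
        rw [div_le_iff₀ (by positivity)]
        have h4 := hineq t ht
        have h5 := hK t ht
        have h6 : g t * √(E t) ≤ g t * √(E t + ε) := mul_le_mul_of_nonneg_left hle h1
        have h7 : 0 ≤ K t * ε := by positivity
        nlinarith
      nlinarith [mul_le_mul_of_nonneg_left h3 h2]
  have lim : ∀ t, Tendsto (fun ε : ℝ => Θ t * √(E t + ε)) (𝓝[>] 0) (𝓝 (Θ t * √(E t))) := by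
    intro t
    have : Continuous fun ε : ℝ => Θ t * √(E t + ε) := by fun_prop
    simpa using (this.tendsto 0).mono_left nhdsWithin_le_nhds
  have := le_of_tendsto ((lim s₂).sub (lim s₁))
    (eventually_mem_nhdsWithin.mono fun ε hε => key ε hε)
  linarith

/-- The pairing of a polynomial `∑ q_h X^h` with a sequence `w`, namely `∑ q_h w_h`. -/
noncomputable def act (w : ℕ → ℂ) : ℂ[X] →ₗ[ℂ] ℂ :=
  lsum fun h => LinearMap.toSpanSingleton ℂ ℂ (w h)

theorem act_monomial (w : ℕ → ℂ) (n : ℕ) (c : ℂ) : act w (monomial n c) = c * w n := by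
  simp [act, lsum_apply, sum_monomial_index]

theorem act_one (w : ℕ → ℂ) : act w 1 = w 0 := by
  rw [← monomial_zero_one, act_monomial, one_mul]

theorem act_C_mul (w : ℕ → ℂ) (c : ℂ) (Q : ℂ[X]) : act w (C c * Q) = c * act w Q := by
  rw [C_mul', map_smul, smul_eq_mul]

theorem act_X_pow (w : ℕ → ℂ) (n : ℕ) : act w (X ^ n) = w n := by
  rw [X_pow_eq_monomial, act_monomial, one_mul]

theorem act_X_mul (w : ℕ → ℂ) (Q : ℂ[X]) : act w (X * Q) = act (fun h => w (h + 1)) Q := by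
  induction Q using Polynomial.induction_on' with
  | add p q hp hq => rw [mul_add, map_add, map_add, hp, hq]
  | monomial n c => rw [X_mul_monomial, act_monomial, act_monomial]

theorem act_X_sub_C_mul (w : ℕ → ℂ) (c : ℂ) (Q : ℂ[X]) :
    act w ((X - C c) * Q) = act (fun h => w (h + 1)) Q - c * act w Q := by
  rw [sub_mul, map_sub, act_X_mul, act_C_mul]

/-- `act` pairs the symbol with frozen coefficients against the derivatives of `w`. Differentiation
in time thus either hits `w`, which multiplies the symbol by `X`, or hits one coefficient, which
removes the corresponding factor. -/
theorem hasDerivAt_act_prod {ι : Type*} [DecidableEq ι] {c : ι → ℝ → ℂ} {c' : ι → ℂ} {t : ℝ}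
    (S : Finset ι) (hc : ∀ i ∈ S, HasDerivAt (c i) (c' i) t) {w : ℕ → ℝ → ℂ}
    (hw : ∀ h ≤ S.card, HasDerivAt (w h) (w (h + 1) t) t) :
    HasDerivAt (fun s => act (fun h => w h s) (∏ j ∈ S, (X - C (c j s))))
      (act (fun h => w h t) (X * ∏ j ∈ S, (X - C (c j t)))
        - ∑ i ∈ S, c' i * act (fun h => w h t) (∏ j ∈ S.erase i, (X - C (c j t)))) t := by
  induction S using Finset.induction_on generalizing w with
  | empty =>
    simp only [Finset.prod_empty, Finset.sum_empty, sub_zero, act_one, mul_one]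
    rw [← pow_one X, act_X_pow]
    exact hw 0 le_rfl
  | insert j S hj ih =>
    rw [Finset.card_insert_of_notMem hj] at hw
    have hcS : ∀ i ∈ S, HasDerivAt (c i) (c' i) t := fun i hi => hc i (Finset.mem_insert_of_mem hi)
    have h1 := ih hcS (w := fun h => w (h + 1)) fun h hh => hw (h + 1) (by omega)
    have h2 := ih hcS (w := w) fun h hh => hw h (by omega)
    have h3 := hc j (Finset.mem_insert_self j S)
    have h4 := h1.sub (h3.mul h2)
    have hfun : (fun s => act (fun h => w h s) (∏ j ∈ insert j S, (X - C (c j s))))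
        = (fun s => act (fun h => w (h + 1) s) (∏ j ∈ S, (X - C (c j s))))
          - (c j * fun s => act (fun h => w h s) (∏ j ∈ S, (X - C (c j s)))) := by
      funext s
      rw [Finset.prod_insert hj, act_X_sub_C_mul]
      rfl
    rw [hfun]
    refine h4.congr_deriv ?_
    have e1 : ∀ i ∈ S, act (fun h => w h t) (∏ j ∈ (insert j S).erase i, (X - C (c j t)))
        = act (fun h => w (h + 1) t) (∏ j ∈ S.erase i, (X - C (c j t)))
          - c j t * act (fun h => w h t) (∏ j ∈ S.erase i, (X - C (c j t))) := by
      intro i hi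
      have hij : j ≠ i := fun h => hj (h ▸ hi)
      rw [Finset.erase_insert_of_ne hij, Finset.prod_insert (fun h => hj (Finset.mem_of_mem_erase h)),
        act_X_sub_C_mul]
    have e2 : ∑ i ∈ S, c' i * act (fun h => w h t) (∏ j ∈ (insert j S).erase i, (X - C (c j t)))
        = ∑ i ∈ S, c' i * (act (fun h => w (h + 1) t) (∏ j ∈ S.erase i, (X - C (c j t)))
          - c j t * act (fun h => w h t) (∏ j ∈ S.erase i, (X - C (c j t)))) :=
      Finset.sum_congr rfl fun i hi => by rw [e1 i hi]
    rw [Finset.sum_insert hj, Finset.erase_insert hj, Finset.prod_insert hj,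
      mul_left_comm, act_X_sub_C_mul, e2]
    simp only [mul_sub, Finset.sum_sub_distrib, Finset.mul_sum]
    have : ∀ i, c j t * (c' i * act (fun h => w h t) (∏ j ∈ S.erase i, (X - C (c j t))))
      = c' i * (c j t * act (fun h => w h t) (∏ j ∈ S.erase i, (X - C (c j t)))) := fun i => by ring
    simp only [this]
    ring

/-- The symbol `∏_{j ∈ S} (X - i η μ_j)`. -/
noncomputable def sym {m : ℕ} (η : ℝ) (μ : Fin m → ℝ) (S : Finset (Fin m)) : ℂ[X] :=
  ∏ j ∈ S, (X - C (Complex.I * η * μ j))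

theorem act_sym_insert {m : ℕ} (η : ℝ) (μ : Fin m → ℝ) {S : Finset (Fin m)} {j : Fin m}
    (hj : j ∉ S) (w : ℕ → ℂ) :
    act w (sym η μ (insert j S))
      = act (fun h => w (h + 1)) (sym η μ S) - Complex.I * η * μ j * act w (sym η μ S) := by
  rw [sym, Finset.prod_insert hj, act_X_sub_C_mul]
  rfl

theorem sym_perm {m : ℕ} (η : ℝ) (μ : Fin m → ℝ) (S : Finset (Fin m)) (π : Equiv.Perm (Fin m)) :
    sym η (fun i => μ (π i)) S = sym η μ (S.map π.toEmbedding) := by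
  simp [sym, Finset.prod_map]

/-- The proper subsets of the set of indices. -/
def properSubsets (m : ℕ) : Finset (Finset (Fin m)) := Finset.univ.filter fun S => S ≠ Finset.univ

/-- The energy `∑_S (σ^{m-1-|S|} |∏_{j ∈ S} (∂_t - i η μ_j) v|)²`, the sum being over all proper
subsets of the set of indices. -/
noncomputable def energy {m : ℕ} (η σ : ℝ) (μ : Fin m → ℝ) (w : ℕ → ℂ) : ℝ :=
  ∑ S ∈ properSubsets m, (σ ^ (m - 1 - S.card) * ‖act w (sym η μ S)‖) ^ 2

theorem mem_properSubsets {m : ℕ} {S : Finset (Fin m)} :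
    S ∈ properSubsets m ↔ S ≠ Finset.univ := by simp [properSubsets]

theorem card_lt_of_mem_properSubsets {m : ℕ} {S : Finset (Fin m)} (hS : S ∈ properSubsets m) :
    S.card < m := by
  refine lt_of_le_of_ne (by simpa using Finset.card_le_univ S) fun h => ?_
  exact mem_properSubsets.1 hS ((Finset.card_eq_iff_eq_univ S).1 (by simpa using h))

theorem mem_properSubsets_of_card_lt {m : ℕ} {S : Finset (Fin m)} (hS : S.card < m) :
    S ∈ properSubsets m := by
  rw [mem_properSubsets]
  rintro rfl
  simp at hS

theorem energy_nonneg {m : ℕ} (η σ : ℝ) (μ : Fin m → ℝ) (w : ℕ → ℂ) : 0 ≤ energy η σ μ w :=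
  Finset.sum_nonneg fun _ _ => by positivity

/-- Summing over all subsets makes the energy depend only on the unordered roots. This lets it be
differentiated through any local relabelling, even if the given labelling is discontinuous. -/
theorem energy_perm {m : ℕ} (η σ : ℝ) (μ : Fin m → ℝ) (w : ℕ → ℂ) (π : Equiv.Perm (Fin m)) :
    energy η σ (fun i => μ (π i)) w = energy η σ μ w := by
  unfold energy
  refine Finset.sum_equiv (Equiv.finsetCongr π) (fun S => ?_) fun S _ => ?_
  · simp only [mem_properSubsets, Equiv.finsetCongr_apply]
    rw [not_iff_not]
    constructor
    · rintro rfl; simp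
    · intro h
      rw [← Finset.card_eq_iff_eq_univ] at h ⊢
      simpa using h
  · simp [sym_perm]

theorem le_sqrt_energy {m : ℕ} {η σ : ℝ} (μ : Fin m → ℝ) (w : ℕ → ℂ)
    {S : Finset (Fin m)} (hS : S ∈ properSubsets m) :
    σ ^ (m - 1 - S.card) * ‖act w (sym η μ S)‖ ≤ √(energy η σ μ w) := by
  refine Real.le_sqrt_of_sq_le ?_
  exact Finset.single_le_sum (f := fun S => (σ ^ (m - 1 - S.card) * ‖act w (sym η μ S)‖) ^ 2)
    (fun _ _ => by positivity) hS

/-- Adjoining an index leads either to another term of the energy, at the price of one factor `σ`,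
or to the full symbol, which is the source of the equation. -/
theorem norm_act_sym_insert_le {m : ℕ} {η σ : ℝ} (hσ : 0 < σ) (μ : Fin m → ℝ) (w : ℕ → ℂ)
    {S : Finset (Fin m)} {j : Fin m} (hj : j ∉ S) :
    σ ^ (m - 1 - S.card) * ‖act w (sym η μ (insert j S))‖
      ≤ σ * √(energy η σ μ w) + ‖act w (sym η μ Finset.univ)‖ := by
  by_cases hu : insert j S = Finset.univ
  · have : S.card + 1 = m := by
      rw [← Finset.card_insert_of_notMem hj, hu]; simp
    rw [hu, show m - 1 - S.card = 0 by omega, pow_zero, one_mul]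
    have : 0 ≤ σ * √(energy η σ μ w) := by positivity
    linarith
  · have hS := mem_properSubsets.2 hu
    have hc := card_lt_of_mem_properSubsets hS
    have h1 := le_sqrt_energy (η := η) (σ := σ) μ w hS
    rw [Finset.card_insert_of_notMem hj] at h1 hc
    have : σ ^ (m - 1 - S.card) = σ * σ ^ (m - 1 - (S.card + 1)) := by
      rw [← pow_succ']; congr 1; omega
    rw [this, mul_assoc]
    have := mul_le_mul_of_nonneg_left h1 hσ.le
    linarith [norm_nonneg (act w (sym η μ Finset.univ))]

/-- Two products that differ in a single factor subtract to a multiple of the common part. The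
multiple contains `η`, so a lower-order product times `η` is controlled by products of the original
order. -/
theorem act_sym_exchange {m : ℕ} (η : ℝ) (μ : Fin m → ℝ) (w : ℕ → ℂ) {S : Finset (Fin m)}
    {i j : Fin m} (hi : i ∈ S) (hj : j ∉ S) :
    Complex.I * η * (μ i - μ j) * act w (sym η μ (S.erase i))
      = act w (sym η μ (insert j (S.erase i))) - act w (sym η μ S) := by
  have h1 : S = insert i (S.erase i) := (Finset.insert_erase hi).symm
  conv_rhs => rw [h1, Finset.erase_insert (Finset.notMem_erase i S)]
  rw [act_sym_insert η μ (fun h => hj (Finset.mem_of_mem_erase h)),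
    act_sym_insert η μ (Finset.notMem_erase i S)]
  ring

/-- The term with a differentiated root carries a factor `η` that the energy does not control by
itself. The bound on `d` replaces it by `η (μ i - μ j)`, and the exchange identity rewrites the
result as two terms with as many factors as `S`. An index `j` outside `S` is available because `S`
is proper. -/
theorem norm_deriv_root_mul_le {m : ℕ} {η σ K : ℝ} (hσ : 0 < σ) (hK : 0 ≤ K) (μ : Fin m → ℝ)
    (w : ℕ → ℂ) {S : Finset (Fin m)} (hS : S ∈ properSubsets m) {i j : Fin m} (hi : i ∈ S)
    (hj : j ∉ S) {d : ℝ} (hd : |d| ≤ K * σ * |μ i - μ j|) :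
    σ ^ (m - 1 - S.card) * ‖Complex.I * η * d * act w (sym η μ (S.erase i))‖
      ≤ 2 * K * σ * √(energy η σ μ w) := by
  have hcard : (insert j (S.erase i)).card = S.card := by
    rw [Finset.card_insert_of_notMem (fun h => hj (Finset.mem_of_mem_erase h)),
      Finset.card_erase_add_one hi]
  have hS' : insert j (S.erase i) ∈ properSubsets m :=
    mem_properSubsets_of_card_lt (by rw [hcard]; exact card_lt_of_mem_properSubsets hS)
  have h1 := le_sqrt_energy (η := η) (σ := σ) μ w hS
  have h2 := le_sqrt_energy (η := η) (σ := σ) μ w hS'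
  rw [hcard] at h2
  set p := σ ^ (m - 1 - S.card) with hp
  have hp0 : 0 ≤ p := by positivity
  calc p * ‖Complex.I * η * d * act w (sym η μ (S.erase i))‖
      = p * (|η| * |d| * ‖act w (sym η μ (S.erase i))‖) := by simp
    _ ≤ p * (|η| * (K * σ * |μ i - μ j|) * ‖act w (sym η μ (S.erase i))‖) := by gcongr
    _ = K * σ * (p * ‖Complex.I * η * (μ i - μ j) * act w (sym η μ (S.erase i))‖) := by
        rw [norm_mul, norm_mul, norm_mul, Complex.norm_I, Complex.norm_real, ← Complex.ofReal_sub,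
          Complex.norm_real, Real.norm_eq_abs, Real.norm_eq_abs]
        ring
    _ ≤ K * σ * (p * (‖act w (sym η μ (insert j (S.erase i)))‖ + ‖act w (sym η μ S)‖)) := by
        rw [act_sym_exchange η μ w hi hj]
        gcongr
        exact norm_sub_le _ _
    _ ≤ K * σ * (√(energy η σ μ w) + √(energy η σ μ w)) := by
        rw [mul_add]
        gcongr
    _ = _ := by ring

/-- The growth rate is proportional to `σ` and does not involve `η`. The hypothesis `σ' = ε σ²` with
`|ε| ≤ 1` covers both `1/(t - α)` and `1/(β - t)`, and makes the derivative of the powers of `σ`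
cost only another factor `σ`. -/
theorem hasDerivAt_energy {m : ℕ} {η K : ℝ} (hK : 0 ≤ K) {t : ℝ} {σ : ℝ → ℝ} {ε : ℝ}
    (hσ : 0 < σ t) (hε : |ε| ≤ 1) (hσ' : HasDerivAt σ (ε * σ t ^ 2) t)
    {ψ : Fin m → ℝ → ℝ} {ψ' : Fin m → ℝ} (hψ : ∀ i, HasDerivAt (ψ i) (ψ' i) t)
    (hψ' : ∀ i j, i ≠ j → |ψ' i| ≤ K * σ t * |ψ i t - ψ j t|)
    {w : ℕ → ℝ → ℂ} (hw : ∀ h < m, HasDerivAt (w h) (w (h + 1) t) t) :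
    ∃ E' : ℝ, HasDerivAt (fun s => energy η (σ s) (fun i => ψ i s) (fun h => w h s)) E' t ∧
      E' ≤ 2 * (2 ^ m * (m + 1 + 2 * m * K) * σ t)
            * energy η (σ t) (fun i => ψ i t) (fun h => w h t)
          + 2 * (2 ^ m * ‖act (fun h => w h t) (sym η (fun i => ψ i t) Finset.univ)‖)
            * √(energy η (σ t) (fun i => ψ i t) (fun h => w h t)) := by
  set wt : ℕ → ℂ := fun h => w h t with hwt
  set μ : Fin m → ℝ := fun i => ψ i t with hμ
  set e := √(energy η (σ t) μ wt) with he
  set G := ‖act wt (sym η μ Finset.univ)‖ with hG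
  have he0 : 0 ≤ e := Real.sqrt_nonneg _
  have hG0 : 0 ≤ G := norm_nonneg _
  have hee : energy η (σ t) μ wt = e * e := (Real.mul_self_sqrt (energy_nonneg _ _ _ _)).symm
  have hterm : ∀ S ∈ properSubsets m, ∃ d : ℝ,
      HasDerivAt (fun s => (σ s ^ (m - 1 - S.card) *
        ‖act (fun h => w h s) (sym η (fun i => ψ i s) S)‖) ^ 2) d t ∧
      d ≤ 2 * ((m + 1 + 2 * m * K) * σ t) * (e * e) + 2 * G * e := by
    intro S hS
    have hcard := card_lt_of_mem_properSubsets hS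
    obtain ⟨j, hj⟩ : ∃ j, j ∉ S := by
      by_contra! hall
      exact mem_properSubsets.1 hS (Finset.eq_univ_of_forall hall)
    set n := m - 1 - S.card with hn
    have hA := hasDerivAt_act_prod (t := t) S (c := fun i s => Complex.I * η * (ψ i s : ℂ))
      (c' := fun i => Complex.I * η * (ψ' i : ℂ)) (fun i _ => ((hψ i).ofReal_comp).const_mul _)
      (w := w) fun h hh => hw h (by omega)
    -- One time derivative is rewritten as the factor of an arbitrary index `j` outside `S`, plus a
    -- multiple of the product itself.
    have hX : act (fun h => w h t) (X * ∏ j ∈ S, (X - C (Complex.I * η * (ψ j t : ℂ))))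
        = act wt (sym η μ (insert j S)) + Complex.I * η * μ j * act wt (sym η μ S) := by
      rw [act_X_mul, act_sym_insert η μ hj]
      simp only [hwt, hμ, sym]
      ring
    set A := act wt (sym η μ S) with hAdef
    set R := ∑ i ∈ S, Complex.I * η * (ψ' i : ℂ) * act wt (sym η μ (S.erase i)) with hR
    have hA' : HasDerivAt (fun s => act (fun h => w h s) (sym η (fun i => ψ i s) S))
        (act wt (sym η μ (insert j S)) + Complex.I * η * μ j * A - R) t := by
      refine hA.congr_deriv ?_
      rw [hX]
      rfl
    have hsq := hA'.norm_sq
    have hσn : HasDerivAt (fun s => (σ s ^ n) ^ 2) (2 * n * ε * σ t * (σ t ^ n) ^ 2) t := by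
      have h1 : HasDerivAt (fun s => σ s ^ (n * 2)) _ t := hσ'.pow (n * 2)
      simp only [← pow_mul]
      refine h1.congr_deriv ?_
      rcases Nat.eq_zero_or_pos n with h0 | h0
      · simp [h0]
      · rw [show σ t ^ (n * 2) = σ t * σ t ^ (n * 2 - 1) by
          rw [← pow_succ']; congr 1; omega]
        push_cast
        ring
    have hprod := hσn.mul hsq
    refine ⟨_, (hprod.congr_of_eventuallyEq (Eventually.of_forall fun s => ?_)), ?_⟩
    · simp only [mul_pow, Pi.mul_apply]
    · set p := σ t ^ n with hp
      have hp0 : 0 ≤ p := by positivity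
      have hpA : p * ‖A‖ ≤ e := le_sqrt_energy μ wt hS
      have hpA0 : 0 ≤ p * ‖A‖ := by positivity
      have hinner : inner ℝ A (act wt (sym η μ (insert j S)) + Complex.I * η * μ j * A - R)
          ≤ ‖A‖ * (‖act wt (sym η μ (insert j S))‖ + ‖R‖) := by
        -- This is where reality of the roots enters: `i η μ_j A` is orthogonal to `A`, so the large
        -- term does not contribute.
        have h0 : inner ℝ A (Complex.I * η * μ j * A) = 0 := by
          simp [Complex.inner]; ring
        rw [inner_sub_right, inner_add_right, h0, add_zero, mul_add]
        have h1 := real_inner_le_norm A (act wt (sym η μ (insert j S)))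
        have h2 := neg_le_of_abs_le (abs_real_inner_le_norm A R)
        linarith
      have hb1 : p * ‖act wt (sym η μ (insert j S))‖ ≤ σ t * e + G :=
        norm_act_sym_insert_le hσ μ wt hj
      have hb2 : p * ‖R‖ ≤ m * (2 * K * σ t * e) := by
        calc p * ‖R‖ ≤ p * ∑ i ∈ S, ‖Complex.I * η * (ψ' i : ℂ) * act wt (sym η μ (S.erase i))‖ :=
              mul_le_mul_of_nonneg_left (norm_sum_le _ _) hp0
          _ = ∑ i ∈ S, p * ‖Complex.I * η * (ψ' i : ℂ) * act wt (sym η μ (S.erase i))‖ :=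
              Finset.mul_sum _ _ _
          _ ≤ ∑ i ∈ S, 2 * K * σ t * e := Finset.sum_le_sum fun i hi =>
              norm_deriv_root_mul_le hσ hK μ wt hS hi hj (hψ' i j fun h => hj (h ▸ hi))
          _ = S.card * (2 * K * σ t * e) := by simp
          _ ≤ m * (2 * K * σ t * e) := by
              have : (S.card : ℝ) ≤ m := by exact_mod_cast hcard.le
              gcongr
      have hn' : (n : ℝ) * ε ≤ m := by
        have h1 : (n : ℝ) ≤ m := by exact_mod_cast (by omega : n ≤ m)
        have h2 := (abs_le.1 hε).2
        nlinarith [Nat.cast_nonneg (α := ℝ) n]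
      have h3 : 2 * n * ε * σ t * p ^ 2 * ‖A‖ ^ 2 ≤ 2 * m * σ t * (e * e) := by
        have : (p * ‖A‖) * (p * ‖A‖) ≤ e * e := mul_self_le_mul_self hpA0 hpA
        calc 2 * n * ε * σ t * p ^ 2 * ‖A‖ ^ 2
            = (n * ε) * (2 * σ t * ((p * ‖A‖) * (p * ‖A‖))) := by ring
          _ ≤ m * (2 * σ t * ((p * ‖A‖) * (p * ‖A‖))) :=
              mul_le_mul_of_nonneg_right hn' (by positivity)
          _ ≤ m * (2 * σ t * (e * e)) := by gcongr
          _ = _ := by ring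
      have h4 : p ^ 2 * (2 * inner ℝ A (act wt (sym η μ (insert j S))
          + Complex.I * η * μ j * A - R))
          ≤ 2 * (e * (σ t * e + G + m * (2 * K * σ t * e))) := by
        calc _ ≤ p ^ 2 * (2 * (‖A‖ * (‖act wt (sym η μ (insert j S))‖ + ‖R‖))) := by gcongr
          _ = 2 * ((p * ‖A‖) * (p * ‖act wt (sym η μ (insert j S))‖ + p * ‖R‖)) := by ring
          _ ≤ _ := by gcongr
      calc _ ≤ 2 * m * σ t * (e * e) + 2 * (e * (σ t * e + G + m * (2 * K * σ t * e))) :=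
            add_le_add h3 h4
        _ = _ := by ring
  choose! d hd1 hd2 using hterm
  refine ⟨∑ S ∈ properSubsets m, d S, ?_, ?_⟩
  · exact HasDerivAt.fun_sum hd1
  · have hcard : ((properSubsets m).card : ℝ) ≤ 2 ^ m := by
      have h := Finset.card_le_univ (properSubsets m)
      rw [Fintype.card_finset, Fintype.card_fin] at h
      exact_mod_cast h
    calc ∑ S ∈ properSubsets m, d S
        ≤ ∑ S ∈ properSubsets m, (2 * ((m + 1 + 2 * m * K) * σ t) * (e * e) + 2 * G * e) :=
          Finset.sum_le_sum hd2
      _ = (properSubsets m).card * (2 * ((m + 1 + 2 * m * K) * σ t) * (e * e) + 2 * G * e) := by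
          rw [Finset.sum_const, nsmul_eq_mul]
      _ ≤ 2 ^ m * (2 * ((m + 1 + 2 * m * K) * σ t) * (e * e) + 2 * G * e) := by
          gcongr
      _ = _ := by rw [hee]; ring

end Energy

/-! ### Energy inequalities for a single Fourier mode -/

section Modes

open Polynomial

/-- Near `t` the roots can be relabelled so as to be differentiable at `t`, with derivatives at most
`K σ` times the distance to the other roots. -/
def RootsRegularAt {m : ℕ} (lam : Fin m → ℝ → ℝ) (K σ t : ℝ) : Prop :=
  ∃ (ψ : Fin m → ℝ → ℝ) (ψ' : Fin m → ℝ),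
    (∀ i, ψ i t = lam i t) ∧ (∀ i, HasDerivAt (ψ i) (ψ' i) t) ∧
    (∀ i j, i ≠ j → |ψ' i| ≤ K * σ * |lam i t - lam j t|) ∧
    ∀ᶠ s in 𝓝 t, ∃ π : Equiv.Perm (Fin m), ∀ i, ψ i s = lam (π i) s

/-- `w h`, `h ≤ m`, are the successive derivatives of a solution of the ordinary differential
equation `v^{(m)} + ∑ a_k (iη)^k v^{(m-k)} = G`. -/
structure ModeSolution (m : ℕ) (T : ℝ) (a : ℕ → ℝ → ℝ) (η : ℝ) (w : ℕ → ℝ → ℂ) (G : ℝ → ℂ) :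
    Prop where
  deriv : ∀ h < m, ∀ t ∈ Icc 0 T, HasDerivWithinAt (w h) (w (h + 1) t) (Icc 0 T) t
  equation : ∀ t ∈ Icc 0 T,
    w m t + ∑ k ∈ Finset.Icc 1 m, (a k t : ℂ) * (Complex.I * η) ^ k * w (m - k) t = G t
  continuousOn : ContinuousOn G (Icc 0 T)

theorem ModeSolution.hasDerivAt {m : ℕ} {T : ℝ} {a : ℕ → ℝ → ℝ} {η : ℝ} {w : ℕ → ℝ → ℂ}
    {G : ℝ → ℂ} (hw : ModeSolution m T a η w G) {h : ℕ} (hh : h < m) {t : ℝ} (ht : t ∈ Ioo 0 T) :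
    HasDerivAt (w h) (w (h + 1) t) t :=
  (hw.deriv h hh t (Ioo_subset_Icc_self ht)).hasDerivAt (Icc_mem_nhds ht.1 ht.2)

theorem scaleRoots_prod_X_sub_C {ι : Type*} (s : Finset ι) (μ : ι → ℂ) (z : ℂ) :
    (∏ i ∈ s, (X - C (μ i)) : ℂ[X]).scaleRoots z = ∏ i ∈ s, (X - C (z * μ i)) := by
  classical
  induction s using Finset.induction_on with
  | empty => simp
  | insert i s hi ih =>
    rw [Finset.prod_insert hi, Finset.prod_insert hi, mul_scaleRoots_of_noZeroDivisors, ih,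
      X_sub_C_scaleRoots, mul_comm (μ i)]

theorem natDegree_charPoly {m : ℕ} {a : ℕ → ℝ → ℝ} {μ : Fin m → ℝ} {t : ℝ}
    (h : charPoly m a t = ∏ i, (X - C (μ i))) : (charPoly m a t).natDegree = m := by
  rw [h]
  simp [natDegree_prod_of_monic, monic_X_sub_C]

/-- Scaling the roots of the characteristic polynomial by `i η` multiplies the coefficient `a_k` by
`(i η)^k`. Hence the full product of first-order factors is exactly the operator of the mode
equation. -/
theorem sym_univ {m : ℕ} {a : ℕ → ℝ → ℝ} {μ : Fin m → ℝ} {t : ℝ} (η : ℝ)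
    (h : charPoly m a t = ∏ i, (X - C (μ i))) :
    sym η μ Finset.univ = X ^ m + ∑ k ∈ Finset.Icc 1 m,
      C ((a k t : ℂ) * (Complex.I * η) ^ k) * X ^ (m - k) := by
  have h1 : sym η μ Finset.univ
      = ((charPoly m a t).map Complex.ofRealHom).scaleRoots (Complex.I * η) := by
    rw [h, Polynomial.map_prod]
    simp only [Polynomial.map_sub, map_X, map_C]
    rw [scaleRoots_prod_X_sub_C]
    rfl
  rw [h1]
  ext i
  rw [coeff_scaleRoots, natDegree_map, natDegree_charPoly h]
  simp only [charPoly, Polynomial.map_add, Polynomial.map_pow, map_X, Polynomial.map_sum,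
    Polynomial.map_mul, map_C, coeff_add, coeff_X_pow, finsetSum_coeff, coeff_C_mul, add_mul,
    Finset.sum_mul]
  congr 1
  · split_ifs with h0
    · simp [h0]
    · simp
  · refine Finset.sum_congr rfl fun k hk => ?_
    rw [Finset.mem_Icc] at hk
    split_ifs with h0
    · rw [h0, show m - (m - k) = k by omega]
      simp
    · simp

theorem ModeSolution.act_sym_univ {m : ℕ} {T : ℝ} {a : ℕ → ℝ → ℝ} {η : ℝ} {w : ℕ → ℝ → ℂ}
    {G : ℝ → ℂ} (hw : ModeSolution m T a η w G) {μ : Fin m → ℝ} {t : ℝ} (ht : t ∈ Icc 0 T)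
    (h : charPoly m a t = ∏ i, (X - C (μ i))) :
    act (fun h => w h t) (sym η μ Finset.univ) = G t := by
  rw [sym_univ η h, map_add, map_sum, act_X_pow, ← hw.equation t ht]
  simp only [act_C_mul, act_X_pow]

/-- At each time the differential inequality is proved for a local differentiable labelling and
carried over to `lam` by permutation invariance. No continuity of the individual `lam i` is
required. -/
theorem ModeSolution.energy_le {m : ℕ} {T : ℝ} {a : ℕ → ℝ → ℝ} {η : ℝ} {w : ℕ → ℝ → ℂ}
    {G : ℝ → ℂ} (hw : ModeSolution m T a η w G) {lam : Fin m → ℝ → ℝ}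
    (hlam : ∀ t ∈ Icc 0 T, charPoly m a t = ∏ i, (X - C (lam i t)))
    {K N : ℝ} (hK : 0 ≤ K) (hN : 2 ^ m * (m + 1 + 2 * m * K) ≤ N) {s₁ s₂ : ℝ} (h12 : s₁ ≤ s₂)
    (hs : Icc s₁ s₂ ⊆ Ioo 0 T) {σ Θ : ℝ → ℝ} {ε : ℝ} (hε : |ε| ≤ 1)
    (hreg : ∀ t ∈ Icc s₁ s₂, RootsRegularAt lam K (σ t) t)
    (hσ0 : ∀ t ∈ Icc s₁ s₂, 0 < σ t)
    (hσ : ∀ t ∈ Icc s₁ s₂, HasDerivAt σ (ε * σ t ^ 2) t)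
    (hΘ0 : ∀ t ∈ Icc s₁ s₂, 0 ≤ Θ t)
    (hΘ : ∀ t ∈ Icc s₁ s₂, HasDerivAt Θ (-(N * σ t * Θ t)) t) :
    Θ s₂ * √(energy η (σ s₂) (fun i => lam i s₂) fun h => w h s₂)
      ≤ Θ s₁ * √(energy η (σ s₁) (fun i => lam i s₁) fun h => w h s₁)
        + 2 ^ m * ∫ t in s₁..s₂, Θ t * ‖G t‖ := by
  set E : ℝ → ℝ := fun s => energy η (σ s) (fun i => lam i s) fun h => w h s with hE
  have key : ∀ t ∈ Icc s₁ s₂, ∃ E' : ℝ, HasDerivAt E E' t ∧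
      E' ≤ 2 * (N * σ t) * E t + 2 * (2 ^ m * ‖G t‖) * √(E t) := by
    intro t ht
    obtain ⟨ψ, ψ', h1, h2, h3, h4⟩ := hreg t ht
    obtain ⟨E', h5, h6⟩ := hasDerivAt_energy (η := η) hK (hσ0 t ht) hε (hσ t ht) h2
      (fun i j hij => by rw [h1, h1]; exact h3 i j hij) (w := w)
      fun h hh => hw.hasDerivAt hh (hs ht)
    simp only [h1] at h6
    rw [hw.act_sym_univ (Ioo_subset_Icc_self (hs ht)) (hlam t (Ioo_subset_Icc_self (hs ht)))] at h6
    refine ⟨E', h5.congr_of_eventuallyEq ?_, h6.trans ?_⟩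
    · filter_upwards [h4] with s hs
      obtain ⟨π, hπ⟩ := hs
      simp only [hπ, hE]
      exact (energy_perm η (σ s) (fun i => lam i s) _ π).symm
    · have := energy_nonneg η (σ t) (fun i => lam i t) fun h => w h t
      have := (hσ0 t ht).le
      simp only [hE]
      gcongr
  choose! E' hE1 hE2 using key
  have hGc : ContinuousOn (fun t => 2 ^ m * ‖G t‖) (Icc s₁ s₂) :=
    continuousOn_const.mul (hw.continuousOn.mono (hs.trans Ioo_subset_Icc_self)).norm
  have hN0 : 0 ≤ N := le_trans (by positivity) hN
  have := mul_sqrt_le_of_deriv_le (E := E) (E' := E') (K := fun t => N * σ t) (Θ := Θ)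
    (g := fun t => 2 ^ m * ‖G t‖) h12
    (fun t _ => energy_nonneg _ _ _ _)
    (fun t ht => (hE1 t ht).continuousAt.continuousWithinAt)
    (fun t ht => hE1 t (Ioo_subset_Icc_self ht))
    (fun t ht => (hΘ t ht).continuousAt.continuousWithinAt) hΘ0
    (fun t ht => hΘ t (Ioo_subset_Icc_self ht))
    (fun t ht => mul_nonneg hN0 (hσ0 t (Ioo_subset_Icc_self ht)).le)
    hGc (fun t _ => by positivity) fun t ht => hE2 t (Ioo_subset_Icc_self ht)
  refine this.trans (le_of_eq ?_)
  rw [← intervalIntegral.integral_const_mul]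
  congr 2
  funext t
  ring

/-- The energy of the companion system, with weights of size `y`. -/
noncomputable def crudeEnergy (m : ℕ) (y : ℝ) (w : ℕ → ℂ) : ℝ :=
  ∑ h ∈ Finset.range m, (y ^ (m - 1 - h) * ‖w h‖) ^ 2

theorem crudeEnergy_nonneg (m : ℕ) (y : ℝ) (w : ℕ → ℂ) : 0 ≤ crudeEnergy m y w :=
  Finset.sum_nonneg fun _ _ => by positivity

theorem le_sqrt_crudeEnergy {m : ℕ} {y : ℝ} {w : ℕ → ℂ} {h : ℕ} (hh : h < m) :
    y ^ (m - 1 - h) * ‖w h‖ ≤ √(crudeEnergy m y w) := by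
  refine Real.le_sqrt_of_sq_le ?_
  exact Finset.single_le_sum (f := fun h => (y ^ (m - 1 - h) * ‖w h‖) ^ 2)
    (fun _ _ => by positivity) (Finset.mem_range.2 hh)

theorem sqrt_crudeEnergy_le {m : ℕ} {y B : ℝ} (hB : 0 ≤ B) (hy : 0 ≤ y) {w : ℕ → ℂ}
    (h : ∀ h < m, y ^ (m - 1 - h) * ‖w h‖ ≤ B) : √(crudeEnergy m y w) ≤ m * B := by
  refine Real.sqrt_le_iff.2 ⟨by positivity, ?_⟩
  have hm : (m : ℝ) ≤ (m : ℝ) ^ 2 := by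
    rcases Nat.eq_zero_or_pos m with h0 | h0
    · simp [h0]
    · have : (1 : ℝ) ≤ m := by exact_mod_cast h0
      nlinarith
  calc crudeEnergy m y w ≤ ∑ h ∈ Finset.range m, B ^ 2 := Finset.sum_le_sum fun i hi =>
        pow_le_pow_left₀ (by positivity) (h i (Finset.mem_range.1 hi)) 2
    _ = m * B ^ 2 := by simp
    _ ≤ m ^ 2 * B ^ 2 := by gcongr
    _ = _ := by ring

theorem ModeSolution.norm_top_le {m : ℕ} {T : ℝ} {a : ℕ → ℝ → ℝ} {η : ℝ} {w : ℕ → ℝ → ℂ}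
    {G : ℝ → ℂ} (hw : ModeSolution m T a η w G) {A y : ℝ}
    (hη : |η| ≤ 2 * Real.pi * y) {t : ℝ} (ht : t ∈ Icc 0 T) (hA : ∀ k ∈ Finset.Icc 1 m, |a k t| ≤ A) :
    ‖w m t‖ ≤ m * (A * (2 * Real.pi) ^ m) * y * √(crudeEnergy m y fun h => w h t) + ‖G t‖ := by
  have hpi : 1 ≤ 2 * Real.pi := by linarith [Real.pi_gt_three]
  have hy : 0 ≤ y := by
    by_contra! h
    nlinarith [abs_nonneg η]
  set e := √(crudeEnergy m y fun h => w h t) with he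
  have h1 : w m t = G t - ∑ k ∈ Finset.Icc 1 m, (a k t : ℂ) * (Complex.I * η) ^ k * w (m - k) t := by
    rw [← hw.equation t ht]; ring
  have h2 : ∀ k ∈ Finset.Icc 1 m, ‖(a k t : ℂ) * (Complex.I * η) ^ k * w (m - k) t‖
      ≤ A * (2 * Real.pi) ^ m * y * e := by
    intro k hk
    have hk' := Finset.mem_Icc.1 hk
    have hA0 : 0 ≤ A := (abs_nonneg _).trans (hA k hk)
    have h3 := le_sqrt_crudeEnergy (y := y) (w := fun h => w h t) (show m - k < m by omega)
    rw [show m - 1 - (m - k) = k - 1 by omega] at h3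
    have hyk : y ^ k = y * y ^ (k - 1) := by rw [← pow_succ']; congr 1; omega
    calc ‖(a k t : ℂ) * (Complex.I * η) ^ k * w (m - k) t‖
        = |a k t| * |η| ^ k * ‖w (m - k) t‖ := by simp
      _ ≤ A * (2 * Real.pi * y) ^ k * ‖w (m - k) t‖ := by
          gcongr
          exact hA k hk
      _ = A * (2 * Real.pi) ^ k * y * (y ^ (k - 1) * ‖w (m - k) t‖) := by
          rw [mul_pow, hyk]; ring
      _ ≤ A * (2 * Real.pi) ^ m * y * e := by
          gcongr
          exact hk'.2
  rw [h1]
  calc _ ≤ ‖G t‖ + ‖∑ k ∈ Finset.Icc 1 m, (a k t : ℂ) * (Complex.I * η) ^ k * w (m - k) t‖ :=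
        norm_sub_le _ _
    _ ≤ ‖G t‖ + ∑ k ∈ Finset.Icc 1 m, A * (2 * Real.pi) ^ m * y * e := by
        gcongr
        exact (norm_sum_le _ _).trans (Finset.sum_le_sum h2)
    _ = _ := by
        rw [Finset.sum_const, nsmul_eq_mul, Nat.card_Icc]
        simp only [Nat.add_sub_cancel]
        ring

/-- Grönwall for the companion system, without any hyperbolicity. The growth rate is of order `y`,
which is harmless over a time of length `1/y`. -/
theorem ModeSolution.crudeEnergy_le {m : ℕ} {T : ℝ} {a : ℕ → ℝ → ℝ} {η : ℝ} {w : ℕ → ℝ → ℂ}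
    {G : ℝ → ℂ} (hw : ModeSolution m T a η w G) {A y : ℝ} (hA0 : 0 ≤ A) (hy : 0 ≤ y)
    (hη : |η| ≤ 2 * Real.pi * y) (hA : ∀ t ∈ Icc 0 T, ∀ k ∈ Finset.Icc 1 m, |a k t| ≤ A)
    {s₁ s₂ : ℝ} (h12 : s₁ ≤ s₂) (hs : Icc s₁ s₂ ⊆ Icc 0 T) :
    √(crudeEnergy m y fun h => w h s₂)
      ≤ Real.exp (m * (1 + m * (A * (2 * Real.pi) ^ m)) * y * (s₂ - s₁)) *
        (√(crudeEnergy m y fun h => w h s₁) + m * ∫ t in s₁..s₂, ‖G t‖) := by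
  set L := 1 + m * (A * (2 * Real.pi) ^ m) with hL
  have hL0 : 0 ≤ L := by positivity
  have hIoo : Ioo s₁ s₂ ⊆ Ioo 0 T := by
    intro t ht
    have h1 := hs (left_mem_Icc.2 h12)
    have h2 := hs (right_mem_Icc.2 h12)
    exact ⟨h1.1.trans_lt ht.1, ht.2.trans_le h2.2⟩
  set E : ℝ → ℝ := fun s => crudeEnergy m y fun h => w h s with hE
  set E' : ℝ → ℝ := fun t => ∑ h ∈ Finset.range m,
    (y ^ (m - 1 - h)) ^ 2 * (2 * inner ℝ (w h t) (w (h + 1) t)) with hE'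
  have hEd : ∀ t ∈ Ioo s₁ s₂, HasDerivAt E (E' t) t := by
    intro t ht
    simp only [hE, crudeEnergy, mul_pow]
    refine HasDerivAt.fun_sum fun h hh => ?_
    exact ((hw.hasDerivAt (Finset.mem_range.1 hh) (hIoo ht)).norm_sq).const_mul _
  have hEc : ContinuousOn E (Icc s₁ s₂) := by
    simp only [hE, crudeEnergy]
    refine continuousOn_finsetSum _ fun h hh => ?_
    refine (continuousOn_const.mul ?_).pow 2
    exact ContinuousOn.norm fun t ht => ((hw.deriv h (Finset.mem_range.1 hh) t
      (hs ht)).continuousWithinAt).mono hs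
  have hineq : ∀ t ∈ Ioo s₁ s₂, E' t ≤ 2 * (m * L * y) * E t + 2 * (m * ‖G t‖) * √(E t) := by
    intro t ht
    have htT := hs (Ioo_subset_Icc_self ht)
    set e := √(E t) with he
    have he0 : 0 ≤ e := Real.sqrt_nonneg _
    have hee : E t = e * e := (Real.mul_self_sqrt (crudeEnergy_nonneg _ _ _)).symm
    have hterm : ∀ h ∈ Finset.range m,
        (y ^ (m - 1 - h)) ^ 2 * (2 * inner ℝ (w h t) (w (h + 1) t))
          ≤ 2 * (e * (L * y * e + ‖G t‖)) := by
      intro h hh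
      have hh' := Finset.mem_range.1 hh
      have h1 : y ^ (m - 1 - h) * ‖w h t‖ ≤ e := le_sqrt_crudeEnergy (w := fun h => w h t) hh'
      have h2 : y ^ (m - 1 - h) * ‖w (h + 1) t‖ ≤ L * y * e + ‖G t‖ := by
        by_cases hm : h + 1 < m
        · have h3 : y ^ (m - 1 - (h + 1)) * ‖w (h + 1) t‖ ≤ e :=
            le_sqrt_crudeEnergy (w := fun h => w h t) hm
          have h4 : y ^ (m - 1 - h) = y * y ^ (m - 1 - (h + 1)) := by
            rw [← pow_succ']; congr 1; omega
          rw [h4, mul_assoc]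
          have h5 : 1 ≤ L := by rw [hL]; linarith [show 0 ≤ m * (A * (2 * Real.pi) ^ m) by positivity]
          calc y * (y ^ (m - 1 - (h + 1)) * ‖w (h + 1) t‖) ≤ y * e := by gcongr
            _ ≤ L * (y * e) := le_mul_of_one_le_left (by positivity) h5
            _ ≤ _ := by linarith [norm_nonneg (G t)]
        · rw [show m - 1 - h = 0 by omega, pow_zero, one_mul, show h + 1 = m by omega]
          refine (hw.norm_top_le hη htT (hA t htT)).trans ?_
          have : 0 ≤ y * e := by positivity
          rw [hL]
          nlinarith
      calc _ ≤ (y ^ (m - 1 - h)) ^ 2 * (2 * (‖w h t‖ * ‖w (h + 1) t‖)) := by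
            gcongr
            exact real_inner_le_norm _ _
        _ = 2 * ((y ^ (m - 1 - h) * ‖w h t‖) * (y ^ (m - 1 - h) * ‖w (h + 1) t‖)) := by ring
        _ ≤ _ := by gcongr
    calc E' t ≤ ∑ h ∈ Finset.range m, 2 * (e * (L * y * e + ‖G t‖)) := Finset.sum_le_sum hterm
      _ = _ := by
        rw [Finset.sum_const, nsmul_eq_mul, Finset.card_range, hee]; ring
  set κ := m * L * y with hκ
  have hκ0 : 0 ≤ κ := by positivity
  have := mul_sqrt_le_of_deriv_le (E := E) (E' := E') (K := fun _ => κ)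
    (Θ := fun t => Real.exp (-(κ * (t - s₁)))) (g := fun t => m * ‖G t‖) h12
    (fun t _ => crudeEnergy_nonneg _ _ _) hEc hEd (by fun_prop) (fun t _ => (Real.exp_pos _).le)
    (fun t _ => by
      have h1 : HasDerivAt (fun t => -(κ * (t - s₁))) (-(κ * 1)) t :=
        (((hasDerivAt_id t).sub_const s₁).const_mul κ).neg
      exact h1.exp.congr_deriv (by ring))
    (fun _ _ => hκ0) (continuousOn_const.mul (hw.continuousOn.mono hs).norm)
    (fun t _ => by positivity) hineq
  simp only [sub_self, mul_zero, neg_zero, Real.exp_zero, one_mul] at this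
  have hInt : ∫ t in s₁..s₂, Real.exp (-(κ * (t - s₁))) * (m * ‖G t‖)
      ≤ m * ∫ t in s₁..s₂, ‖G t‖ := by
    rw [← intervalIntegral.integral_const_mul]
    have hGc := (hw.continuousOn.mono hs).norm
    refine intervalIntegral.integral_mono_on h12 ?_ ?_ fun t ht => ?_
    · refine ContinuousOn.intervalIntegrable ?_
      rw [uIcc_of_le h12]
      exact ContinuousOn.mul (by fun_prop) (continuousOn_const.mul hGc)
    · refine ContinuousOn.intervalIntegrable ?_
      rw [uIcc_of_le h12]
      exact continuousOn_const.mul hGc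
    · refine mul_le_of_le_one_left (by positivity) (Real.exp_le_one_iff.2 ?_)
      have : 0 ≤ κ * (t - s₁) := mul_nonneg hκ0 (by linarith [ht.1])
      linarith
  have h3 := this.trans (add_le_add_right hInt _)
  have h4 := mul_le_mul_of_nonneg_left h3 (Real.exp_pos (κ * (s₂ - s₁))).le
  rw [← mul_assoc, ← Real.exp_add, add_neg_cancel, Real.exp_zero, one_mul] at h4
  exact h4

end Modes

/-! ### Mode estimates on intervals with a singular endpoint -/

section ModeEstimates

open Polynomial

/-- The shift `k` is there for the induction: removing a factor `X - c` produces the same pairing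
with the sequence shifted by one. -/
theorem norm_act_sym_le_crude {m : ℕ} {η y Λ : ℝ} (hy : 0 ≤ y) (hΛ : 0 ≤ Λ) {μ : Fin m → ℝ}
    (hμ : ∀ j, |η * μ j| ≤ Λ * y) {w : ℕ → ℂ} (S : Finset (Fin m)) (k : ℕ) (hk : S.card + k < m) :
    y ^ (m - 1 - S.card - k) * ‖act (fun h => w (h + k)) (sym η μ S)‖
      ≤ (1 + Λ) ^ S.card * √(crudeEnergy m y w) := by
  induction S using Finset.induction_on generalizing k with
  | empty =>
    simp only [sym, Finset.prod_empty, act_one, Finset.card_empty, pow_zero, one_mul, zero_add,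
      Nat.sub_zero]
    simp only [Finset.card_empty, zero_add] at hk
    exact le_sqrt_crudeEnergy hk
  | insert j S hj ih =>
    rw [Finset.card_insert_of_notMem hj] at hk ⊢
    rw [act_sym_insert η μ hj]
    have h1 := ih (k + 1) (by omega)
    have h2 := ih k (by omega)
    have e1 : m - 1 - (S.card + 1) - k = m - 1 - S.card - (k + 1) := by omega
    have e2 : y ^ (m - 1 - S.card - k) = y * y ^ (m - 1 - S.card - (k + 1)) := by
      rw [← pow_succ']; congr 1; omega
    rw [e2] at h2
    rw [e1]
    set p := y ^ (m - 1 - S.card - (k + 1)) with hp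
    have hp0 : 0 ≤ p := by positivity
    have h3 : (fun h => w (h + 1 + k)) = fun h => w (h + (k + 1)) := by
      funext h; congr 1; ring
    rw [h3]
    calc p * ‖act (fun h => w (h + (k + 1))) (sym η μ S)
          - Complex.I * η * μ j * act (fun h => w (h + k)) (sym η μ S)‖
        ≤ p * (‖act (fun h => w (h + (k + 1))) (sym η μ S)‖
          + |η * μ j| * ‖act (fun h => w (h + k)) (sym η μ S)‖) := by
          gcongr
          refine (norm_sub_le _ _).trans (le_of_eq ?_)
          simp [abs_mul]
      _ ≤ p * (‖act (fun h => w (h + (k + 1))) (sym η μ S)‖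
          + (Λ * y) * ‖act (fun h => w (h + k)) (sym η μ S)‖) := by
          gcongr
          exact hμ j
      _ = p * ‖act (fun h => w (h + (k + 1))) (sym η μ S)‖
          + Λ * (y * p * ‖act (fun h => w (h + k)) (sym η μ S)‖) := by ring
      _ ≤ (1 + Λ) ^ S.card * √(crudeEnergy m y w)
          + Λ * ((1 + Λ) ^ S.card * √(crudeEnergy m y w)) := by gcongr
      _ = _ := by ring

theorem sqrt_energy_le_crude {m : ℕ} {η y σ Λ : ℝ} (hσ : 0 ≤ σ) (hσy : σ ≤ y) (hΛ : 0 ≤ Λ)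
    {μ : Fin m → ℝ} (hμ : ∀ j, |η * μ j| ≤ Λ * y) (w : ℕ → ℂ) :
    √(energy η σ μ w) ≤ 2 ^ m * (1 + Λ) ^ m * √(crudeEnergy m y w) := by
  have hy : 0 ≤ y := hσ.trans hσy
  set e := √(crudeEnergy m y w) with he
  have he0 : 0 ≤ e := Real.sqrt_nonneg _
  refine Real.sqrt_le_iff.2 ⟨by positivity, ?_⟩
  have hterm : ∀ S ∈ properSubsets m,
      (σ ^ (m - 1 - S.card) * ‖act w (sym η μ S)‖) ^ 2 ≤ ((1 + Λ) ^ m * e) ^ 2 := by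
    intro S hS
    have hc := card_lt_of_mem_properSubsets hS
    have h1 := norm_act_sym_le_crude hy hΛ hμ (w := w) S 0 (by omega)
    refine pow_le_pow_left₀ (by positivity) ?_ 2
    calc σ ^ (m - 1 - S.card) * ‖act w (sym η μ S)‖
        ≤ y ^ (m - 1 - S.card) * ‖act w (sym η μ S)‖ := by gcongr
      _ ≤ (1 + Λ) ^ S.card * e := h1
      _ ≤ (1 + Λ) ^ m * e := by
          gcongr
          linarith
  have hcard : ((properSubsets m).card : ℝ) ≤ 2 ^ m := by
    have h := Finset.card_le_univ (properSubsets m)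
    rw [Fintype.card_finset, Fintype.card_fin] at h
    exact_mod_cast h
  have h2 : (1 : ℝ) ≤ 2 ^ m := one_le_pow₀ (by norm_num)
  calc energy η σ μ w ≤ ∑ S ∈ properSubsets m, ((1 + Λ) ^ m * e) ^ 2 := Finset.sum_le_sum hterm
    _ = (properSubsets m).card * ((1 + Λ) ^ m * e) ^ 2 := by rw [Finset.sum_const, nsmul_eq_mul]
    _ ≤ 2 ^ m * ((1 + Λ) ^ m * e) ^ 2 := by gcongr
    _ ≤ 2 ^ m * (2 ^ m * ((1 + Λ) ^ m * e) ^ 2) := le_mul_of_one_le_left (by positivity) h2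
    _ = _ := by ring

/-- A bare derivative is recovered from the products one order at a time: each shift equals an
adjoined factor plus `i η μ_j` times the unshifted term, and both cost at most a multiple of `y`. -/
theorem norm_shift_le_energy {m : ℕ} {η y σ Λ : ℝ} (hσ : 0 ≤ σ) (hσy : σ ≤ y) (hΛ : 0 ≤ Λ)
    {μ : Fin m → ℝ} (hμ : ∀ j, |η * μ j| ≤ Λ * y) {w : ℕ → ℂ} (k : ℕ) (S : Finset (Fin m))
    (hk : S.card + k < m) :
    σ ^ (m - 1 - S.card) * ‖act (fun h => w (h + k)) (sym η μ S)‖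
      ≤ ((1 + Λ) * y) ^ k * √(energy η σ μ w) := by
  have hy : 0 ≤ y := hσ.trans hσy
  induction k generalizing S with
  | zero =>
    simpa using le_sqrt_energy (σ := σ) (η := η) μ w (mem_properSubsets_of_card_lt (by omega))
  | succ k ih =>
    obtain ⟨j, hj⟩ : ∃ j, j ∉ S := by
      by_contra! hall
      have : S.card = m := by rw [Finset.eq_univ_of_forall hall]; simp
      omega
    have h1 := ih (insert j S) (by rw [Finset.card_insert_of_notMem hj]; omega)
    have h2 := ih S (by omega)
    rw [Finset.card_insert_of_notMem hj] at h1
    have e1 : σ ^ (m - 1 - S.card) = σ * σ ^ (m - 1 - (S.card + 1)) := by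
      rw [← pow_succ']; congr 1; omega
    have e2 : act (fun h => w (h + (k + 1))) (sym η μ S)
        = act (fun h => w (h + k)) (sym η μ (insert j S))
          + Complex.I * η * μ j * act (fun h => w (h + k)) (sym η μ S) := by
      rw [act_sym_insert η μ hj]
      have h3 : (fun h => w (h + 1 + k)) = fun h => w (h + (k + 1)) := by
        funext h; congr 1; ring
      rw [h3]; ring
    set B := ((1 + Λ) * y) ^ k * √(energy η σ μ w) with hB
    calc σ ^ (m - 1 - S.card) * ‖act (fun h => w (h + (k + 1))) (sym η μ S)‖
        ≤ σ ^ (m - 1 - S.card) * (‖act (fun h => w (h + k)) (sym η μ (insert j S))‖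
          + |η * μ j| * ‖act (fun h => w (h + k)) (sym η μ S)‖) := by
          rw [e2]
          gcongr
          refine (norm_add_le _ _).trans (le_of_eq ?_)
          simp [abs_mul]
      _ = σ * (σ ^ (m - 1 - (S.card + 1)) * ‖act (fun h => w (h + k)) (sym η μ (insert j S))‖)
          + |η * μ j| * (σ ^ (m - 1 - S.card) * ‖act (fun h => w (h + k)) (sym η μ S)‖) := by
          rw [mul_add, ← mul_assoc, ← mul_assoc, ← e1]; ring
      _ ≤ y * B + (Λ * y) * B := by
          gcongr
          exact hμ j
      _ = _ := by rw [hB]; ring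

theorem norm_le_energy {m : ℕ} {η y σ Λ : ℝ} (hσ : 1 ≤ σ) (hσy : σ ≤ y) (hΛ : 0 ≤ Λ)
    {μ : Fin m → ℝ} (hμ : ∀ j, |η * μ j| ≤ Λ * y) {w : ℕ → ℂ} {h : ℕ} (hh : h < m) :
    ‖w h‖ ≤ (1 + Λ) ^ m * y ^ h * √(energy η σ μ w) := by
  have h1 := norm_shift_le_energy (zero_le_one.trans hσ) hσy hΛ hμ (w := w) h ∅ (by simpa using hh)
  have h2 : 1 ≤ σ ^ (m - 1 - 0) := one_le_pow₀ hσ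
  simp only [Finset.card_empty, sym, Finset.prod_empty, act_one, zero_add] at h1
  have hy : 0 ≤ y := by linarith
  calc ‖w h‖ ≤ σ ^ (m - 1 - 0) * ‖w h‖ := le_mul_of_one_le_left (norm_nonneg _) h2
    _ ≤ _ := h1
    _ ≤ (1 + Λ) ^ m * y ^ h * √(energy η σ μ w) := by
        rw [mul_pow]
        gcongr
        linarith

theorem sqrt_crudeEnergy_le_energy {m : ℕ} {η y Λ : ℝ} (hy : 0 < y) (hΛ : 0 ≤ Λ)
    {μ : Fin m → ℝ} (hμ : ∀ j, |η * μ j| ≤ Λ * y) (w : ℕ → ℂ) :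
    √(crudeEnergy m y w) ≤ m * ((1 + Λ) ^ m * √(energy η y μ w)) := by
  refine sqrt_crudeEnergy_le (by positivity) hy.le fun h hh => ?_
  have h1 := norm_shift_le_energy hy.le le_rfl hΛ hμ (w := w) h ∅ (by simpa using hh)
  simp only [Finset.card_empty, sym, Finset.prod_empty, act_one, zero_add, Nat.sub_zero] at h1
  have e1 : y ^ (m - 1) = y ^ h * y ^ (m - 1 - h) := by rw [← pow_add]; congr 1; omega
  rw [e1, mul_pow, mul_comm ((1 + Λ) ^ h), mul_assoc, mul_assoc] at h1
  have h2 := le_of_mul_le_mul_left h1 (by positivity)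
  refine h2.trans ?_
  gcongr
  linarith

theorem sqrt_crudeEnergy_le_sum {m : ℕ} {y : ℝ} (hy : 1 ≤ y) (w : ℕ → ℂ) :
    √(crudeEnergy m y w) ≤ m * (y ^ m * ∑ h ∈ Finset.range m, ‖w h‖) := by
  refine sqrt_crudeEnergy_le (by positivity) (by linarith) fun h hh => ?_
  gcongr
  · omega
  · exact Finset.single_le_sum (f := fun h => ‖w h‖) (fun _ _ => norm_nonneg _)
      (Finset.mem_range.2 hh)

theorem ModeSolution.inner_estimate {m : ℕ} {T : ℝ} {a : ℕ → ℝ → ℝ} {η : ℝ} {w : ℕ → ℝ → ℂ}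
    {G : ℝ → ℂ} (hw : ModeSolution m T a η w G) {A y : ℝ} (hA0 : 0 ≤ A) (hy : 1 ≤ y)
    (hη : |η| ≤ 2 * Real.pi * y) (hA : ∀ t ∈ Icc 0 T, ∀ k ∈ Finset.Icc 1 m, |a k t| ≤ A)
    {s₁ s₂ : ℝ} (h12 : s₁ ≤ s₂) (hs : Icc s₁ s₂ ⊆ Icc 0 T) (hlen : y * (s₂ - s₁) ≤ 1) :
    √(crudeEnergy m y fun h => w h s₂)
      ≤ Real.exp (m * (1 + m * (A * (2 * Real.pi) ^ m))) *
        (√(crudeEnergy m y fun h => w h s₁) + m * ∫ t in s₁..s₂, ‖G t‖) := by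
  refine (hw.crudeEnergy_le hA0 (by linarith) hη hA h12 hs).trans ?_
  have h0 : 0 ≤ ∫ t in s₁..s₂, ‖G t‖ :=
    intervalIntegral.integral_nonneg h12 fun _ _ => norm_nonneg _
  refine mul_le_mul_of_nonneg_right (Real.exp_le_exp.2 ?_) (by positivity)
  rw [mul_assoc]
  exact mul_le_of_le_one_right (by positivity) hlen

theorem norm_le_crude {m : ℕ} {y : ℝ} (hy : 1 ≤ y) {w : ℕ → ℂ} {h : ℕ} (hh : h < m) :
    ‖w h‖ ≤ y ^ h * √(crudeEnergy m y w) := by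
  have h1 := le_sqrt_crudeEnergy (y := y) (w := w) hh
  have h2 : 1 ≤ y ^ (m - 1 - h) := one_le_pow₀ hy
  have h3 : 1 ≤ y ^ h := one_le_pow₀ hy
  calc ‖w h‖ ≤ y ^ (m - 1 - h) * ‖w h‖ := le_mul_of_one_le_left (norm_nonneg _) h2
    _ ≤ √(crudeEnergy m y w) := h1
    _ ≤ _ := le_mul_of_one_le_left (Real.sqrt_nonneg _) h3

theorem intervalIntegral_mul_le_of_le {g : ℝ → ℝ} {f₁ f₂ : ℝ → ℝ} {s₁ s₂ c : ℝ} (h12 : s₁ ≤ s₂)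
    (hg : ContinuousOn g (Icc s₁ s₂)) (hf₁ : ContinuousOn f₁ (Icc s₁ s₂))
    (hf₂ : ContinuousOn f₂ (Icc s₁ s₂)) (hg0 : ∀ t ∈ Icc s₁ s₂, 0 ≤ g t)
    (h : ∀ t ∈ Icc s₁ s₂, f₁ t ≤ c * f₂ t) :
    ∫ t in s₁..s₂, f₁ t * g t ≤ c * ∫ t in s₁..s₂, f₂ t * g t := by
  rw [← intervalIntegral.integral_const_mul]
  refine intervalIntegral.integral_mono_on h12 ?_ ?_ fun t ht => ?_
  · exact ContinuousOn.intervalIntegrable (by rw [uIcc_of_le h12]; exact hf₁.mul hg)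
  · refine ContinuousOn.intervalIntegrable ?_
    rw [uIcc_of_le h12]
    exact continuousOn_const.mul (hf₂.mul hg)
  · rw [← mul_assoc]
    exact mul_le_mul_of_nonneg_right (h t ht) (hg0 t ht)

/-- Estimate of the Fourier modes on an interval `[α, β]` for which only the left end point is
singular. -/
theorem mode_estimate_left {m : ℕ} (hm : 1 ≤ m) {T : ℝ} {a : ℕ → ℝ → ℝ} {lam : Fin m → ℝ → ℝ}
    (hlam : ∀ t ∈ Icc 0 T, charPoly m a t = ∏ i, (X - C (lam i t)))
    {A Λ : ℝ} (hA0 : 0 ≤ A) (hA : ∀ t ∈ Icc 0 T, ∀ k ∈ Finset.Icc 1 m, |a k t| ≤ A)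
    (hΛ0 : 0 ≤ Λ) (hΛ : ∀ t ∈ Icc 0 T, ∀ i, |lam i t| ≤ Λ) {K : ℝ} (hK : 0 ≤ K) {α β : ℝ}
    (hα : 0 ≤ α) (hβ : β < T) (hlen : β ≤ α + 1)
    (hreg : ∀ t ∈ Ioc α β, RootsRegularAt lam K (t - α)⁻¹ t) :
    ∃ (N : ℕ) (D : ℝ), 0 ≤ D ∧ ∀ (y η : ℝ) (w : ℕ → ℝ → ℂ) (G : ℝ → ℂ), 1 ≤ y →
      |η| ≤ 2 * Real.pi * y → ModeSolution m T a η w G → ∀ t ∈ Icc α β, ∀ h < m,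
      ((1 + (t - α) * y) ^ N)⁻¹ * ‖w h t‖ ≤ D * y ^ h * (y ^ (m + N) * ∑ l ∈ Finset.range m, ‖w l α‖
        + ∫ s in α..t, ((1 + (s - α) * y) ^ N)⁻¹ * ‖G s‖) := by
  -- The rate constant of the energy becomes an exponent: integrating `N/(t - α)` from `α + 1/y`
  -- gives `((t - α) y)^N`.
  obtain ⟨N, hN⟩ := exists_nat_ge (2 ^ m * (m + 1 + 2 * m * K) : ℝ)
  set Λ' := 2 * Real.pi * Λ with hΛ'
  have hΛ'0 : 0 ≤ Λ' := by positivity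
  set c₁ := Real.exp (m * (1 + m * (A * (2 * Real.pi) ^ m))) with hc₁
  have hc₁1 : 1 ≤ c₁ := Real.one_le_exp (by positivity)
  have hm1 : (1 : ℝ) ≤ m := by exact_mod_cast hm
  set D₀ := 2 ^ m * (1 + Λ') ^ m * (c₁ * m) with hD₀
  have hL1 : 1 ≤ (1 + Λ') ^ m := one_le_pow₀ (by linarith)
  have h2m : (1 : ℝ) ≤ 2 ^ m := one_le_pow₀ (by norm_num)
  have h2N : (1 : ℝ) ≤ 2 ^ N := one_le_pow₀ (by norm_num)
  have hcm : 1 ≤ c₁ * m := one_le_mul_of_one_le_of_one_le hc₁1 hm1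
  have hD₀c : c₁ * m ≤ D₀ :=
    le_mul_of_one_le_left (by positivity) (one_le_mul_of_one_le_of_one_le h2m hL1)
  have hD₀2 : 2 ^ m ≤ D₀ := by
    rw [hD₀, mul_assoc]
    exact le_mul_of_one_le_right (by positivity) (one_le_mul_of_one_le_of_one_le hL1 hcm)
  refine ⟨N, (1 + Λ') ^ m * (D₀ * 2 ^ N), by positivity, ?_⟩
  intro y η w G hy hη hw t ht h hh
  set Θ : ℝ → ℝ := fun s => ((1 + (s - α) * y) ^ N)⁻¹ with hΘ
  set V := ∑ l ∈ Finset.range m, ‖w l α‖ with hV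
  have hV0 : 0 ≤ V := Finset.sum_nonneg fun _ _ => norm_nonneg _
  have hy0 : 0 < y := by linarith
  have hsub : Icc α β ⊆ Icc 0 T := Icc_subset_Icc hα hβ.le
  have hμ : ∀ s ∈ Icc α β, ∀ j, |η * lam j s| ≤ Λ' * y := by
    intro s hs j
    rw [abs_mul, hΛ']
    calc |η| * |lam j s| ≤ (2 * Real.pi * y) * Λ :=
          mul_le_mul hη (hΛ s (hsub hs) j) (abs_nonneg _) (by positivity)
      _ = _ := by ring
  have hbase : ∀ s, α ≤ s → 1 ≤ 1 + (s - α) * y := fun s hs => by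
    have : 0 ≤ (s - α) * y := mul_nonneg (by linarith) hy0.le
    linarith
  have hΘ0 : ∀ s, α ≤ s → 0 < Θ s := fun s hs => by
    have := hbase s hs
    simp only [hΘ]; positivity
  have hΘ1 : ∀ s, α ≤ s → Θ s ≤ 1 := fun s hs => inv_le_one_of_one_le₀ (one_le_pow₀ (hbase s hs))
  have hΘc : ContinuousOn Θ (Icc α β) := by
    refine ContinuousOn.inv₀ (by fun_prop) fun s hs => ?_
    have := hbase s hs.1
    positivity
  have hGc : ContinuousOn (fun s => ‖G s‖) (Icc α β) := (hw.continuousOn.mono hsub).norm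
  -- Within distance `1/y` of the singular point the crude energy grows by a bounded factor, and
  -- there `Θ` is at least `2^(-N)`.
  have hinner : ∀ s ∈ Icc α β, y * (s - α) ≤ 1 → √(crudeEnergy m y fun h => w h s)
      ≤ c₁ * m * (y ^ m * V + 2 ^ N * ∫ r in α..s, Θ r * ‖G r‖) := by
    intro s hs hys
    have hss : Icc α s ⊆ Icc α β := Icc_subset_Icc_right hs.2
    have h1 := hw.inner_estimate hA0 hy hη hA hs.1 (hss.trans hsub) hys
    have h2 := sqrt_crudeEnergy_le_sum (m := m) hy fun h => w h α
    have h3 : ∫ r in α..s, ‖G r‖ ≤ 2 ^ N * ∫ r in α..s, Θ r * ‖G r‖ := by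
      have := intervalIntegral_mul_le_of_le (g := fun r => ‖G r‖) (f₁ := fun _ => 1) (f₂ := Θ)
        (c := 2 ^ N) hs.1 (hGc.mono hss) continuousOn_const (hΘc.mono hss)
        (fun _ _ => norm_nonneg _) fun r hr => ?_
      · simpa using this
      · simp only [hΘ]
        rw [← div_eq_mul_inv, one_le_div (by have := hbase r hr.1; positivity)]
        refine pow_le_pow_left₀ (by linarith [hbase r hr.1]) ?_ N
        have : y * (r - α) ≤ y * (s - α) := mul_le_mul_of_nonneg_left (by linarith [hr.2]) hy0.le
        linarith
    calc _ ≤ c₁ * (m * (y ^ m * V) + m * (2 ^ N * ∫ r in α..s, Θ r * ‖G r‖)) := by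
          refine h1.trans ?_
          gcongr
      _ = _ := by ring
  have hJ0 : ∀ s s', α ≤ s → s ≤ s' → 0 ≤ ∫ r in s..s', Θ r * ‖G r‖ := fun s s' hs hss' =>
    intervalIntegral.integral_nonneg hss' fun r hr =>
      mul_nonneg (hΘ0 r (hs.trans hr.1)).le (norm_nonneg _)
  have hyN : y ^ m * V ≤ y ^ (m + N) * V := by
    gcongr
    · omega
  set J := ∫ s in α..t, Θ s * ‖G s‖ with hJ
  have hJnn : 0 ≤ J := hJ0 α t le_rfl ht.1
  have hfin : ∀ B, B ≤ D₀ * (y ^ m * V + 2 ^ N * J) →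
      (1 + Λ') ^ m * y ^ h * B ≤ (1 + Λ') ^ m * (D₀ * 2 ^ N) * y ^ h * (y ^ (m + N) * V + J) := by
    intro B hB
    calc (1 + Λ') ^ m * y ^ h * B
        ≤ (1 + Λ') ^ m * y ^ h * (D₀ * (y ^ m * V + 2 ^ N * J)) := by gcongr
      _ ≤ (1 + Λ') ^ m * y ^ h * (D₀ * (2 ^ N * (y ^ (m + N) * V) + 2 ^ N * J)) := by
          refine mul_le_mul_of_nonneg_left (mul_le_mul_of_nonneg_left ?_ (by positivity))
            (by positivity)
          have := hyN.trans (le_mul_of_one_le_left (by positivity) h2N)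
          linarith
      _ = _ := by ring
  by_cases htin : y * (t - α) ≤ 1
  · have h1 := hinner t ht htin
    have h2 := norm_le_crude hy (w := fun h => w h t) hh
    have h3 : √(crudeEnergy m y fun h => w h t) ≤ D₀ * (y ^ m * V + 2 ^ N * J) :=
      h1.trans (mul_le_mul_of_nonneg_right hD₀c (by positivity))
    calc Θ t * ‖w h t‖ ≤ 1 * ‖w h t‖ := mul_le_mul_of_nonneg_right (hΘ1 t ht.1) (norm_nonneg _)
      _ ≤ y ^ h * √(crudeEnergy m y fun h => w h t) := by rw [one_mul]; exact h2
      _ ≤ (1 + Λ') ^ m * y ^ h * √(crudeEnergy m y fun h => w h t) := by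
          rw [mul_assoc]
          exact le_mul_of_one_le_left (by positivity) hL1
      _ ≤ _ := hfin _ h3
  · push Not at htin
    -- The time at which `σ = 1/(t - α)` equals `y`. Here the refined energy is comparable with the
    -- crude one, so the two regimes can be joined.
    set t₁ := α + y⁻¹ with ht₁
    have ht₁α : α < t₁ := by rw [ht₁]; linarith [inv_pos.2 hy0]
    have ht₁t : t₁ ≤ t := by
      have : y⁻¹ ≤ t - α := by rw [inv_le_iff_one_le_mul₀ hy0]; linarith
      linarith
    have ht₁mem : t₁ ∈ Icc α β := ⟨ht₁α.le, ht₁t.trans ht.2⟩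
    have hIcc : Icc t₁ t ⊆ Ioc α β := fun s hs => ⟨ht₁α.trans_le hs.1, hs.2.trans ht.2⟩
    have hpos : ∀ s ∈ Icc t₁ t, 0 < s - α := fun s hs => by linarith [(hIcc hs).1]
    have hder : ∀ s ∈ Icc t₁ t, HasDerivAt (fun s => (s - α)⁻¹) (-1 * ((s - α)⁻¹) ^ 2) s := by
      intro s hs
      refine (((hasDerivAt_id s).sub_const α).inv (hpos s hs).ne').congr_deriv ?_
      simp only [id]
      field_simp
    -- With `σ = 1/(s - α)` the integrating factor is `(s - α)^(-N)`. Beyond `t₁` it agrees with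
    -- `y^N Θ` up to a factor at most `2^N`.
    have hout := hw.energy_le hlam (σ := fun s => (s - α)⁻¹) (Θ := fun s => ((s - α)⁻¹) ^ N)
      (ε := -1) (N := N) hK hN ht₁t
      (fun s hs => ⟨hα.trans_lt (hIcc hs).1, (hIcc hs).2.trans_lt hβ⟩) (by norm_num)
      (fun s hs => hreg s (hIcc hs)) (fun s hs => inv_pos.2 (hpos s hs)) hder
      (fun s hs => by have := hpos s hs; positivity) fun s hs => by
        refine ((hder s hs).pow N).congr_deriv ?_
        rcases Nat.eq_zero_or_pos N with h0 | h0
        · simp [h0]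
        · rw [show ((s - α)⁻¹) ^ N = (s - α)⁻¹ * ((s - α)⁻¹) ^ (N - 1) by
            rw [← pow_succ']; congr 1; omega]
          ring
    have hσ₁ : (t₁ - α)⁻¹ = y := by rw [ht₁]; simp
    simp only [hσ₁] at hout
    have hss : Icc t₁ t ⊆ Icc α β := hIcc.trans Ioc_subset_Icc_self
    have hInt : ∫ s in t₁..t, ((s - α)⁻¹) ^ N * ‖G s‖
        ≤ 2 ^ N * y ^ N * ∫ s in t₁..t, Θ s * ‖G s‖ := by
      refine intervalIntegral_mul_le_of_le ht₁t (hGc.mono hss) ?_ (hΘc.mono hss)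
        (fun _ _ => norm_nonneg _) fun s hs => ?_
      · exact fun s hs => ((hder s hs).continuousAt.pow N).continuousWithinAt
      · have h0 := hpos s hs
        have h1 : 1 ≤ y * (s - α) := by
          have : y⁻¹ ≤ s - α := by linarith [hs.1]
          rwa [inv_le_iff_one_le_mul₀ hy0, mul_comm] at this
        simp only [hΘ]
        rw [← inv_pow, ← mul_pow, ← mul_pow]
        refine pow_le_pow_left₀ (by positivity) ?_ N
        rw [← div_eq_mul_inv, inv_eq_one_div, div_le_div_iff₀ h0 (by positivity)]
        linarith
    have hΘt : y ^ N * Θ t ≤ ((t - α)⁻¹) ^ N := by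
      have h0 := hpos t ⟨ht₁t, le_rfl⟩
      simp only [hΘ]
      rw [← inv_pow, ← mul_pow]
      refine pow_le_pow_left₀ (by positivity) ?_ N
      rw [← div_eq_mul_inv, inv_eq_one_div, div_le_div_iff₀ (by positivity) h0]
      linarith
    set Et := √(energy η (t - α)⁻¹ (fun i => lam i t) fun h => w h t) with hEt
    set E₁ := √(energy η y (fun i => lam i t₁) fun h => w h t₁) with hE₁
    set J₂ := ∫ s in t₁..t, Θ s * ‖G s‖ with hJ₂
    set J₁ := ∫ s in α..t₁, Θ s * ‖G s‖ with hJ₁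
    have hJadd : J₁ + J₂ = J := by
      refine intervalIntegral.integral_add_adjacent_intervals ?_ ?_
      · refine ContinuousOn.intervalIntegrable ?_
        rw [uIcc_of_le ht₁α.le]
        exact (hΘc.mul hGc).mono (Icc_subset_Icc_right ht₁mem.2)
      · refine ContinuousOn.intervalIntegrable ?_
        rw [uIcc_of_le ht₁t]
        exact (hΘc.mul hGc).mono hss
    have hJ₁0 : 0 ≤ J₁ := hJ0 α t₁ le_rfl ht₁α.le
    have hJ₂0 : 0 ≤ J₂ := hJ0 t₁ t ht₁α.le ht₁t
    have hEt0 : 0 ≤ Et := Real.sqrt_nonneg _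
    have h1 : y ^ N * (Θ t * Et) ≤ y ^ N * (E₁ + 2 ^ m * (2 ^ N * J₂)) := by
      calc y ^ N * (Θ t * Et) = (y ^ N * Θ t) * Et := by ring
        _ ≤ ((t - α)⁻¹) ^ N * Et := by gcongr
        _ ≤ y ^ N * E₁ + 2 ^ m * ∫ s in t₁..t, ((s - α)⁻¹) ^ N * ‖G s‖ := hout
        _ ≤ y ^ N * E₁ + 2 ^ m * (2 ^ N * y ^ N * J₂) := by gcongr
        _ = _ := by ring
    have h2 : Θ t * Et ≤ E₁ + 2 ^ m * (2 ^ N * J₂) := le_of_mul_le_mul_left h1 (by positivity)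
    have h3 : E₁ ≤ 2 ^ m * (1 + Λ') ^ m * √(crudeEnergy m y fun h => w h t₁) :=
      sqrt_energy_le_crude hy0.le le_rfl hΛ'0 (hμ t₁ ht₁mem) _
    have h4 := hinner t₁ ht₁mem (by rw [ht₁]; field_simp; simp)
    have h5 : E₁ ≤ D₀ * (y ^ m * V + 2 ^ N * J₁) := by
      calc E₁ ≤ 2 ^ m * (1 + Λ') ^ m * (c₁ * m * (y ^ m * V + 2 ^ N * J₁)) := h3.trans (by gcongr)
        _ = _ := by rw [hD₀]; ring
    have h6 : Θ t * Et ≤ D₀ * (y ^ m * V + 2 ^ N * J) := by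
      calc Θ t * Et ≤ D₀ * (y ^ m * V + 2 ^ N * J₁) + D₀ * (2 ^ N * J₂) := by
            refine h2.trans (add_le_add h5 ?_)
            gcongr
        _ = _ := by rw [← hJadd]; ring
    have hσt : (t - α)⁻¹ ≤ y := by
      rw [inv_le_iff_one_le_mul₀ (hpos t ⟨ht₁t, le_rfl⟩)]
      linarith
    -- The length restriction on the interval ensures `σ ≥ 1`, so powers of `σ` in the energy can be
    -- dropped from below.
    have hσt1 : 1 ≤ (t - α)⁻¹ := (one_le_inv₀ (hpos t ⟨ht₁t, le_rfl⟩)).2 (by linarith [ht.2])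
    have h7 := norm_le_energy hσt1 hσt hΛ'0 (hμ t ht) (w := fun h => w h t) hh
    calc Θ t * ‖w h t‖ ≤ Θ t * ((1 + Λ') ^ m * y ^ h * Et) :=
          mul_le_mul_of_nonneg_left h7 (hΘ0 t ht.1).le
      _ = (1 + Λ') ^ m * y ^ h * (Θ t * Et) := by ring
      _ ≤ _ := hfin _ h6

/-- Estimate of the Fourier modes on an interval `[α, β]` for which only the right end point is
singular. -/
theorem mode_estimate_right {m : ℕ} (hm : 1 ≤ m) {T : ℝ} {a : ℕ → ℝ → ℝ} {lam : Fin m → ℝ → ℝ}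
    (hlam : ∀ t ∈ Icc 0 T, charPoly m a t = ∏ i, (X - C (lam i t)))
    {A Λ : ℝ} (hA0 : 0 ≤ A) (hA : ∀ t ∈ Icc 0 T, ∀ k ∈ Finset.Icc 1 m, |a k t| ≤ A)
    (hΛ0 : 0 ≤ Λ) (hΛ : ∀ t ∈ Icc 0 T, ∀ i, |lam i t| ≤ Λ) {K : ℝ} (hK : 0 ≤ K) {α β : ℝ}
    (hα : 0 < α) (hβ : β ≤ T) (hlen : β ≤ α + 1)
    (hreg : ∀ t ∈ Ico α β, RootsRegularAt lam K (β - t)⁻¹ t) :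
    ∃ (N : ℕ) (D : ℝ), 0 ≤ D ∧ ∀ (y η : ℝ) (w : ℕ → ℝ → ℂ) (G : ℝ → ℂ), 1 ≤ y →
      |η| ≤ 2 * Real.pi * y → ModeSolution m T a η w G → ∀ t ∈ Icc α β, ∀ h < m,
      (1 + (β - t) * y) ^ N * ‖w h t‖ ≤ D * y ^ h * (y ^ (m + N) * ∑ l ∈ Finset.range m, ‖w l α‖
        + ∫ s in α..t, (1 + (β - s) * y) ^ N * ‖G s‖) := by
  obtain ⟨N, hN⟩ := exists_nat_ge (2 ^ m * (m + 1 + 2 * m * K) : ℝ)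
  set Λ' := 2 * Real.pi * Λ with hΛ'
  have hΛ'0 : 0 ≤ Λ' := by positivity
  set c₁ := Real.exp (m * (1 + m * (A * (2 * Real.pi) ^ m))) with hc₁
  have hc₁1 : 1 ≤ c₁ := Real.one_le_exp (by positivity)
  have hm1 : (1 : ℝ) ≤ m := by exact_mod_cast hm
  have hL1 : 1 ≤ (1 + Λ') ^ m := one_le_pow₀ (by linarith)
  have h2m : (1 : ℝ) ≤ 2 ^ m := one_le_pow₀ (by norm_num)
  have h2N : (1 : ℝ) ≤ 2 ^ N := one_le_pow₀ (by norm_num)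
  set D₀ := 2 ^ N * (2 ^ m * (1 + Λ') ^ m * m) with hD₀
  have hD₀m : (m : ℝ) ≤ D₀ := by
    rw [hD₀, ← mul_assoc]
    exact le_mul_of_one_le_left (by positivity) (one_le_mul_of_one_le_of_one_le h2N
      (one_le_mul_of_one_le_of_one_le h2m hL1))
  have hD₀2 : 2 ^ N * 2 ^ m ≤ D₀ := by
    rw [hD₀, mul_assoc (2 ^ m : ℝ)]
    gcongr
    exact le_mul_of_one_le_right (by positivity) (one_le_mul_of_one_le_of_one_le hL1 hm1)
  have hD₀1 : 1 ≤ D₀ := hm1.trans hD₀m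
  set D₁ := c₁ * (m * (1 + Λ') ^ m * D₀) with hD₁
  have hD₀₁ : D₀ ≤ D₁ := by
    rw [hD₁, ← mul_assoc]
    exact le_mul_of_one_le_left (by positivity)
      (one_le_mul_of_one_le_of_one_le hc₁1 (one_le_mul_of_one_le_of_one_le hm1 hL1))
  refine ⟨N, (1 + Λ') ^ m * (2 ^ N * D₁), by positivity, ?_⟩
  intro y η w G hy hη hw t ht h hh
  set Θ : ℝ → ℝ := fun s => (1 + (β - s) * y) ^ N with hΘ
  set V := ∑ l ∈ Finset.range m, ‖w l α‖ with hV
  have hV0 : 0 ≤ V := Finset.sum_nonneg fun _ _ => norm_nonneg _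
  have hy0 : 0 < y := by linarith
  have hsub : Icc α β ⊆ Icc 0 T := Icc_subset_Icc hα.le hβ
  have hμ : ∀ s ∈ Icc α β, ∀ j, |η * lam j s| ≤ Λ' * y := by
    intro s hs j
    rw [abs_mul, hΛ']
    calc |η| * |lam j s| ≤ (2 * Real.pi * y) * Λ :=
          mul_le_mul hη (hΛ s (hsub hs) j) (abs_nonneg _) (by positivity)
      _ = _ := by ring
  have hbase : ∀ s, s ≤ β → 1 ≤ 1 + (β - s) * y := fun s hs => by
    have : 0 ≤ (β - s) * y := mul_nonneg (by linarith) hy0.le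
    linarith
  have hΘ1 : ∀ s, s ≤ β → 1 ≤ Θ s := fun s hs => one_le_pow₀ (hbase s hs)
  have hΘ0 : ∀ s, s ≤ β → 0 ≤ Θ s := fun s hs => zero_le_one.trans (hΘ1 s hs)
  have hΘc : ContinuousOn Θ (Icc α β) := by fun_prop
  have hGc : ContinuousOn (fun s => ‖G s‖) (Icc α β) := (hw.continuousOn.mono hsub).norm
  have hJ0 : ∀ s s', s ≤ s' → s' ≤ β → 0 ≤ ∫ r in s..s', Θ r * ‖G r‖ := fun s s' hss' hs' =>
    intervalIntegral.integral_nonneg hss' fun r hr =>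
      mul_nonneg (hΘ0 r (hr.2.trans hs')) (norm_nonneg _)
  have hyN : y ^ m * V ≤ y ^ (m + N) * V := by
    gcongr
    · omega
  have hVα : √(crudeEnergy m y fun h => w h α) ≤ m * (y ^ m * V) :=
    sqrt_crudeEnergy_le_sum (m := m) hy fun h => w h α
  -- With the singularity on the right the regimes come in the opposite order. The refined energy,
  -- now with `σ = 1/(β - s)`, is used first, as long as `β - s ≥ 1/y`.
  have houter : ∀ s ∈ Icc α β, 1 ≤ y * (β - s) →
      Θ s * √(energy η (β - s)⁻¹ (fun i => lam i s) fun h => w h s)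
        ≤ D₀ * (y ^ (m + N) * V + ∫ r in α..s, Θ r * ‖G r‖) := by
    intro s hs hys
    have hsβ : s < β := by
      by_contra! hcon
      have : y * (β - s) ≤ 0 := mul_nonpos_of_nonneg_of_nonpos hy0.le (by linarith)
      linarith
    have hIco : Icc α s ⊆ Ico α β := fun r hr => ⟨hr.1, hr.2.trans_lt hsβ⟩
    have hpos : ∀ r ∈ Icc α s, 0 < β - r := fun r hr => by linarith [(hIco hr).2]
    have hder : ∀ r ∈ Icc α s, HasDerivAt (fun r => (β - r)⁻¹) (1 * ((β - r)⁻¹) ^ 2) r := by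
      intro r hr
      refine (((hasDerivAt_id r).const_sub β).inv (hpos r hr).ne').congr_deriv ?_
      simp only [id]
      field_simp
    have hout := hw.energy_le hlam (σ := fun s => (β - s)⁻¹) (Θ := fun s => (β - s) ^ N)
      (ε := 1) (N := N) hK hN hs.1
      (fun r hr => ⟨hα.trans_le hr.1, (hIco hr).2.trans_le hβ⟩) (by norm_num)
      (fun r hr => hreg r (hIco hr)) (fun r hr => inv_pos.2 (hpos r hr)) hder
      (fun r hr => by have := hpos r hr; positivity) fun r hr => by
        refine (((hasDerivAt_id r).const_sub β).pow N).congr_deriv ?_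
        have h1 := (hpos r hr).ne'
        rcases Nat.eq_zero_or_pos N with h0 | h0
        · simp [h0]
        · rw [show (β - r) ^ N = (β - r) * (β - r) ^ (N - 1) by
            rw [← pow_succ']; congr 1; omega]
          simp only [id]
          field_simp
    have hss : Icc α s ⊆ Icc α β := Icc_subset_Icc_right hs.2
    have hle : ∀ r ∈ Icc α s, y ^ N * (β - r) ^ N ≤ Θ r := by
      intro r hr
      rw [← mul_pow]
      have := hpos r hr
      exact pow_le_pow_left₀ (by positivity) (by linarith) N
    have hInt : ∫ r in α..s, (β - r) ^ N * ‖G r‖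
        ≤ (y ^ N)⁻¹ * ∫ r in α..s, Θ r * ‖G r‖ := by
      refine intervalIntegral_mul_le_of_le hs.1 (hGc.mono hss) (by fun_prop) (hΘc.mono hss)
        (fun _ _ => norm_nonneg _) fun r hr => ?_
      rw [← div_eq_inv_mul, le_div_iff₀' (by positivity)]
      exact hle r hr
    set Es := √(energy η (β - s)⁻¹ (fun i => lam i s) fun h => w h s) with hEs
    set Eα := √(energy η (β - α)⁻¹ (fun i => lam i α) fun h => w h α) with hEα
    set J := ∫ r in α..s, Θ r * ‖G r‖ with hJ
    have hJnn : 0 ≤ J := hJ0 α s hs.1 hs.2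
    have hEs0 : 0 ≤ Es := Real.sqrt_nonneg _
    have hEα0 : 0 ≤ Eα := Real.sqrt_nonneg _
    have hα' : α ∈ Icc α s := ⟨le_rfl, hs.1⟩
    have hσα : (β - α)⁻¹ ≤ y := by
      rw [inv_le_iff_one_le_mul₀ (hpos α hα')]
      have : y * (β - s) ≤ y * (β - α) := mul_le_mul_of_nonneg_left (by linarith [hs.1]) hy0.le
      linarith
    have hEαle : Eα ≤ 2 ^ m * (1 + Λ') ^ m * (m * (y ^ m * V)) :=
      (sqrt_energy_le_crude (inv_pos.2 (hpos α hα')).le hσα hΛ'0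
        (hμ α (hss hα')) _).trans (by gcongr)
    have hΘs : Θ s ≤ 2 ^ N * (y ^ N * (β - s) ^ N) := by
      rw [← mul_pow, ← mul_pow]
      exact pow_le_pow_left₀ (by linarith [hbase s hs.2]) (by linarith) N
    have hpα : (β - α) ^ N ≤ 1 := pow_le_one₀ (hpos α hα').le (by linarith)
    have h1 : (β - s) ^ N * Es ≤ Eα + 2 ^ m * ((y ^ N)⁻¹ * J) := by
      refine hout.trans (add_le_add ?_ ?_)
      · exact mul_le_of_le_one_left hEα0 hpα
      · gcongr
    calc Θ s * Es ≤ 2 ^ N * (y ^ N * (β - s) ^ N) * Es := by gcongr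
      _ = 2 ^ N * y ^ N * ((β - s) ^ N * Es) := by ring
      _ ≤ 2 ^ N * y ^ N * (Eα + 2 ^ m * ((y ^ N)⁻¹ * J)) := by gcongr
      _ = 2 ^ N * (y ^ N * Eα) + 2 ^ N * 2 ^ m * J := by field_simp
      _ ≤ 2 ^ N * (y ^ N * (2 ^ m * (1 + Λ') ^ m * (m * (y ^ m * V)))) + D₀ * J := by gcongr
      _ = _ := by rw [hD₀, pow_add]; ring
  set J := ∫ s in α..t, Θ s * ‖G s‖ with hJ
  have hJnn : 0 ≤ J := hJ0 α t ht.1 ht.2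
  have hfin : ∀ B, B ≤ 2 ^ N * D₁ * (y ^ (m + N) * V + J) →
      (1 + Λ') ^ m * y ^ h * B ≤ (1 + Λ') ^ m * (2 ^ N * D₁) * y ^ h * (y ^ (m + N) * V + J) := by
    intro B hB
    calc (1 + Λ') ^ m * y ^ h * B
        ≤ (1 + Λ') ^ m * y ^ h * (2 ^ N * D₁ * (y ^ (m + N) * V + J)) := by gcongr
      _ = _ := by ring
  by_cases htout : 1 ≤ y * (β - t)
  · have h1 := houter t ht htout
    have hpos : 0 < β - t := by
      by_contra! hcon
      have : y * (β - t) ≤ 0 := mul_nonpos_of_nonneg_of_nonpos hy0.le hcon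
      linarith
    have hσt : (β - t)⁻¹ ≤ y := by
      rw [inv_le_iff_one_le_mul₀ hpos]; linarith
    have hσt1 : 1 ≤ (β - t)⁻¹ := (one_le_inv₀ hpos).2 (by linarith [ht.1])
    have h7 := norm_le_energy hσt1 hσt hΛ'0 (hμ t ht) (w := fun h => w h t) hh
    calc Θ t * ‖w h t‖ ≤ Θ t * ((1 + Λ') ^ m * y ^ h *
          √(energy η (β - t)⁻¹ (fun i => lam i t) fun h => w h t)) :=
          mul_le_mul_of_nonneg_left h7 (hΘ0 t ht.2)
      _ = (1 + Λ') ^ m * y ^ h * (Θ t *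
          √(energy η (β - t)⁻¹ (fun i => lam i t) fun h => w h t)) := by ring
      _ ≤ _ := hfin _ (h1.trans ?_)
    refine mul_le_mul_of_nonneg_right (hD₀₁.trans ?_) (by positivity)
    exact le_mul_of_one_le_left (by positivity) h2N
  · push Not at htout
    -- The crude bound takes over at distance `1/y` from `β`, or at once from `α` if the whole
    -- interval is shorter than that.
    set s₀ := max α (β - y⁻¹) with hs₀
    have hs₀t : s₀ ≤ t := by
      refine max_le ht.1 ?_
      have : β - t ≤ y⁻¹ := by rw [← one_div, le_div_iff₀' hy0]; exact htout.le
      linarith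
    have hs₀mem : s₀ ∈ Icc α β := ⟨le_max_left _ _, hs₀t.trans ht.2⟩
    have hss : Icc s₀ t ⊆ Icc α β := Icc_subset_Icc hs₀mem.1 ht.2
    set J₁ := ∫ s in α..s₀, Θ s * ‖G s‖ with hJ₁
    set J₂ := ∫ s in s₀..t, Θ s * ‖G s‖ with hJ₂
    have hJadd : J₁ + J₂ = J := by
      refine intervalIntegral.integral_add_adjacent_intervals ?_ ?_
      · refine ContinuousOn.intervalIntegrable ?_
        rw [uIcc_of_le hs₀mem.1]
        exact (hΘc.mul hGc).mono (Icc_subset_Icc_right hs₀mem.2)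
      · refine ContinuousOn.intervalIntegrable ?_
        rw [uIcc_of_le hs₀t]
        exact (hΘc.mul hGc).mono hss
    have hJ₁0 : 0 ≤ J₁ := hJ0 α s₀ hs₀mem.1 hs₀mem.2
    have hJ₂0 : 0 ≤ J₂ := hJ0 s₀ t hs₀t ht.2
    have hstart : √(crudeEnergy m y fun h => w h s₀)
        ≤ m * (1 + Λ') ^ m * D₀ * (y ^ (m + N) * V + J₁) := by
      rcases le_total (β - y⁻¹) α with hc | hc
      · have hs₀α : s₀ = α := max_eq_left hc
        rw [hs₀α]
        calc _ ≤ m * (y ^ m * V) := hVα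
          _ ≤ m * (y ^ (m + N) * V + J₁) := by
              gcongr
              linarith
          _ ≤ m * ((1 + Λ') ^ m * D₀ * (y ^ (m + N) * V + J₁)) := by
              gcongr
              exact le_mul_of_one_le_left (by positivity)
                (one_le_mul_of_one_le_of_one_le hL1 hD₀1)
          _ = _ := by ring
      · have hs₀β : s₀ = β - y⁻¹ := max_eq_right hc
        have hσ : (β - s₀)⁻¹ = y := by rw [hs₀β]; simp
        have h1 := houter s₀ hs₀mem (by rw [hs₀β]; field_simp; simp)
        rw [hσ] at h1
        have h2 := sqrt_crudeEnergy_le_energy hy0 hΛ'0 (hμ s₀ hs₀mem) fun h => w h s₀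
        have h3 : √(energy η y (fun i => lam i s₀) fun h => w h s₀)
            ≤ Θ s₀ * √(energy η y (fun i => lam i s₀) fun h => w h s₀) :=
          le_mul_of_one_le_left (Real.sqrt_nonneg _) (hΘ1 s₀ hs₀mem.2)
        calc _ ≤ m * ((1 + Λ') ^ m * √(energy η y (fun i => lam i s₀) fun h => w h s₀)) := h2
          _ ≤ m * ((1 + Λ') ^ m * (D₀ * (y ^ (m + N) * V + J₁))) := by
              gcongr
              exact h3.trans h1
          _ = _ := by ring
    have hlen' : y * (t - s₀) ≤ 1 := by
      have h1 : β - y⁻¹ ≤ s₀ := le_max_right _ _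
      have h2 : t - s₀ ≤ y⁻¹ := by linarith [ht.2]
      calc y * (t - s₀) ≤ y * y⁻¹ := by gcongr
        _ = 1 := mul_inv_cancel₀ hy0.ne'
    have hin := hw.inner_estimate hA0 hy hη hA hs₀t (hss.trans hsub) hlen'
    have hG : ∫ r in s₀..t, ‖G r‖ ≤ J₂ := by
      have := intervalIntegral_mul_le_of_le (g := fun r => ‖G r‖) (f₁ := fun _ => 1) (f₂ := Θ)
        (c := 1) hs₀t (hGc.mono hss) continuousOn_const (hΘc.mono hss)
        (fun _ _ => norm_nonneg _) fun r hr => by rw [one_mul]; exact hΘ1 r (hss hr).2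
      simpa using this
    have hmD : (m : ℝ) ≤ m * (1 + Λ') ^ m * D₀ := by
      rw [mul_assoc]
      exact le_mul_of_one_le_right (by positivity) (one_le_mul_of_one_le_of_one_le hL1 hD₀1)
    have hcr : √(crudeEnergy m y fun h => w h t) ≤ D₁ * (y ^ (m + N) * V + J) := by
      calc _ ≤ c₁ * (m * (1 + Λ') ^ m * D₀ * (y ^ (m + N) * V + J₁)
              + m * (1 + Λ') ^ m * D₀ * J₂) := by
            refine hin.trans (mul_le_mul_of_nonneg_left (add_le_add hstart
              (mul_le_mul hmD hG ?_ (by positivity))) (by positivity))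
            exact intervalIntegral.integral_nonneg hs₀t fun _ _ => norm_nonneg _
        _ = _ := by rw [hD₁, ← hJadd]; ring
    have hΘt : Θ t ≤ 2 ^ N :=
      pow_le_pow_left₀ (by linarith [hbase t ht.2]) (by linarith) N
    calc Θ t * ‖w h t‖ ≤ 2 ^ N * (y ^ h * √(crudeEnergy m y fun h => w h t)) :=
          mul_le_mul hΘt (norm_le_crude hy (w := fun h => w h t) hh) (norm_nonneg _) (by positivity)
      _ ≤ (1 + Λ') ^ m * (2 ^ N * (y ^ h * √(crudeEnergy m y fun h => w h t))) :=
          le_mul_of_one_le_left (by positivity) hL1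
      _ = (1 + Λ') ^ m * y ^ h * (2 ^ N * √(crudeEnergy m y fun h => w h t)) := by ring
      _ ≤ _ := hfin _ ?_
    calc 2 ^ N * √(crudeEnergy m y fun h => w h t) ≤ 2 ^ N * (D₁ * (y ^ (m + N) * V + J)) := by
          gcongr
      _ = _ := by ring

end ModeEstimates

/-! ### Derivatives of the roots near a given time -/

section Regularity

open Polynomial

/-- The logarithmic derivative of an analytic function has at most simple poles. -/
theorem exists_abs_deriv_le_of_analyticAt {g : ℝ → ℝ} {t₀ : ℝ} (hg : AnalyticAt ℝ g t₀) :
    ∃ K : ℝ, 0 ≤ K ∧ ∀ᶠ t in 𝓝[≠] t₀, AnalyticAt ℝ g t ∧ (g t = 0 → ∀ᶠ s in 𝓝 t, g s = 0) ∧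
      |deriv g t| ≤ K * |t - t₀|⁻¹ * |g t| := by
  have han : ∀ᶠ t in 𝓝[≠] t₀, AnalyticAt ℝ g t := hg.eventually_analyticAt.filter_mono
    nhdsWithin_le_nhds
  by_cases h0 : ∀ᶠ z in 𝓝 t₀, g z = 0
  · refine ⟨0, le_rfl, ?_⟩
    filter_upwards [han, nhdsWithin_le_nhds (eventually_eventually_nhds.2 h0)] with t h1 h2
    refine ⟨h1, fun _ => h2, ?_⟩
    have : deriv g t = 0 := by
      have h3 : g =ᶠ[𝓝 t] fun _ => 0 := h2
      rw [h3.deriv_eq]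
      simp
    simp [this]
  · obtain ⟨n, q, hq, hq0, heq⟩ := hg.exists_eventuallyEq_pow_smul_nonzero_iff.2 h0
    have hqd : ContinuousAt (fun t => |deriv q t| / |q t|) t₀ :=
      (hq.deriv.continuousAt.abs).div hq.continuousAt.abs (by simpa using hq0)
    set B := |deriv q t₀| / |q t₀| + 1 with hB
    have hB1 : ∀ᶠ t in 𝓝 t₀, |deriv q t| / |q t| < B := hqd.eventually_lt_const (by simp [hB])
    have hq1 : ∀ᶠ t in 𝓝 t₀, q t ≠ 0 := hq.continuousAt.eventually_ne hq0
    have hdist : ∀ᶠ t in 𝓝 t₀, |t - t₀| < 1 := by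
      have := Metric.ball_mem_nhds t₀ one_pos
      filter_upwards [this] with t ht
      simpa [Real.dist_eq] using ht
    have hB0 : 0 ≤ B := by positivity
    refine ⟨n + B, by positivity, ?_⟩
    filter_upwards [han, nhdsWithin_le_nhds hB1, nhdsWithin_le_nhds hq1, nhdsWithin_le_nhds hdist,
      nhdsWithin_le_nhds (eventually_eventually_nhds.2 heq), nhdsWithin_le_nhds
      hq.eventually_analyticAt, self_mem_nhdsWithin] with t h1 h2 h3 h4 h5 h6 h7
    have hne : t - t₀ ≠ 0 := sub_ne_zero.2 h7
    have hgt : g t = (t - t₀) ^ n * q t := by simpa using h5.self_of_nhds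
    have hgt0 : g t ≠ 0 := by rw [hgt]; exact mul_ne_zero (pow_ne_zero _ hne) h3
    refine ⟨h1, fun h => absurd h hgt0, ?_⟩
    have hd : deriv g t = n * (t - t₀) ^ (n - 1) * q t + (t - t₀) ^ n * deriv q t := by
      have e1 : HasDerivAt (fun s => (s - t₀) ^ n * q s)
          (n * (t - t₀) ^ (n - 1) * 1 * q t + (t - t₀) ^ n * deriv q t) t :=
        (((hasDerivAt_id t).sub_const t₀).pow n).mul h6.differentiableAt.hasDerivAt
      rw [mul_one] at e1
      refine (e1.congr_of_eventuallyEq ?_).deriv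
      filter_upwards [h5] with s hs
      simpa using hs
    have hq' : |deriv q t| ≤ B * |q t| := by
      rw [div_lt_iff₀ (abs_pos.2 h3)] at h2
      exact h2.le
    have hpos : 0 < |t - t₀| := abs_pos.2 hne
    have hn : (n : ℝ) * |t - t₀| ^ (n - 1) = n * |t - t₀|⁻¹ * |t - t₀| ^ n := by
      rcases Nat.eq_zero_or_pos n with hn0 | hn0
      · simp [hn0]
      · rw [show |t - t₀| ^ n = |t - t₀| * |t - t₀| ^ (n - 1) by
          rw [← pow_succ']; congr 1; omega]
        field_simp
    have hinv : 1 ≤ |t - t₀|⁻¹ := (one_le_inv₀ hpos).2 h4.le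
    calc |deriv g t| ≤ n * |t - t₀| ^ (n - 1) * |q t| + |t - t₀| ^ n * |deriv q t| := by
          rw [hd]
          refine (abs_add_le _ _).trans (le_of_eq ?_)
          simp [abs_mul, abs_pow]
      _ ≤ n * |t - t₀| ^ (n - 1) * |q t| + |t - t₀| ^ n * (B * |q t|) := by gcongr
      _ ≤ n * |t - t₀| ^ (n - 1) * |q t| + |t - t₀| ^ n * (B * |t - t₀|⁻¹ * |q t|) := by
          gcongr
          exact le_mul_of_one_le_right hB0 hinv
      _ = (n + B) * |t - t₀|⁻¹ * |g t| := by
          rw [hn, hgt, abs_mul, abs_pow]; ring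

/-- The simple-pole bound for the coefficients supplies `κ/|t - t₀|` in the derivative bound `|λ_i'|
≤ C |λ_i| / |t - t₀|`; separation then replaces `|λ_i|` by `|λ_i - λ_j|`. Local analytic extensions
of the coefficients allow `t₀` to be an endpoint. -/
theorem exists_rootsRegularAt {m : ℕ} {T : ℝ} {a : ℕ → ℝ → ℝ}
    (ha : ∀ k ∈ Finset.Icc 1 m, AnalyticOn ℝ (a k) (Icc 0 T)) {lam : Fin m → ℝ → ℝ}
    (hlam : ∀ t ∈ Icc 0 T, charPoly m a t = ∏ i, (X - C (lam i t))) {M : ℝ}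
    (hM : ∀ t ∈ Icc 0 T, ∀ i j : Fin m, i ≠ j →
      lam i t ^ 2 + lam j t ^ 2 ≤ M * (lam i t - lam j t) ^ 2) {t₀ : ℝ} (ht₀ : t₀ ∈ Icc 0 T) :
    ∃ K δ : ℝ, 0 ≤ K ∧ 0 < δ ∧ ∀ t ∈ Ioo 0 T, t ≠ t₀ → |t - t₀| < δ →
      RootsRegularAt lam K |t - t₀|⁻¹ t := by
  have hk : ∀ k ∈ Finset.Icc 1 m, ∃ K : ℝ, 0 ≤ K ∧ ∃ δ > 0, ∀ t ∈ Ioo 0 T, t ≠ t₀ →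
      |t - t₀| < δ → AnalyticAt ℝ (a k) t ∧ (a k t = 0 → ∀ᶠ s in 𝓝 t, a k s = 0) ∧
        |deriv (a k) t| ≤ K * |t - t₀|⁻¹ * |a k t| := by
    intro k hk
    obtain ⟨g, hag, hg⟩ := analyticWithinAt_iff_exists_analyticAt.1 (ha k hk t₀ ht₀)
    rw [insert_eq_of_mem ht₀] at hag
    obtain ⟨K, hK, hev⟩ := exists_abs_deriv_le_of_analyticAt hg
    rw [eventually_nhdsWithin_iff, Metric.eventually_nhds_iff] at hev
    obtain ⟨δ₁, hδ₁, h1⟩ := hev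
    obtain ⟨δ₂, hδ₂, h2⟩ := Metric.eventually_nhds_iff.1 (eventually_nhdsWithin_iff.1 hag)
    refine ⟨K, hK, min δ₁ δ₂, lt_min hδ₁ hδ₂, fun t ht hne htδ => ?_⟩
    have hnear : a k =ᶠ[𝓝 t] g := by
      have hball : Metric.ball t₀ δ₂ ∈ 𝓝 t := Metric.isOpen_ball.mem_nhds (by
        rw [Metric.mem_ball, Real.dist_eq]; exact htδ.trans_le (min_le_right _ _))
      filter_upwards [hball, Ioo_mem_nhds ht.1 ht.2] with s hs1 hs2
      exact h2 (Metric.mem_ball.1 hs1) (Ioo_subset_Icc_self hs2)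
    obtain ⟨h3, h4, h5⟩ := h1 (y := t) (by rw [Real.dist_eq]; exact htδ.trans_le (min_le_left _ _))
      hne
    refine ⟨h3.congr hnear.symm, fun h0 => ?_, ?_⟩
    · have := h4 (by rw [← hnear.self_of_nhds]; exact h0)
      filter_upwards [this, hnear] with s hs1 hs2
      rw [hs2, hs1]
    · rw [hnear.deriv_eq, hnear.self_of_nhds]
      exact h5
  choose! K hK0 δ hδ hprop using hk
  set κ := ∑ k ∈ Finset.Icc 1 m, K k with hκ
  have hκle : ∀ k ∈ Finset.Icc 1 m, K k ≤ κ := fun k hk =>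
    Finset.single_le_sum (fun i hi => hK0 i hi) hk
  have hκ0 : 0 ≤ κ := Finset.sum_nonneg hK0
  obtain ⟨δ', hδ', hδle⟩ : ∃ δ' > 0, ∀ k ∈ Finset.Icc 1 m, δ' ≤ δ k := by
    rcases (Finset.Icc 1 m).eq_empty_or_nonempty with h | h
    · exact ⟨1, one_pos, by simp [h]⟩
    · refine ⟨(Finset.Icc 1 m).inf' h δ, (Finset.lt_inf'_iff h).2 hδ, fun k hk =>
        Finset.inf'_le _ hk⟩
  -- Chosen so that `2 |M| ≤ D²`, since the square of `|λ_i| + |λ_j|` is at most `2 (λ_i² + λ_j²)`.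
  set D := |M| + 1 with hD
  have hD0 : 0 ≤ D := by positivity
  refine ⟨κ * (m * 2 * D ^ (m - 1)) * D, δ', by positivity, hδ', fun t ht hne htδ => ?_⟩
  have htI := Ioo_subset_Icc_self ht
  have hsep : ∀ i j, i ≠ j → |lam i t| + |lam j t| ≤ D * |lam i t - lam j t| := by
    intro i j hij
    refine abs_le_of_sq_le_sq' ?_ (by positivity) |>.2
    have h1 := hM t htI i j hij
    have h2 : M * (lam i t - lam j t) ^ 2 ≤ |M| * (lam i t - lam j t) ^ 2 := by
      gcongr
      exact le_abs_self M
    have h3 : (|lam i t| + |lam j t|) ^ 2 ≤ 2 * (lam i t ^ 2 + lam j t ^ 2) := by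
      nlinarith [sq_nonneg (|lam i t| - |lam j t|), sq_abs (lam i t), sq_abs (lam j t)]
    rw [mul_pow, sq_abs]
    have h4 : 2 * |M| ≤ D ^ 2 := by rw [hD]; nlinarith [abs_nonneg M]
    nlinarith [mul_le_mul_of_nonneg_right h4 (sq_nonneg (lam i t - lam j t))]
  have hpos : 0 < |t - t₀| := abs_pos.2 (sub_ne_zero.2 hne)
  obtain ⟨ψ, ψ', h1, h2, h3, h4⟩ := exists_differentiable_roots (κ := κ * |t - t₀|⁻¹)
    (by positivity) (fun k hk => (hprop k hk t ht hne (htδ.trans_le (hδle k hk))).1)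
    (fun k hk => (hprop k hk t ht hne (htδ.trans_le (hδle k hk))).2.1)
    (fun k hk => ((hprop k hk t ht hne (htδ.trans_le (hδle k hk))).2.2).trans (by
      have := hκle k hk
      gcongr))
    (by filter_upwards [Ioo_mem_nhds ht.1 ht.2] with s hs using hlam s (Ioo_subset_Icc_self hs))
    hsep
  refine ⟨ψ, ψ', h1, h2, fun i j hij => (h3 i).trans ?_, h4⟩
  have h5 : |lam i t| ≤ D * |lam i t - lam j t| :=
    (le_add_of_nonneg_right (abs_nonneg _)).trans (hsep i j hij)
  calc κ * |t - t₀|⁻¹ * (m * 2 * D ^ (m - 1)) * |lam i t|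
      ≤ κ * |t - t₀|⁻¹ * (m * 2 * D ^ (m - 1)) * (D * |lam i t - lam j t|) := by gcongr
    _ = _ := by ring

end Regularity

/-! ### An abstract moment inequality with a shrinking radius -/

section Fencing

/-- A bound for a family of moments `M k` with generating function `∑ ρ^k / k! M k`, whose radius of
convergence is shown to shrink at most exponentially. -/
theorem exists_moment_bound {α β c Clow ρ₀ B₀ : ℝ} (hc : 0 ≤ c) (hClow : 0 ≤ Clow)
    (hρ₀ : 0 < ρ₀) {M μ : ℕ → ℝ → ℝ}
    (hM : ∀ k, ∀ t ∈ Icc α β, HasDerivWithinAt (M k) (c * μ k t) (Icc α β) t)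
    (hM0 : ∀ k, ∀ t ∈ Icc α β, 0 ≤ M k t) {Φ : ℝ → ℝ} (hΦ : ∀ B, 0 ≤ Φ B)
    (h0 : ∀ n, ∑ k ∈ Finset.range (n + 1), ρ₀ ^ k / k ! * M k α ≤ B₀)
    (hnl : ∀ n, ∀ t ∈ Icc α β, ∀ ρ, 0 < ρ → ρ ≤ ρ₀ → ∀ B,
      ∑ k ∈ Finset.range (n + 1), ρ ^ k / k ! * M k t ≤ B →
      ∑ k ∈ Finset.range (n + 1), ρ ^ k / k ! * μ k t
        ≤ Clow + ρ * Φ B * ∑ k ∈ Finset.range n, ρ ^ k / k ! * M (k + 1) t) :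
    ∃ ρ > 0, ∃ B, ∀ t ∈ Icc α β, ∀ k, ρ ^ k / k ! * M k t ≤ B := by
  -- The final height of the linear barrier. Fixing it beforehand fixes `Φ B`, hence the rate at
  -- which the radius shrinks.
  set B := B₀ + (c * Clow + 1) * (β - α) with hB
  set κ := c * Φ B with hκ
  have hκ0 : 0 ≤ κ := mul_nonneg hc (hΦ B)
  -- Differentiating the generating function along this radius produces `-κ ρ Y`, where `Y` is the
  -- sum of the shifted moments. This cancels the derivative loss in the source exactly.
  set ρ : ℝ → ℝ := fun t => ρ₀ * Real.exp (-(κ * (t - α))) with hρ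
  have hρpos : ∀ t, 0 < ρ t := fun t => by positivity
  have hρle : ∀ t, α ≤ t → ρ t ≤ ρ₀ := fun t ht => by
    refine mul_le_of_le_one_right hρ₀.le (Real.exp_le_one_iff.2 ?_)
    have : 0 ≤ κ * (t - α) := mul_nonneg hκ0 (by linarith)
    linarith
  have hρd : ∀ t, HasDerivAt ρ (-κ * ρ t) t := fun t => by
    have h1 : HasDerivAt (fun t => -(κ * (t - α))) (-(κ * 1)) t :=
      (((hasDerivAt_id t).sub_const α).const_mul κ).neg
    exact (h1.exp.const_mul ρ₀).congr_deriv (by simp only [hρ]; ring)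
  have key : ∀ n, ∀ t ∈ Icc α β, ∑ k ∈ Finset.range (n + 1), ρ t ^ k / k ! * M k t
      ≤ B₀ + (c * Clow + 1) * (t - α) := by
    intro n
    set X : ℝ → ℝ := fun t => ∑ k ∈ Finset.range (n + 1), ρ t ^ k / k ! * M k t with hX
    set Y : ℝ → ℝ := fun t => ∑ k ∈ Finset.range n, ρ t ^ k / k ! * M (k + 1) t with hY
    set Z : ℝ → ℝ := fun t => ∑ k ∈ Finset.range (n + 1), ρ t ^ k / k ! * μ k t with hZ
    have hXd : ∀ t ∈ Icc α β, HasDerivWithinAt X (-κ * ρ t * Y t + c * Z t) (Icc α β) t := by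
      intro t ht
      have h1 : HasDerivWithinAt X (∑ k ∈ Finset.range (n + 1),
          ((k * ρ t ^ (k - 1) * (-κ * ρ t)) / k ! * M k t + ρ t ^ k / k ! * (c * μ k t)))
          (Icc α β) t := by
        refine HasDerivWithinAt.fun_sum fun k _ => ?_
        exact ((((hρd t).pow k).div_const _).hasDerivWithinAt).mul (hM k t ht)
      refine h1.congr_deriv ?_
      rw [Finset.sum_add_distrib]
      congr 1
      · rw [Finset.sum_range_succ', hY, Finset.mul_sum]
        simp only [Nat.cast_zero, zero_mul, zero_div, add_zero]
        refine Finset.sum_congr rfl fun k _ => ?_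
        rw [Nat.factorial_succ]
        push_cast
        have h2 : (k ! : ℝ) ≠ 0 := by positivity
        have h3 : (k + 1 : ℝ) ≠ 0 := by positivity
        field_simp
      · rw [hZ, Finset.mul_sum]
        exact Finset.sum_congr rfl fun k _ => by ring
    -- The source bound is needed only where the sum touches the barrier, and there the sum is at
    -- most `B`. The extra `1` in the slope makes the comparison strict.
    refine image_le_of_deriv_right_lt_deriv_boundary' (f := X)
      (f' := fun t => -κ * ρ t * Y t + c * Z t)
      (B := fun t => B₀ + (c * Clow + 1) * (t - α)) (B' := fun _ => c * Clow + 1)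
      (fun t ht => (hXd t ht).continuousWithinAt) (fun t ht => ?_) ?_ (by fun_prop)
      (fun t _ => ?_) fun t ht heq => ?_
    · exact (hXd t (Ico_subset_Icc_self ht)).mono_of_mem_nhdsWithin
        (Icc_mem_nhdsGE_of_mem ht)
    · simpa [hX, hρ] using h0 n
    · have h1 : HasDerivAt (fun t => B₀ + (c * Clow + 1) * (t - α)) ((c * Clow + 1) * 1) t :=
        (((hasDerivAt_id t).sub_const α).const_mul _).const_add _
      simpa using h1.hasDerivWithinAt
    · have htI := Ico_subset_Icc_self ht
      have hXB : X t ≤ B := by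
        rw [heq, hB]
        have : 0 ≤ c * Clow + 1 := by positivity
        gcongr
        exact htI.2
      have h1 := hnl n t htI (ρ t) (hρpos t) (hρle t htI.1) B hXB
      have h2 := mul_le_mul_of_nonneg_left h1 hc
      have h3 : c * (Clow + ρ t * Φ B * Y t) = c * Clow + κ * ρ t * Y t := by rw [hκ]; ring
      calc -κ * ρ t * Y t + c * Z t ≤ -κ * ρ t * Y t + (c * Clow + κ * ρ t * Y t) := by
            rw [← h3]; exact add_le_add_right h2 _
        _ < c * Clow + 1 := by linarith
  refine ⟨ρ β, hρpos β, B, fun t ht k => ?_⟩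
  have hρβ : ρ β ≤ ρ t := by
    refine mul_le_mul_of_nonneg_left (Real.exp_le_exp.2 ?_) hρ₀.le
    have := mul_le_mul_of_nonneg_left (show t - α ≤ β - α by linarith [ht.2]) hκ0
    linarith
  calc ρ β ^ k / k ! * M k t ≤ ρ t ^ k / k ! * M k t := by
        have := hM0 k t ht
        have := (hρpos β).le
        gcongr
    _ ≤ ∑ k ∈ Finset.range (k + 1), ρ t ^ k / k ! * M k t :=
        Finset.single_le_sum (f := fun k => ρ t ^ k / k ! * M k t)
          (fun i _ => mul_nonneg (by have := hρpos t; positivity) (hM0 i t ht)) (by simp)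
    _ ≤ B₀ + (c * Clow + 1) * (t - α) := key k t ht
    _ ≤ B := by
        rw [hB]
        have : 0 ≤ c * Clow + 1 := by positivity
        gcongr
        exact ht.2

end Fencing

/-! ### The Fourier transform of products and of entire functions of a given function -/

section FourierAlgebra

open FourierTransform

/-- The Fourier transform of a real-valued function on the line. -/
noncomputable def ft (g : ℝ → ℝ) (ξ : ℝ) : ℂ := 𝓕 (fun x => (g x : ℂ)) ξ

theorem ft_eq (g : ℝ → ℝ) (ξ : ℝ) :
    ft g ξ = ∫ x : ℝ, Complex.exp (↑(-2 * Real.pi * x * ξ) * Complex.I) * (g x : ℂ) := by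
  rw [ft, Real.fourier_real_eq_integral_exp_smul]; rfl

theorem norm_exp_mul_I_mul (r : ℝ) (z : ℂ) : ‖Complex.exp (r * Complex.I) * z‖ = ‖z‖ := by
  rw [norm_mul, Complex.norm_exp_ofReal_mul_I, one_mul]

theorem integrable_exp_mul {g : ℝ → ℝ} (hg : Integrable g) (ξ : ℝ) :
    Integrable fun x : ℝ => Complex.exp (↑(-2 * Real.pi * x * ξ) * Complex.I) * (g x : ℂ) := by
  refine (hg.ofReal (𝕜 := ℂ)).mono ?_ (ae_of_all _ fun x => (norm_exp_mul_I_mul _ _).le)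
  exact (by fun_prop : Continuous fun x : ℝ =>
    Complex.exp (↑(-2 * Real.pi * x * ξ) * Complex.I)).aestronglyMeasurable.mul
    (hg.ofReal (𝕜 := ℂ)).aestronglyMeasurable

theorem norm_ft_le (g : ℝ → ℝ) (ξ : ℝ) : ‖ft g ξ‖ ≤ ∫ x, |g x| := by
  rw [ft_eq]
  refine (norm_integral_le_integral_norm _).trans (le_of_eq ?_)
  simp only [norm_exp_mul_I_mul, Complex.norm_real, Real.norm_eq_abs]

theorem ft_sub {g h : ℝ → ℝ} (hg : Integrable g) (hh : Integrable h) (ξ : ℝ) :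
    ft (fun x => g x - h x) ξ = ft g ξ - ft h ξ := by
  simp only [ft_eq]
  rw [← integral_sub (integrable_exp_mul hg ξ) (integrable_exp_mul hh ξ)]
  congr 1 with x
  push_cast; ring

theorem ft_const_mul (c : ℝ) (g : ℝ → ℝ) (ξ : ℝ) :
    ft (fun x => c * g x) ξ = c * ft g ξ := by
  simp only [ft_eq]
  rw [← integral_const_mul]
  congr 1 with x
  push_cast; ring

theorem ft_add {g h : ℝ → ℝ} (hg : Integrable g) (hh : Integrable h) (ξ : ℝ) :
    ft (fun x => g x + h x) ξ = ft g ξ + ft h ξ := by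
  simp only [ft_eq]
  rw [← integral_add (integrable_exp_mul hg ξ) (integrable_exp_mul hh ξ)]
  congr 1 with x
  push_cast; ring

theorem ft_sum {ι : Type*} (s : Finset ι) {g : ι → ℝ → ℝ} (hg : ∀ i ∈ s, Integrable (g i)) (ξ : ℝ) :
    ft (fun x => ∑ i ∈ s, g i x) ξ = ∑ i ∈ s, ft (g i) ξ := by
  simp only [ft_eq]
  rw [← integral_finsetSum _ fun i hi => integrable_exp_mul (hg i hi) ξ]
  congr 1 with x
  push_cast; rw [Finset.mul_sum]

theorem continuous_ft {g : ℝ → ℝ} (hg : Integrable g) : Continuous (ft g) := by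
  have h : ft g = fun ξ => ∫ x : ℝ, Complex.exp (↑(-2 * Real.pi * x * ξ) * Complex.I) * (g x : ℂ) :=
    funext (ft_eq g)
  rw [h]
  refine continuous_of_dominated (fun ξ => (integrable_exp_mul hg ξ).aestronglyMeasurable)
    (fun ξ => ae_of_all _ fun x => (norm_exp_mul_I_mul _ _).le) (hg.ofReal (𝕜 := ℂ)).norm
    (ae_of_all _ fun x => by fun_prop)

theorem eq_integral_ft {g : ℝ → ℝ} (hc : Continuous g) (hg : Integrable g)
    (hft : Integrable (ft g)) (x : ℝ) :
    (g x : ℂ) = ∫ ξ : ℝ, Complex.exp (↑(2 * Real.pi * (ξ * x)) * Complex.I) * ft g ξ := by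
  have h := congrFun (Continuous.fourierInv_fourier_eq
    (f := fun x => (g x : ℂ)) (by fun_prop) (hg.ofReal (𝕜 := ℂ)) hft) x
  rw [← h, Real.fourierInv_eq']
  simp only [smul_eq_mul, RCLike.inner_apply, conj_trivial]
  congr 1 with ξ
  rw [mul_comm x ξ]; rfl

theorem abs_le_integral_norm_ft {g : ℝ → ℝ} (hc : Continuous g) (hg : Integrable g)
    (hft : Integrable (ft g)) (x : ℝ) : |g x| ≤ ∫ ξ, ‖ft g ξ‖ := by
  have h : ‖(g x : ℂ)‖ ≤ ∫ ξ, ‖ft g ξ‖ := by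
    rw [eq_integral_ft hc hg hft]
    refine (norm_integral_le_integral_norm _).trans (le_of_eq ?_)
    simp only [norm_exp_mul_I_mul]
  simpa using h

/-- Insert the inversion formula for `g` and apply Fubini. Only `g` needs an integrable transform,
so `h` may be any integrable function, such as a power of `g`. -/
theorem ft_mul_eq {g h : ℝ → ℝ} (hc : Continuous g) (hg : Integrable g)
    (hft : Integrable (ft g)) (hh : Integrable h) (ξ : ℝ) :
    ft (fun x => g x * h x) ξ = ∫ η, ft g η * ft h (ξ - η) := by
  have hI : Integrable (Function.uncurry fun x η : ℝ =>
      Complex.exp (↑(-2 * Real.pi * x * (ξ - η)) * Complex.I) * ((h x : ℂ) * ft g η))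
      (volume.prod volume) := by
    have h1 := (hh.ofReal (𝕜 := ℂ)).mul_prod hft
    refine h1.mono ?_ (ae_of_all _ fun p => (norm_exp_mul_I_mul _ _).le)
    exact (by fun_prop : Continuous fun p : ℝ × ℝ =>
      Complex.exp (↑(-2 * Real.pi * p.1 * (ξ - p.2)) * Complex.I)).aestronglyMeasurable.mul
      h1.aestronglyMeasurable
  have hswap := integral_integral_swap hI
  rw [ft_eq]
  calc _ = ∫ x, ∫ η, Complex.exp (↑(-2 * Real.pi * x * (ξ - η)) * Complex.I)
        * ((h x : ℂ) * ft g η) := by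
        congr 1 with x
        push_cast
        rw [eq_integral_ft hc hg hft x, mul_comm _ (h x : ℂ), ← mul_assoc, ← integral_const_mul]
        congr 1 with η
        rw [mul_assoc, mul_left_comm, ← mul_assoc (Complex.exp _) (Complex.exp _), ← Complex.exp_add,
          mul_left_comm]
        congr 2
        push_cast; ring
    _ = _ := hswap
    _ = _ := by
        congr 1 with η
        rw [ft_eq h, ← integral_const_mul]
        congr 1 with x
        ring

theorem enorm_ft_mul_le {g h : ℝ → ℝ} (hc : Continuous g) (hg : Integrable g)
    (hft : Integrable (ft g)) (hh : Integrable h) (ξ : ℝ) :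
    ‖ft (fun x => g x * h x) ξ‖ₑ ≤ ∫⁻ η, ‖ft g η‖ₑ * ‖ft h (ξ - η)‖ₑ := by
  rw [ft_mul_eq hc hg hft hh]
  refine (enorm_integral_le_lintegral_enorm _).trans (le_of_eq ?_)
  simp only [enorm_mul]

end FourierAlgebra

/-! ### Convolution with submultiplicative weights -/

section WeightedConvolution

theorem lintegral_mul_conv {V p q : ℝ → ℝ≥0∞} (hV : Measurable V) (hp : Measurable p)
    (hq : Measurable q) :
    ∫⁻ ξ, V ξ * ∫⁻ η, p η * q (ξ - η) = ∫⁻ η, ∫⁻ ζ, V (η + ζ) * (p η * q ζ) := by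
  calc _ = ∫⁻ ξ, ∫⁻ η, V ξ * (p η * q (ξ - η)) := by
        refine lintegral_congr fun ξ => ?_
        rw [lintegral_const_mul _ (by fun_prop)]
    _ = ∫⁻ η, ∫⁻ ξ, V ξ * (p η * q (ξ - η)) := by
        rw [lintegral_lintegral_swap]
        exact Measurable.aemeasurable (by unfold Function.uncurry; fun_prop)
    _ = _ := by
        refine lintegral_congr fun η => ?_
        rw [← lintegral_sub_right_eq_self (fun ζ => V (η + ζ) * (p η * q ζ)) η]
        simp only [add_sub_cancel]

theorem lintegral_mul_conv_le {W p q : ℝ → ℝ≥0∞} (hW : Measurable W) (hp : Measurable p)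
    (hq : Measurable q) (hsub : ∀ ξ η, W (ξ + η) ≤ W ξ * W η) :
    ∫⁻ ξ, W ξ * ∫⁻ η, p η * q (ξ - η) ≤ (∫⁻ ξ, W ξ * p ξ) * ∫⁻ ξ, W ξ * q ξ := by
  rw [lintegral_mul_conv hW hp hq]
  calc _ ≤ ∫⁻ η, ∫⁻ ζ, (W η * p η) * (W ζ * q ζ) := by
        refine lintegral_mono fun η => lintegral_mono fun ζ => ?_
        calc _ ≤ W η * W ζ * (p η * q ζ) := by gcongr; exact hsub η ζ
          _ = _ := by ring
    _ = _ := by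
        rw [← lintegral_mul_const _ (by fun_prop)]
        refine lintegral_congr fun η => ?_
        rw [lintegral_const_mul _ (by fun_prop)]

/-- The triangle inequality makes multiplication by `|ξ|` act like a derivation, so the first moment
of a convolution obeys a Leibniz rule. -/
theorem lintegral_enorm_mul_conv_le {W p q : ℝ → ℝ≥0∞} (hW : Measurable W) (hp : Measurable p)
    (hq : Measurable q) (hsub : ∀ ξ η, W (ξ + η) ≤ W ξ * W η) :
    ∫⁻ ξ, ‖ξ‖ₑ * W ξ * ∫⁻ η, p η * q (ξ - η)
      ≤ (∫⁻ ξ, ‖ξ‖ₑ * W ξ * p ξ) * (∫⁻ ξ, W ξ * q ξ)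
        + (∫⁻ ξ, W ξ * p ξ) * ∫⁻ ξ, ‖ξ‖ₑ * W ξ * q ξ := by
  rw [lintegral_mul_conv (V := fun ξ => ‖ξ‖ₑ * W ξ) (by fun_prop) hp hq]
  calc _ ≤ ∫⁻ η, ∫⁻ ζ, ((‖η‖ₑ * W η * p η) * (W ζ * q ζ) + (W η * p η) * (‖ζ‖ₑ * W ζ * q ζ)) := by
        refine lintegral_mono fun η => lintegral_mono fun ζ => ?_
        calc _ ≤ (‖η‖ₑ + ‖ζ‖ₑ) * (W η * W ζ) * (p η * q ζ) := by
              gcongr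
              · exact enorm_add_le η ζ
              · exact hsub η ζ
          _ = _ := by ring
    _ = _ := by
        rw [← lintegral_mul_const _ (by fun_prop), ← lintegral_mul_const _ (by fun_prop),
          ← lintegral_add_left (by fun_prop)]
        refine lintegral_congr fun η => ?_
        rw [lintegral_add_left (by fun_prop), lintegral_const_mul _ (by fun_prop),
          lintegral_const_mul _ (by fun_prop)]

theorem mul_conv_le {W p q : ℝ → ℝ≥0∞} (hW : Measurable W) (hp : Measurable p)
    (hsub : ∀ ξ η, W (ξ + η) ≤ W ξ * W η) {S : ℝ≥0∞}
    (hS : ∀ ξ, W ξ * q ξ ≤ S) (ξ : ℝ) :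
    W ξ * ∫⁻ η, p η * q (ξ - η) ≤ (∫⁻ ξ, W ξ * p ξ) * S := by
  calc W ξ * ∫⁻ η, p η * q (ξ - η) ≤ ∫⁻ η, W ξ * (p η * q (ξ - η)) :=
        lintegral_const_mul_le _ _
    _ ≤ ∫⁻ η, W η * p η * S := by
        refine lintegral_mono fun η => ?_
        calc _ ≤ W η * W (ξ - η) * (p η * q (ξ - η)) := by
              gcongr
              simpa using hsub η (ξ - η)
          _ = W η * p η * (W (ξ - η) * q (ξ - η)) := by ring
          _ ≤ _ := by gcongr; exact hS _
    _ = _ := lintegral_mul_const _ (by fun_prop)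

end WeightedConvolution

/-! ### Powers and entire functions on the Fourier side -/

section Powers

variable {g : ℝ → ℝ} {W : ℝ → ℝ≥0∞}

theorem integrable_pow_succ (hc : Continuous g) (hg : Integrable g)
    (hft : Integrable (ft g)) (ν : ℕ) : Integrable fun x => g x ^ (ν + 1) := by
  induction ν with
  | zero => simpa using hg
  | succ ν ih =>
    have := ih.bdd_mul (f := g) (c := ∫ ξ, ‖ft g ξ‖) hc.aestronglyMeasurable
      (ae_of_all _ fun x => by simpa using abs_le_integral_norm_ft hc hg hft x)
    simpa [pow_succ' _ (ν + 1)] using this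

theorem enorm_ft_pow_succ_le (hc : Continuous g) (hg : Integrable g)
    (hft : Integrable (ft g)) (ν : ℕ) (ξ : ℝ) :
    ‖ft (fun x => g x ^ (ν + 2)) ξ‖ₑ
      ≤ ∫⁻ η, ‖ft g η‖ₑ * ‖ft (fun x => g x ^ (ν + 1)) (ξ - η)‖ₑ := by
  simp only [pow_succ' _ (ν + 1)]
  exact enorm_ft_mul_le hc hg hft (integrable_pow_succ hc hg hft ν) ξ

theorem measurable_enorm_ft (hg : Integrable g) : Measurable fun ξ => ‖ft g ξ‖ₑ :=
  (continuous_ft hg).measurable.enorm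

theorem lintegral_ft_pow_le (hc : Continuous g) (hg : Integrable g) (hft : Integrable (ft g))
    (hW : Measurable W) (hsub : ∀ ξ η, W (ξ + η) ≤ W ξ * W η) (ν : ℕ) :
    ∫⁻ ξ, W ξ * ‖ft (fun x => g x ^ (ν + 1)) ξ‖ₑ ≤ (∫⁻ ξ, W ξ * ‖ft g ξ‖ₑ) ^ (ν + 1) := by
  induction ν with
  | zero => simp
  | succ ν ih =>
    calc _ ≤ ∫⁻ ξ, W ξ * ∫⁻ η, ‖ft g η‖ₑ * ‖ft (fun x => g x ^ (ν + 1)) (ξ - η)‖ₑ := by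
          gcongr with ξ; exact enorm_ft_pow_succ_le hc hg hft ν ξ
      _ ≤ _ := lintegral_mul_conv_le hW (measurable_enorm_ft hg)
          (measurable_enorm_ft (integrable_pow_succ hc hg hft ν)) hsub
      _ ≤ _ := by rw [pow_succ' _ (ν + 1)]; gcongr

/-- Iterating the Leibniz rule gives the analogue of `(g^(ν+1))' = (ν + 1) g^ν g'`; in particular
the first moment enters linearly. -/
theorem lintegral_enorm_ft_pow_le (hc : Continuous g) (hg : Integrable g)
    (hft : Integrable (ft g)) (hW : Measurable W) (hsub : ∀ ξ η, W (ξ + η) ≤ W ξ * W η) (ν : ℕ) :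
    ∫⁻ ξ, ‖ξ‖ₑ * W ξ * ‖ft (fun x => g x ^ (ν + 1)) ξ‖ₑ
      ≤ (ν + 1) * (∫⁻ ξ, W ξ * ‖ft g ξ‖ₑ) ^ ν * ∫⁻ ξ, ‖ξ‖ₑ * W ξ * ‖ft g ξ‖ₑ := by
  induction ν with
  | zero => simp
  | succ ν ih =>
    calc _ ≤ ∫⁻ ξ, ‖ξ‖ₑ * W ξ * ∫⁻ η, ‖ft g η‖ₑ * ‖ft (fun x => g x ^ (ν + 1)) (ξ - η)‖ₑ := by
          gcongr with ξ; exact enorm_ft_pow_succ_le hc hg hft ν ξ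
      _ ≤ _ := lintegral_enorm_mul_conv_le hW (measurable_enorm_ft hg)
          (measurable_enorm_ft (integrable_pow_succ hc hg hft ν)) hsub
      _ ≤ (∫⁻ ξ, ‖ξ‖ₑ * W ξ * ‖ft g ξ‖ₑ) * (∫⁻ ξ, W ξ * ‖ft g ξ‖ₑ) ^ (ν + 1)
          + (∫⁻ ξ, W ξ * ‖ft g ξ‖ₑ) * ((ν + 1) * (∫⁻ ξ, W ξ * ‖ft g ξ‖ₑ) ^ ν
            * ∫⁻ ξ, ‖ξ‖ₑ * W ξ * ‖ft g ξ‖ₑ) := by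
          gcongr
          exact lintegral_ft_pow_le hc hg hft hW hsub ν
      _ = _ := by push_cast; ring

theorem mul_enorm_ft_pow_le (hc : Continuous g) (hg : Integrable g)
    (hft : Integrable (ft g)) (hW : Measurable W) (hsub : ∀ ξ η, W (ξ + η) ≤ W ξ * W η)
    {S : ℝ≥0∞} (hS : ∀ ξ, W ξ * ‖ft g ξ‖ₑ ≤ S) (ν : ℕ) (ξ : ℝ) :
    W ξ * ‖ft (fun x => g x ^ (ν + 1)) ξ‖ₑ ≤ (∫⁻ ξ, W ξ * ‖ft g ξ‖ₑ) ^ ν * S := by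
  induction ν generalizing ξ with
  | zero => simpa using hS ξ
  | succ ν ih =>
    calc _ ≤ W ξ * ∫⁻ η, ‖ft g η‖ₑ * ‖ft (fun x => g x ^ (ν + 1)) (ξ - η)‖ₑ := by
          gcongr; exact enorm_ft_pow_succ_le hc hg hft ν ξ
      _ ≤ _ := mul_conv_le hW (measurable_enorm_ft hg) hsub ih ξ
      _ = _ := by ring

/-- The majorant `∑ (ν + 1) |c (ν + 1)| I ^ ν` of the derivative of `∑ c ν y ^ ν`. -/
noncomputable def derivMajorant (c : ℕ → ℝ) (I : ℝ≥0∞) : ℝ≥0∞ :=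
  ∑' ν : ℕ, ‖c (ν + 1)‖ₑ * ((ν + 1) * I ^ ν)

theorem derivMajorant_mono (c : ℕ → ℝ) : Monotone (derivMajorant c) := fun I J h => by
  unfold derivMajorant; gcongr

/-- Since `ν + 1 ≤ 2^ν`, the terms are dominated by those of the absolutely convergent power series
at `2 r + 1`. -/
theorem summable_abs_coeff {c : ℕ → ℝ} {f : ℝ → ℝ}
    (hf : ∀ y : ℝ, HasSum (fun ν : ℕ => c ν * y ^ ν) (f y)) {r : ℝ} (hr : 0 ≤ r) :
    Summable fun ν : ℕ => |c (ν + 1)| * ((ν + 1) * r ^ ν) := by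
  have h1 : Summable fun ν : ℕ => |c (ν + 1)| * (2 * r + 1) ^ (ν + 1) := by
    have := ((summable_nat_add_iff 1).2 (hf (2 * r + 1)).summable).abs
    refine this.congr fun ν => ?_
    rw [abs_mul, abs_of_nonneg (a := (2 * r + 1) ^ (ν + 1)) (by positivity)]
  refine Summable.of_nonneg_of_le (fun ν => by positivity) (fun ν => ?_) h1
  gcongr
  have h2 : ((ν : ℝ) + 1) ≤ 2 ^ ν := by
    have : ν + 1 ≤ 2 ^ ν := Nat.lt_two_pow_self
    exact_mod_cast this
  calc ((ν : ℝ) + 1) * r ^ ν ≤ 2 ^ ν * r ^ ν := by gcongr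
    _ = (2 * r) ^ ν := (mul_pow _ _ _).symm
    _ ≤ (2 * r + 1) ^ ν := by gcongr; linarith
    _ ≤ (2 * r + 1) ^ (ν + 1) := pow_le_pow_right₀ (by linarith) (Nat.le_succ ν)

theorem derivMajorant_lt_top {c : ℕ → ℝ} {f : ℝ → ℝ}
    (hf : ∀ y : ℝ, HasSum (fun ν : ℕ => c ν * y ^ ν) (f y)) {I : ℝ≥0∞} (hI : I < ⊤) :
    derivMajorant c I < ⊤ := by
  have h := (summable_abs_coeff hf (r := I.toReal) ENNReal.toReal_nonneg)
  have h2 : derivMajorant c I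
      = ∑' ν : ℕ, ENNReal.ofReal (|c (ν + 1)| * ((ν + 1) * I.toReal ^ ν)) := by
    refine tsum_congr fun ν => ?_
    rw [ENNReal.ofReal_mul (abs_nonneg _), ENNReal.ofReal_mul (by positivity),
      ENNReal.ofReal_pow ENNReal.toReal_nonneg, ENNReal.ofReal_toReal hI.ne,
      Real.enorm_eq_ofReal_abs]
    congr
    exact_mod_cast (ENNReal.ofReal_natCast (ν + 1)).symm
  rw [h2, ← ENNReal.ofReal_tsum_of_nonneg (fun ν => by positivity) h]
  exact ENNReal.ofReal_lt_top

variable {c : ℕ → ℝ} {f : ℝ → ℝ}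

/-- The power series is transformed term by term. The vanishing of `c 0` is essential, as it leaves
a factor `|g|` to integrate in every term. -/
theorem enorm_ft_comp_le (hf : ∀ y : ℝ, HasSum (fun ν : ℕ => c ν * y ^ ν) (f y)) (hc0 : c 0 = 0)
    (hc : Continuous g) (hg : Integrable g) (hft : Integrable (ft g)) (ξ : ℝ) :
    ‖ft (fun x => f (g x)) ξ‖ₑ ≤ ∑' ν : ℕ, ‖c (ν + 1)‖ₑ * ‖ft (fun x => g x ^ (ν + 1)) ξ‖ₑ := by
  set b := ∫ ξ, ‖ft g ξ‖ with hb
  have hb0 : 0 ≤ b := integral_nonneg fun _ => norm_nonneg _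
  have hgb : ∀ x, |g x| ≤ b := abs_le_integral_norm_ft hc hg hft
  have hf' : ∀ y : ℝ, HasSum (fun ν : ℕ => c (ν + 1) * y ^ (ν + 1)) (f y) := fun y => by
    have := (hasSum_nat_add_iff' 1).2 (hf y)
    simpa [hc0] using this
  have hInt : ∀ ν : ℕ, Integrable fun x => c (ν + 1) * g x ^ (ν + 1) := fun ν =>
    (integrable_pow_succ hc hg hft ν).const_mul _
  have hsum : Summable fun ν : ℕ => ∫ x, ‖Complex.exp (↑(-2 * Real.pi * x * ξ) * Complex.I)
      * ((c (ν + 1) * g x ^ (ν + 1) : ℝ) : ℂ)‖ := by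
    refine Summable.of_nonneg_of_le (fun ν => integral_nonneg fun _ => norm_nonneg _) (fun ν => ?_)
      ((summable_abs_coeff hf hb0).mul_right (∫ x, |g x|))
    calc _ = ∫ x, |c (ν + 1)| * (|g x| ^ ν * |g x|) := by
          congr 1 with x
          rw [norm_exp_mul_I_mul, Complex.norm_real, Real.norm_eq_abs, abs_mul, abs_pow, pow_succ]
      _ ≤ ∫ x, |c (ν + 1)| * ((ν + 1) * b ^ ν) * |g x| := by
          refine integral_mono_of_nonneg (ae_of_all _ fun x => by positivity)
            (hg.abs.const_mul _) (ae_of_all _ fun x => ?_)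
          beta_reduce
          rw [mul_assoc |c (ν + 1)|]
          refine mul_le_mul_of_nonneg_left ?_ (abs_nonneg _)
          have h2 : |g x| ^ ν ≤ b ^ ν := by gcongr; exact hgb x
          have h3 : |g x| ^ ν * |g x| ≤ b ^ ν * |g x| := by gcongr
          have h4 : 0 ≤ (ν : ℝ) * (b ^ ν * |g x|) := by positivity
          nlinarith
      _ = _ := integral_const_mul _ _
  have h1 := hasSum_integral_of_summable_integral_norm
    (fun ν => integrable_exp_mul (hInt ν) ξ) hsum
  have h2 : (∫ x, ∑' ν : ℕ, Complex.exp (↑(-2 * Real.pi * x * ξ) * Complex.I)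
      * ((c (ν + 1) * g x ^ (ν + 1) : ℝ) : ℂ)) = ft (fun x => f (g x)) ξ := by
    rw [ft_eq]
    congr 1 with x
    exact ((Complex.hasSum_ofReal.2 (hf' (g x))).mul_left _).tsum_eq
  rw [h2] at h1
  rw [← h1.tsum_eq]
  refine (enorm_tsum_le_tsum_enorm).trans (ENNReal.tsum_le_tsum fun ν => le_of_eq ?_)
  rw [← ft_eq, ft_const_mul, enorm_mul, ← ofReal_norm, Complex.norm_real, ofReal_norm]

/-- The nonlinear estimate that closes the scheme: the first moment appears linearly, with a factor
depending only on the zeroth moment. -/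
theorem lintegral_enorm_ft_comp_le (hf : ∀ y : ℝ, HasSum (fun ν : ℕ => c ν * y ^ ν) (f y))
    (hc0 : c 0 = 0) (hc : Continuous g) (hg : Integrable g) (hft : Integrable (ft g))
    (hW : Measurable W) (hsub : ∀ ξ η, W (ξ + η) ≤ W ξ * W η) :
    ∫⁻ ξ, ‖ξ‖ₑ * W ξ * ‖ft (fun x => f (g x)) ξ‖ₑ
      ≤ derivMajorant c (∫⁻ ξ, W ξ * ‖ft g ξ‖ₑ) * ∫⁻ ξ, ‖ξ‖ₑ * W ξ * ‖ft g ξ‖ₑ := by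
  have hm : ∀ ν : ℕ, Measurable fun ξ => ‖ft (fun x => g x ^ (ν + 1)) ξ‖ₑ := fun ν =>
    measurable_enorm_ft (integrable_pow_succ hc hg hft ν)
  calc _ ≤ ∫⁻ ξ, ∑' ν : ℕ, ‖c (ν + 1)‖ₑ * (‖ξ‖ₑ * W ξ * ‖ft (fun x => g x ^ (ν + 1)) ξ‖ₑ) := by
        refine lintegral_mono fun ξ => ?_
        calc _ ≤ ‖ξ‖ₑ * W ξ * ∑' ν : ℕ, ‖c (ν + 1)‖ₑ * ‖ft (fun x => g x ^ (ν + 1)) ξ‖ₑ := by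
              gcongr; exact enorm_ft_comp_le hf hc0 hc hg hft ξ
          _ = _ := by
              rw [← ENNReal.tsum_mul_left]
              exact tsum_congr fun ν => by ring
    _ = ∑' ν : ℕ, ‖c (ν + 1)‖ₑ * ∫⁻ ξ, ‖ξ‖ₑ * W ξ * ‖ft (fun x => g x ^ (ν + 1)) ξ‖ₑ := by
        rw [lintegral_tsum fun ν => by have := hm ν; fun_prop]
        refine tsum_congr fun ν => lintegral_const_mul _ (by have := hm ν; fun_prop)
    _ ≤ _ := by
        rw [derivMajorant, ← ENNReal.tsum_mul_right]
        refine ENNReal.tsum_le_tsum fun ν => ?_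
        rw [mul_assoc]
        gcongr
        exact lintegral_enorm_ft_pow_le hc hg hft hW hsub ν

/-- The pointwise counterpart, with one factor taken in the supremum norm. It provides polynomial
decay of the source before any exponential decay is known. -/
theorem mul_enorm_ft_comp_le (hf : ∀ y : ℝ, HasSum (fun ν : ℕ => c ν * y ^ ν) (f y))
    (hc0 : c 0 = 0) (hc : Continuous g) (hg : Integrable g) (hft : Integrable (ft g))
    (hW : Measurable W) (hsub : ∀ ξ η, W (ξ + η) ≤ W ξ * W η)
    {S : ℝ≥0∞} (hS : ∀ ξ, W ξ * ‖ft g ξ‖ₑ ≤ S) (ξ : ℝ) :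
    W ξ * ‖ft (fun x => f (g x)) ξ‖ₑ ≤ derivMajorant c (∫⁻ ξ, W ξ * ‖ft g ξ‖ₑ) * S := by
  calc _ ≤ W ξ * ∑' ν : ℕ, ‖c (ν + 1)‖ₑ * ‖ft (fun x => g x ^ (ν + 1)) ξ‖ₑ := by
        gcongr; exact enorm_ft_comp_le hf hc0 hc hg hft ξ
    _ = ∑' ν : ℕ, ‖c (ν + 1)‖ₑ * (W ξ * ‖ft (fun x => g x ^ (ν + 1)) ξ‖ₑ) := by
        rw [← ENNReal.tsum_mul_left]
        exact tsum_congr fun ν => by ring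
    _ ≤ _ := by
        rw [derivMajorant, ← ENNReal.tsum_mul_right]
        refine ENNReal.tsum_le_tsum fun ν => ?_
        rw [mul_assoc]
        refine mul_le_mul_right ((mul_enorm_ft_pow_le hc hg hft hW hsub hS ν ξ).trans ?_) _
        gcongr
        calc _ = 1 * (∫⁻ ξ, W ξ * ‖ft g ξ‖ₑ) ^ ν := (one_mul _).symm
          _ ≤ _ := by gcongr; exact le_add_self

end Powers

/-! ### Propagation of the exponential decay of the Fourier transform -/

section Propagation

/-- Truncated exponentials remain submultiplicative: the binomial expansion sums over a triangle of
index pairs, contained in the square that indexes the product. They can therefore serve as weights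
while only finitely many moments are involved. -/
theorem sum_pow_div_factorial_add_le {x y : ℝ} (hx : 0 ≤ x) (hy : 0 ≤ y) (n : ℕ) :
    ∑ k ∈ Finset.range n, (x + y) ^ k / k !
      ≤ (∑ k ∈ Finset.range n, x ^ k / k !) * ∑ k ∈ Finset.range n, y ^ k / k ! := by
  have h1 : ∀ k, (x + y) ^ k / k !
      = ∑ p ∈ Finset.HasAntidiagonal.antidiagonal k, x ^ p.1 / p.1 ! * (y ^ p.2 / p.2 !) := fun k => by
    rw [(Commute.all x y).add_pow', Finset.sum_div]
    refine Finset.sum_congr rfl fun p hp => ?_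
    have h2 : k ! = k.choose p.1 * p.1 ! * p.2 ! := by
      rw [← Finset.HasAntidiagonal.mem_antidiagonal.1 hp, Nat.choose_symm_add, Nat.add_choose_mul_factorial_mul_factorial]
    have h3 : (k.choose p.1 : ℝ) ≠ 0 := by
      have : p.1 ≤ k := by have := Finset.HasAntidiagonal.mem_antidiagonal.1 hp; omega
      exact_mod_cast (Nat.choose_pos this).ne'
    rw [h2, nsmul_eq_mul]
    push_cast
    field_simp
  simp_rw [h1, Finset.sum_mul_sum]
  rw [← Finset.sum_product']
  set s := (Finset.range n ×ˢ Finset.range n).filter fun p => p.1 + p.2 < n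
  have h2 : ∑ k ∈ Finset.range n, ∑ p ∈ Finset.HasAntidiagonal.antidiagonal k,
      x ^ p.1 / p.1 ! * (y ^ p.2 / p.2 !) = ∑ p ∈ s, x ^ p.1 / p.1 ! * (y ^ p.2 / p.2 !) := by
    rw [← Finset.sum_fiberwise_of_maps_to (s := s) (t := Finset.range n)
      (g := fun p : ℕ × ℕ => p.1 + p.2) fun p hp => Finset.mem_range.2 (Finset.mem_filter.1 hp).2]
    refine Finset.sum_congr rfl fun k hk => Finset.sum_congr ?_ fun _ _ => rfl
    ext p
    simp only [s, Finset.HasAntidiagonal.mem_antidiagonal, Finset.mem_filter, Finset.mem_product,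
      Finset.mem_range] at hk ⊢
    omega
  rw [h2]
  exact Finset.sum_le_sum_of_subset_of_nonneg (Finset.filter_subset _ _)
    fun p _ _ => by positivity

theorem lintegral_sum_pow_mul {p : ℝ → ℝ} (hp : Measurable p) (hp0 : ∀ ξ, 0 ≤ p ξ) {ρ : ℝ}
    (hρ : 0 ≤ ρ) (n i : ℕ) :
    ∫⁻ ξ, ENNReal.ofReal ((∑ k ∈ Finset.range n, (ρ * |ξ|) ^ k / k !) * (|ξ| ^ i * p ξ))
      = ∑ k ∈ Finset.range n, ENNReal.ofReal (ρ ^ k / k !)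
        * ∫⁻ ξ, ENNReal.ofReal (|ξ| ^ (k + i) * p ξ) := by
  calc _ = ∫⁻ ξ, ∑ k ∈ Finset.range n, ENNReal.ofReal (ρ ^ k / k !)
        * ENNReal.ofReal (|ξ| ^ (k + i) * p ξ) := by
        refine lintegral_congr fun ξ => ?_
        rw [Finset.sum_mul, ENNReal.ofReal_sum_of_nonneg fun k _ => by
          have := hp0 ξ; positivity]
        refine Finset.sum_congr rfl fun k _ => ?_
        rw [← ENNReal.ofReal_mul (by positivity)]
        congr 1
        rw [mul_pow, pow_add]; ring
    _ = _ := by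
        rw [lintegral_finsetSum _ fun k _ => by fun_prop]
        exact Finset.sum_congr rfl fun k _ => lintegral_const_mul _ (by fun_prop)

theorem lintegral_exp_mul {p : ℝ → ℝ} (hp : Measurable p) (hp0 : ∀ ξ, 0 ≤ p ξ) {ρ : ℝ}
    (hρ : 0 ≤ ρ) :
    ∫⁻ ξ, ENNReal.ofReal (Real.exp (ρ * |ξ|) * p ξ)
      = ∑' k : ℕ, ENNReal.ofReal (ρ ^ k / k !) * ∫⁻ ξ, ENNReal.ofReal (|ξ| ^ k * p ξ) := by
  calc _ = ∫⁻ ξ, ∑' k : ℕ, ENNReal.ofReal (ρ ^ k / k !) * ENNReal.ofReal (|ξ| ^ k * p ξ) := by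
        refine lintegral_congr fun ξ => ?_
        have h1 := (NormedSpace.expSeries_div_hasSum_exp (𝔸 := ℝ) (ρ * |ξ|)).mul_right (p ξ)
        rw [← Real.exp_eq_exp_ℝ] at h1
        rw [← h1.tsum_eq, ENNReal.ofReal_tsum_of_nonneg (fun k => by
          have := hp0 ξ; positivity) h1.summable]
        refine tsum_congr fun k => ?_
        rw [← ENNReal.ofReal_mul (by positivity)]
        congr 1
        rw [mul_pow]; ring
    _ = _ := by
        rw [lintegral_tsum fun k => by fun_prop]
        exact tsum_congr fun k => lintegral_const_mul _ (by fun_prop)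

theorem integrable_of_lintegral_ofReal_lt_top {p : ℝ → ℝ} (hp : AEStronglyMeasurable p volume)
    (hp0 : ∀ ξ, 0 ≤ p ξ) (h : ∫⁻ ξ, ENNReal.ofReal (p ξ) < ⊤) : Integrable p :=
  ⟨hp, (hasFiniteIntegral_iff_ofReal (ae_of_all _ hp0)).2 h⟩

theorem lintegral_moment_lt_top {p : ℝ → ℝ} (hp0 : ∀ ξ, 0 ≤ p ξ) {ρ : ℝ}
    (hρ : 0 < ρ) (h : ∫⁻ ξ, ENNReal.ofReal (Real.exp (ρ * |ξ|) * p ξ) < ⊤) (k : ℕ) :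
    ∫⁻ ξ, ENNReal.ofReal (|ξ| ^ k * p ξ) < ⊤ := by
  refine lt_of_le_of_lt ?_ (ENNReal.mul_lt_top (ENNReal.ofReal_lt_top (r := k ! / ρ ^ k)) h)
  rw [← lintegral_const_mul' _ _ ENNReal.ofReal_ne_top]
  refine lintegral_mono fun ξ => ?_
  rw [← ENNReal.ofReal_mul (by positivity), ← mul_assoc]
  refine ENNReal.ofReal_le_ofReal (mul_le_mul_of_nonneg_right ?_ (hp0 ξ))
  have h1 := Real.pow_div_factorial_le_exp (ρ * |ξ|) (by positivity) k
  have h2 : |ξ| ^ k = k ! / ρ ^ k * ((ρ * |ξ|) ^ k / k !) := by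
    rw [mul_pow]; field_simp
  rw [h2]
  gcongr

/-- If the weighted Fourier modes satisfy Duhamel's inequality, with a source term controlled by the
modes, then exponential decay of the initial modes propagates. -/
theorem exists_exp_bound_of_duhamel {α β D C ρ₀ : ℝ} {N : ℕ} (hαβ : α ≤ β) (hD : 0 < D) (hC : 0 ≤ C)
    (hρ₀ : 0 < ρ₀) {Ω : ℝ → ℝ → ℝ} {v F : ℝ → ℝ → ℂ} {ζ : ℝ → ℝ} {Ψ : ℝ≥0∞ → ℝ≥0∞}
    (hΩc : ContinuousOn (fun p : ℝ × ℝ => Ω p.1 p.2) (Icc α β ×ˢ univ))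
    (hΩ0 : ∀ t ∈ Icc α β, ∀ ξ, 0 ≤ Ω t ξ)
    (hΩle : ∀ t ∈ Icc α β, ∀ ξ, Ω t ξ ≤ C * (1 + |ξ|) ^ N)
    (hΩsub : ∀ t ∈ Icc α β, ∀ ξ η, Ω t (ξ + η) ≤ Ω t ξ * Ω t η)
    (hFc : ContinuousOn (fun p : ℝ × ℝ => F p.1 p.2) (Icc α β ×ˢ univ))
    (hF : ∀ j : ℕ, ∃ K, ∀ t ∈ Icc α β, ∀ ξ, (1 + |ξ|) ^ j * ‖F t ξ‖ ≤ K)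
    (hv : ∀ t ∈ Icc α β, Continuous (v t))
    (hζc : Continuous ζ) (hζ0 : ∀ ξ, 0 ≤ ζ ξ)
    (hζ : ∫⁻ ξ, ENNReal.ofReal (Real.exp (ρ₀ * |ξ|) * ζ ξ) < ⊤)
    (hmode : ∀ t ∈ Icc α β, ∀ ξ,
      Ω t ξ * ‖v t ξ‖ ≤ D * (ζ ξ + ∫ s in α..t, Ω s ξ * ‖F s ξ‖))
    (hΨ : Monotone Ψ) (hΨ' : ∀ I < ⊤, Ψ I < ⊤)
    (hnl : ∀ t ∈ Icc α β, ∀ W : ℝ → ℝ≥0∞, Measurable W → (∀ ξ η, W (ξ + η) ≤ W ξ * W η) →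
      ∫⁻ ξ, ‖ξ‖ₑ * W ξ * ‖F t ξ‖ₑ
        ≤ Ψ (∫⁻ ξ, W ξ * ‖v t ξ‖ₑ) * ∫⁻ ξ, ‖ξ‖ₑ * W ξ * ‖v t ξ‖ₑ) :
    ∃ ρ > 0, ∃ B < (⊤ : ℝ≥0∞), ∀ t ∈ Icc α β,
      ∫⁻ ξ, ENNReal.ofReal (Real.exp (ρ * |ξ|) * (ζ ξ + ∫ s in α..t, Ω s ξ * ‖F s ξ‖)) ≤ B := by
  -- Projecting time onto `[α, β]` makes the weighted source continuous on the whole plane and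
  -- leaves it unchanged on the interval.
  set P : ℝ → ℝ → ℝ := fun s ξ => Ω (projIcc α β hαβ s) ξ * ‖F (projIcc α β hαβ s) ξ‖ with hP
  have hPc : Continuous fun p : ℝ × ℝ => P p.1 p.2 := by
    have h1 : Continuous fun p : ℝ × ℝ => ((projIcc α β hαβ p.1 : ℝ), p.2) := by fun_prop
    have h2 : ∀ p : ℝ × ℝ, ((projIcc α β hαβ p.1 : ℝ), p.2) ∈ Icc α β ×ˢ (univ : Set ℝ) :=
      fun p => ⟨(projIcc α β hαβ p.1).2, mem_univ _⟩
    exact (hΩc.comp_continuous h1 h2).mul (hFc.comp_continuous h1 h2).norm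
  have hPeq : ∀ s ∈ Icc α β, ∀ ξ, P s ξ = Ω s ξ * ‖F s ξ‖ := fun s hs ξ => by
    simp only [hP, projIcc_of_mem hαβ hs]
  have hP0 : ∀ s ξ, 0 ≤ P s ξ := fun s ξ =>
    mul_nonneg (hΩ0 _ (projIcc α β hαβ s).2 ξ) (norm_nonneg _)
  have hPb : ∀ k : ℕ, ∃ K, 0 ≤ K ∧ ∀ s ξ, |ξ| ^ k * P s ξ ≤ K * (1 + ξ ^ 2)⁻¹ := by
    intro k
    obtain ⟨K, hK⟩ := hF (N + k + 2)
    have hK0 : 0 ≤ K := le_trans (by positivity) (hK α ⟨le_rfl, hαβ⟩ 0)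
    refine ⟨C * K, by positivity, fun s ξ => ?_⟩
    have h1 := hK _ (projIcc α β hαβ s).2 ξ
    have h2 := hΩle _ (projIcc α β hαβ s).2 ξ
    have h3 := hΩ0 _ (projIcc α β hαβ s).2 ξ
    simp only [hP]
    rw [← div_eq_mul_inv, le_div_iff₀ (by positivity)]
    calc _ ≤ (1 + |ξ|) ^ k * (C * (1 + |ξ|) ^ N * ‖F (projIcc α β hαβ s) ξ‖) * (1 + |ξ|) ^ 2 := by
          gcongr
          · linarith
          · nlinarith [abs_nonneg ξ, sq_abs ξ]
      _ = C * ((1 + |ξ|) ^ (N + k + 2) * ‖F (projIcc α β hαβ s) ξ‖) := by ring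
      _ ≤ _ := by gcongr
  have hPint : ∀ (k : ℕ) s, Integrable fun ξ => |ξ| ^ k * P s ξ := by
    intro k s
    obtain ⟨K, hK0, hK⟩ := hPb k
    refine (integrable_inv_one_add_sq.const_mul K).mono'
      (by have := hPc.comp (Continuous.prodMk_right s); exact
            (Continuous.mul (by fun_prop) this).aestronglyMeasurable) (ae_of_all _ fun ξ => ?_)
    rw [Real.norm_of_nonneg (mul_nonneg (by positivity) (hP0 s ξ))]
    exact hK s ξ
  set μ : ℕ → ℝ → ℝ := fun k s => ∫ ξ, |ξ| ^ k * P s ξ with hμ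
  have hμ0 : ∀ k s, 0 ≤ μ k s := fun k s =>
    integral_nonneg fun ξ => mul_nonneg (by positivity) (hP0 s ξ)
  have hμc : ∀ k, Continuous (μ k) := by
    intro k
    obtain ⟨K, hK0, hK⟩ := hPb k
    refine continuous_of_dominated (bound := fun ξ => K * (1 + ξ ^ 2)⁻¹)
      (fun s => (hPint k s).aestronglyMeasurable) (fun s => ae_of_all _ fun ξ => ?_)
      (integrable_inv_one_add_sq.const_mul K) (ae_of_all _ fun ξ => ?_)
    · rw [Real.norm_of_nonneg (mul_nonneg (by positivity) (hP0 s ξ))]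
      exact hK s ξ
    · exact continuous_const.mul (hPc.comp (Continuous.prodMk_left ξ))
  have hζm : ∀ k, ∫⁻ ξ, ENNReal.ofReal (|ξ| ^ k * ζ ξ) < ⊤ := lintegral_moment_lt_top hζ0 hρ₀ hζ
  have hζint : ∀ k : ℕ, Integrable fun ξ => |ξ| ^ k * ζ ξ := fun k =>
    integrable_of_lintegral_ofReal_lt_top (Continuous.aestronglyMeasurable (by fun_prop))
      (fun ξ => mul_nonneg (by positivity) (hζ0 ξ)) (hζm k)
  set L : ℕ → ℝ → ℝ := fun k t => (∫ ξ, |ξ| ^ k * ζ ξ) + ∫ s in α..t, μ k s with hL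
  have hL0 : ∀ k, ∀ t ∈ Icc α β, 0 ≤ L k t := fun k t ht =>
    add_nonneg (integral_nonneg fun ξ => mul_nonneg (by positivity) (hζ0 ξ))
      (intervalIntegral.integral_nonneg ht.1 fun s _ => hμ0 k s)
  set Z : ℝ → ℝ → ℝ := fun t ξ => ζ ξ + ∫ s in α..t, P s ξ with hZ
  have hZeq : ∀ t ∈ Icc α β, ∀ ξ, ζ ξ + ∫ s in α..t, Ω s ξ * ‖F s ξ‖ = Z t ξ := by
    intro t ht ξ
    simp only [hZ]
    congr 1
    refine intervalIntegral.integral_congr fun s hs => (hPeq s ?_ ξ).symm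
    rw [uIcc_of_le ht.1] at hs
    exact ⟨hs.1, hs.2.trans ht.2⟩
  have hZ0 : ∀ t ∈ Icc α β, ∀ ξ, 0 ≤ Z t ξ := fun t ht ξ =>
    add_nonneg (hζ0 ξ) (intervalIntegral.integral_nonneg ht.1 fun s _ => hP0 s ξ)
  have hZc : ∀ t, Continuous (Z t) := fun t =>
    hζc.add (intervalIntegral.continuous_parametric_intervalIntegral_of_continuous'
      (f := fun ξ s => P s ξ) (hPc.comp continuous_swap) α t)
  have hLeq : ∀ k, ∀ t ∈ Icc α β, ∫⁻ ξ, ENNReal.ofReal (|ξ| ^ k * Z t ξ) = ENNReal.ofReal (L k t) := by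
    intro k t ht
    have h1 : ∀ ξ, ENNReal.ofReal (|ξ| ^ k * Z t ξ) = ENNReal.ofReal (|ξ| ^ k * ζ ξ)
        + ∫⁻ s in Ioc α t, ENNReal.ofReal (|ξ| ^ k * P s ξ) := by
      intro ξ
      have hc : Continuous fun s => |ξ| ^ k * P s ξ :=
        continuous_const.mul (hPc.comp (Continuous.prodMk_left ξ))
      rw [← ofReal_integral_eq_lintegral_ofReal ((hc.integrableOn_Icc).mono_set Ioc_subset_Icc_self)
        (ae_of_all _ fun s => mul_nonneg (by positivity) (hP0 s ξ)),
        ← intervalIntegral.integral_of_le ht.1, intervalIntegral.integral_const_mul,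
        ← ENNReal.ofReal_add (mul_nonneg (by positivity) (hζ0 ξ)) (mul_nonneg (by positivity)
          (intervalIntegral.integral_nonneg ht.1 fun s _ => hP0 s ξ)), ← mul_add]
    simp_rw [h1]
    rw [lintegral_add_left (by have := hζc.measurable; fun_prop), lintegral_lintegral_swap]
    · have h2 : ∀ s, ∫⁻ ξ, ENNReal.ofReal (|ξ| ^ k * P s ξ) = ENNReal.ofReal (μ k s) := fun s =>
        (ofReal_integral_eq_lintegral_ofReal (hPint k s)
          (ae_of_all _ fun ξ => mul_nonneg (by positivity) (hP0 s ξ))).symm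
      simp_rw [h2]
      rw [← ofReal_integral_eq_lintegral_ofReal (hζint k)
          (ae_of_all _ fun ξ => mul_nonneg (by positivity) (hζ0 ξ)),
        ← ofReal_integral_eq_lintegral_ofReal
          (((hμc k).integrableOn_Icc).mono_set Ioc_subset_Icc_self) (ae_of_all _ (hμ0 k)),
        ← intervalIntegral.integral_of_le ht.1, ← ENNReal.ofReal_add
          (integral_nonneg fun ξ => mul_nonneg (by positivity) (hζ0 ξ))
          (intervalIntegral.integral_nonneg ht.1 fun s _ => hμ0 k s)]
    · refine (Continuous.measurable ?_).ennreal_ofReal.aemeasurable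
      exact (by fun_prop : Continuous fun p : ℝ × ℝ => |p.1| ^ k).mul (hPc.comp continuous_swap)
  have hMv : ∀ k, ∀ t ∈ Icc α β,
      ∫⁻ ξ, ENNReal.ofReal (|ξ| ^ k * (Ω t ξ * ‖v t ξ‖)) ≤ ENNReal.ofReal (D * L k t) := by
    intro k t ht
    rw [ENNReal.ofReal_mul hD.le, ← hLeq k t ht, ← lintegral_const_mul' _ _ ENNReal.ofReal_ne_top]
    refine lintegral_mono fun ξ => ?_
    rw [← ENNReal.ofReal_mul hD.le]
    refine ENNReal.ofReal_le_ofReal ?_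
    have := hmode t ht ξ
    rw [hZeq t ht] at this
    calc _ ≤ |ξ| ^ k * (D * Z t ξ) := by gcongr
      _ = _ := by ring
  -- The zeroth moment of the source is bounded directly by polynomial decay. Only the higher
  -- moments need the nonlinear estimate.
  obtain ⟨K₀, hK₀0, hK₀⟩ := hPb 0
  set Clow := ∫ ξ : ℝ, K₀ * (1 + ξ ^ 2)⁻¹ with hClow
  have hClow0 : 0 ≤ Clow := integral_nonneg fun ξ => by positivity
  have hμlow : ∀ s, μ 0 s ≤ Clow := fun s =>
    integral_mono (hPint 0 s) (integrable_inv_one_add_sq.const_mul K₀) (hK₀ s)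
  have hsum : ∀ n, ∀ t ∈ Icc α β, ∀ ρ, 0 < ρ → ∀ B,
      ∑ k ∈ Finset.range (n + 1), ρ ^ k / k ! * (D * L k t) ≤ B →
      ∑ k ∈ Finset.range n, ρ ^ k / k ! * μ (k + 1) t ≤ (Ψ (ENNReal.ofReal B)).toReal
        * ∑ k ∈ Finset.range n, ρ ^ k / k ! * (D * L (k + 1) t) := by
    intro n t ht ρ hρ B hB
    have hΩm : Measurable (Ω t) := by
      have : Continuous (Ω t) := hΩc.comp_continuous (f := fun ξ => (t, ξ)) (by fun_prop)
        fun ξ => ⟨ht, mem_univ _⟩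
      exact this.measurable
    have hFm : Measurable (F t) := by
      have : Continuous (F t) := hFc.comp_continuous (f := fun ξ => (t, ξ)) (by fun_prop)
        fun ξ => ⟨ht, mem_univ _⟩
      exact this.measurable
    have hvm : Measurable (v t) := (hv t ht).measurable
    have hpos : ∀ ξ, 0 ≤ ∑ k ∈ Finset.range n, (ρ * |ξ|) ^ k / k ! := fun ξ => by positivity
    -- The weight `Ω` times a truncated exponential is submultiplicative. Integrating against it
    -- gives exactly the truncated generating function of the moments.
    set W : ℝ → ℝ≥0∞ := fun ξ =>
      ENNReal.ofReal ((∑ k ∈ Finset.range n, (ρ * |ξ|) ^ k / k !) * Ω t ξ) with hW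
    have hWm : Measurable W := by fun_prop
    have hWsub : ∀ ξ η, W (ξ + η) ≤ W ξ * W η := by
      intro ξ η
      simp only [hW]
      rw [← ENNReal.ofReal_mul (mul_nonneg (hpos ξ) (hΩ0 t ht ξ))]
      refine ENNReal.ofReal_le_ofReal ?_
      have h1 := sum_pow_div_factorial_add_le (x := ρ * |ξ|) (y := ρ * |η|)
        (by positivity) (by positivity) n
      have h2 : ∑ k ∈ Finset.range n, (ρ * |ξ + η|) ^ k / k !
          ≤ ∑ k ∈ Finset.range n, (ρ * |ξ| + ρ * |η|) ^ k / k ! := by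
        gcongr
        rw [← mul_add]; gcongr; exact abs_add_le ξ η
      calc _ ≤ _ := mul_le_mul (h2.trans h1) (hΩsub t ht ξ η) (hΩ0 t ht _)
            (mul_nonneg (hpos ξ) (hpos η))
        _ = _ := by ring
    have hconv : ∀ (q : ℝ → ℂ), Measurable q → ∀ i, ∫⁻ ξ, ‖ξ‖ₑ ^ i * W ξ * ‖q ξ‖ₑ
        = ∑ k ∈ Finset.range n, ENNReal.ofReal (ρ ^ k / k !)
          * ∫⁻ ξ, ENNReal.ofReal (|ξ| ^ (k + i) * (Ω t ξ * ‖q ξ‖)) := by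
      intro q hq i
      rw [← lintegral_sum_pow_mul (p := fun ξ => Ω t ξ * ‖q ξ‖) (by fun_prop)
        (fun ξ => mul_nonneg (hΩ0 t ht ξ) (norm_nonneg _)) hρ.le]
      refine lintegral_congr fun ξ => ?_
      have e1 : ‖ξ‖ₑ ^ i = ENNReal.ofReal (|ξ| ^ i) := by
        rw [Real.enorm_eq_ofReal_abs, ENNReal.ofReal_pow (abs_nonneg ξ)]
      rw [e1, ← ofReal_norm (q ξ), ← ENNReal.ofReal_mul (by positivity),
        ← ENNReal.ofReal_mul (mul_nonneg (by positivity) (mul_nonneg (hpos ξ) (hΩ0 t ht ξ)))]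
      congr 1; ring
    have hle : ∀ i, ∫⁻ ξ, ‖ξ‖ₑ ^ i * W ξ * ‖v t ξ‖ₑ
        ≤ ENNReal.ofReal (∑ k ∈ Finset.range n, ρ ^ k / k ! * (D * L (k + i) t)) := by
      intro i
      rw [hconv _ hvm, ENNReal.ofReal_sum_of_nonneg fun k _ => mul_nonneg (by positivity)
        (mul_nonneg hD.le (hL0 _ t ht))]
      refine Finset.sum_le_sum fun k _ => ?_
      rw [ENNReal.ofReal_mul (by positivity)]
      gcongr
      exact hMv (k + i) t ht
    have hFsum : ENNReal.ofReal (∑ k ∈ Finset.range n, ρ ^ k / k ! * μ (k + 1) t)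
        = ∫⁻ ξ, ‖ξ‖ₑ ^ 1 * W ξ * ‖F t ξ‖ₑ := by
      rw [hconv _ hFm, ENNReal.ofReal_sum_of_nonneg fun k _ => mul_nonneg (by positivity) (hμ0 _ t)]
      refine Finset.sum_congr rfl fun k _ => ?_
      rw [ENNReal.ofReal_mul (by positivity)]
      congr 1
      rw [ofReal_integral_eq_lintegral_ofReal (hPint (k + 1) t)
          (ae_of_all _ fun ξ => mul_nonneg (by positivity) (hP0 t ξ))]
      simp only [hPeq t ht]
    have hX : ∫⁻ ξ, W ξ * ‖v t ξ‖ₑ ≤ ENNReal.ofReal B := by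
      have h1 := hle 0
      simp only [pow_zero, one_mul, add_zero] at h1
      refine h1.trans (ENNReal.ofReal_le_ofReal (le_trans ?_ hB))
      exact Finset.sum_le_sum_of_subset_of_nonneg (Finset.range_mono (Nat.le_succ n))
        fun k _ _ => mul_nonneg (by positivity) (mul_nonneg hD.le (hL0 _ t ht))
    have h1 := hnl t ht W hWm hWsub
    have h2 := hle 1
    simp only [pow_one] at hFsum h2
    rw [← hFsum] at h1
    have h3 := h1.trans (mul_le_mul' (hΨ hX) h2)
    have hfin := hΨ' _ (ENNReal.ofReal_lt_top (r := B))
    rw [← ENNReal.ofReal_toReal hfin.ne, ← ENNReal.ofReal_mul ENNReal.toReal_nonneg] at h3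
    exact (ENNReal.ofReal_le_ofReal_iff (mul_nonneg ENNReal.toReal_nonneg
      (Finset.sum_nonneg fun k _ => mul_nonneg (by positivity)
        (mul_nonneg hD.le (hL0 _ t ht))))).1 h3
  have key : ∃ ρ > 0, ∃ B, ∀ t ∈ Icc α β, ∀ k, ρ ^ k / k ! * (D * L k t) ≤ B := by
    refine exists_moment_bound (α := α) (β := β) (c := D) (Clow := Clow)
      (M := fun k t => D * L k t) (μ := μ) (Φ := fun B => (Ψ (ENNReal.ofReal B)).toReal)
      (B₀ := (ENNReal.ofReal D * ∫⁻ ξ, ENNReal.ofReal (Real.exp (ρ₀ * |ξ|) * ζ ξ)).toReal)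
      hD.le hClow0 hρ₀ ?_ ?_ ?_ ?_ ?_
    · intro k t ht
      have h1 : HasDerivAt (L k) (μ k t) t :=
        (((hμc k).integral_hasStrictDerivAt α t).hasDerivAt).const_add _
      exact (h1.const_mul D).hasDerivWithinAt
    · exact fun k t ht => mul_nonneg hD.le (hL0 k t ht)
    · exact fun B => ENNReal.toReal_nonneg
    · intro n
      refine (ENNReal.ofReal_le_iff_le_toReal
        (ENNReal.mul_lt_top ENNReal.ofReal_lt_top hζ).ne).1 ?_
      have hα : α ∈ Icc α β := ⟨le_rfl, hαβ⟩
      have hLα : ∀ k, ENNReal.ofReal (L k α) = ∫⁻ ξ, ENNReal.ofReal (|ξ| ^ (k + 0) * ζ ξ) := by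
        intro k
        rw [← hLeq k α hα]; simp [hZ]
      rw [ENNReal.ofReal_sum_of_nonneg fun k _ => mul_nonneg (by positivity)
          (mul_nonneg hD.le (hL0 _ α hα))]
      calc _ = ENNReal.ofReal D * ∑ k ∈ Finset.range (n + 1), ENNReal.ofReal (ρ₀ ^ k / k !)
            * ∫⁻ ξ, ENNReal.ofReal (|ξ| ^ (k + 0) * ζ ξ) := by
            rw [Finset.mul_sum]
            refine Finset.sum_congr rfl fun k _ => ?_
            rw [ENNReal.ofReal_mul (by positivity), ENNReal.ofReal_mul hD.le, hLα]; ring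
        _ ≤ _ := by
            rw [← lintegral_sum_pow_mul hζc.measurable hζ0 hρ₀.le]
            gcongr with ξ
            · simpa using hζ0 ξ
            · exact Real.sum_le_exp_of_nonneg (by positivity) _
            · simp
    · intro n t ht ρ hρ hρle B hB
      have h1 := hsum n t ht ρ hρ B hB
      rw [Finset.sum_range_succ']
      -- Removing the term `k = 0` leaves moments of index `k + 1`; the spare power of `ρ` is the
      -- factor required by the fencing lemma.
      have h2 : ∑ k ∈ Finset.range n, ρ ^ (k + 1) / (k + 1)! * μ (k + 1) t
          ≤ ρ * ∑ k ∈ Finset.range n, ρ ^ k / k ! * μ (k + 1) t := by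
        rw [Finset.mul_sum]
        refine Finset.sum_le_sum fun k _ => ?_
        rw [← mul_assoc]
        refine mul_le_mul_of_nonneg_right ?_ (hμ0 _ t)
        rw [pow_succ', mul_div_assoc]
        gcongr
        exact Nat.le_succ k
      have h3 := mul_le_mul_of_nonneg_left h1 hρ.le
      have h4 := hμlow t
      simp only [pow_zero, Nat.factorial_zero, Nat.cast_one, div_one, one_mul]
      linarith
  obtain ⟨ρ, hρ, B, hB⟩ := key
  -- Halving the radius turns the uniform bound on the individual terms into a geometric series with
  -- sum `2`.
  refine ⟨ρ / 2, by positivity, ENNReal.ofReal (B / D) * 2,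
    ENNReal.mul_lt_top ENNReal.ofReal_lt_top (by simp), fun t ht => ?_⟩
  simp_rw [hZeq t ht]
  rw [lintegral_exp_mul (hZc t).measurable (hZ0 t ht) (by positivity)]
  rw [← ENNReal.tsum_geometric_two, ← ENNReal.tsum_mul_left]
  refine ENNReal.tsum_le_tsum fun k => ?_
  rw [hLeq k t ht, ← ENNReal.ofReal_mul (by positivity)]
  have e : (2⁻¹ : ℝ≥0∞) ^ k = ENNReal.ofReal ((1 / 2) ^ k) := by
    rw [ENNReal.ofReal_pow (by norm_num), one_div, ENNReal.ofReal_inv_of_pos (by norm_num)]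
    simp
  rw [e, ← ENNReal.ofReal_mul' (by positivity)]
  refine ENNReal.ofReal_le_ofReal ?_
  have h1 := hB t ht k
  calc _ = (ρ ^ k / k ! * (D * L k t)) / D * (1 / 2) ^ k := by
        rw [div_pow, div_pow, one_pow]; field_simp
    _ ≤ _ := by gcongr

end Propagation

/-! ### Smooth functions with integrable derivatives -/

section IntegrableDerivs

/-- Smooth functions all of whose derivatives are integrable. -/
structure HasIntegrableDerivs (g : ℝ → ℝ) : Prop where
  contDiff : ContDiff ℝ ∞ g
  integrable : ∀ j : ℕ, Integrable (iteratedDeriv j g)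

variable {g h : ℝ → ℝ}

theorem HasIntegrableDerivs.integrable_self (hg : HasIntegrableDerivs g) : Integrable g := by
  simpa using hg.integrable 0

theorem HasIntegrableDerivs.of_iteratedDeriv (hg : HasIntegrableDerivs g) (j : ℕ) :
    HasIntegrableDerivs (iteratedDeriv j g) := by
  constructor
  · rw [iteratedDeriv_eq_iterate]
    exact hg.contDiff.iterate_deriv j
  · intro i
    have h := hg.integrable (i + j)
    rw [iteratedDeriv_eq_iterate, Function.iterate_add_apply] at h
    rwa [iteratedDeriv_eq_iterate, iteratedDeriv_eq_iterate]

theorem HasIntegrableDerivs.sub (hg : HasIntegrableDerivs g) (hh : HasIntegrableDerivs h) :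
    HasIntegrableDerivs fun x => g x - h x := by
  refine ⟨hg.contDiff.sub hh.contDiff, fun j => ?_⟩
  have : iteratedDeriv j (fun x => g x - h x) = iteratedDeriv j g - iteratedDeriv j h := by
    ext x
    exact iteratedDeriv_fun_sub (hg.contDiff.contDiffAt.of_le (by exact_mod_cast le_top))
      (hh.contDiff.contDiffAt.of_le (by exact_mod_cast le_top))
  rw [this]
  exact (hg.integrable j).sub (hh.integrable j)

theorem HasIntegrableDerivs.const_mul (hg : HasIntegrableDerivs g) (c : ℝ) :
    HasIntegrableDerivs fun x => c * g x := by
  refine ⟨contDiff_const.mul hg.contDiff, fun j => ?_⟩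
  have : iteratedDeriv j (fun x => c * g x) = fun x => c * iteratedDeriv j g x := by
    ext x
    exact iteratedDeriv_const_mul_field c g
  rw [this]
  exact (hg.integrable j).const_mul c

theorem ft_iteratedDeriv (hg : HasIntegrableDerivs g) (j : ℕ) (ξ : ℝ) :
    ft (iteratedDeriv j g) ξ = (Complex.I * ((2 * Real.pi * ξ : ℝ) : ℂ)) ^ j * ft g ξ := by
  induction j with
  | zero => simp
  | succ j ih =>
    have h1 : Differentiable ℝ (iteratedDeriv j g) :=
      (hg.of_iteratedDeriv j).contDiff.differentiable (by simp)
    have h2 : (fun x => ((iteratedDeriv (j + 1) g x : ℝ) : ℂ))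
        = deriv fun x => ((iteratedDeriv j g x : ℝ) : ℂ) := by
      ext x
      rw [iteratedDeriv_succ]
      exact ((h1 x).hasDerivAt.ofReal_comp).deriv.symm
    have h4 := Real.fourier_deriv (f := fun x => ((iteratedDeriv j g x : ℝ) : ℂ))
      ((hg.integrable j).ofReal (𝕜 := ℂ)) (fun x => (h1 x).hasDerivAt.ofReal_comp.differentiableAt)
      (by rw [← h2]; exact (hg.integrable (j + 1)).ofReal (𝕜 := ℂ))
    rw [ft, h2, h4]
    have h3 : (FourierTransform.fourier fun x => ((iteratedDeriv j g x : ℝ) : ℂ)) ξ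
      = ft (iteratedDeriv j g) ξ := rfl
    beta_reduce
    rw [h3, ih, smul_eq_mul]
    push_cast; ring

theorem norm_ft_iteratedDeriv (hg : HasIntegrableDerivs g) (j : ℕ) (ξ : ℝ) :
    ‖ft (iteratedDeriv j g) ξ‖ = (2 * Real.pi * |ξ|) ^ j * ‖ft g ξ‖ := by
  rw [ft_iteratedDeriv hg, norm_mul, norm_pow, norm_mul, Complex.norm_I, one_mul,
    Complex.norm_real, Real.norm_eq_abs, abs_mul, abs_of_pos Real.two_pi_pos]

theorem pow_mul_norm_ft_le (hg : HasIntegrableDerivs g) (j : ℕ) (ξ : ℝ) :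
    (1 + |ξ|) ^ j * ‖ft g ξ‖ ≤ 2 ^ j * ((∫ x, |g x|) + ∫ x, |iteratedDeriv j g x|) := by
  have h1 := norm_ft_le g ξ
  have h2 := norm_ft_le (iteratedDeriv j g) ξ
  rw [norm_ft_iteratedDeriv hg] at h2
  have h3 : (1 + |ξ|) ^ j ≤ 2 ^ j * (1 + (2 * Real.pi * |ξ|) ^ j) := by
    have hp : |ξ| ≤ 2 * Real.pi * |ξ| :=
      le_mul_of_one_le_left (abs_nonneg ξ) (by linarith [Real.pi_gt_three])
    have h0 : 0 ≤ |ξ| := abs_nonneg ξ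
    rcases le_total (|ξ|) 1 with hx | hx
    · calc (1 + |ξ|) ^ j ≤ 2 ^ j := by gcongr; linarith
        _ ≤ _ := le_mul_of_one_le_right (by positivity) (by linarith [pow_nonneg (h0.trans hp) j])
    · calc (1 + |ξ|) ^ j ≤ (2 * (2 * Real.pi * |ξ|)) ^ j := by gcongr; linarith
        _ = 2 ^ j * (2 * Real.pi * |ξ|) ^ j := mul_pow _ _ _
        _ ≤ _ := by gcongr; linarith
  calc _ ≤ 2 ^ j * (1 + (2 * Real.pi * |ξ|) ^ j) * ‖ft g ξ‖ := by gcongr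
    _ = 2 ^ j * (‖ft g ξ‖ + (2 * Real.pi * |ξ|) ^ j * ‖ft g ξ‖) := by ring
    _ ≤ _ := by gcongr

theorem integrable_of_sq_decay {q : ℝ → ℂ} (hq : Continuous q) {K : ℝ}
    (hK : ∀ ξ, (1 + |ξ|) ^ 2 * ‖q ξ‖ ≤ K) : Integrable q := by
  refine (integrable_inv_one_add_sq.const_mul K).mono' hq.aestronglyMeasurable
    (ae_of_all _ fun ξ => ?_)
  rw [← div_eq_mul_inv, le_div_iff₀ (by positivity)]
  refine le_trans ?_ (hK ξ)
  rw [mul_comm]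
  gcongr
  nlinarith [abs_nonneg ξ, sq_abs ξ]

theorem HasIntegrableDerivs.integrable_ft (hg : HasIntegrableDerivs g) : Integrable (ft g) :=
  integrable_of_sq_decay (continuous_ft hg.integrable_self) (pow_mul_norm_ft_le hg 2)

theorem HasIntegrableDerivs.continuous (hg : HasIntegrableDerivs g) : Continuous g :=
  hg.contDiff.continuous

theorem ft_neg (g : ℝ → ℝ) (ξ : ℝ) : ft g (-ξ) = (starRingEnd ℂ) (ft g ξ) := by
  rw [ft_eq, ft_eq, ← integral_conj]
  congr 1 with x
  rw [map_mul, ← Complex.exp_conj, map_mul, Complex.conj_ofReal, Complex.conj_ofReal,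
    Complex.conj_I]
  congr 2
  push_cast; ring

/-- Plancherel, read off from the convolution formula for `g * g` at frequency `0`: for real `g` the
transform at `-η` is the conjugate of that at `η`. -/
theorem lintegral_sq_ft (hg : HasIntegrableDerivs g) :
    ∫⁻ ξ, ‖ft g ξ‖ₑ ^ 2 = ∫⁻ x, ‖g x‖ₑ ^ 2 := by
  have hI := hg.integrable_self
  have hf := hg.integrable_ft
  have h1 := ft_mul_eq hg.continuous hI hf hI 0
  have i1 : Integrable fun x => g x ^ 2 := integrable_pow_succ hg.continuous hI hf 1
  have i2 : Integrable fun ξ => ‖ft g ξ‖ ^ 2 := by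
    have := hf.norm.bdd_mul (f := fun ξ => ‖ft g ξ‖) (c := ∫ x, |g x|)
      hf.norm.aestronglyMeasurable (ae_of_all _ fun x => by simpa using norm_ft_le g x)
    simpa [sq] using this
  have e1 : ft (fun x => g x * g x) 0 = ((∫ x, g x ^ 2 : ℝ) : ℂ) := by
    rw [ft_eq, ← integral_complex_ofReal]
    congr 1 with x
    simp [sq]
  have e2 : ∫ η, ft g η * ft g (0 - η) = ((∫ ξ, ‖ft g ξ‖ ^ 2 : ℝ) : ℂ) := by
    rw [← integral_complex_ofReal]
    congr 1 with η
    rw [zero_sub, ft_neg, Complex.mul_conj, Complex.normSq_eq_norm_sq]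
  rw [e1, e2] at h1
  have h2 : ∫ x, g x ^ 2 = ∫ ξ, ‖ft g ξ‖ ^ 2 := by exact_mod_cast h1
  have h3 := congrArg ENNReal.ofReal h2
  rw [ofReal_integral_eq_lintegral_ofReal i1 (ae_of_all _ fun x => by positivity),
    ofReal_integral_eq_lintegral_ofReal i2 (ae_of_all _ fun x => by positivity)] at h3
  rw [lintegral_congr fun ξ => (by rw [← ofReal_norm, ENNReal.ofReal_pow (norm_nonneg _)] :
    ‖ft g ξ‖ₑ ^ 2 = ENNReal.ofReal (‖ft g ξ‖ ^ 2)), ← h3]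
  refine lintegral_congr fun x => ?_
  rw [← ofReal_norm, ← ENNReal.ofReal_pow (norm_nonneg _), Real.norm_eq_abs, sq_abs]

theorem eLpNorm_two_sq (g : ℝ → ℝ) : eLpNorm g 2 volume ^ 2 = ∫⁻ x, ‖g x‖ₑ ^ 2 := by
  have := eLpNorm_nnreal_pow_eq_lintegral (f := g) (μ := volume) (p := 2) (by norm_num)
  simpa using this

theorem eLpNorm_iteratedDeriv_sq (hg : HasIntegrableDerivs g) (j : ℕ) :
    eLpNorm (iteratedDeriv j g) 2 volume ^ 2
      = ∫⁻ ξ, ENNReal.ofReal ((2 * Real.pi * |ξ|) ^ (2 * j) * ‖ft g ξ‖ ^ 2) := by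
  rw [eLpNorm_two_sq, ← lintegral_sq_ft (hg.of_iteratedDeriv j)]
  refine lintegral_congr fun ξ => ?_
  rw [← ofReal_norm, ← ENNReal.ofReal_pow (norm_nonneg _), norm_ft_iteratedDeriv hg, mul_pow,
    ← pow_mul, mul_comm j 2]

theorem factorial_two_mul_le (j : ℕ) : ((2 * j)! : ℝ) ≤ 4 ^ j * (j ! : ℝ) ^ 2 := by
  have h1 : (2 * j)! = Nat.centralBinom j * j ! ^ 2 := by
    rw [Nat.centralBinom_eq_two_mul_choose, ← Nat.choose_mul_factorial_mul_factorial
      (show j ≤ 2 * j by omega), show 2 * j - j = j by omega]; ring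
  rw [h1]
  push_cast
  gcongr
  exact_mod_cast Nat.centralBinom_le_four_pow j

/-- Exponential decay of the Fourier transform of an integrable function gives analyticity. -/
theorem stepNorm_le_of_exp_decay (hg : HasIntegrableDerivs g) {K ρ : ℝ} (hK : ∫ x, |g x| ≤ K)
    (hρ : 0 < ρ) {Λ : ℝ≥0} (hΛ : 4 * Real.pi / ρ ≤ Λ) :
    stepNorm Λ g ≤ (ENNReal.ofReal K
      * ∫⁻ ξ, ENNReal.ofReal (Real.exp (ρ * |ξ|) * ‖ft g ξ‖)) ^ (1 / 2 : ℝ) := by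
  set A := ∫⁻ ξ, ENNReal.ofReal (Real.exp (ρ * |ξ|) * ‖ft g ξ‖) with hA
  have hΛ0 : 0 < Λ := by
    have : (0 : ℝ) < Λ := lt_of_lt_of_le (by positivity) hΛ
    exact_mod_cast this
  have hK0 : 0 ≤ K := le_trans (integral_nonneg fun _ => abs_nonneg _) hK
  -- In the Plancherel integral one factor `|ĝ|` is bounded by the `L¹` norm and the other is kept
  -- with the exponential weight. The power `|ξ|^(2j)` costs `(2j)! ≤ 4^j j!²`, whence the constant
  -- `4π` instead of `2π`.
  have key : ∀ j : ℕ, eLpNorm (iteratedDeriv j g) 2 volume ^ 2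
      ≤ (((Λ ^ j * (j ! : ℝ≥0) : ℝ≥0) : ℝ≥0∞)) ^ 2 * (ENNReal.ofReal K * A) := by
    intro j
    rw [eLpNorm_iteratedDeriv_sq hg]
    have e : (((Λ ^ j * (j ! : ℝ≥0) : ℝ≥0) : ℝ≥0∞)) ^ 2
        = ENNReal.ofReal (((Λ : ℝ) ^ j * j !) ^ 2) := by
      rw [ENNReal.ofReal_pow (by positivity), ← ENNReal.ofReal_coe_nnreal]
      push_cast
      rfl
    rw [e, ← mul_assoc, ← ENNReal.ofReal_mul (by positivity), hA,
      ← lintegral_const_mul' _ _ ENNReal.ofReal_ne_top]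
    refine lintegral_mono fun ξ => ?_
    rw [← ENNReal.ofReal_mul (by positivity)]
    refine ENNReal.ofReal_le_ofReal ?_
    have h1 : (2 * Real.pi * |ξ|) ^ (2 * j)
        ≤ ((Λ : ℝ) ^ j * j !) ^ 2 * Real.exp (ρ * |ξ|) := by
      have h2 := Real.pow_div_factorial_le_exp (ρ * |ξ|) (by positivity) (2 * j)
      rw [div_le_iff₀ (by positivity)] at h2
      calc (2 * Real.pi * |ξ|) ^ (2 * j)
          = (2 * Real.pi / ρ) ^ (2 * j) * (ρ * |ξ|) ^ (2 * j) := by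
            rw [← mul_pow]; congr 1; field_simp
        _ ≤ (2 * Real.pi / ρ) ^ (2 * j) * (Real.exp (ρ * |ξ|) * (4 ^ j * (j ! : ℝ) ^ 2)) := by
            gcongr
            exact h2.trans (by gcongr; exact factorial_two_mul_le j)
        _ = ((4 * Real.pi / ρ) ^ j * j !) ^ 2 * Real.exp (ρ * |ξ|) := by
            have h4 : (4 : ℝ) ^ j = 2 ^ (2 * j) := by rw [pow_mul]; norm_num
            rw [show 4 * Real.pi / ρ = 2 * (2 * Real.pi / ρ) by ring, mul_pow 2, h4]; ring
        _ ≤ _ := by gcongr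
    have h3 := (norm_ft_le g ξ).trans hK
    calc _ ≤ ((Λ : ℝ) ^ j * j !) ^ 2 * Real.exp (ρ * |ξ|) * (K * ‖ft g ξ‖) := by
          rw [sq ‖ft g ξ‖]; gcongr
      _ = _ := by ring
  refine iSup_le fun j => ?_
  have hne : ((Λ ^ j * (j ! : ℝ≥0) : ℝ≥0) : ℝ≥0∞) ≠ 0 := by
    have : 0 < Λ ^ j * (j ! : ℝ≥0) := by positivity
    exact_mod_cast this.ne'
  rw [one_div, ENNReal.le_rpow_inv_iff (by norm_num), ENNReal.rpow_two, div_eq_mul_inv, mul_pow,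
    ← ENNReal.inv_pow, ← div_eq_mul_inv,
    ENNReal.div_le_iff (pow_ne_zero _ hne) (ENNReal.pow_ne_top ENNReal.coe_ne_top), mul_comm _ (_ ^ 2)]
  exact key j

theorem lintegral_exp_neg_lt_top {ρ : ℝ} (hρ : 0 < ρ) :
    ∫⁻ ξ : ℝ, ENNReal.ofReal (Real.exp (-(ρ * |ξ|))) < ⊤ := by
  set δ := min 1 (ρ ^ 2 / 2) with hδ
  have hδ0 : 0 < δ := lt_min one_pos (by positivity)
  have hI := integrable_inv_one_add_sq.const_mul δ⁻¹
  have h1 := (hasFiniteIntegral_iff_ofReal (ae_of_all _ fun ξ => by positivity)).1 hI.2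
  refine lt_of_le_of_lt (lintegral_mono fun ξ => ENNReal.ofReal_le_ofReal ?_) h1
  rw [Real.exp_neg, ← mul_inv]
  refine inv_anti₀ (by positivity) ?_
  have h2 := Real.quadratic_le_exp_of_nonneg (x := ρ * |ξ|) (by positivity)
  have h3 : δ * 1 ≤ 1 := by rw [mul_one]; exact min_le_left _ _
  have h4 : δ * ξ ^ 2 ≤ ρ ^ 2 / 2 * ξ ^ 2 := by gcongr; exact min_le_right _ _
  have h5 : (ρ * |ξ|) ^ 2 = ρ ^ 2 * ξ ^ 2 := by rw [mul_pow, sq_abs]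
  have h6 : 0 ≤ ρ * |ξ| := by positivity
  nlinarith

/-- The Fourier transform of a function in `A_{L²}` decays exponentially in the mean. -/
theorem InAL2.exists_exp_decay (hg : HasIntegrableDerivs g) (h : InAL2 g) :
    ∃ ρ > 0, ∫⁻ ξ, ENNReal.ofReal (Real.exp (ρ * |ξ|) * ‖ft g ξ‖) < ⊤ := by
  obtain ⟨-, C, Λ, hC⟩ := h
  set r : ℝ := 1 / (2 * (Λ + 1)) with hr
  have hr0 : 0 < r := by positivity
  have hrΛ : r * Λ ≤ 1 / 2 := by
    rw [hr, div_mul_eq_mul_div, one_mul, div_le_div_iff₀ (by positivity) (by norm_num)]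
    linarith
  have hm : ∀ j : ℕ, ∫⁻ ξ, ENNReal.ofReal (|ξ| ^ (2 * j) * ‖ft g ξ‖ ^ 2)
      ≤ ENNReal.ofReal ((C * Λ ^ j * j !) ^ 2) := by
    intro j
    calc _ ≤ eLpNorm (iteratedDeriv j g) 2 volume ^ 2 := by
          rw [eLpNorm_iteratedDeriv_sq hg]
          refine lintegral_mono fun ξ => ENNReal.ofReal_le_ofReal ?_
          gcongr
          exact le_mul_of_one_le_left (abs_nonneg ξ) (by linarith [Real.pi_gt_three])
      _ ≤ _ := by
          rw [ENNReal.ofReal_pow (by positivity)]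
          gcongr
          refine (hC j).trans (le_of_eq ?_)
          rw [← ENNReal.ofReal_coe_nnreal]
          push_cast
          rfl
  have hfm := (continuous_ft hg.integrable_self).measurable
  -- The exponential is at most twice a hyperbolic cosine, whose even powers match the `L²` norms of
  -- the derivatives. Since `j!² ≤ (2j)!` and `r Λ ≤ 1/2`, the series converges.
  have hsq : ∫⁻ ξ, ENNReal.ofReal (Real.exp (r * |ξ|) * ‖ft g ξ‖ ^ 2) < ⊤ := by
    have h1 : ∀ ξ, ENNReal.ofReal (Real.exp (r * |ξ|) * ‖ft g ξ‖ ^ 2)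
        ≤ ∑' j : ℕ, ENNReal.ofReal (2 * (r ^ (2 * j) / (2 * j)!))
          * ENNReal.ofReal (|ξ| ^ (2 * j) * ‖ft g ξ‖ ^ 2) := by
      intro ξ
      have h2 := ((Real.hasSum_cosh (r * |ξ|)).mul_left 2).mul_right (‖ft g ξ‖ ^ 2)
      calc _ ≤ ENNReal.ofReal (2 * Real.cosh (r * |ξ|) * ‖ft g ξ‖ ^ 2) := by
            refine ENNReal.ofReal_le_ofReal ?_
            gcongr
            rw [Real.cosh_eq]
            linarith [Real.exp_pos (-(r * |ξ|))]
        _ ≤ _ := by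
            rw [← h2.tsum_eq, ENNReal.ofReal_tsum_of_nonneg (fun j => by positivity) h2.summable]
            refine ENNReal.tsum_le_tsum fun j => le_of_eq ?_
            rw [← ENNReal.ofReal_mul (by positivity)]
            congr 1
            rw [mul_pow]; ring
    calc _ ≤ _ := lintegral_mono h1
      _ = ∑' j : ℕ, ENNReal.ofReal (2 * (r ^ (2 * j) / (2 * j)!))
          * ∫⁻ ξ, ENNReal.ofReal (|ξ| ^ (2 * j) * ‖ft g ξ‖ ^ 2) := by
          rw [lintegral_tsum fun j => by fun_prop]
          exact tsum_congr fun j => lintegral_const_mul _ (by fun_prop)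
      _ ≤ ∑' j : ℕ, ENNReal.ofReal (2 * (C : ℝ) ^ 2) * 2⁻¹ ^ j := by
          refine ENNReal.tsum_le_tsum fun j => ?_
          have e : (2⁻¹ : ℝ≥0∞) ^ j = ENNReal.ofReal ((1 / 2) ^ j) := by
            rw [ENNReal.ofReal_pow (by norm_num), one_div,
              ENNReal.ofReal_inv_of_pos (by norm_num)]
            simp
          refine (mul_le_mul_right (hm j) _).trans ?_
          rw [e, ← ENNReal.ofReal_mul (by positivity), ← ENNReal.ofReal_mul (by positivity)]
          refine ENNReal.ofReal_le_ofReal ?_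
          have h3 : ((j ! : ℝ)) ^ 2 ≤ (2 * j)! := by
            have : j ! * j ! ≤ (2 * j)! := by
              rw [two_mul]
              exact Nat.le_of_dvd (Nat.factorial_pos _) (Nat.factorial_mul_factorial_dvd_factorial_add j j)
            rw [sq]; exact_mod_cast this
          calc 2 * (r ^ (2 * j) / (2 * j)!) * (C * Λ ^ j * j !) ^ 2
              = 2 * (C : ℝ) ^ 2 * ((r * Λ) ^ (2 * j) * ((j ! : ℝ) ^ 2 / (2 * j)!)) := by
                rw [mul_pow, mul_pow, mul_pow]; ring
            _ ≤ 2 * (C : ℝ) ^ 2 * ((1 / 2) ^ (2 * j) * 1) := by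
                gcongr
                exact (div_le_one (by positivity)).2 h3
            _ ≤ 2 * (C : ℝ) ^ 2 * (1 / 2) ^ j := by
                rw [mul_one]
                refine mul_le_mul_of_nonneg_left ?_ (by positivity)
                exact pow_le_pow_of_le_one (by norm_num) (by norm_num) (by omega)
      _ < ⊤ := by
          rw [ENNReal.tsum_mul_left, ENNReal.tsum_geometric_two]
          exact ENNReal.mul_lt_top ENNReal.ofReal_lt_top (by simp)
  -- To pass from `L²` to `L¹`, put `E = exp (r |ξ| / 3)`. Then `E |ĝ| ≤ E⁻¹ + E³ |ĝ|²`, and both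
  -- terms are integrable.
  refine ⟨r / 3, by positivity, ?_⟩
  refine lt_of_le_of_lt ?_ (ENNReal.add_lt_top.2
    ⟨lintegral_exp_neg_lt_top (ρ := r / 3) (by positivity), hsq⟩)
  rw [← lintegral_add_right _ (by fun_prop)]
  refine lintegral_mono fun ξ => ?_
  rw [← ENNReal.ofReal_add (by positivity) (by positivity)]
  refine ENNReal.ofReal_le_ofReal ?_
  set E := Real.exp (r / 3 * |ξ|) with hE
  have hE0 : 0 < E := Real.exp_pos _
  have e1 : Real.exp (r * |ξ|) = E ^ 3 := by
    rw [hE, ← Real.exp_nat_mul]; congr 1; push_cast; ring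
  rw [Real.exp_neg, ← hE, e1]
  have h1 : E * ‖ft g ξ‖ = E⁻¹ * (E ^ 2 * ‖ft g ξ‖) := by field_simp
  have h2 : E ^ 3 * ‖ft g ξ‖ ^ 2 = E⁻¹ * (E ^ 2 * ‖ft g ξ‖) ^ 2 := by field_simp
  rw [h1, h2]
  have h3 : E ^ 2 * ‖ft g ξ‖ ≤ 1 + (E ^ 2 * ‖ft g ξ‖) ^ 2 := by nlinarith [sq_nonneg (E ^ 2 * ‖ft g ξ‖ - 1)]
  calc _ ≤ E⁻¹ * (1 + (E ^ 2 * ‖ft g ξ‖) ^ 2) := by gcongr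
    _ = _ := by ring

end IntegrableDerivs

/-! ### Bounds for a solution and its spatial Fourier transform -/

section Solution

theorem exists_lipschitz_of_hasSum {c : ℕ → ℝ} {f : ℝ → ℝ}
    (hf : ∀ y : ℝ, HasSum (fun ν : ℕ => c ν * y ^ ν) (f y)) (b : ℝ) :
    ∃ L, 0 ≤ L ∧ ∀ y z, |y| ≤ b → |z| ≤ b → |f y - f z| ≤ L * |y - z| := by
  rcases lt_or_ge b 0 with hb | hb
  · exact ⟨0, le_rfl, fun y z hy => absurd (hy.trans_lt hb) (not_lt.2 (abs_nonneg y))⟩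
  have hs := summable_abs_coeff hf hb
  refine ⟨∑' ν : ℕ, |c (ν + 1)| * ((ν + 1) * b ^ ν), tsum_nonneg fun ν => by positivity,
    fun y z hy hz => ?_⟩
  have h1 := (hasSum_nat_add_iff' 1).2 ((hf y).sub (hf z))
  simp only [Finset.range_one, Finset.sum_singleton, pow_zero, sub_self, sub_zero] at h1
  rw [← h1.tsum_eq, ← hs.tsum_mul_right]
  have h2 : ∀ ν : ℕ, ‖c (ν + 1) * y ^ (ν + 1) - c (ν + 1) * z ^ (ν + 1)‖
      ≤ |c (ν + 1)| * ((ν + 1) * b ^ ν) * |y - z| := by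
    intro ν
    rw [← mul_sub, norm_mul, Real.norm_eq_abs, Real.norm_eq_abs, mul_assoc]
    gcongr
    have h3 := abs_pow_sub_pow_le y z (ν + 1)
    have h4 : (max |y| |z|) ^ (ν + 1 - 1) ≤ b ^ ν := by
      rw [Nat.add_sub_cancel]
      gcongr
      exact max_le hy hz
    calc _ ≤ |y - z| * (ν + 1) * b ^ ν := h3.trans (by push_cast; exact mul_le_mul_of_nonneg_left h4 (by positivity))
      _ = _ := by ring
  exact tsum_of_norm_bounded (hs.mul_right |y - z|).hasSum h2

theorem continuous_of_hasSum {c : ℕ → ℝ} {f : ℝ → ℝ}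
    (hf : ∀ y : ℝ, HasSum (fun ν : ℕ => c ν * y ^ ν) (f y)) : Continuous f := by
  refine continuous_iff_continuousAt.2 fun y => ?_
  obtain ⟨L, hL, h⟩ := exists_lipschitz_of_hasSum hf (|y| + 1)
  have h1 : LipschitzOnWith L.toNNReal f (Metric.ball y 1) := by
    refine LipschitzOnWith.of_dist_le_mul fun p hp q hq => ?_
    have hb : ∀ p ∈ Metric.ball y 1, |p| ≤ |y| + 1 := fun p hp => by
      have h2 : |p - y| < 1 := hp
      have := abs_sub_abs_le_abs_sub p y
      linarith
    rw [Real.dist_eq, Real.dist_eq, Real.coe_toNNReal _ hL]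
    exact h p q (hb p hp) (hb q hq)
  exact h1.continuousOn.continuousAt (Metric.ball_mem_nhds y one_pos)

theorem HasIntegrableDerivs.tendsto_zero {g : ℝ → ℝ} (hg : HasIntegrableDerivs g) :
    Tendsto g atTop (𝓝 0) := by
  have hd : Differentiable ℝ g := hg.contDiff.differentiable (by simp)
  have h1 : Integrable (deriv g) := by simpa using hg.integrable 1
  exact tendsto_zero_of_hasDerivAt_of_integrableOn_Ioi (a := 0) (f' := deriv g)
    (fun x _ => (hd x).hasDerivAt) h1.integrableOn hg.integrable_self.integrableOn

/-- A Sobolev bound: two integrable derivatives make the transform decay like `1/(1 + ξ²)`, and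
inversion bounds the supremum. -/
theorem HasIntegrableDerivs.abs_le {g : ℝ → ℝ} (hg : HasIntegrableDerivs g) (x : ℝ) :
    |g x| ≤ (∫ ξ : ℝ, (1 + ξ ^ 2)⁻¹)
      * (2 ^ 2 * ((∫ x, |g x|) + ∫ x, |iteratedDeriv 2 g x|)) := by
  refine (abs_le_integral_norm_ft hg.continuous hg.integrable_self hg.integrable_ft x).trans ?_
  rw [← integral_mul_const]
  refine integral_mono hg.integrable_ft.norm (integrable_inv_one_add_sq.mul_const _) fun ξ => ?_
  beta_reduce
  rw [mul_comm, ← div_eq_mul_inv, le_div_iff₀ (by positivity)]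
  refine le_trans ?_ (pow_mul_norm_ft_le hg 2 ξ)
  rw [mul_comm]
  gcongr
  nlinarith [abs_nonneg ξ, sq_abs ξ]

/-- The derivatives `∂_t^h ∂_x^j u`, `h < m`, are integrable in space, uniformly in time. -/
def HasIntegralBounds (m : ℕ) (T : ℝ) (u : ℝ → ℝ → ℝ) : Prop :=
  ∀ h < m, ∀ j : ℕ, ∃ K : ℝ, ∀ t ∈ Icc 0 T,
    Integrable (mixedDeriv T u h j t) ∧ (∫ x : ℝ, |mixedDeriv T u h j t x|) ≤ K

variable {m : ℕ} {T : ℝ} {a : ℕ → ℝ → ℝ} {f : ℝ → ℝ} {u : ℝ → ℝ → ℝ} {c : ℕ → ℝ}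

theorem IsSolution.hasIntegrableDerivs (hu : IsSolution m T a f u) (hb : HasIntegralBounds m T u)
    {h : ℕ} (hh : h < m) {t : ℝ} (ht : t ∈ Icc 0 T) : HasIntegrableDerivs (timeDeriv T u h t) :=
  ⟨hu.contDiff_space h hh t ht, fun j => ((hb h hh j).choose_spec t ht).1⟩

theorem IsSolution.hasDerivWithinAt (hu : IsSolution m T a f u) (hT : 0 < T) {h : ℕ} (hh : h < m)
    {t : ℝ} (ht : t ∈ Icc 0 T) (x : ℝ) :
    HasDerivWithinAt (fun s => timeDeriv T u h s x) (timeDeriv T u (h + 1) t x) (Icc 0 T) t := by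
  have h1 : DifferentiableWithinAt ℝ (fun s => timeDeriv T u h s x) (Icc 0 T) t :=
    (hu.contDiff_time x).differentiableOn_iteratedDerivWithin (by exact_mod_cast hh)
      (uniqueDiffOn_Icc hT) t ht
  have h2 := h1.hasDerivWithinAt
  rwa [show derivWithin (fun s => timeDeriv T u h s x) (Icc 0 T) t = timeDeriv T u (h + 1) t x from
    (congrFun iteratedDerivWithin_succ t).symm] at h2

theorem IsSolution.continuousOn_time (hu : IsSolution m T a f u) (hT : 0 < T) {h : ℕ} (hh : h ≤ m)
    (x : ℝ) : ContinuousOn (fun s => timeDeriv T u h s x) (Icc 0 T) :=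
  (hu.contDiff_time x).continuousOn_iteratedDerivWithin (by exact_mod_cast hh)
    (uniqueDiffOn_Icc hT)

theorem IsSolution.integral_timeDeriv (hu : IsSolution m T a f u) (hT : 0 < T) {h : ℕ} (hh : h < m)
    {s t : ℝ} (hs : s ∈ Icc 0 T) (ht : t ∈ Icc 0 T) (x : ℝ) :
    ∫ r in s..t, timeDeriv T u (h + 1) r x = timeDeriv T u h t x - timeDeriv T u h s x := by
  have hsub : uIcc s t ⊆ Icc 0 T := by
    intro r hr
    rw [mem_uIcc] at hr
    rcases hr with hr | hr
    · exact ⟨hs.1.trans hr.1, hr.2.trans ht.2⟩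
    · exact ⟨ht.1.trans hr.1, hr.2.trans hs.2⟩
  refine intervalIntegral.integral_eq_sub_of_hasDeriv_right
    ((hu.continuousOn_time hT hh.le x).mono hsub) (fun r hr => ?_)
    ((hu.continuousOn_time hT hh x).mono hsub).intervalIntegrable
  have hr' : r ∈ Ioo 0 T := by
    have h0 := hsub (left_mem_uIcc (a := s) (b := t))
    constructor
    · exact lt_of_le_of_lt (le_min hs.1 ht.1) hr.1
    · exact lt_of_lt_of_le hr.2 (max_le hs.2 ht.2)
  exact ((hu.hasDerivWithinAt hT hh (Ioo_subset_Icc_self hr') x).hasDerivAt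
    (Icc_mem_nhds hr'.1 hr'.2)).hasDerivWithinAt

theorem mixedDeriv_zero (T : ℝ) (u : ℝ → ℝ → ℝ) (h : ℕ) (t x : ℝ) :
    mixedDeriv T u h 0 t x = timeDeriv T u h t x := by
  simp [mixedDeriv]

theorem timeDeriv_zero (T : ℝ) (u : ℝ → ℝ → ℝ) (t x : ℝ) : timeDeriv T u 0 t x = u t x := by
  simp [timeDeriv]

theorem IsSolution.exists_abs_le (hu : IsSolution m T a f u) (hb : HasIntegralBounds m T u)
    {h : ℕ} (hh : h < m) (j : ℕ) :
    ∃ b, ∀ t ∈ Icc 0 T, ∀ x, |mixedDeriv T u h j t x| ≤ b := by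
  obtain ⟨K, hK⟩ := hb h hh j
  obtain ⟨K', hK'⟩ := hb h hh (2 + j)
  refine ⟨(∫ ξ : ℝ, (1 + ξ ^ 2)⁻¹) * (2 ^ 2 * (K + K')), fun t ht x => ?_⟩
  refine (((hu.hasIntegrableDerivs hb hh ht).of_iteratedDeriv j).abs_le x).trans ?_
  have h0 : 0 ≤ ∫ ξ : ℝ, (1 + ξ ^ 2)⁻¹ := integral_nonneg fun ξ => by positivity
  have e : iteratedDeriv 2 (iteratedDeriv j (timeDeriv T u h t)) = mixedDeriv T u h (2 + j) t := by
    rw [iteratedDeriv_eq_iterate, iteratedDeriv_eq_iterate, ← Function.iterate_add_apply,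
      ← iteratedDeriv_eq_iterate]
    rfl
  rw [e]
  gcongr
  · exact (hK t ht).2
  · exact (hK' t ht).2

theorem exists_forall_abs_coeff_le (ha : ∀ k ∈ Finset.Icc 1 m, ContinuousOn (a k) (Icc 0 T)) :
    ∃ A, 0 ≤ A ∧ ∀ t ∈ Icc 0 T, ∀ k ∈ Finset.Icc 1 m, |a k t| ≤ A := by
  have h1 : ∀ k, ∃ A, 0 ≤ A ∧ (k ∈ Finset.Icc 1 m → ∀ t ∈ Icc 0 T, |a k t| ≤ A) := fun k => by
    by_cases hk : k ∈ Finset.Icc 1 m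
    · obtain ⟨A, hA⟩ := isCompact_Icc.exists_bound_of_continuousOn (ha k hk)
      exact ⟨max A 0, le_max_right _ _, fun _ t ht => (hA t ht).trans (le_max_left _ _)⟩
    · exact ⟨0, le_rfl, fun h => absurd h hk⟩
  choose A hA0 hA using h1
  refine ⟨∑ k ∈ Finset.Icc 1 m, A k, Finset.sum_nonneg fun k _ => hA0 k, fun t ht k hk => ?_⟩
  exact (hA k hk t ht).trans (Finset.single_le_sum (f := A) (fun i _ => hA0 i) hk)

theorem IsSolution.timeDeriv_eq (hu : IsSolution m T a f u) {t : ℝ} (ht : t ∈ Icc 0 T) (x : ℝ) :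
    timeDeriv T u m t x
      = f (u t x) - ∑ k ∈ Finset.Icc 1 m, a k t * mixedDeriv T u (m - k) k t x := by
  rw [← hu.equation t ht x]; ring

/-- The derivatives `∂_t^h ∂_x^j u` with `h < m` tend to `0` as `x → ∞`, so by the equation `∂_t^m u
→ f 0`. Its integral over `[0,T]` then tends both to `T f 0`, by dominated convergence, and to `0`,
being an increment of `∂_t^(m-1) u`. -/
theorem IsSolution.map_zero (hu : IsSolution m T a f u) (hb : HasIntegralBounds m T u)
    (hm : 1 ≤ m) (hT : 0 < T) (ha : ∀ k ∈ Finset.Icc 1 m, ContinuousOn (a k) (Icc 0 T))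
    (hf : Continuous f) : f 0 = 0 := by
  obtain ⟨A, hA0, hA⟩ := exists_forall_abs_coeff_le ha
  have h0 : (0 : ℝ) ∈ Icc 0 T := ⟨le_rfl, hT.le⟩
  have hT' : T ∈ Icc 0 T := ⟨hT.le, le_rfl⟩
  obtain ⟨b, hbu⟩ := hu.exists_abs_le hb (show 0 < m by omega) 0
  have hub : ∀ t ∈ Icc 0 T, ∀ x, |u t x| ≤ b := fun t ht x => by
    have := hbu t ht x
    rwa [mixedDeriv_zero, timeDeriv_zero] at this
  obtain ⟨Bf, hBf⟩ := (isCompact_Icc (a := -b) (b := b)).exists_bound_of_continuousOn hf.continuousOn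
  have hmix : ∀ k, ∃ B, k ∈ Finset.Icc 1 m → ∀ t ∈ Icc 0 T, ∀ x,
      |mixedDeriv T u (m - k) k t x| ≤ B := fun k => by
    by_cases hk : k ∈ Finset.Icc 1 m
    · obtain ⟨B, hB⟩ := hu.exists_abs_le hb (show m - k < m by
        have := Finset.mem_Icc.1 hk; omega) k
      exact ⟨B, fun _ => hB⟩
    · exact ⟨0, fun h => absurd h hk⟩
  choose B hB using hmix
  have hlim : ∀ h < m, ∀ j, ∀ t ∈ Icc 0 T,
      Tendsto (fun x => mixedDeriv T u h j t x) atTop (𝓝 0) := fun h hh j t ht =>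
    ((hu.hasIntegrableDerivs hb hh ht).of_iteratedDeriv j).tendsto_zero
  have hlim0 : ∀ t ∈ Icc 0 T, Tendsto (fun x => timeDeriv T u m t x) atTop (𝓝 (f 0)) := by
    intro t ht
    have h1 : Tendsto (fun x => f (u t x)) atTop (𝓝 (f 0)) := by
      refine (hf.tendsto 0).comp ?_
      have := hlim 0 (by omega) 0 t ht
      simpa only [mixedDeriv_zero, timeDeriv_zero] using this
    have h2 : Tendsto (fun x => ∑ k ∈ Finset.Icc 1 m, a k t * mixedDeriv T u (m - k) k t x) atTop
        (𝓝 (∑ k ∈ Finset.Icc 1 m, a k t * 0)) :=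
      tendsto_finsetSum _ fun k hk => (hlim (m - k) (by
        have := Finset.mem_Icc.1 hk; omega) k t ht).const_mul _
    have h3 := h1.sub h2
    simp only [mul_zero, Finset.sum_const_zero, sub_zero] at h3
    exact h3.congr fun x => (hu.timeDeriv_eq ht x).symm
  have hI : Tendsto (fun x => ∫ r in (0 : ℝ)..T, timeDeriv T u m r x) atTop
      (𝓝 (∫ _ in (0 : ℝ)..T, f 0)) := by
    refine intervalIntegral.tendsto_integral_filter_of_dominated_convergence
      (fun _ => Bf + ∑ k ∈ Finset.Icc 1 m, A * B k) (Eventually.of_forall fun x => ?_)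
      (Eventually.of_forall fun x => ae_of_all _ fun t ht => ?_) intervalIntegrable_const
      (ae_of_all _ fun t ht => ?_)
    · rw [uIoc_of_le hT.le]
      exact ((hu.continuousOn_time hT le_rfl x).mono Ioc_subset_Icc_self).aestronglyMeasurable
        measurableSet_Ioc
    · rw [uIoc_of_le hT.le] at ht
      have ht' := Ioc_subset_Icc_self ht
      rw [hu.timeDeriv_eq ht' x]
      refine (norm_sub_le _ _).trans (add_le_add (hBf _ (abs_le.1 (hub t ht' x))) ?_)
      refine (norm_sum_le _ _).trans (Finset.sum_le_sum fun k hk => ?_)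
      rw [norm_mul]
      exact mul_le_mul (hA t ht' k hk) (hB k hk t ht' x) (norm_nonneg _) hA0
    · rw [uIoc_of_le hT.le] at ht
      exact hlim0 t (Ioc_subset_Icc_self ht)
  have hI' : Tendsto (fun x => ∫ r in (0 : ℝ)..T, timeDeriv T u m r x) atTop (𝓝 0) := by
    have h1 := (hlim (m - 1) (by omega) 0 T hT').sub (hlim (m - 1) (by omega) 0 0 h0)
    rw [sub_zero] at h1
    refine h1.congr fun x => ?_
    have h2 := hu.integral_timeDeriv hT (h := m - 1) (by omega) h0 hT' x
    rw [Nat.sub_add_cancel hm] at h2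
    rw [h2, mixedDeriv_zero, mixedDeriv_zero]
  have h := tendsto_nhds_unique hI hI'
  rw [intervalIntegral.integral_const, sub_zero, smul_eq_mul] at h
  exact (mul_eq_zero.1 h).resolve_left hT.ne'

end Solution

/-! ### Time integrals of functions integrable in space -/

section TimeIntegral

variable {G : ℝ → ℝ → ℝ} {K : ℝ}

theorem integrable_prod_of_integral_le (hG : Continuous fun p : ℝ × ℝ => G p.1 p.2)
    (hGi : ∀ r, Integrable (G r)) (hK : ∀ r, ∫ x, |G r x| ≤ K) (s t : ℝ) :
    Integrable (fun p : ℝ × ℝ => G p.1 p.2) ((volume.restrict (uIoc s t)).prod volume) := by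
  have hm : AEStronglyMeasurable (fun p : ℝ × ℝ => G p.1 p.2)
      ((volume.restrict (uIoc s t)).prod volume) := hG.aestronglyMeasurable
  rw [integrable_prod_iff hm]
  refine ⟨ae_of_all _ hGi, ?_⟩
  have : IsFiniteMeasure (volume.restrict (uIoc s t)) :=
    ⟨by rw [Measure.restrict_apply_univ, uIoc, Real.volume_Ioc]; exact ENNReal.ofReal_lt_top⟩
  refine Integrable.of_bound hm.norm.integral_prod_right' K (ae_of_all _ fun r => ?_)
  rw [Real.norm_of_nonneg (integral_nonneg fun _ => norm_nonneg _)]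
  exact hK r

theorem integral_abs_intervalIntegral_le (hG : Continuous fun p : ℝ × ℝ => G p.1 p.2)
    (hGi : ∀ r, Integrable (G r)) (hK : ∀ r, ∫ x, |G r x| ≤ K) (s t : ℝ) :
    ∫ x, |∫ r in s..t, G r x| ≤ K * |t - s| := by
  have hI := (integrable_prod_of_integral_le hG hGi hK s t).abs
  have hswap := integral_integral_swap (f := fun r x => |G r x|) hI
  calc _ ≤ ∫ x, ∫ r in uIoc s t, |G r x| := by
        refine integral_mono_of_nonneg (ae_of_all _ fun x => abs_nonneg _) hI.integral_prod_right
          (ae_of_all _ fun x => ?_)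
        simpa using intervalIntegral.norm_integral_le_integral_norm_uIoc (f := fun r => G r x)
          (a := s) (b := t) (μ := volume)
    _ = ∫ r in uIoc s t, ∫ x, |G r x| := hswap.symm
    _ ≤ ∫ r in uIoc s t, K := by
        refine integral_mono hI.integral_prod_left ?_ fun r => hK r
        exact integrableOn_const (by rw [uIoc, Real.volume_Ioc]; exact ENNReal.ofReal_ne_top)
    _ = _ := by
        rw [setIntegral_const, uIoc, smul_eq_mul, mul_comm, Measure.real, Real.volume_Ioc,
          ENNReal.toReal_ofReal (sub_nonneg.2 min_le_max), max_sub_min_eq_abs]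

theorem ft_intervalIntegral (hG : Continuous fun p : ℝ × ℝ => G p.1 p.2)
    (hGi : ∀ r, Integrable (G r)) (hK : ∀ r, ∫ x, |G r x| ≤ K) (s t ξ : ℝ) :
    ft (fun x => ∫ r in s..t, G r x) ξ = ∫ r in s..t, ft (G r) ξ := by
  have hI := (integrable_prod_of_integral_le hG hGi hK s t)
  have hI' : Integrable (Function.uncurry fun r x : ℝ =>
      Complex.exp (↑(-2 * Real.pi * x * ξ) * Complex.I) * ((G r x : ℝ) : ℂ))
      ((volume.restrict (uIoc s t)).prod volume) := by
    refine (hI.ofReal (𝕜 := ℂ)).mono ?_ (ae_of_all _ fun p => (norm_exp_mul_I_mul _ _).le)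
    exact (by fun_prop : Continuous fun p : ℝ × ℝ =>
      Complex.exp (↑(-2 * Real.pi * p.2 * ξ) * Complex.I)).aestronglyMeasurable.mul
      (hI.ofReal (𝕜 := ℂ)).aestronglyMeasurable
  have h1 := intervalIntegral_integral_swap hI'
  simp only [ft_eq]
  rw [h1]
  congr 1 with x
  rw [intervalIntegral.integral_const_mul, intervalIntegral.integral_ofReal]

end TimeIntegral

/-! ### The Fourier transform of the solution as a family of mode solutions -/

section Solution

variable {m : ℕ} {T : ℝ} {a : ℕ → ℝ → ℝ} {f : ℝ → ℝ} {u : ℝ → ℝ → ℝ} {c : ℕ → ℝ}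

theorem IsSolution.exists_abs_comp_sub_le (hu : IsSolution m T a f u) (hb : HasIntegralBounds m T u)
    (hm : 1 ≤ m) (hf : ∀ y : ℝ, HasSum (fun ν : ℕ => c ν * y ^ ν) (f y)) :
    ∃ L, 0 ≤ L ∧ (∀ t ∈ Icc 0 T, ∀ x, |f (u t x) - f 0| ≤ L * |u t x|) ∧
      ∀ t ∈ Icc 0 T, ∀ s ∈ Icc 0 T, ∀ x, |f (u t x) - f (u s x)| ≤ L * |u t x - u s x| := by
  obtain ⟨b, hbu⟩ := hu.exists_abs_le hb (show 0 < m by omega) 0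
  have hub : ∀ t ∈ Icc 0 T, ∀ x, |u t x| ≤ b := fun t ht x => by
    have := hbu t ht x
    rwa [mixedDeriv_zero, timeDeriv_zero] at this
  obtain ⟨L, hL0, hL⟩ := exists_lipschitz_of_hasSum hf b
  refine ⟨L, hL0, fun t ht x => ?_, fun t ht s hs x => hL _ _ (hub t ht x) (hub s hs x)⟩
  have := hL (u t x) 0 (hub t ht x) (by
    rw [abs_zero]; exact (abs_nonneg _).trans (hub t ht x))
  rwa [sub_zero] at this

/-- The standing assumptions on the solution of the Cauchy problem. -/
structure Setting (m : ℕ) (T : ℝ) (a : ℕ → ℝ → ℝ) (f : ℝ → ℝ) (c : ℕ → ℝ) (u : ℝ → ℝ → ℝ) :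
    Prop where
  one_le : 1 ≤ m
  pos : 0 < T
  continuousOn : ∀ k ∈ Finset.Icc 1 m, ContinuousOn (a k) (Icc 0 T)
  hasSum : ∀ y : ℝ, HasSum (fun ν : ℕ => c ν * y ^ ν) (f y)
  solution : IsSolution m T a f u
  bounds : HasIntegralBounds m T u

theorem timeDeriv_zero_eq (T : ℝ) (u : ℝ → ℝ → ℝ) (t : ℝ) : timeDeriv T u 0 t = u t :=
  funext fun x => timeDeriv_zero T u t x

theorem Setting.map_zero (S : Setting m T a f c u) : f 0 = 0 :=
  S.solution.map_zero S.bounds S.one_le S.pos S.continuousOn (continuous_of_hasSum S.hasSum)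

theorem Setting.coeff_zero (S : Setting m T a f c u) : c 0 = 0 := by
  have h1 := (S.hasSum 0).unique (hasSum_single 0 fun ν hν => by simp [hν])
  rw [S.map_zero] at h1
  simpa using h1.symm

theorem Setting.nice (S : Setting m T a f c u) {h : ℕ} (hh : h < m) {t : ℝ} (ht : t ∈ Icc 0 T) :
    HasIntegrableDerivs (timeDeriv T u h t) := S.solution.hasIntegrableDerivs S.bounds hh ht

theorem Setting.nice_zero (S : Setting m T a f c u) {t : ℝ} (ht : t ∈ Icc 0 T) :
    HasIntegrableDerivs (u t) := by
  have := S.nice (show 0 < m from S.one_le) ht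
  rwa [timeDeriv_zero_eq] at this

theorem Setting.continuousOn_u (S : Setting m T a f c u) :
    ContinuousOn (fun p : ℝ × ℝ => u p.1 p.2) (Icc 0 T ×ˢ univ) := by
  have := S.solution.continuous_mixed 0 S.one_le 0
  simpa only [mixedDeriv_zero, timeDeriv_zero] using this

theorem Setting.exists_comp_bound (S : Setting m T a f c u) :
    ∃ K, ∀ t ∈ Icc 0 T, Integrable (fun x => f (u t x)) ∧ ∫ x, |f (u t x)| ≤ K := by
  obtain ⟨L, hL0, hL, -⟩ := S.solution.exists_abs_comp_sub_le S.bounds S.one_le S.hasSum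
  obtain ⟨K, hK⟩ := S.bounds 0 S.one_le 0
  rw [S.map_zero] at hL
  simp only [sub_zero] at hL
  refine ⟨L * K, fun t ht => ?_⟩
  have hI : Integrable (u t) := (S.nice_zero ht).integrable_self
  have hK' : ∫ x, |u t x| ≤ K := by
    have := (hK t ht).2
    simpa only [mixedDeriv_zero, timeDeriv_zero] using this
  refine ⟨(hI.abs.const_mul L).mono' ((continuous_of_hasSum S.hasSum).comp
    (S.nice_zero ht).continuous).aestronglyMeasurable (ae_of_all _ fun x => hL t ht x), ?_⟩
  calc _ ≤ ∫ x, L * |u t x| := integral_mono_of_nonneg (ae_of_all _ fun x => abs_nonneg _)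
        (hI.abs.const_mul L) (ae_of_all _ fun x => hL t ht x)
    _ = L * ∫ x, |u t x| := integral_const_mul _ _
    _ ≤ _ := by gcongr

/-- The bound for `h = m` is not assumed. It is read off from the equation, since `f(u)` is
dominated by a multiple of `|u|`. -/
theorem Setting.exists_timeDeriv_bound (S : Setting m T a f c u) {h : ℕ} (hh : h ≤ m) :
    ∃ K, ∀ t ∈ Icc 0 T, Integrable (timeDeriv T u h t) ∧ ∫ x, |timeDeriv T u h t x| ≤ K := by
  rcases lt_or_eq_of_le hh with hh | rfl
  · obtain ⟨K, hK⟩ := S.bounds h hh 0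
    refine ⟨K, fun t ht => ?_⟩
    have h1 := hK t ht
    have e : mixedDeriv T u h 0 t = timeDeriv T u h t := funext fun x => mixedDeriv_zero T u h t x
    rwa [e] at h1
  · obtain ⟨Kf, hKf⟩ := S.exists_comp_bound
    obtain ⟨A, hA0, hA⟩ := exists_forall_abs_coeff_le S.continuousOn
    have hmix : ∀ k, ∃ B, k ∈ Finset.Icc 1 h → ∀ t ∈ Icc 0 T,
        Integrable (mixedDeriv T u (h - k) k t) ∧ ∫ x, |mixedDeriv T u (h - k) k t x| ≤ B :=
        fun k => by
      by_cases hk : k ∈ Finset.Icc 1 h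
      · obtain ⟨B, hB⟩ := S.bounds (h - k) (by have := Finset.mem_Icc.1 hk; omega) k
        exact ⟨B, fun _ => hB⟩
      · exact ⟨0, fun h => absurd h hk⟩
    choose B hB using hmix
    refine ⟨Kf + ∑ k ∈ Finset.Icc 1 h, A * B k, fun t ht => ?_⟩
    have e : timeDeriv T u h t = fun x =>
        f (u t x) - ∑ k ∈ Finset.Icc 1 h, a k t * mixedDeriv T u (h - k) k t x :=
      funext fun x => S.solution.timeDeriv_eq ht x
    have hI : ∀ k ∈ Finset.Icc 1 h, Integrable fun x => a k t * mixedDeriv T u (h - k) k t x :=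
      fun k hk => ((hB k hk t ht).1).const_mul _
    rw [e]
    refine ⟨(hKf t ht).1.sub (integrable_finsetSum _ hI), ?_⟩
    calc _ ≤ ∫ x, (|f (u t x)| + ∑ k ∈ Finset.Icc 1 h, |a k t * mixedDeriv T u (h - k) k t x|) := by
          refine integral_mono_of_nonneg (ae_of_all _ fun x => abs_nonneg _)
            ((hKf t ht).1.abs.add (integrable_finsetSum _ fun k hk => (hI k hk).abs))
            (ae_of_all _ fun x => ?_)
          exact (abs_sub _ _).trans (add_le_add le_rfl (Finset.abs_sum_le_sum_abs _ _))
      _ = (∫ x, |f (u t x)|)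
          + ∑ k ∈ Finset.Icc 1 h, ∫ x, |a k t * mixedDeriv T u (h - k) k t x| := by
          rw [integral_add (hKf t ht).1.abs (integrable_finsetSum _ fun k hk => (hI k hk).abs),
            integral_finsetSum _ fun k hk => (hI k hk).abs]
      _ ≤ _ := by
          refine add_le_add (hKf t ht).2 (Finset.sum_le_sum fun k hk => ?_)
          simp_rw [abs_mul]
          rw [integral_const_mul]
          exact mul_le_mul (hA t ht k hk) (hB k hk t ht).2
            (integral_nonneg fun _ => abs_nonneg _) hA0

theorem Setting.continuousOn_timeDeriv (S : Setting m T a f c u) {h : ℕ} (hh : h ≤ m) :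
    ContinuousOn (fun p : ℝ × ℝ => timeDeriv T u h p.1 p.2) (Icc 0 T ×ˢ univ) := by
  rcases lt_or_eq_of_le hh with hh | rfl
  · simpa only [mixedDeriv_zero] using S.solution.continuous_mixed h hh 0
  · have h1 : ContinuousOn (fun p : ℝ × ℝ => f (u p.1 p.2)
        - ∑ k ∈ Finset.Icc 1 h, a k p.1 * mixedDeriv T u (h - k) k p.1 p.2) (Icc 0 T ×ˢ univ) := by
      refine ((continuous_of_hasSum S.hasSum).comp_continuousOn S.continuousOn_u).sub
        (continuousOn_finsetSum _ fun k hk => ?_)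
      refine ((S.continuousOn k hk).comp continuousOn_fst fun p hp => hp.1).mul ?_
      exact S.solution.continuous_mixed (h - k) (by have := Finset.mem_Icc.1 hk; omega) k
    exact h1.congr fun p hp => S.solution.timeDeriv_eq hp.1 p.2

/-- The fundamental theorem of calculus in time, combined with Fubini in space. The Lipschitz bound
in `L¹` gives continuity in time of the transforms, uniformly in frequency. -/
theorem Setting.time_increment (S : Setting m T a f c u) {h : ℕ} (hh : h < m) :
    (∃ K, 0 ≤ K ∧ ∀ s ∈ Icc 0 T, ∀ t ∈ Icc 0 T,
      ∫ x, |timeDeriv T u h t x - timeDeriv T u h s x| ≤ K * |t - s|) ∧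
    ∀ s ∈ Icc 0 T, ∀ t ∈ Icc 0 T, ∀ ξ,
      ft (timeDeriv T u h t) ξ - ft (timeDeriv T u h s) ξ
        = ∫ r in s..t, ft (timeDeriv T u (h + 1) r) ξ := by
  obtain ⟨K, hK⟩ := S.exists_timeDeriv_bound (show h + 1 ≤ m from hh)
  have hT := S.pos
  set G : ℝ → ℝ → ℝ := fun r => timeDeriv T u (h + 1) (projIcc 0 T hT.le r) with hG
  have hGc : Continuous fun p : ℝ × ℝ => G p.1 p.2 :=
    (S.continuousOn_timeDeriv (show h + 1 ≤ m from hh)).comp_continuous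
      (f := fun p : ℝ × ℝ => ((projIcc 0 T hT.le p.1 : ℝ), p.2)) (by fun_prop)
      fun p => ⟨(projIcc 0 T hT.le p.1).2, mem_univ _⟩
  have hGi : ∀ r, Integrable (G r) := fun r => (hK _ (projIcc 0 T hT.le r).2).1
  have hGK : ∀ r, ∫ x, |G r x| ≤ K := fun r => (hK _ (projIcc 0 T hT.le r).2).2
  have hK0 : 0 ≤ K := (integral_nonneg fun _ => abs_nonneg _).trans (hGK 0)
  have hGeq : ∀ r ∈ Icc 0 T, G r = timeDeriv T u (h + 1) r := fun r hr => by
    simp only [hG, projIcc_of_mem hT.le hr]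
  have hsub : ∀ s ∈ Icc 0 T, ∀ t ∈ Icc 0 T, uIcc s t ⊆ Icc 0 T := fun s hs t ht =>
    ordConnected_Icc.uIcc_subset hs ht
  have hInt : ∀ s ∈ Icc 0 T, ∀ t ∈ Icc 0 T, ∀ x,
      timeDeriv T u h t x - timeDeriv T u h s x = ∫ r in s..t, G r x := by
    intro s hs t ht x
    rw [← S.solution.integral_timeDeriv hT hh hs ht x]
    exact intervalIntegral.integral_congr fun r hr => by
      rw [hGeq r (hsub s hs t ht hr)]
  refine ⟨⟨K, hK0, fun s hs t ht => ?_⟩, fun s hs t ht ξ => ?_⟩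
  · simp_rw [hInt s hs t ht]
    exact integral_abs_intervalIntegral_le hGc hGi hGK s t
  · rw [← ft_sub (S.nice hh ht).integrable_self (S.nice hh hs).integrable_self]
    simp_rw [hInt s hs t ht]
    rw [ft_intervalIntegral hGc hGi hGK]
    exact intervalIntegral.integral_congr fun r hr => by
      rw [hGeq r (hsub s hs t ht hr)]

theorem Setting.continuousOn_ft (S : Setting m T a f c u) {h : ℕ} (hh : h < m) :
    ContinuousOn (fun p : ℝ × ℝ => ft (timeDeriv T u h p.1) p.2) (Icc 0 T ×ˢ univ) := by
  obtain ⟨⟨K, hK0, hK⟩, -⟩ := S.time_increment hh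
  refine continuousOn_prod_of_continuousOn_lipschitzOnWith _ K.toNNReal (fun t ht =>
    (continuous_ft (S.nice hh ht).integrable_self).continuousOn) fun ξ _ => ?_
  refine LipschitzOnWith.of_dist_le_mul fun t ht s hs => ?_
  rw [dist_eq_norm, Real.dist_eq, Real.coe_toNNReal _ hK0,
    ← ft_sub (S.nice hh ht).integrable_self (S.nice hh hs).integrable_self]
  exact (norm_ft_le _ _).trans (hK s hs t ht)

theorem Setting.continuousOn_ft_comp (S : Setting m T a f c u) :
    ContinuousOn (fun p : ℝ × ℝ => ft (fun x => f (u p.1 x)) p.2) (Icc 0 T ×ˢ univ) := by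
  obtain ⟨⟨K, hK0, hK⟩, -⟩ := S.time_increment S.one_le
  obtain ⟨L, hL0, -, hL⟩ := S.solution.exists_abs_comp_sub_le S.bounds S.one_le S.hasSum
  obtain ⟨_, hKf⟩ := S.exists_comp_bound
  refine continuousOn_prod_of_continuousOn_lipschitzOnWith _ (L * K).toNNReal (fun t ht =>
    (continuous_ft (hKf t ht).1).continuousOn) fun ξ _ => ?_
  refine LipschitzOnWith.of_dist_le_mul fun t ht s hs => ?_
  rw [dist_eq_norm, Real.dist_eq, Real.coe_toNNReal _ (by positivity),
    ← ft_sub (hKf t ht).1 (hKf s hs).1]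
  refine (norm_ft_le _ _).trans ?_
  have hI : Integrable fun x => |u t x - u s x| :=
    ((S.nice_zero ht).integrable_self.sub (S.nice_zero hs).integrable_self).abs
  calc _ ≤ ∫ x, L * |u t x - u s x| := integral_mono_of_nonneg
        (ae_of_all _ fun x => abs_nonneg _) (hI.const_mul L) (ae_of_all _ fun x => hL t ht s hs x)
    _ = L * ∫ x, |u t x - u s x| := integral_const_mul _ _
    _ ≤ L * (K * |t - s|) := by
        gcongr
        simpa only [timeDeriv_zero] using hK s hs t ht
    _ = _ := by ring

theorem Setting.ft_timeDeriv_eq (S : Setting m T a f c u) {t : ℝ} (ht : t ∈ Icc 0 T) (ξ : ℝ) :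
    ft (timeDeriv T u m t) ξ + ∑ k ∈ Finset.Icc 1 m, (a k t : ℂ)
      * (Complex.I * ((2 * Real.pi * ξ : ℝ) : ℂ)) ^ k * ft (timeDeriv T u (m - k) t) ξ
      = ft (fun x => f (u t x)) ξ := by
  have hk' : ∀ k ∈ Finset.Icc 1 m, m - k < m := fun k hk => by
    have := Finset.mem_Icc.1 hk
    have := S.one_le
    omega
  obtain ⟨_, hKm⟩ := S.exists_timeDeriv_bound le_rfl
  have e : (fun x => f (u t x)) = fun x => timeDeriv T u m t x
      + ∑ k ∈ Finset.Icc 1 m, a k t * mixedDeriv T u (m - k) k t x :=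
    funext fun x => (S.solution.equation t ht x).symm
  have hI : ∀ k ∈ Finset.Icc 1 m, Integrable fun x => a k t * mixedDeriv T u (m - k) k t x :=
    fun k hk => ((S.nice (hk' k hk) ht).integrable k).const_mul _
  rw [e, ft_add (hKm t ht).1 (integrable_finsetSum _ hI), ft_sum _ hI]
  congr 1
  refine Finset.sum_congr rfl fun k hk => ?_
  rw [ft_const_mul, mul_assoc, ← ft_iteratedDeriv (S.nice (hk' k hk) ht)]
  rfl

theorem Setting.continuousOn_ft_le (S : Setting m T a f c u) {h : ℕ} (hh : h ≤ m) :
    ContinuousOn (fun p : ℝ × ℝ => ft (timeDeriv T u h p.1) p.2) (Icc 0 T ×ˢ univ) := by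
  rcases lt_or_eq_of_le hh with hh | rfl
  · exact S.continuousOn_ft hh
  · have h1 : ContinuousOn (fun p : ℝ × ℝ => ft (fun x => f (u p.1 x)) p.2
        - ∑ k ∈ Finset.Icc 1 h, (a k p.1 : ℂ) * (Complex.I * ((2 * Real.pi * p.2 : ℝ) : ℂ)) ^ k
          * ft (timeDeriv T u (h - k) p.1) p.2) (Icc 0 T ×ˢ univ) := by
      refine S.continuousOn_ft_comp.sub (continuousOn_finsetSum _ fun k hk => ?_)
      refine ((Complex.continuous_ofReal.comp_continuousOn ((S.continuousOn k hk).comp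
        continuousOn_fst fun p hp => hp.1)).mul (Continuous.continuousOn (by fun_prop))).mul ?_
      exact S.continuousOn_ft (by have := Finset.mem_Icc.1 hk; omega)
    refine h1.congr fun p hp => ?_
    beta_reduce
    rw [← S.ft_timeDeriv_eq hp.1 p.2]; ring

theorem Setting.hasDerivWithinAt_ft (S : Setting m T a f c u) {h : ℕ} (hh : h < m) {t : ℝ}
    (ht : t ∈ Icc 0 T) (ξ : ℝ) :
    HasDerivWithinAt (fun s => ft (timeDeriv T u h s) ξ) (ft (timeDeriv T u (h + 1) t) ξ)
      (Icc 0 T) t := by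
  have hT := S.pos
  have hc : ContinuousOn (fun r => ft (timeDeriv T u (h + 1) r) ξ) (Icc 0 T) :=
    (S.continuousOn_ft_le hh).comp (f := fun t : ℝ => (t, ξ))
      (Continuous.continuousOn (by fun_prop)) fun t ht => ⟨ht, mem_univ _⟩
  obtain ⟨q, hqc, hqeq⟩ : ∃ q : ℝ → ℂ, Continuous q ∧
      ∀ r ∈ Icc 0 T, q r = ft (timeDeriv T u (h + 1) r) ξ := by
    refine ⟨fun r => ft (timeDeriv T u (h + 1) (projIcc 0 T hT.le r)) ξ,
      hc.comp_continuous (f := fun r => (projIcc 0 T hT.le r : ℝ)) (by fun_prop)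
        fun r => (projIcc 0 T hT.le r).2, fun r hr => ?_⟩
    simp only [projIcc_of_mem hT.le hr]
  have h1 : HasDerivAt (fun s => ft (timeDeriv T u h t) ξ + ∫ r in t..s, q r) (q t) t :=
    ((hqc.integral_hasStrictDerivAt t t).hasDerivAt).const_add _
  rw [hqeq t ht] at h1
  have hEq : ∀ s ∈ Icc 0 T, ft (timeDeriv T u h s) ξ = ft (timeDeriv T u h t) ξ + ∫ r in t..s, q r := by
    intro s hs
    have h2 : ∫ r in t..s, q r = ∫ r in t..s, ft (timeDeriv T u (h + 1) r) ξ :=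
      intervalIntegral.integral_congr fun r hr =>
        hqeq r (ordConnected_Icc.uIcc_subset ht hs hr)
    rw [h2, ← (S.time_increment hh).2 t ht s hs ξ]
    ring
  exact h1.hasDerivWithinAt.congr hEq (hEq t ht)

theorem Setting.modeSolution (S : Setting m T a f c u) (ξ : ℝ) :
    ModeSolution m T a (2 * Real.pi * ξ) (fun h t => ft (timeDeriv T u h t) ξ)
      fun t => ft (fun x => f (u t x)) ξ where
  deriv h hh t ht := S.hasDerivWithinAt_ft hh ht ξ
  equation t ht := S.ft_timeDeriv_eq ht ξ
  continuousOn := S.continuousOn_ft_comp.comp (f := fun t : ℝ => (t, ξ))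
    (Continuous.continuousOn (by fun_prop)) fun t ht => ⟨ht, mem_univ _⟩

theorem Setting.exists_decay (S : Setting m T a f c u) {h : ℕ} (hh : h < m) (j : ℕ) :
    ∃ K, 0 ≤ K ∧ ∀ t ∈ Icc 0 T, ∀ ξ, (1 + |ξ|) ^ j * ‖ft (timeDeriv T u h t) ξ‖ ≤ K := by
  obtain ⟨K₀, hK₀⟩ := S.bounds h hh 0
  obtain ⟨K, hK⟩ := S.bounds h hh j
  have h0 : (0 : ℝ) ∈ Icc 0 T := ⟨le_rfl, S.pos.le⟩
  have hp : ∀ j K, (∀ t ∈ Icc 0 T, Integrable (mixedDeriv T u h j t) ∧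
      (∫ x : ℝ, |mixedDeriv T u h j t x|) ≤ K) → 0 ≤ K := fun j K hK =>
    (integral_nonneg fun _ => abs_nonneg _).trans (hK 0 h0).2
  have := hp _ _ hK₀
  have := hp _ _ hK
  refine ⟨2 ^ j * (K₀ + K), by positivity, fun t ht ξ => ?_⟩
  refine (pow_mul_norm_ft_le (S.nice hh ht) j ξ).trans ?_
  gcongr
  · simpa only [mixedDeriv_zero] using (hK₀ t ht).2
  · exact (hK t ht).2

/-- The weight `(1 + |ξ|)^j` is submultiplicative, so the algebra estimate for weighted suprema
applies; two extra powers of decay make the weighted integral of the transform of `u` finite. -/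
theorem Setting.exists_decay_comp (S : Setting m T a f c u) (j : ℕ) :
    ∃ K, ∀ t ∈ Icc 0 T, ∀ ξ, (1 + |ξ|) ^ j * ‖ft (fun x => f (u t x)) ξ‖ ≤ K := by
  obtain ⟨K₁, hK₁0, hK₁⟩ := S.exists_decay S.one_le j
  obtain ⟨K₂, hK₂0, hK₂⟩ := S.exists_decay S.one_le (j + 2)
  simp only [timeDeriv_zero_eq] at hK₁ hK₂
  set W : ℝ → ℝ≥0∞ := fun ξ => ENNReal.ofReal ((1 + |ξ|) ^ j) with hW
  have hWm : Measurable W := by fun_prop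
  have hsub : ∀ ξ η, W (ξ + η) ≤ W ξ * W η := by
    intro ξ η
    simp only [hW]
    rw [← ENNReal.ofReal_mul (by positivity), ← mul_pow]
    gcongr
    nlinarith [abs_add_le ξ η, abs_nonneg ξ, abs_nonneg η, mul_nonneg (abs_nonneg ξ) (abs_nonneg η)]
  have hWe : ∀ (g : ℝ → ℝ) ξ, W ξ * ‖ft g ξ‖ₑ = ENNReal.ofReal ((1 + |ξ|) ^ j * ‖ft g ξ‖) := by
    intro g ξ
    rw [ENNReal.ofReal_mul (by positivity), ofReal_norm]
  set I₀ := ∫⁻ ξ : ℝ, ENNReal.ofReal (K₂ * (1 + ξ ^ 2)⁻¹) with hI₀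
  have hI₀fin : I₀ < ⊤ := (hasFiniteIntegral_iff_ofReal (ae_of_all _ fun ξ => by positivity)).1
    (integrable_inv_one_add_sq.const_mul K₂).2
  have hfin : derivMajorant c I₀ * ENNReal.ofReal K₁ < ⊤ :=
    ENNReal.mul_lt_top (derivMajorant_lt_top S.hasSum hI₀fin) ENNReal.ofReal_lt_top
  refine ⟨(derivMajorant c I₀ * ENNReal.ofReal K₁).toReal, fun t ht ξ => ?_⟩
  refine (ENNReal.ofReal_le_iff_le_toReal hfin.ne).1 ?_
  rw [← hWe]
  have hn := S.nice_zero ht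
  refine (mul_enorm_ft_comp_le S.hasSum S.coeff_zero hn.continuous hn.integrable_self
    hn.integrable_ft hWm hsub (S := ENNReal.ofReal K₁) (fun ξ => ?_) ξ).trans ?_
  · rw [hWe]; exact ENNReal.ofReal_le_ofReal (hK₁ t ht ξ)
  · gcongr
    refine derivMajorant_mono c (lintegral_mono fun ξ => ?_)
    rw [hWe]
    refine ENNReal.ofReal_le_ofReal ?_
    rw [← div_eq_mul_inv, le_div_iff₀ (by positivity)]
    refine le_trans ?_ (hK₂ t ht ξ)
    rw [pow_add, mul_right_comm]
    gcongr
    nlinarith [abs_nonneg ξ, sq_abs ξ]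

end Solution

/-! ### From local mode estimates to decay on the whole interval -/

section Chaining

variable {m : ℕ} {T : ℝ} {a : ℕ → ℝ → ℝ} {f : ℝ → ℝ} {u : ℝ → ℝ → ℝ} {c : ℕ → ℝ}

theorem exists_one_add_pow_le_exp {ρ : ℝ} (hρ : 0 < ρ) (p : ℕ) :
    ∃ C, 0 ≤ C ∧ ∀ ξ : ℝ, (1 + |ξ|) ^ p ≤ C * Real.exp (ρ * |ξ|) := by
  refine ⟨p ! / ρ ^ p * Real.exp ρ, by positivity, fun ξ => ?_⟩
  have h1 := Real.pow_div_factorial_le_exp (ρ * (1 + |ξ|)) (by positivity) p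
  have h2 : Real.exp (ρ * (1 + |ξ|)) = Real.exp ρ * Real.exp (ρ * |ξ|) := by
    rw [← Real.exp_add]; ring_nf
  rw [h2] at h1
  have h3 : (1 + |ξ|) ^ p = p ! / ρ ^ p * ((ρ * (1 + |ξ|)) ^ p / p !) := by
    rw [mul_pow]; field_simp
  rw [h3, mul_assoc]
  gcongr

/-- The Fourier transforms of the first `m` time derivatives at time `t` are bounded by `B` in the
space of integrable functions with weight `exp (ρ |ξ|)`. -/
def ExpDecayAt (m : ℕ) (T : ℝ) (u : ℝ → ℝ → ℝ) (ρ : ℝ) (B : ℝ≥0∞) (t : ℝ) : Prop :=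
  ∀ h < m, ∫⁻ ξ, ENNReal.ofReal (Real.exp (ρ * |ξ|) * ‖ft (timeDeriv T u h t) ξ‖) ≤ B

theorem ExpDecayAt.mono {ρ ρ' : ℝ} {B B' : ℝ≥0∞} {t : ℝ} (h : ExpDecayAt m T u ρ B t) (hρ : ρ' ≤ ρ)
    (hB : B ≤ B') : ExpDecayAt m T u ρ' B' t := fun k hk =>
  (lintegral_mono fun ξ => ENNReal.ofReal_le_ofReal (by gcongr)).trans ((h k hk).trans hB)

/-- The nonlinear scheme is run on the case `h = 0`, which loses no power of `|ξ|` in front of the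
Duhamel integral. The resulting bound on the right side then controls every `h < m`. Halving the
exponent absorbs the polynomial factor in the data at the start and the factor `(1 + |ξ|)^h` at the
end; `Ω ≥ 1` lets the weight be dropped. -/
theorem Setting.exists_expDecayAt_of_weight (S : Setting m T a f c u) {α β D C : ℝ} {N P : ℕ}
    (hα : 0 ≤ α) (hαβ : α ≤ β) (hβ : β ≤ T) (hD : 0 < D) (hC : 0 ≤ C) {Ω : ℝ → ℝ → ℝ}
    (hΩc : ContinuousOn (fun p : ℝ × ℝ => Ω p.1 p.2) (Icc α β ×ˢ univ))
    (hΩ1 : ∀ t ∈ Icc α β, ∀ ξ, 1 ≤ Ω t ξ)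
    (hΩle : ∀ t ∈ Icc α β, ∀ ξ, Ω t ξ ≤ C * (1 + |ξ|) ^ N)
    (hΩsub : ∀ t ∈ Icc α β, ∀ ξ η, Ω t (ξ + η) ≤ Ω t ξ * Ω t η)
    (hmode : ∀ t ∈ Icc α β, ∀ ξ, ∀ h < m, Ω t ξ * ‖ft (timeDeriv T u h t) ξ‖
      ≤ D * (1 + |ξ|) ^ h * (C * (1 + |ξ|) ^ P
          * ∑ l ∈ Finset.range m, ‖ft (timeDeriv T u l α) ξ‖
        + ∫ s in α..t, Ω s ξ * ‖ft (fun x => f (u s x)) ξ‖))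
    {ρ : ℝ} (hρ : 0 < ρ) {B : ℝ≥0∞} (hB : B < ⊤) (hdec : ExpDecayAt m T u ρ B α) :
    ∃ ρ' > 0, ∃ B' < (⊤ : ℝ≥0∞), ∀ t ∈ Icc α β, ExpDecayAt m T u ρ' B' t := by
  have hsub : Icc α β ⊆ Icc 0 T := Icc_subset_Icc hα hβ
  have hαm : α ∈ Icc 0 T := hsub ⟨le_rfl, hαβ⟩
  have hΩ0 : ∀ t ∈ Icc α β, ∀ ξ, 0 ≤ Ω t ξ := fun t ht ξ => zero_le_one.trans (hΩ1 t ht ξ)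
  set ζ : ℝ → ℝ := fun ξ => C * (1 + |ξ|) ^ P
    * ∑ l ∈ Finset.range m, ‖ft (timeDeriv T u l α) ξ‖ with hζ
  have hftc : ∀ l ∈ Finset.range m, Continuous (ft (timeDeriv T u l α)) := fun l hl =>
    continuous_ft (S.nice (Finset.mem_range.1 hl) hαm).integrable_self
  have hζc : Continuous ζ := by
    have := continuous_finsetSum _ fun l hl => (hftc l hl).norm
    fun_prop
  have hζ0 : ∀ ξ, 0 ≤ ζ ξ := fun ξ => by positivity
  have hζfin : ∫⁻ ξ, ENNReal.ofReal (Real.exp (ρ / 2 * |ξ|) * ζ ξ) < ⊤ := by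
    obtain ⟨C', hC'0, hC'⟩ := exists_one_add_pow_le_exp (half_pos hρ) P
    calc _ ≤ ∫⁻ ξ, ∑ l ∈ Finset.range m, ENNReal.ofReal (C * C')
          * ENNReal.ofReal (Real.exp (ρ * |ξ|) * ‖ft (timeDeriv T u l α) ξ‖) := by
          refine lintegral_mono fun ξ => ?_
          rw [← Finset.mul_sum, ← ENNReal.ofReal_sum_of_nonneg fun l _ => by positivity,
            ← ENNReal.ofReal_mul (by positivity), ← Finset.mul_sum]
          refine ENNReal.ofReal_le_ofReal ?_
          calc _ ≤ Real.exp (ρ / 2 * |ξ|) * (C * (C' * Real.exp (ρ / 2 * |ξ|))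
                * ∑ l ∈ Finset.range m, ‖ft (timeDeriv T u l α) ξ‖) := by
                simp only [hζ]
                gcongr
                exact hC' ξ
            _ = C * C' * ((Real.exp (ρ / 2 * |ξ|) * Real.exp (ρ / 2 * |ξ|))
                * ∑ l ∈ Finset.range m, ‖ft (timeDeriv T u l α) ξ‖) := by ring
            _ = _ := by rw [← Real.exp_add]; ring_nf
      _ = ∑ l ∈ Finset.range m, ENNReal.ofReal (C * C')
          * ∫⁻ ξ, ENNReal.ofReal (Real.exp (ρ * |ξ|) * ‖ft (timeDeriv T u l α) ξ‖) := by
          rw [lintegral_finsetSum' _ fun l hl => by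
            have := (hftc l hl).measurable
            exact Measurable.aemeasurable (by fun_prop)]
          exact Finset.sum_congr rfl fun l hl => lintegral_const_mul' _ _ ENNReal.ofReal_ne_top
      _ < ⊤ := ENNReal.sum_lt_top.2 fun l hl => ENNReal.mul_lt_top ENNReal.ofReal_lt_top
          ((hdec l (Finset.mem_range.1 hl)).trans_lt hB)
  obtain ⟨ρ₁, hρ₁, B₁, hB₁, hbd⟩ := exists_exp_bound_of_duhamel hαβ hD hC (half_pos hρ)
    (Ω := Ω) (v := fun t => ft (u t)) (F := fun t => ft (fun x => f (u t x))) (ζ := ζ)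
    (Ψ := derivMajorant c) hΩc hΩ0 hΩle hΩsub
    (S.continuousOn_ft_comp.mono (prod_mono hsub Subset.rfl))
    (fun j => let ⟨K, hK⟩ := S.exists_decay_comp j; ⟨K, fun t ht => hK t (hsub ht)⟩)
    (fun t ht => continuous_ft (S.nice_zero (hsub ht)).integrable_self) hζc hζ0 hζfin
    (fun t ht ξ => by
      have := hmode t ht ξ 0 S.one_le
      rwa [pow_zero, mul_one, timeDeriv_zero_eq] at this)
    (derivMajorant_mono c) (fun I hI => derivMajorant_lt_top S.hasSum hI)
    (fun t ht W hW hWs => by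
      have hn := S.nice_zero (hsub ht)
      exact lintegral_enorm_ft_comp_le S.hasSum S.coeff_zero hn.continuous hn.integrable_self
        hn.integrable_ft hW hWs)
  obtain ⟨C₁, hC₁0, hC₁⟩ := exists_one_add_pow_le_exp (half_pos hρ₁) m
  refine ⟨ρ₁ / 2, half_pos hρ₁, ENNReal.ofReal (D * C₁) * B₁,
    ENNReal.mul_lt_top ENNReal.ofReal_lt_top hB₁, fun t ht h hh => ?_⟩
  refine le_trans ?_ (mul_le_mul_right (hbd t ht) _)
  rw [← lintegral_const_mul' _ _ ENNReal.ofReal_ne_top]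
  refine lintegral_mono fun ξ => ?_
  rw [← ENNReal.ofReal_mul (by positivity)]
  refine ENNReal.ofReal_le_ofReal ?_
  have h1 := hmode t ht ξ h hh
  have hZ0 : 0 ≤ ζ ξ + ∫ s in α..t, Ω s ξ * ‖ft (fun x => f (u s x)) ξ‖ :=
    add_nonneg (hζ0 ξ) (intervalIntegral.integral_nonneg ht.1 fun s hs =>
      mul_nonneg (hΩ0 s ⟨hs.1, hs.2.trans ht.2⟩ ξ) (norm_nonneg _))
  set Z := ζ ξ + ∫ s in α..t, Ω s ξ * ‖ft (fun x => f (u s x)) ξ‖ with hZ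
  have h2 : ‖ft (timeDeriv T u h t) ξ‖ ≤ D * (1 + |ξ|) ^ h * Z :=
    (le_mul_of_one_le_left (norm_nonneg _) (hΩ1 t ht ξ)).trans h1
  have h3 : (1 + |ξ|) ^ h ≤ C₁ * Real.exp (ρ₁ / 2 * |ξ|) :=
    (pow_le_pow_right₀ (by linarith [abs_nonneg ξ]) hh.le).trans (hC₁ ξ)
  calc _ ≤ Real.exp (ρ₁ / 2 * |ξ|) * (D * (C₁ * Real.exp (ρ₁ / 2 * |ξ|)) * Z) := by
        gcongr
        exact h2.trans (by gcongr)
    _ = D * C₁ * ((Real.exp (ρ₁ / 2 * |ξ|) * Real.exp (ρ₁ / 2 * |ξ|)) * Z) := by ring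
    _ = _ := by rw [← Real.exp_add]; ring_nf

/-- With `y = 1 + |ξ|` and `τ = t - α` this is submultiplicativity of the left weight `4 y / (1 + τ
y)`; the constant `4` leaves room for it. -/
theorem two_mul_le_mul_of_one_le {τ Y y₁ y₂ : ℝ} (hτ0 : 0 ≤ τ) (hτ1 : τ ≤ 1) (h₁ : 1 ≤ y₁)
    (h₂ : 1 ≤ y₂) (hY0 : 0 ≤ Y) (hY : Y ≤ y₁ + y₂) :
    4 * Y / (1 + τ * Y) ≤ 4 * y₁ / (1 + τ * y₁) * (4 * y₂ / (1 + τ * y₂)) := by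
  have hy : y₁ + y₂ ≤ 2 * (y₁ * y₂) := by nlinarith
  have hp : 0 ≤ y₁ * y₂ := by positivity
  rw [div_mul_div_comm, div_le_div_iff₀ (by positivity) (by positivity)]
  have e1 : τ * Y * (y₁ + y₂) ≤ τ * Y * (2 * (y₁ * y₂)) := by gcongr
  have e2 : τ * (τ * Y * (y₁ * y₂)) ≤ 1 * (τ * Y * (y₁ * y₂)) := by gcongr
  have e3 : 0 ≤ τ * Y * (y₁ * y₂) := by positivity
  nlinarith

variable {lam : Fin m → ℝ → ℝ} {M : ℝ}

theorem exists_forall_abs_root_le (hm : 1 ≤ m) (hlam : AreCharRoots m T a lam) {A : ℝ}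
    (hA : ∀ t ∈ Icc 0 T, ∀ k ∈ Finset.Icc 1 m, |a k t| ≤ A) :
    ∀ t ∈ Icc 0 T, ∀ i, |lam i t| ≤ 1 + m * A := by
  intro t ht i
  refine abs_root_le hm (hA t ht) ?_
  rw [show charPoly m a t = ∏ i, (Polynomial.X - Polynomial.C (lam i t)) from hlam t ht,
    Polynomial.eval_prod]
  exact Finset.prod_eq_zero (Finset.mem_univ i) (by simp)

theorem abs_two_pi_mul_le (ξ : ℝ) : |2 * Real.pi * ξ| ≤ 2 * Real.pi * (1 + |ξ|) := by
  rw [abs_mul, abs_of_pos Real.two_pi_pos]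
  gcongr
  linarith

/-- The length of the interval is determined by the coefficients alone, before `ρ` and `B` are
given; otherwise the steps of the continuation might shrink. -/
theorem Setting.exists_expDecayAt_right (S : Setting m T a f c u)
    (ha : ∀ k ∈ Finset.Icc 1 m, AnalyticOn ℝ (a k) (Icc 0 T)) (hlam : AreCharRoots m T a lam)
    (hM : ∀ t ∈ Icc 0 T, ∀ i j : Fin m, i ≠ j →
      lam i t ^ 2 + lam j t ^ 2 ≤ M * (lam i t - lam j t) ^ 2) {α : ℝ} (hα : 0 ≤ α) (hαT : α < T) :
    ∃ β, α < β ∧ β ≤ T ∧ ∀ ρ > 0, ∀ B < (⊤ : ℝ≥0∞), ExpDecayAt m T u ρ B α →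
      ∃ ρ' > 0, ∃ B' < (⊤ : ℝ≥0∞), ∀ t ∈ Icc α β, ExpDecayAt m T u ρ' B' t := by
  obtain ⟨A, hA0, hA⟩ := exists_forall_abs_coeff_le S.continuousOn
  obtain ⟨K, δ, hK, hδ, hreg⟩ := exists_rootsRegularAt ha hlam hM ⟨hα, hαT.le⟩
  obtain ⟨β, hαβ, hβ⟩ : ∃ β, α < β ∧ β < min (min (α + δ) (α + 1)) T :=
    exists_between (lt_min (lt_min (by linarith) (by linarith)) hαT)
  have hβδ : β < α + δ := hβ.trans_le ((min_le_left _ _).trans (min_le_left _ _))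
  have hβ1 : β < α + 1 := hβ.trans_le ((min_le_left _ _).trans (min_le_right _ _))
  have hβT : β < T := hβ.trans_le (min_le_right _ _)
  refine ⟨β, hαβ, hβT.le, fun ρ hρ B hB hdec => ?_⟩
  obtain ⟨N, D, hD, hest⟩ := mode_estimate_left S.one_le hlam hA0 hA (by positivity)
    (exists_forall_abs_root_le S.one_le hlam hA) hK hα hβT hβ1.le (fun t ht => by
      have h1 := hreg t ⟨hα.trans_lt ht.1, ht.2.trans_lt hβT⟩ ht.1.ne' (by
        rw [abs_of_pos (sub_pos.2 ht.1)]; linarith [ht.2])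
      rwa [abs_of_pos (sub_pos.2 ht.1)] at h1)
  have hpos : ∀ t ∈ Icc α β, ∀ ξ : ℝ, 0 < 1 + (t - α) * (1 + |ξ|) := fun t ht ξ => by
    have := sub_nonneg.2 ht.1
    positivity
  -- The mode estimate carries the factor `(1 + (t - α) y)^(-N)`, which is neither bounded below by
  -- `1` nor submultiplicative. Multiplying the estimate by `(4 y)^N`, constant in time, repairs
  -- both, and the extra power falls only on the data.
  set Ω : ℝ → ℝ → ℝ := fun t ξ => (4 * (1 + |ξ|) / (1 + (t - α) * (1 + |ξ|))) ^ N with hΩ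
  have hΩe : ∀ t ξ, Ω t ξ = (4 * (1 + |ξ|)) ^ N * ((1 + (t - α) * (1 + |ξ|)) ^ N)⁻¹ := fun t ξ => by
    simp only [hΩ]; rw [div_pow, div_eq_mul_inv]
  refine S.exists_expDecayAt_of_weight hα hαβ.le hβT.le (D := D + 1) (C := 4 ^ N) (N := N)
    (P := N + (m + N)) (by linarith) (by positivity) (Ω := Ω) ?_ ?_ ?_ ?_ ?_ hρ hB hdec
  · refine ContinuousOn.pow (ContinuousOn.div (by fun_prop) (by fun_prop) ?_) N
    exact fun p hp => (hpos p.1 hp.1 p.2).ne'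
  · intro t ht ξ
    refine one_le_pow₀ ((one_le_div (hpos t ht ξ)).2 ?_)
    have : (t - α) * (1 + |ξ|) ≤ 1 * (1 + |ξ|) := by
      gcongr; linarith [ht.2]
    nlinarith [abs_nonneg ξ]
  · intro t ht ξ
    simp only [hΩ]
    rw [← mul_pow]
    have h0 := sub_nonneg.2 ht.1
    gcongr
    exact div_le_self (by positivity) (by
      have : 0 ≤ (t - α) * (1 + |ξ|) := by positivity
      linarith)
  · intro t ht ξ η
    simp only [hΩ]
    rw [← mul_pow]
    have h0 := sub_nonneg.2 ht.1
    gcongr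
    refine two_mul_le_mul_of_one_le h0 (by linarith [ht.2]) (by linarith [abs_nonneg ξ])
      (by linarith [abs_nonneg η]) (by positivity) ?_
    linarith [abs_add_le ξ η]
  · intro t ht ξ h hh
    have h1 := hest (1 + |ξ|) (2 * Real.pi * ξ) _ _ (by linarith [abs_nonneg ξ])
      (abs_two_pi_mul_le ξ) (S.modeSolution ξ) t ht h hh
    have h2 := mul_le_mul_of_nonneg_left h1 (show 0 ≤ (4 * (1 + |ξ|)) ^ N by positivity)
    have hI : ∫ s in α..t, Ω s ξ * ‖ft (fun x => f (u s x)) ξ‖ = (4 * (1 + |ξ|)) ^ N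
        * ∫ s in α..t, ((1 + (s - α) * (1 + |ξ|)) ^ N)⁻¹ * ‖ft (fun x => f (u s x)) ξ‖ := by
      rw [← intervalIntegral.integral_const_mul]
      congr 1 with s
      rw [hΩe, mul_assoc]
    have hI0 : 0 ≤ ∫ s in α..t, ((1 + (s - α) * (1 + |ξ|)) ^ N)⁻¹
        * ‖ft (fun x => f (u s x)) ξ‖ := by
      refine intervalIntegral.integral_nonneg ht.1 fun s hs => ?_
      have := (hpos s ⟨hs.1, hs.2.trans ht.2⟩ ξ).le
      positivity
    rw [hI, hΩe, mul_assoc]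
    refine h2.trans ?_
    calc _ = D * (1 + |ξ|) ^ h * (4 ^ N * (1 + |ξ|) ^ (N + (m + N))
            * ∑ l ∈ Finset.range m, ‖ft (timeDeriv T u l α) ξ‖ + (4 * (1 + |ξ|)) ^ N
            * ∫ s in α..t, ((1 + (s - α) * (1 + |ξ|)) ^ N)⁻¹ * ‖ft (fun x => f (u s x)) ξ‖) := by
          rw [mul_pow]; ring
      _ ≤ _ := by
          gcongr
          linarith

/-- This reaches a time `β` from earlier times: any start close enough to `β` works, with closeness
independent of `ρ` and `B`. In the continuation argument it shows that the supremum is attained. -/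
theorem Setting.exists_expDecayAt_left (S : Setting m T a f c u)
    (ha : ∀ k ∈ Finset.Icc 1 m, AnalyticOn ℝ (a k) (Icc 0 T)) (hlam : AreCharRoots m T a lam)
    (hM : ∀ t ∈ Icc 0 T, ∀ i j : Fin m, i ≠ j →
      lam i t ^ 2 + lam j t ^ 2 ≤ M * (lam i t - lam j t) ^ 2) {β : ℝ} (hβ : 0 < β) (hβT : β ≤ T) :
    ∃ α₀, α₀ < β ∧ ∀ α, 0 < α → α₀ < α → α ≤ β → ∀ ρ > 0, ∀ B < (⊤ : ℝ≥0∞), ExpDecayAt m T u ρ B α →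
      ∃ ρ' > 0, ∃ B' < (⊤ : ℝ≥0∞), ∀ t ∈ Icc α β, ExpDecayAt m T u ρ' B' t := by
  obtain ⟨A, hA0, hA⟩ := exists_forall_abs_coeff_le S.continuousOn
  obtain ⟨K, δ, hK, hδ, hreg⟩ := exists_rootsRegularAt ha hlam hM ⟨hβ.le, hβT⟩
  refine ⟨β - min δ 1, by have := lt_min hδ one_pos; linarith,
    fun α hα hα₀ hαβ ρ hρ B hB hdec => ?_⟩
  have hαδ : β - α < δ := by have := min_le_left δ 1; linarith
  have hα1 : β ≤ α + 1 := by have := min_le_right δ 1; linarith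
  obtain ⟨N, D, hD, hest⟩ := mode_estimate_right S.one_le hlam hA0 hA (by positivity)
    (exists_forall_abs_root_le S.one_le hlam hA) hK hα hβT hα1 (fun t ht => by
      have e : |t - β| = β - t := by rw [abs_sub_comm, abs_of_pos (sub_pos.2 ht.2)]
      have h1 := hreg t ⟨hα.trans_le ht.1, ht.2.trans_le hβT⟩ ht.2.ne (by
        rw [e]; linarith [ht.1])
      rwa [e] at h1)
  set Ω : ℝ → ℝ → ℝ := fun t ξ => (1 + (β - t) * (1 + |ξ|)) ^ N with hΩ
  refine S.exists_expDecayAt_of_weight hα.le hαβ hβT (D := D + 1) (C := 2 ^ N) (N := N)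
    (P := m + N) (by linarith) (by positivity) (Ω := Ω) ?_ ?_ ?_ ?_ ?_ hρ hB hdec
  · exact Continuous.continuousOn (by fun_prop)
  · intro t ht ξ
    have := sub_nonneg.2 ht.2
    refine one_le_pow₀ ?_
    have : 0 ≤ (β - t) * (1 + |ξ|) := by positivity
    linarith
  · intro t ht ξ
    have h0 := sub_nonneg.2 ht.2
    simp only [hΩ]
    rw [← mul_pow]
    gcongr
    have : (β - t) * (1 + |ξ|) ≤ 1 * (1 + |ξ|) := by
      gcongr; linarith [ht.1]
    linarith [abs_nonneg ξ]
  · intro t ht ξ η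
    have h0 := sub_nonneg.2 ht.2
    simp only [hΩ]
    rw [← mul_pow]
    refine pow_le_pow_left₀ (by positivity) ?_ N
    have h1 : (β - t) * (1 + |ξ + η|) ≤ (β - t) * ((1 + |ξ|) + (1 + |η|)) := by
      refine mul_le_mul_of_nonneg_left ?_ h0
      linarith [abs_add_le ξ η]
    have h2 : 0 ≤ (β - t) * (1 + |ξ|) * ((β - t) * (1 + |η|)) := by positivity
    nlinarith
  · intro t ht ξ h hh
    have h1 := hest (1 + |ξ|) (2 * Real.pi * ξ) _ _ (by linarith [abs_nonneg ξ])
      (abs_two_pi_mul_le ξ) (S.modeSolution ξ) t ht h hh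
    refine h1.trans ?_
    have hI0 : 0 ≤ ∫ s in α..t, (1 + (β - s) * (1 + |ξ|)) ^ N
        * ‖ft (fun x => f (u s x)) ξ‖ := by
      refine intervalIntegral.integral_nonneg ht.1 fun s hs => ?_
      have := sub_nonneg.2 (hs.2.trans ht.2)
      positivity
    simp only [hΩ]
    have h2N : (1 : ℝ) ≤ 2 ^ N := one_le_pow₀ (by norm_num)
    gcongr
    · linarith
    · exact le_mul_of_one_le_left (by positivity) h2N

/-- Exponential decay of the Fourier transform propagates to the whole time interval. -/
theorem Setting.exists_expDecayAt (S : Setting m T a f c u)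
    (ha : ∀ k ∈ Finset.Icc 1 m, AnalyticOn ℝ (a k) (Icc 0 T)) (hlam : AreCharRoots m T a lam)
    (hM : ∀ t ∈ Icc 0 T, ∀ i j : Fin m, i ≠ j →
      lam i t ^ 2 + lam j t ^ 2 ≤ M * (lam i t - lam j t) ^ 2)
    (hdata : ∀ h < m, InAL2 (timeDeriv T u h 0)) :
    ∃ ρ > 0, ∃ B < (⊤ : ℝ≥0∞), ∀ t ∈ Icc 0 T, ExpDecayAt m T u ρ B t := by
  set P : ℝ → Prop := fun t => ∃ ρ > 0, ∃ B < (⊤ : ℝ≥0∞), ∀ s ∈ Icc 0 t, ExpDecayAt m T u ρ B s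
    with hP
  have hT := S.pos
  have hstep : ∀ α β, 0 ≤ α → P α → (∀ ρ > 0, ∀ B < (⊤ : ℝ≥0∞), ExpDecayAt m T u ρ B α →
      ∃ ρ' > 0, ∃ B' < (⊤ : ℝ≥0∞), ∀ t ∈ Icc α β, ExpDecayAt m T u ρ' B' t) → P β := by
    rintro α β hα ⟨ρ, hρ, B, hB, hdec⟩ hex
    obtain ⟨ρ', hρ', B', hB', hdec'⟩ := hex ρ hρ B hB (hdec α ⟨hα, le_rfl⟩)
    refine ⟨min ρ ρ', lt_min hρ hρ', max B B', max_lt hB hB', fun s hs => ?_⟩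
    rcases le_total s α with h | h
    · exact (hdec s ⟨hs.1, h⟩).mono (min_le_left _ _) (le_max_left _ _)
    · exact (hdec' s ⟨h, hs.2⟩).mono (min_le_right _ _) (le_max_right _ _)
  have hP0 : P 0 := by
    have h1 : ∀ h, ∃ ρ > 0, ∃ B < (⊤ : ℝ≥0∞), h < m →
        ∫⁻ ξ, ENNReal.ofReal (Real.exp (ρ * |ξ|) * ‖ft (timeDeriv T u h 0) ξ‖) ≤ B := fun h => by
      by_cases hh : h < m
      · obtain ⟨ρ, hρ, hfin⟩ := (hdata h hh).exists_exp_decay (S.nice hh ⟨le_rfl, hT.le⟩)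
        exact ⟨ρ, hρ, _, hfin, fun _ => le_rfl⟩
      · exact ⟨1, one_pos, 0, ENNReal.zero_lt_top, fun h => absurd h hh⟩
    choose ρ hρ B hB hle using h1
    have hne : (Finset.range m).Nonempty := Finset.nonempty_range_iff.2 (by have := S.one_le; omega)
    refine ⟨(Finset.range m).inf' hne ρ, (Finset.lt_inf'_iff hne).2 fun h _ => hρ h,
      ∑ h ∈ Finset.range m, B h, ENNReal.sum_lt_top.2 fun h _ => hB h, fun s hs h hh => ?_⟩
    obtain rfl : s = 0 := le_antisymm hs.2 hs.1
    calc _ ≤ ∫⁻ ξ, ENNReal.ofReal (Real.exp (ρ h * |ξ|) * ‖ft (timeDeriv T u h 0) ξ‖) := by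
          refine lintegral_mono fun ξ => ENNReal.ofReal_le_ofReal ?_
          gcongr
          exact Finset.inf'_le _ (Finset.mem_range.2 hh)
      _ ≤ B h := hle h hh
      _ ≤ _ := Finset.single_le_sum (f := B) (fun _ _ => zero_le) (Finset.mem_range.2 hh)
  -- Continuation by supremum: approaching from the left puts `sSup G` into `G`, and stepping to the
  -- right contradicts `sSup G < T`.
  set G := {t | t ∈ Icc 0 T ∧ P t} with hG
  have hGne : G.Nonempty := ⟨0, ⟨le_rfl, hT.le⟩, hP0⟩
  have hGbdd : BddAbove G := ⟨T, fun t ht => ht.1.2⟩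
  set σ := sSup G with hσ
  have hσ0 : 0 ≤ σ := le_csSup hGbdd ⟨⟨le_rfl, hT.le⟩, hP0⟩
  have hσT : σ ≤ T := csSup_le hGne fun t ht => ht.1.2
  have hPσ : P σ := by
    rcases hσ0.eq_or_lt with h0 | h0
    · rwa [← h0]
    · obtain ⟨α₀, hα₀, hex⟩ := S.exists_expDecayAt_left ha hlam hM h0 hσT
      obtain ⟨α, hα, hlt⟩ := exists_lt_of_lt_csSup hGne (max_lt hα₀ h0)
      have hασ : α ≤ σ := le_csSup hGbdd hα
      exact hstep α σ hα.1.1 hα.2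
        (hex α ((le_max_right _ _).trans_lt hlt) ((le_max_left _ _).trans_lt hlt) hασ)
  rcases hσT.eq_or_lt with h | h
  · rwa [h] at hPσ
  · obtain ⟨β, hσβ, hβT, hex⟩ := S.exists_expDecayAt_right ha hlam hM hσ0 h
    have hPβ := hstep σ β hσ0 hPσ hex
    exact absurd (le_csSup hGbdd ⟨⟨hσ0.trans hσβ.le, hβT⟩, hPβ⟩) (not_le.2 hσβ)

end Chaining

/-! ### Regularity in time with values in `A_{L²}` -/

section TimeRegularity

variable {m : ℕ} {T : ℝ} {a : ℕ → ℝ → ℝ} {f : ℝ → ℝ} {u : ℝ → ℝ → ℝ} {c : ℕ → ℝ}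

theorem lintegral_exp_intervalIntegral_le {V : ℝ → ℝ → ℂ} {s t ρ : ℝ}
    (hV : ContinuousOn (fun p : ℝ × ℝ => V p.1 p.2) (uIcc s t ×ˢ univ)) {B : ℝ≥0∞}
    (hB : ∀ r ∈ uIcc s t, ∫⁻ ξ, ENNReal.ofReal (Real.exp (ρ * |ξ|) * ‖V r ξ‖) ≤ B) :
    ∫⁻ ξ, ENNReal.ofReal (Real.exp (ρ * |ξ|) * ‖∫ r in s..t, V r ξ‖)
      ≤ B * ENNReal.ofReal |t - s| := by
  set pr : ℝ → ℝ := fun r => projIcc (min s t) (max s t) min_le_max r with hpr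
  have hprm : ∀ r, pr r ∈ uIcc s t := fun r => (projIcc (min s t) (max s t) min_le_max r).2
  have hprc : Continuous pr := by fun_prop
  have hVc : Continuous fun p : ℝ × ℝ => V (pr p.1) p.2 :=
    hV.comp_continuous (f := fun p : ℝ × ℝ => (pr p.1, p.2)) (by fun_prop)
      fun p => ⟨hprm p.1, mem_univ _⟩
  have hpreq : ∀ r ∈ uIoc s t, pr r = r := fun r hr => by
    simp only [hpr]
    rw [projIcc_of_mem min_le_max (uIoc_subset_uIcc hr)]
  calc _ ≤ ∫⁻ ξ, ∫⁻ r in uIoc s t, ENNReal.ofReal (Real.exp (ρ * |ξ|) * ‖V (pr r) ξ‖) := by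
        refine lintegral_mono fun ξ => ?_
        have hc : Continuous fun r => V (pr r) ξ := hVc.comp (Continuous.prodMk_left ξ)
        calc _ = ENNReal.ofReal (Real.exp (ρ * |ξ|)) * ‖∫ r in s..t, V r ξ‖ₑ := by
              rw [ENNReal.ofReal_mul (Real.exp_pos _).le, ofReal_norm]
          _ = ENNReal.ofReal (Real.exp (ρ * |ξ|)) * ‖∫ r in uIoc s t, V (pr r) ξ‖ₑ := by
              congr 1
              rw [← ofReal_norm, ← ofReal_norm, intervalIntegral.norm_intervalIntegral_eq]
              congr 2
              exact setIntegral_congr_fun measurableSet_uIoc fun r hr => by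
                rw [hpreq r hr]
          _ ≤ ENNReal.ofReal (Real.exp (ρ * |ξ|)) * ∫⁻ r in uIoc s t, ‖V (pr r) ξ‖ₑ := by
              gcongr; exact enorm_integral_le_lintegral_enorm _
          _ = _ := by
              rw [← lintegral_const_mul' _ _ ENNReal.ofReal_ne_top]
              refine lintegral_congr fun r => ?_
              rw [ENNReal.ofReal_mul (Real.exp_pos _).le, ofReal_norm]
    _ = ∫⁻ r in uIoc s t, ∫⁻ ξ, ENNReal.ofReal (Real.exp (ρ * |ξ|) * ‖V (pr r) ξ‖) := by
        rw [lintegral_lintegral_swap]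
        refine (Continuous.measurable ?_).ennreal_ofReal.aemeasurable
        exact (by fun_prop : Continuous fun p : ℝ × ℝ => Real.exp (ρ * |p.1|)).mul
          (hVc.comp continuous_swap).norm
    _ ≤ ∫⁻ r in uIoc s t, B := lintegral_mono fun r => hB _ (hprm r)
    _ = _ := by
        rw [setLIntegral_const, uIoc, Real.volume_Ioc, max_sub_min_eq_abs]

theorem lintegral_exp_mul_pow_le {p : ℝ → ℝ} (hp : ∀ ξ, 0 ≤ p ξ) {ρ C : ℝ} {k : ℕ}
    (hC : ∀ ξ : ℝ, (1 + |ξ|) ^ k ≤ C * Real.exp (ρ / 2 * |ξ|)) (hC0 : 0 ≤ C) :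
    ∫⁻ ξ, ENNReal.ofReal (Real.exp (ρ / 2 * |ξ|) * ((1 + |ξ|) ^ k * p ξ))
      ≤ ENNReal.ofReal C * ∫⁻ ξ, ENNReal.ofReal (Real.exp (ρ * |ξ|) * p ξ) := by
  rw [← lintegral_const_mul' _ _ ENNReal.ofReal_ne_top]
  refine lintegral_mono fun ξ => ?_
  rw [← ENNReal.ofReal_mul hC0]
  refine ENNReal.ofReal_le_ofReal ?_
  have := hp ξ
  calc _ ≤ Real.exp (ρ / 2 * |ξ|) * (C * Real.exp (ρ / 2 * |ξ|) * p ξ) := by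
        gcongr; exact hC ξ
    _ = C * ((Real.exp (ρ / 2 * |ξ|) * Real.exp (ρ / 2 * |ξ|)) * p ξ) := by ring
    _ = _ := by rw [← Real.exp_add]; ring_nf

/-- For `|ξ| ≥ 1` the estimate for the first moment suffices, the factor `|ξ|` on `u` being paid by
half of the exponent. For `|ξ| ≤ 1` the polynomial decay of the source is enough. -/
theorem Setting.exists_exp_bound_comp (S : Setting m T a f c u) {ρ : ℝ} (hρ : 0 < ρ) {B : ℝ≥0∞}
    (hB : B < ⊤) (hdec : ∀ t ∈ Icc 0 T, ExpDecayAt m T u ρ B t) :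
    ∃ B' < (⊤ : ℝ≥0∞), ∀ t ∈ Icc 0 T,
      ∫⁻ ξ, ENNReal.ofReal (Real.exp (ρ / 2 * |ξ|) * ‖ft (fun x => f (u t x)) ξ‖) ≤ B' := by
  obtain ⟨K, hK⟩ := S.exists_decay_comp 2
  obtain ⟨C, hC0, hC⟩ := exists_one_add_pow_le_exp (half_pos hρ) 1
  have hK0 : 0 ≤ K := le_trans (by positivity) (hK 0 ⟨le_rfl, S.pos.le⟩ 0)
  set L := ∫⁻ ξ : ℝ, ENNReal.ofReal (Real.exp (ρ / 2) * K * (1 + ξ ^ 2)⁻¹) with hL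
  have hLfin : L < ⊤ := (hasFiniteIntegral_iff_ofReal (ae_of_all _ fun ξ => by positivity)).1
    (integrable_inv_one_add_sq.const_mul (Real.exp (ρ / 2) * K)).2
  refine ⟨L + derivMajorant c B * (ENNReal.ofReal C * B), ENNReal.add_lt_top.2 ⟨hLfin,
    ENNReal.mul_lt_top (derivMajorant_lt_top S.hasSum hB)
      (ENNReal.mul_lt_top ENNReal.ofReal_lt_top hB)⟩, fun t ht => ?_⟩
  have hn := S.nice_zero ht
  set W : ℝ → ℝ≥0∞ := fun ξ => ENNReal.ofReal (Real.exp (ρ / 2 * |ξ|)) with hW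
  have hWm : Measurable W := by fun_prop
  have hsub : ∀ ξ η, W (ξ + η) ≤ W ξ * W η := by
    intro ξ η
    simp only [hW]
    rw [← ENNReal.ofReal_mul (Real.exp_pos _).le, ← Real.exp_add, ← mul_add]
    gcongr
    exact abs_add_le ξ η
  have h0 : ∫⁻ ξ, ENNReal.ofReal (Real.exp (ρ * |ξ|) * ‖ft (u t) ξ‖) ≤ B := by
    have := hdec t ht 0 S.one_le
    rwa [timeDeriv_zero_eq] at this
  have h1 : ∫⁻ ξ, W ξ * ‖ft (u t) ξ‖ₑ ≤ B := by
    refine le_trans (lintegral_mono fun ξ => ?_) h0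
    rw [ENNReal.ofReal_mul (Real.exp_pos _).le, ofReal_norm]
    refine mul_le_mul_left (ENNReal.ofReal_le_ofReal ?_) _
    gcongr; linarith
  have h2 : ∫⁻ ξ, ‖ξ‖ₑ * W ξ * ‖ft (u t) ξ‖ₑ ≤ ENNReal.ofReal C * B := by
    refine le_trans (lintegral_mono fun ξ => ?_)
      ((lintegral_exp_mul_pow_le (fun ξ => norm_nonneg (ft (u t) ξ)) hC hC0).trans
        (mul_le_mul_right h0 _))
    rw [ENNReal.ofReal_mul (Real.exp_pos _).le, ENNReal.ofReal_mul (by positivity), ofReal_norm,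
      mul_comm ‖ξ‖ₑ, mul_assoc, Real.enorm_eq_ofReal_abs, pow_one]
    gcongr
    linarith
  have h3 := lintegral_enorm_ft_comp_le S.hasSum S.coeff_zero hn.continuous hn.integrable_self
    hn.integrable_ft hWm hsub
  calc _ ≤ ∫⁻ ξ, (ENNReal.ofReal (Real.exp (ρ / 2) * K * (1 + ξ ^ 2)⁻¹)
        + ‖ξ‖ₑ * W ξ * ‖ft (fun x => f (u t x)) ξ‖ₑ) := by
        refine lintegral_mono fun ξ => ?_
        rcases le_total |ξ| 1 with hξ | hξ
        · refine le_trans (ENNReal.ofReal_le_ofReal ?_) le_self_add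
          rw [mul_assoc]
          have h4 : ‖ft (fun x => f (u t x)) ξ‖ ≤ K * (1 + ξ ^ 2)⁻¹ := by
            rw [← div_eq_mul_inv, le_div_iff₀ (by positivity), mul_comm]
            refine le_trans ?_ (hK t ht ξ)
            gcongr
            nlinarith [abs_nonneg ξ, sq_abs ξ]
          gcongr
          exact mul_le_of_le_one_right (half_pos hρ).le hξ
        · refine le_trans ?_ le_add_self
          rw [ENNReal.ofReal_mul (Real.exp_pos _).le, ofReal_norm, mul_assoc]
          refine le_mul_of_one_le_left zero_le ?_
          rw [Real.enorm_eq_ofReal_abs]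
          exact ENNReal.one_le_ofReal.2 hξ
    _ = L + ∫⁻ ξ, ‖ξ‖ₑ * W ξ * ‖ft (fun x => f (u t x)) ξ‖ₑ :=
        lintegral_add_left (by fun_prop) _
    _ ≤ _ := by
        gcongr
        exact h3.trans (mul_le_mul' (derivMajorant_mono c h1) h2)

/-- The transformed equation expresses the `m`-th time derivative by the source and lower
derivatives times powers of `ξ`, which half of the exponent absorbs. Continuity in time of the lower
derivatives requires this bound. -/
theorem Setting.exists_expDecayAt_succ (S : Setting m T a f c u) {ρ : ℝ} (hρ : 0 < ρ) {B : ℝ≥0∞}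
    (hB : B < ⊤) (hdec : ∀ t ∈ Icc 0 T, ExpDecayAt m T u ρ B t) :
    ∃ B' < (⊤ : ℝ≥0∞), ∀ t ∈ Icc 0 T, ExpDecayAt (m + 1) T u (ρ / 2) B' t := by
  obtain ⟨B₁, hB₁, hF⟩ := S.exists_exp_bound_comp hρ hB hdec
  obtain ⟨A, hA0, hA⟩ := exists_forall_abs_coeff_le S.continuousOn
  obtain ⟨C, hC0, hC⟩ := exists_one_add_pow_le_exp (half_pos hρ) m
  set D := A * (2 * Real.pi) ^ m with hD
  set B₂ := B₁ + ∑ k ∈ Finset.Icc 1 m, ENNReal.ofReal D * (ENNReal.ofReal C * B) with hB₂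
  have hB₂fin : B₂ < ⊤ := ENNReal.add_lt_top.2 ⟨hB₁, ENNReal.sum_lt_top.2 fun k _ =>
    ENNReal.mul_lt_top ENNReal.ofReal_lt_top (ENNReal.mul_lt_top ENNReal.ofReal_lt_top hB)⟩
  refine ⟨max B B₂, max_lt hB hB₂fin, fun t ht h hh => ?_⟩
  rcases (Nat.lt_succ_iff.1 hh).lt_or_eq with hlt | rfl
  · exact ((hdec t ht).mono (by linarith) le_rfl h hlt).trans (le_max_left _ _)
  refine le_trans ?_ (le_max_right _ _)
  have hk' : ∀ k ∈ Finset.Icc 1 h, h - k < h := fun k hk => by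
    have := Finset.mem_Icc.1 hk
    omega
  have hpt : ∀ ξ, ‖ft (timeDeriv T u h t) ξ‖ ≤ ‖ft (fun x => f (u t x)) ξ‖
      + ∑ k ∈ Finset.Icc 1 h, D * ((1 + |ξ|) ^ h * ‖ft (timeDeriv T u (h - k) t) ξ‖) := by
    intro ξ
    have e := S.ft_timeDeriv_eq ht ξ
    rw [← eq_sub_iff_add_eq] at e
    rw [e]
    refine (norm_sub_le _ _).trans (add_le_add le_rfl ((norm_sum_le _ _).trans
      (Finset.sum_le_sum fun k hk => ?_)))
    have hk1 := Finset.mem_Icc.1 hk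
    rw [norm_mul, norm_mul, norm_pow, norm_mul, Complex.norm_I, one_mul, Complex.norm_real,
      Complex.norm_real, Real.norm_eq_abs, Real.norm_eq_abs, ← mul_assoc]
    refine mul_le_mul_of_nonneg_right ?_ (norm_nonneg _)
    have h1 : (1 : ℝ) ≤ 2 * Real.pi := by linarith [Real.pi_gt_three]
    calc |a k t| * |2 * Real.pi * ξ| ^ k ≤ A * (2 * Real.pi * (1 + |ξ|)) ^ k := by
          gcongr
          · exact hA t ht k hk
          · exact abs_two_pi_mul_le ξ
      _ ≤ A * (2 * Real.pi * (1 + |ξ|)) ^ h := by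
          refine mul_le_mul_of_nonneg_left (pow_le_pow_right₀ ?_ hk1.2) hA0
          exact one_le_mul_of_one_le_of_one_le h1 (by linarith [abs_nonneg ξ])
      _ = _ := by rw [mul_pow, hD]; ring
  calc _ ≤ ∫⁻ ξ, (ENNReal.ofReal (Real.exp (ρ / 2 * |ξ|) * ‖ft (fun x => f (u t x)) ξ‖)
        + ∑ k ∈ Finset.Icc 1 h, ENNReal.ofReal D * ENNReal.ofReal (Real.exp (ρ / 2 * |ξ|)
          * ((1 + |ξ|) ^ h * ‖ft (timeDeriv T u (h - k) t) ξ‖))) := by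
        refine lintegral_mono fun ξ => ?_
        rw [← Finset.mul_sum, ← ENNReal.ofReal_sum_of_nonneg fun l _ => by positivity,
            ← ENNReal.ofReal_mul (by positivity), ← ENNReal.ofReal_add (by positivity)
            (by positivity), ← Finset.mul_sum]
        refine ENNReal.ofReal_le_ofReal ?_
        calc _ ≤ _ := mul_le_mul_of_nonneg_left (hpt ξ) (Real.exp_pos _).le
          _ = _ := by rw [mul_add, ← Finset.mul_sum]; ring
    _ = (∫⁻ ξ, ENNReal.ofReal (Real.exp (ρ / 2 * |ξ|) * ‖ft (fun x => f (u t x)) ξ‖))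
        + ∑ k ∈ Finset.Icc 1 h, ENNReal.ofReal D * ∫⁻ ξ, ENNReal.ofReal (Real.exp (ρ / 2 * |ξ|)
          * ((1 + |ξ|) ^ h * ‖ft (timeDeriv T u (h - k) t) ξ‖)) := by
        obtain ⟨_, hKf⟩ := S.exists_comp_bound
        have hm := (continuous_ft (hKf t ht).1).measurable
        rw [lintegral_add_left (by fun_prop), lintegral_finsetSum' _ fun k hk => by
          have := (continuous_ft (S.nice (hk' k hk) ht).integrable_self).measurable
          exact Measurable.aemeasurable (by fun_prop)]
        congr 1
        exact Finset.sum_congr rfl fun k hk => lintegral_const_mul' _ _ ENNReal.ofReal_ne_top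
    _ ≤ _ := by
        refine add_le_add (hF t ht) (Finset.sum_le_sum fun k hk => mul_le_mul_right ?_ _)
        exact (lintegral_exp_mul_pow_le (fun ξ => norm_nonneg _) hC hC0).trans
          (mul_le_mul_right (hdec t ht _ (hk' k hk)) _)

theorem tendsto_stepNorm_of_le {Λ : ℝ≥0} {g : ℝ → ℝ → ℝ} {t : ℝ} {s : Set ℝ} {B : ℝ≥0∞} (hB : B < ⊤)
    (hg : ∀ r ∈ s, stepNorm Λ (g r) ≤ (B * ENNReal.ofReal |r - t|) ^ (1 / 2 : ℝ)) :
    Tendsto (fun r => stepNorm Λ (g r)) (𝓝[s] t) (𝓝 0) := by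
  have h1 : Tendsto (fun r : ℝ => ENNReal.ofReal |r - t|) (𝓝 t) (𝓝 0) := by
    have h2 : Continuous fun r : ℝ => ENNReal.ofReal |r - t| :=
      ENNReal.continuous_ofReal.comp (by fun_prop)
    simpa using h2.tendsto t
  have h3 := (ENNReal.continuous_rpow_const (y := (1 / 2 : ℝ))).tendsto (B * 0) |>.comp
    (ENNReal.Tendsto.const_mul h1 (Or.inr hB.ne))
  rw [mul_zero, ENNReal.zero_rpow_of_pos (by norm_num)] at h3
  exact tendsto_of_tendsto_of_tendsto_of_le_of_le' tendsto_const_nhds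
    (h3.mono_left nhdsWithin_le_nhds) (Eventually.of_forall fun r => zero_le)
    (eventually_mem_nhdsWithin.mono hg)

theorem Setting.lintegral_exp_increment_le (S : Setting m T a f c u) {ρ : ℝ} {B : ℝ≥0∞}
    (hdec : ∀ t ∈ Icc 0 T, ExpDecayAt (m + 1) T u ρ B t) {h : ℕ} (hh : h < m)
    {s t : ℝ} (hs : s ∈ Icc 0 T) (ht : t ∈ Icc 0 T) :
    ∫⁻ ξ, ENNReal.ofReal (Real.exp (ρ * |ξ|)
      * ‖ft (timeDeriv T u h t) ξ - ft (timeDeriv T u h s) ξ‖) ≤ B * ENNReal.ofReal |t - s| := by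
  have hsub : uIcc s t ⊆ Icc 0 T := ordConnected_Icc.uIcc_subset hs ht
  simp_rw [(S.time_increment hh).2 s hs t ht]
  exact lintegral_exp_intervalIntegral_le (V := fun r => ft (timeDeriv T u (h + 1) r))
    ((S.continuousOn_ft_le hh).mono (prod_mono hsub Subset.rfl))
    fun r hr => hdec r (hsub hr) (h + 1) (by omega)

/-- The step norm is at most the square root of an `L¹` norm times an exponentially weighted
integral of the transform. For an increment or a difference-quotient error the first factor stays
bounded and the second is `O(|s - t|)`, so the norm is `O(|s - t|^(1/2))`. -/
theorem Setting.isCkAL2 (S : Setting m T a f c u) {ρ : ℝ} (hρ : 0 < ρ) {B : ℝ≥0∞}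
    (hB : B < ⊤) (hdec : ∀ t ∈ Icc 0 T, ExpDecayAt (m + 1) T u ρ B t) :
    IsCkAL2 (m - 1) T u := by
  have hm := S.one_le
  set Λ : ℝ≥0 := (4 * Real.pi / ρ).toNNReal with hΛ
  have hΛ' : 4 * Real.pi / ρ ≤ Λ := Real.le_coe_toNNReal _
  have hΛ0 : 0 < Λ := Real.toNNReal_pos.2 (by positivity)
  refine ⟨Λ, hΛ0, fun h hle t ht => ⟨?_, ?_, ?_⟩, fun h hlt t ht => ?_⟩
  · exact (S.nice (show h < m by omega) ht).contDiff
  · have hh : h < m := by omega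
    refine (stepNorm_le_of_exp_decay (S.nice hh ht) le_rfl hρ hΛ').trans_lt
      (ENNReal.rpow_lt_top_of_nonneg (by norm_num)
        (ENNReal.mul_lt_top ENNReal.ofReal_lt_top ?_).ne)
    exact (hdec t ht h (by omega)).trans_lt hB
  · have hh : h < m := by omega
    obtain ⟨⟨K, hK0, hK⟩, -⟩ := S.time_increment hh
    refine tendsto_stepNorm_of_le (B := ENNReal.ofReal (K * T) * B)
      (ENNReal.mul_lt_top ENNReal.ofReal_lt_top hB) fun s hs => ?_
    refine (stepNorm_le_of_exp_decay ((S.nice hh hs).sub (S.nice hh ht)) (K := K * T) ?_ hρ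
      hΛ').trans (ENNReal.rpow_le_rpow ?_ (by norm_num))
    · refine (hK t ht s hs).trans ?_
      gcongr
      exact abs_le.2 ⟨by linarith [hs.1, ht.2], by linarith [hs.2, ht.1]⟩
    · rw [mul_assoc]
      gcongr
      simp_rw [ft_sub (S.nice hh hs).integrable_self (S.nice hh ht).integrable_self]
      exact S.lintegral_exp_increment_le hdec hh ht hs
  · have hh : h < m := by omega
    have hh' : h + 1 < m := by omega
    obtain ⟨⟨K, hK0, hK⟩, hInt⟩ := S.time_increment hh
    obtain ⟨K', hK'⟩ := S.exists_timeDeriv_bound hh'.le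
    have hn1 := S.nice hh' ht
    refine tendsto_stepNorm_of_le (B := ENNReal.ofReal (K + K') * B)
      (ENNReal.mul_lt_top ENNReal.ofReal_lt_top hB) fun s hs => ?_
    have hst : 0 < |s - t| := abs_pos.2 (sub_ne_zero.2 hs.2)
    have hst0 : s - t ≠ 0 := sub_ne_zero.2 hs.2
    have hd := (S.nice hh hs.1).sub (S.nice hh ht)
    have hg := (hd.const_mul (s - t)⁻¹).sub hn1
    have e : (fun x => (timeDeriv T u h s x - timeDeriv T u h t x) / (s - t)
        - timeDeriv T u (h + 1) t x) = fun x => (s - t)⁻¹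
        * (timeDeriv T u h s x - timeDeriv T u h t x) - timeDeriv T u (h + 1) t x := by
      ext x; rw [div_eq_inv_mul]
    rw [e]
    refine (stepNorm_le_of_exp_decay hg (K := K + K') ?_ hρ
      hΛ').trans (ENNReal.rpow_le_rpow ?_ (by norm_num))
    · calc _ ≤ ∫ x, (|s - t|⁻¹ * |timeDeriv T u h s x - timeDeriv T u h t x|
            + |timeDeriv T u (h + 1) t x|) := by
            refine integral_mono_of_nonneg (ae_of_all _ fun x => abs_nonneg _)
              ((hd.integrable_self.abs.const_mul _).add hn1.integrable_self.abs)
              (ae_of_all _ fun x => ?_)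
            refine (abs_sub _ _).trans (le_of_eq ?_)
            rw [abs_mul, abs_inv]
        _ = |s - t|⁻¹ * (∫ x, |timeDeriv T u h s x - timeDeriv T u h t x|)
            + ∫ x, |timeDeriv T u (h + 1) t x| := by
            rw [integral_add (hd.integrable_self.abs.const_mul _) hn1.integrable_self.abs,
              integral_const_mul]
        _ ≤ |s - t|⁻¹ * (K * |s - t|) + K' := by
            gcongr
            · exact hK t ht s hs.1
            · exact (hK' t ht).2
        _ = K + K' := by field_simp
    · rw [mul_assoc]
      gcongr
      have hsub : uIcc t s ⊆ Icc 0 T := ordConnected_Icc.uIcc_subset ht hs.1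
      -- The error of the difference quotient is the mean over `[t, s]` of the increments of the
      -- next derivative, each again `O(|s - t|)`.
      have hft : ∀ ξ, ft (fun x => (s - t)⁻¹ * (timeDeriv T u h s x - timeDeriv T u h t x)
          - timeDeriv T u (h + 1) t x) ξ = ((s - t)⁻¹ : ℝ)
          * ∫ r in t..s, (ft (timeDeriv T u (h + 1) r) ξ - ft (timeDeriv T u (h + 1) t) ξ) := by
        intro ξ
        have hc : ContinuousOn (fun r => ft (timeDeriv T u (h + 1) r) ξ) (uIcc t s) :=
          ((S.continuousOn_ft_le hh).comp (f := fun t : ℝ => (t, ξ))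
            (Continuous.continuousOn (by fun_prop)) fun t ht => ⟨ht, mem_univ _⟩).mono hsub
        rw [ft_sub (hd.integrable_self.const_mul _) hn1.integrable_self, ft_const_mul,
          ft_sub (S.nice hh hs.1).integrable_self (S.nice hh ht).integrable_self,
          intervalIntegral.integral_sub hc.intervalIntegrable intervalIntegrable_const,
          ← hInt t ht s hs.1, intervalIntegral.integral_const, mul_sub _ (_ - _), Complex.real_smul,
          ← mul_assoc, ← Complex.ofReal_mul, inv_mul_cancel₀ hst0, Complex.ofReal_one, one_mul]
      have hbd : ∫⁻ ξ, ENNReal.ofReal (Real.exp (ρ * |ξ|) * ‖∫ r in t..s,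
          (ft (timeDeriv T u (h + 1) r) ξ - ft (timeDeriv T u (h + 1) t) ξ)‖)
          ≤ B * ENNReal.ofReal |s - t| * ENNReal.ofReal |s - t| := by
        refine lintegral_exp_intervalIntegral_le (V := fun r ξ =>
          ft (timeDeriv T u (h + 1) r) ξ - ft (timeDeriv T u (h + 1) t) ξ) ?_ fun r hr => ?_
        · refine ((S.continuousOn_ft hh').mono (prod_mono hsub Subset.rfl)).sub ?_
          exact ((continuous_ft hn1.integrable_self).comp continuous_snd).continuousOn
        · refine (S.lintegral_exp_increment_le hdec hh' ht (hsub hr)).trans ?_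
          exact mul_le_mul_right (ENNReal.ofReal_le_ofReal (abs_sub_left_of_mem_uIcc hr)) _
      calc _ = ∫⁻ ξ, ENNReal.ofReal |s - t|⁻¹ * ENNReal.ofReal (Real.exp (ρ * |ξ|) * ‖∫ r in t..s,
            (ft (timeDeriv T u (h + 1) r) ξ - ft (timeDeriv T u (h + 1) t) ξ)‖) := by
            refine lintegral_congr fun ξ => ?_
            rw [hft, norm_mul, Complex.norm_real, Real.norm_eq_abs, abs_inv,
              ← ENNReal.ofReal_mul (by positivity)]
            congr 1; ring
        _ ≤ ENNReal.ofReal |s - t|⁻¹ * (B * ENNReal.ofReal |s - t| * ENNReal.ofReal |s - t|) := by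
            rw [lintegral_const_mul' _ _ ENNReal.ofReal_ne_top]
            gcongr
        _ = ENNReal.ofReal (|s - t|⁻¹ * |s - t|) * (B * ENNReal.ofReal |s - t|) := by
            rw [ENNReal.ofReal_mul (by positivity)]; ring
        _ = _ := by rw [inv_mul_cancel₀ hst.ne', ENNReal.ofReal_one, one_mul]

end TimeRegularity

/-! ### Taylor series in one and two variables -/

section Taylor

theorem abs_sub_le_of_hasDerivAt_Ioo {f f' : ℝ → ℝ} {a b C : ℝ} (hf : ContinuousOn f (uIcc a b))
    (hf' : ∀ x ∈ Ioo (min a b) (max a b), HasDerivAt f (f' x) x)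
    (hC : ∀ x ∈ Ioo (min a b) (max a b), |f' x| ≤ C) : |f b - f a| ≤ C * |b - a| := by
  wlog hab : a ≤ b generalizing a b
  · have := this (a := b) (b := a) (by rwa [uIcc_comm]) (by rwa [min_comm, max_comm])
      (by rwa [min_comm, max_comm]) (le_of_not_ge hab)
    rwa [abs_sub_comm (f b), abs_sub_comm b]
  rw [min_eq_left hab, max_eq_right hab] at hf' hC
  rw [uIcc_of_le hab] at hf
  rcases hab.eq_or_lt with rfl | hlt
  · simp
  obtain ⟨x, hx, hxe⟩ := exists_hasDerivAt_eq_slope f f' hlt hf hf'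
  have h1 := hC x hx
  rw [hxe, abs_div, div_le_iff₀ (abs_pos.2 (sub_ne_zero.2 hlt.ne'))] at h1
  exact h1

/-- Taylor's formula with the base point as the variable: the polynomial with coefficients at `s`
equals `e 0 b` at `s = b`, and its `s`-derivative telescopes to one small term. Only interior
derivatives and continuity are used, so endpoints are allowed. -/
theorem hasSum_taylor {e : ℕ → ℝ → ℝ} {a b K ρ : ℝ} (hc : ∀ j, ContinuousOn (e j) (uIcc a b))
    (hd : ∀ j : ℕ, ∀ x ∈ Ioo (min a b) (max a b), HasDerivAt (e j) ((j + 1) * e (j + 1) x) x)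
    (hK : ∀ j, ∀ x ∈ uIcc a b, |e j x| ≤ K * ρ ^ j) (hρ0 : 0 ≤ ρ) (hρ : ρ * |b - a| < 1) :
    HasSum (fun j => e j a * (b - a) ^ j) (e 0 b) := by
  set q := ρ * |b - a| with hq
  have hq0 : 0 ≤ q := by positivity
  have hK0 : 0 ≤ K := by
    have := hK 0 a left_mem_uIcc
    rw [pow_zero, mul_one] at this
    exact (abs_nonneg _).trans this
  have hsum : Summable fun j => e j a * (b - a) ^ j := by
    refine Summable.of_norm_bounded ((summable_geometric_of_lt_one hq0 hρ).mul_left K) fun j => ?_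
    rw [norm_mul, norm_pow, Real.norm_eq_abs, Real.norm_eq_abs, hq, mul_pow, ← mul_assoc]
    gcongr
    exact hK j a left_mem_uIcc
  set p : ℕ → ℝ → ℝ := fun n s => ∑ j ∈ Finset.range (n + 1), e j s * (b - s) ^ j with hp
  have hpc : ∀ n, ContinuousOn (p n) (uIcc a b) := fun n =>
    continuousOn_finsetSum _ fun j _ => (hc j).mul (Continuous.continuousOn (by fun_prop))
  have hpd : ∀ n : ℕ, ∀ x ∈ Ioo (min a b) (max a b),
      HasDerivAt (p n) ((n + 1) * e (n + 1) x * (b - x) ^ n) x := by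
    intro n x hx
    induction n with
    | zero => simpa [hp] using hd 0 x hx
    | succ n ih =>
      have h1 : HasDerivAt (fun s => e (n + 1) s * (b - s) ^ (n + 1))
          (((n + 1 : ℕ) + 1) * e (n + 1 + 1) x * (b - x) ^ (n + 1)
            + e (n + 1) x * (((n + 1 : ℕ) : ℝ) * (b - x) ^ n * (-1))) x :=
        (hd (n + 1) x hx).mul (((hasDerivAt_id x).const_sub b).pow (n + 1))
      have e1 : p (n + 1) = fun s => p n s + e (n + 1) s * (b - s) ^ (n + 1) := by
        ext s; simp only [hp]; rw [Finset.sum_range_succ]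
      rw [e1]
      refine (ih.add h1).congr_deriv ?_
      push_cast; ring
  have hpb : ∀ n, p n b = e 0 b := fun n => by
    simp only [hp, sub_self]
    rw [Finset.sum_eq_single 0] <;> simp +contextual
  have hbd : ∀ n : ℕ, |e 0 b - p n a| ≤ K * ((n + 1 : ℕ) * q ^ (n + 1)) := by
    intro n
    have h1 := abs_sub_le_of_hasDerivAt_Ioo (hpc n) (hpd n)
      (C := (n + 1) * (K * ρ ^ (n + 1)) * |b - a| ^ n) fun x hx => ?_
    · rw [hpb] at h1
      refine h1.trans (le_of_eq ?_)
      rw [hq, mul_pow]; push_cast; ring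
    · have hx' : x ∈ uIcc a b := Ioo_subset_Icc_self hx
      rw [abs_mul, abs_mul, abs_pow, abs_of_nonneg (by positivity : (0 : ℝ) ≤ n + 1)]
      have h2 : |b - x| ≤ |b - a| := abs_sub_right_of_mem_uIcc hx'
      gcongr
      exact hK (n + 1) x hx'
  have hlim : Tendsto (fun n => p n a) atTop (𝓝 (e 0 b)) := by
    have h1 : Tendsto (fun n : ℕ => K * ((n : ℝ) * q ^ n)) atTop (𝓝 (K * 0)) :=
      (tendsto_self_mul_const_pow_of_lt_one hq0 hρ).const_mul K
    rw [mul_zero] at h1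
    have h2 := (tendsto_add_atTop_iff_nat 1).2 h1
    rw [tendsto_iff_norm_sub_tendsto_zero]
    refine squeeze_zero (fun n => norm_nonneg _) (fun n => ?_) h2
    rw [norm_sub_rev]
    exact hbd n
  have h3 := (tendsto_add_atTop_iff_nat 1).2 hsum.hasSum.tendsto_sum_nat
  rw [← tendsto_nhds_unique h3 hlim]
  exact hsum.hasSum

/-- The homogeneous part of degree `n` of a double power series. -/
noncomputable def doubleSeries (c : ℕ → ℕ → ℝ) : FormalMultilinearSeries ℝ (ℝ × ℝ) ℝ := fun n =>
  ∑ h ∈ Finset.range (n + 1), c h (n - h) •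
    (ContinuousMultilinearMap.mkPiAlgebra ℝ (Fin n) ℝ).compContinuousLinearMap fun i =>
      if (i : ℕ) < h then ContinuousLinearMap.fst ℝ ℝ ℝ else ContinuousLinearMap.snd ℝ ℝ ℝ

theorem doubleSeries_apply (c : ℕ → ℕ → ℝ) (n : ℕ) (y : ℝ × ℝ) :
    (doubleSeries c n fun _ => y)
      = ∑ h ∈ Finset.range (n + 1), c h (n - h) * (y.1 ^ h * y.2 ^ (n - h)) := by
  rw [doubleSeries, sum_apply]
  refine Finset.sum_congr rfl fun h hh => ?_
  have hh' : h ≤ n := by have := Finset.mem_range.1 hh; omega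
  simp only [smul_apply, smul_eq_mul,
    ContinuousMultilinearMap.compContinuousLinearMap_apply,
    ContinuousMultilinearMap.mkPiAlgebra_apply]
  congr 1
  have h1 : ∀ i : Fin n, (if (i : ℕ) < h then ContinuousLinearMap.fst ℝ ℝ ℝ
      else ContinuousLinearMap.snd ℝ ℝ ℝ) y = if (i : ℕ) < h then y.1 else y.2 := fun i => by
    split_ifs <;> rfl
  simp_rw [h1]
  rw [Fin.prod_univ_eq_prod_range (fun i => if i < h then y.1 else y.2) n,
    ← Finset.prod_range_mul_prod_Ico _ hh']
  congr 1
  · rw [Finset.prod_congr rfl fun i hi => if_pos (Finset.mem_range.1 hi)]; simp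
  · rw [Finset.prod_congr rfl fun i hi => if_neg (not_lt.2 (Finset.mem_Ico.1 hi).1)]; simp

theorem norm_doubleSeries_le {c : ℕ → ℕ → ℝ} {M ρ : ℝ} (hc : ∀ h j, |c h j| ≤ M * ρ ^ (h + j))
    (n : ℕ) : ‖doubleSeries c n‖ ≤ (n + 1) * (M * ρ ^ n) := by
  refine (norm_sum_le _ _).trans ?_
  have h1 : ∀ h ∈ Finset.range (n + 1), ‖c h (n - h) •
      (ContinuousMultilinearMap.mkPiAlgebra ℝ (Fin n) ℝ).compContinuousLinearMap fun i =>
      if (i : ℕ) < h then ContinuousLinearMap.fst ℝ ℝ ℝ else ContinuousLinearMap.snd ℝ ℝ ℝ‖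
      ≤ M * ρ ^ n := by
    intro h hh
    have hh' : h + (n - h) = n := by have := Finset.mem_range.1 hh; omega
    rw [norm_smul]
    have h2 := hc h (n - h)
    rw [hh'] at h2
    have h3 : ‖(ContinuousMultilinearMap.mkPiAlgebra ℝ (Fin n) ℝ).compContinuousLinearMap fun i =>
        if (i : ℕ) < h then ContinuousLinearMap.fst ℝ ℝ ℝ else ContinuousLinearMap.snd ℝ ℝ ℝ‖
        ≤ 1 := by
      refine (ContinuousMultilinearMap.norm_compContinuousLinearMap_le _ _).trans ?_
      have h4 : ‖ContinuousMultilinearMap.mkPiAlgebra ℝ (Fin n) ℝ‖ ≤ 1 :=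
        ContinuousMultilinearMap.opNorm_le_bound zero_le_one fun v => by simp [norm_prod]
      refine mul_le_one₀ h4 (Finset.prod_nonneg fun _ _ => norm_nonneg _)
        (Finset.prod_le_one (fun _ _ => norm_nonneg _) fun i _ => ?_)
      split_ifs
      · exact ContinuousLinearMap.norm_fst_le ℝ ℝ ℝ
      · exact ContinuousLinearMap.norm_snd_le ℝ ℝ ℝ
    calc _ ≤ |c h (n - h)| * 1 := mul_le_mul_of_nonneg_left h3 (abs_nonneg _)
      _ ≤ _ := by rwa [mul_one]
  refine (Finset.sum_le_sum h1).trans (le_of_eq ?_)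
  rw [Finset.sum_const, Finset.card_range, nsmul_eq_mul]
  push_cast; ring

/-- The homogeneous parts of the double series form the power series. The degree-`n` part has `n + 1
≤ 2^n` terms, which explains the radius `1/(2ρ)`. -/
theorem analyticWithinAt_of_hasSum {g : ℝ × ℝ → ℝ} {s : Set (ℝ × ℝ)} {p₀ : ℝ × ℝ} {c : ℕ → ℕ → ℝ}
    {M ρ δ : ℝ} (hp₀ : p₀ ∈ s) (hρ : 0 < ρ) (hδ : 0 < δ) (hc : ∀ h j, |c h j| ≤ M * ρ ^ (h + j))
    (hsum : ∀ y : ℝ × ℝ, p₀ + y ∈ s → |y.1| < δ → |y.2| < δ →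
      HasSum (fun q : ℕ × ℕ => c q.1 q.2 * (y.1 ^ q.1 * y.2 ^ q.2)) (g (p₀ + y))) :
    AnalyticWithinAt ℝ g s p₀ := by
  have hM0 : 0 ≤ M := by
    have := hc 0 0
    simp only [add_zero, pow_zero, mul_one] at this
    exact (abs_nonneg _).trans this
  set r : ℝ := min δ (1 / (2 * ρ)) with hr
  have hr0 : 0 < r := lt_min hδ (by positivity)
  have hrρ : ρ * r ≤ 1 / 2 := by
    calc ρ * r ≤ ρ * (1 / (2 * ρ)) := by gcongr; exact min_le_right _ _
      _ = 1 / 2 := by field_simp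
  refine ⟨doubleSeries c, ENNReal.ofReal r, ?_, ENNReal.ofReal_pos.2 hr0, fun {y} hy hyr => ?_⟩
  · rw [ENNReal.ofReal]
    refine (doubleSeries c).le_radius_of_bound M fun n => ?_
    rw [Real.coe_toNNReal _ hr0.le]
    calc ‖doubleSeries c n‖ * r ^ n ≤ (n + 1) * (M * ρ ^ n) * r ^ n := by
          gcongr; exact norm_doubleSeries_le hc n
      _ = M * ((n + 1) * (ρ * r) ^ n) := by rw [mul_pow]; ring
      _ ≤ M * (2 ^ n * (1 / 2) ^ n) := by
          gcongr
          have : n + 1 ≤ 2 ^ n := Nat.lt_two_pow_self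
          exact_mod_cast this
      _ = M := by rw [← mul_pow]; norm_num
  · rw [insert_eq_of_mem hp₀] at hy
    have hy2 : ‖y‖ < r := by
      rw [Metric.mem_eball, edist_zero_right, ← ofReal_norm,
        ENNReal.ofReal_lt_ofReal_iff hr0] at hyr
      exact hyr
    have hy1 : |y.1| < δ := (norm_fst_le y).trans_lt (hy2.trans_le (min_le_left _ _))
    have hy2 : |y.2| < δ := (norm_snd_le y).trans_lt (hy2.trans_le (min_le_left _ _))
    have h1 := hsum y hy hy1 hy2
    rw [← Finset.HasAntidiagonal.sigmaAntidiagonalEquivProd.hasSum_iff] at h1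
    have h2 := h1.sigma fun n => hasSum_fintype _
    refine h2.congr_fun fun n => ?_
    rw [doubleSeries_apply, ← Finset.Nat.sum_antidiagonal_eq_sum_range_succ
      (fun h k => c h k * (y.1 ^ h * y.2 ^ k)), ← Finset.sum_coe_sort]
    rfl

end Taylor

/-! ### Bounds for the derivatives of analytic functions of one variable -/

section AnalyticBounds

/-- Re-expansion at `y` is dominated by one absolutely convergent rearranged series evaluated at `s
+ s`. The resulting Cauchy estimates are therefore uniform in `y`. -/
theorem exists_norm_changeOrigin_le {p : FormalMultilinearSeries ℝ ℝ ℝ} {s : ℝ≥0} (hs : 0 < s)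
    (hp : (s + s : ℝ≥0∞) < p.radius) :
    ∃ D : ℝ, ∀ y : ℝ, ‖y‖ ≤ s → ∀ k, ‖p.changeOrigin y k‖ ≤ D * (s⁻¹ : ℝ) ^ k := by
  have hsum := p.changeOriginSeries_summable_aux₁ hp
  refine ⟨((∑' σ : Σ k l : ℕ, { s : Finset (Fin (k + l)) // s.card = l },
      ‖p (σ.1 + σ.2.1)‖₊ * s ^ σ.2.1 * s ^ σ.1 : ℝ≥0) : ℝ), fun y hy k => ?_⟩
  have hs1 : (s : ℝ≥0∞) < p.radius := (le_add_right le_rfl).trans_lt hp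
  have hy' : ‖y‖₊ ≤ s := hy
  have h1 := p.nnnorm_changeOrigin_le (x := y) k ((ENNReal.coe_le_coe.2 hy').trans_lt hs1)
  have h2 : ‖p.changeOrigin y k‖₊ * s ^ k
      ≤ ∑' σ : Σ k l : ℕ, { s : Finset (Fin (k + l)) // s.card = l },
        ‖p (σ.1 + σ.2.1)‖₊ * s ^ σ.2.1 * s ^ σ.1 := by
    calc ‖p.changeOrigin y k‖₊ * s ^ k
        ≤ (∑' σ : Σ l : ℕ, { s : Finset (Fin (k + l)) // s.card = l },
            ‖p (k + σ.1)‖₊ * s ^ σ.1) * s ^ k := by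
          gcongr
          refine h1.trans (Summable.tsum_le_tsum (fun σ => by gcongr) ?_
            (p.changeOriginSeries_summable_aux₂ hs1 k))
          refine NNReal.summable_of_le (fun σ => ?_) (p.changeOriginSeries_summable_aux₂ hs1 k)
          gcongr
      _ = ∑' σ : Σ l : ℕ, { s : Finset (Fin (k + l)) // s.card = l },
            ‖p (k + σ.1)‖₊ * s ^ σ.1 * s ^ k := NNReal.tsum_mul_right _ _ |>.symm
      _ ≤ _ := by
          rw [hsum.tsum_sigma' (NNReal.summable_sigma.1 hsum).1]
          exact (NNReal.summable_sigma.1 hsum).2.le_tsum k fun _ _ => zero_le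
  have h3 : ‖p.changeOrigin y k‖ * (s : ℝ) ^ k
      ≤ ((∑' σ : Σ k l : ℕ, { s : Finset (Fin (k + l)) // s.card = l },
        ‖p (σ.1 + σ.2.1)‖₊ * s ^ σ.2.1 * s ^ σ.1 : ℝ≥0) : ℝ) := by exact_mod_cast h2
  have hs' : (0 : ℝ) < s := hs
  rw [inv_pow, ← div_eq_mul_inv, le_div_iff₀ (by positivity)]
  exact h3

/-- Near each point a single power series, re-expanded at neighbouring points, gives uniform Cauchy
estimates; compactness of the interval makes them global. -/
theorem exists_abs_iteratedDerivWithin_le {g : ℝ → ℝ} {T : ℝ} (hT : 0 < T)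
    (hg : AnalyticOn ℝ g (Icc 0 T)) : ∃ A α : ℝ, 0 ≤ A ∧ 0 ≤ α ∧ ∀ t ∈ Icc 0 T, ∀ i : ℕ,
      |iteratedDerivWithin i g (Icc 0 T) t / i !| ≤ A * α ^ i := by
  refine isCompact_Icc.induction_on (s := Icc (0 : ℝ) T) (p := fun s => ∃ A α : ℝ, 0 ≤ A ∧ 0 ≤ α ∧
    ∀ t ∈ s, ∀ i : ℕ, |iteratedDerivWithin i g (Icc 0 T) t / i !| ≤ A * α ^ i)
    ⟨0, 0, le_rfl, le_rfl, by simp⟩ ?_ ?_ ?_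
  · rintro s s' hss ⟨A, α, hA, hα, h⟩
    exact ⟨A, α, hA, hα, fun t ht => h t (hss ht)⟩
  · rintro s s' ⟨A, α, hA, hα, h⟩ ⟨A', α', hA', hα', h'⟩
    refine ⟨max A A', max α α', le_max_of_le_left hA, le_max_of_le_left hα, fun t ht i => ?_⟩
    rcases ht with ht | ht
    · exact (h t ht i).trans (mul_le_mul (le_max_left _ _)
        (pow_le_pow_left₀ hα (le_max_left _ _) _) (by positivity) (le_max_of_le_left hA))
    · exact (h' t ht i).trans (mul_le_mul (le_max_right _ _)
        (pow_le_pow_left₀ hα' (le_max_right _ _) _) (by positivity) (le_max_of_le_left hA))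
  · intro t₀ ht₀
    obtain ⟨G, hGe, hG⟩ := analyticWithinAt_iff_exists_analyticAt.1 (hg t₀ ht₀)
    rw [insert_eq_of_mem ht₀] at hGe
    obtain ⟨p, r, hp⟩ := hG
    obtain ⟨s₀, hs₀, hs₀r⟩ := ENNReal.lt_iff_exists_nnreal_btwn.1 hp.r_pos
    have hs : 0 < s₀ / 2 := half_pos (ENNReal.coe_pos.1 hs₀)
    have hss : ((s₀ / 2 : ℝ≥0) + (s₀ / 2 : ℝ≥0) : ℝ≥0∞) < r := by
      rw [← ENNReal.coe_add, add_halves]; exact hs₀r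
    obtain ⟨D, hD⟩ := exists_norm_changeOrigin_le hs (hss.trans_le hp.r_le)
    have hD0 : 0 ≤ D := by
      have := hD 0 (by rw [norm_zero]; exact (s₀ / 2).2) 0
      rw [pow_zero, mul_one] at this
      exact (norm_nonneg _).trans this
    have hball : ∀ᶠ t in 𝓝[Icc 0 T] t₀, ‖t - t₀‖ < (s₀ / 2 : ℝ≥0) := by
      refine nhdsWithin_le_nhds ?_
      filter_upwards [Metric.ball_mem_nhds t₀ (NNReal.coe_pos.2 hs)] with t ht
      rwa [← dist_eq_norm]
    refine ⟨_, (eventually_eventually_nhdsWithin.2 hGe).and (hball.and self_mem_nhdsWithin), D,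
      _, hD0, inv_nonneg.2 (s₀ / 2).2, ?_⟩
    rintro t ⟨ht1, ht2, ht3⟩ i
    have hyr : (‖t - t₀‖₊ : ℝ≥0∞) < r := by
      refine lt_of_le_of_lt ?_ ((le_add_right le_rfl).trans_lt hss)
      exact ENNReal.coe_le_coe.2 ht2.le
    have hc := hp.changeOrigin hyr
    rw [add_sub_cancel] at hc
    have hcd : ContDiffAt ℝ i G t := hc.analyticAt.contDiffAt
    rw [Filter.EventuallyEq.iteratedDerivWithin_eq ht1 (ht1.self_of_nhdsWithin ht3),
      iteratedDerivWithin_eq_iteratedDeriv (uniqueDiffOn_Icc hT) hcd ht3,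
      iteratedDeriv_eq_iteratedFDeriv, ← hc.factorial_smul 1 i, nsmul_eq_mul,
      mul_div_cancel_left₀ _ (by positivity)]
    refine le_trans ?_ (hD (t - t₀) ht2.le i)
    rw [← Real.norm_eq_abs]
    refine (ContinuousMultilinearMap.le_opNorm _ _).trans ?_
    simp

end AnalyticBounds

/-! ### Convolution of double sequences -/

section Convolution

/-- The Cauchy product of two double sequences. -/
noncomputable def conv (D E : ℕ → ℕ → ℝ) (h j : ℕ) : ℝ :=
  ∑ q ∈ Finset.HasAntidiagonal.antidiagonal h, ∑ r ∈ Finset.HasAntidiagonal.antidiagonal j,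
    D q.1 r.1 * E q.2 r.2

/-- The Cauchy product of `ν + 1` copies of a double sequence. -/
noncomputable def convPow (D : ℕ → ℕ → ℝ) : ℕ → ℕ → ℕ → ℝ
  | 0 => D
  | ν + 1 => conv D (convPow D ν)

/-- The majorant `R^h S^j (h+j choose h) / (h+j+1)²` of normalized jets. -/
noncomputable def jetWeight (R S : ℝ) (h j : ℕ) : ℝ :=
  R ^ h * S ^ j * ((h + j).choose h / ((h + j : ℕ) + 1) ^ 2)

theorem jetWeight_nonneg {R S : ℝ} (hR : 0 ≤ R) (hS : 0 ≤ S) (h j : ℕ) : 0 ≤ jetWeight R S h j := by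
  unfold jetWeight; positivity

theorem sum_range_inv_sq_le (n : ℕ) :
    ∑ l ∈ Finset.range (n + 1), 1 / ((l : ℝ) + 1) ^ 2 ≤ 2 - 1 / ((n : ℝ) + 1) := by
  induction n with
  | zero => norm_num
  | succ n ih =>
    rw [Finset.sum_range_succ]
    have h1 : 1 / (((n + 1 : ℕ) : ℝ) + 1) ^ 2 ≤ 1 / ((n : ℝ) + 1) - 1 / ((n + 1 : ℕ) + 1) := by
      push_cast
      rw [div_sub_div _ _ (by positivity) (by positivity), div_le_div_iff₀ (by positivity)
        (by positivity)]
      nlinarith [(by positivity : (0 : ℝ) ≤ n)]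
    linarith

theorem one_div_sq_mul_sq_le {x y : ℝ} (hx : 0 < x) (hy : 0 < y) :
    1 / (x ^ 2 * y ^ 2) ≤ 2 / (x + y) ^ 2 * (1 / x ^ 2 + 1 / y ^ 2) := by
  have h1 : 2 / (x + y) ^ 2 * (1 / x ^ 2 + 1 / y ^ 2)
      = (2 * (x ^ 2 + y ^ 2) / (x + y) ^ 2) * (1 / (x ^ 2 * y ^ 2)) := by
    field_simp; ring
  rw [h1]
  refine le_mul_of_one_le_left (by positivity) ?_
  rw [one_le_div (by positivity)]
  nlinarith [sq_nonneg (x - y)]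

/-- The sequence `1/(n + 1)²` is stable under convolution up to a constant: one of the two indices
is at least half of the total. This is the reason for the quadratic denominator in the majorant. -/
theorem sum_range_inv_sq_mul_inv_sq_le (N : ℕ) :
    ∑ l ∈ Finset.range (N + 1), 1 / (((l : ℝ) + 1) ^ 2 * ((N - l : ℕ) + 1) ^ 2)
      ≤ 8 / ((N : ℝ) + 1) ^ 2 := by
  have h0 : ∑ l ∈ Finset.range (N + 1), 1 / ((l : ℝ) + 1) ^ 2 ≤ 2 :=
    (sum_range_inv_sq_le N).trans (by linarith [(by positivity : (0 : ℝ) ≤ 1 / (N + 1))])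
  have h0' : ∑ l ∈ Finset.range (N + 1), 1 / (((N - l : ℕ) : ℝ) + 1) ^ 2 ≤ 2 := by
    rw [Finset.sum_flip (fun l => 1 / ((l : ℝ) + 1) ^ 2)]; exact h0
  calc _ ≤ ∑ l ∈ Finset.range (N + 1), 2 / ((N : ℝ) + 1) ^ 2
        * (1 / ((l : ℝ) + 1) ^ 2 + 1 / (((N - l : ℕ) : ℝ) + 1) ^ 2) := by
        refine Finset.sum_le_sum fun l hl => ?_
        have hl' : l ≤ N := by have := Finset.mem_range.1 hl; omega
        refine (one_div_sq_mul_sq_le (x := (l : ℝ) + 1) (y := ((N - l : ℕ) : ℝ) + 1)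
          (by positivity) (by positivity)).trans ?_
        have h2 : (l : ℝ) + 1 + (((N - l : ℕ) : ℝ) + 1) = N + 2 := by
          rw [Nat.cast_sub hl']; ring
        rw [h2]
        refine mul_le_mul_of_nonneg_right ?_ (by positivity)
        gcongr
        norm_num
    _ ≤ 2 / ((N : ℝ) + 1) ^ 2 * (2 + 2) := by
        rw [← Finset.mul_sum, Finset.sum_add_distrib]
        gcongr
    _ = _ := by ring

/-- Group the terms by the total order `l` of the first factor. Vandermonde's identity sums the
binomials to at most `(h+j choose h)`, and the inverse squares convolve with constant `8`. -/
theorem conv_jetWeight_le {R S : ℝ} (hR : 0 ≤ R) (hS : 0 ≤ S) (h j : ℕ) :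
    conv (jetWeight R S) (jetWeight R S) h j ≤ 8 * jetWeight R S h j := by
  set N := h + j with hN
  set A := Finset.HasAntidiagonal.antidiagonal h ×ˢ Finset.HasAntidiagonal.antidiagonal j with hA
  have hmem : ∀ z ∈ A, z.1.1 + z.1.2 = h ∧ z.2.1 + z.2.2 = j := fun z hz => by
    rw [hA, Finset.mem_product, Finset.HasAntidiagonal.mem_antidiagonal,
      Finset.HasAntidiagonal.mem_antidiagonal] at hz
    exact hz
  have key : ∑ z ∈ A, ((z.1.1 + z.2.1).choose z.1.1 : ℝ) * (z.1.2 + z.2.2).choose z.1.2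
      * (1 / (((z.1.1 + z.2.1 : ℕ) + 1 : ℝ) ^ 2 * ((N - (z.1.1 + z.2.1) : ℕ) + 1) ^ 2))
      ≤ N.choose h * (8 / ((N : ℝ) + 1) ^ 2) := by
    rw [← Finset.sum_fiberwise_of_maps_to (s := A) (t := Finset.range (N + 1))
      (g := fun z => z.1.1 + z.2.1) fun z hz => by
        obtain ⟨h1, h2⟩ := hmem z hz; rw [Finset.mem_range]; omega]
    refine le_trans ?_ (mul_le_mul_of_nonneg_left (sum_range_inv_sq_mul_inv_sq_le N)
      (Nat.cast_nonneg _))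
    rw [Finset.mul_sum]
    refine Finset.sum_le_sum fun l hl => ?_
    have hl' : l ≤ N := by have := Finset.mem_range.1 hl; omega
    calc ∑ z ∈ A with z.1.1 + z.2.1 = l,
          ((z.1.1 + z.2.1).choose z.1.1 : ℝ) * (z.1.2 + z.2.2).choose z.1.2
          * (1 / (((z.1.1 + z.2.1 : ℕ) + 1 : ℝ) ^ 2 * ((N - (z.1.1 + z.2.1) : ℕ) + 1) ^ 2))
        = (∑ z ∈ A with z.1.1 + z.2.1 = l, (l.choose z.1.1 : ℝ) * (N - l).choose z.1.2)
          * (1 / (((l : ℕ) + 1 : ℝ) ^ 2 * ((N - l : ℕ) + 1) ^ 2)) := by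
          rw [Finset.sum_mul]
          refine Finset.sum_congr rfl fun z hz => ?_
          rw [Finset.mem_filter] at hz
          obtain ⟨h1, h2⟩ := hmem z hz.1
          have h3 : z.1.2 + z.2.2 = N - l := by omega
          rw [hz.2, h3]
      _ ≤ _ := by
          refine mul_le_mul_of_nonneg_right ?_ (by positivity)
          -- Once `l` is fixed, the splitting of `h` determines that of `j`, so the group is indexed
          -- by part of the Vandermonde sum.
          have hinj : Set.InjOn (fun z : (ℕ × ℕ) × ℕ × ℕ => z.1)
              (({z ∈ A | z.1.1 + z.2.1 = l} : Finset _) : Set ((ℕ × ℕ) × ℕ × ℕ)) := by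
            rintro ⟨z, w⟩ hz ⟨z', w'⟩ hz' (rfl : z = z')
            rw [Finset.mem_coe, Finset.mem_filter] at hz hz'
            obtain ⟨_, h2⟩ := hmem _ hz.1
            obtain ⟨_, h2'⟩ := hmem _ hz'.1
            have h3 := hz.2
            have h3' := hz'.2
            simp only at h2 h2' h3 h3'
            have e1 : w.1 = w'.1 := by omega
            have e2 : w.2 = w'.2 := by omega
            rw [Prod.ext e1 e2]
          rw [← Finset.sum_image (f := fun q : ℕ × ℕ => (l.choose q.1 : ℝ) * (N - l).choose q.2) hinj]
          have hv : (N.choose h : ℝ) = ∑ q ∈ Finset.HasAntidiagonal.antidiagonal h,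
              (l.choose q.1 : ℝ) * (N - l).choose q.2 := by
            have := Nat.add_choose_eq l (N - l) h
            rw [Nat.add_sub_cancel' hl'] at this
            rw [this]; push_cast; rfl
          rw [hv]
          refine Finset.sum_le_sum_of_subset_of_nonneg ?_ fun _ _ _ => by positivity
          intro q hq
          obtain ⟨z, hz, rfl⟩ := Finset.mem_image.1 hq
          rw [Finset.HasAntidiagonal.mem_antidiagonal]
          exact (hmem z (Finset.mem_filter.1 hz).1).1
  have e1 : conv (jetWeight R S) (jetWeight R S) h j = R ^ h * S ^ j *
      ∑ z ∈ A, ((z.1.1 + z.2.1).choose z.1.1 : ℝ) * (z.1.2 + z.2.2).choose z.1.2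
      * (1 / (((z.1.1 + z.2.1 : ℕ) + 1 : ℝ) ^ 2 * ((N - (z.1.1 + z.2.1) : ℕ) + 1) ^ 2)) := by
    rw [conv, ← Finset.sum_product', Finset.mul_sum]
    refine Finset.sum_congr rfl fun z hz => ?_
    obtain ⟨h1, h2⟩ := hmem z hz
    have h3 : N - (z.1.1 + z.2.1) = z.1.2 + z.2.2 := by omega
    rw [h3, jetWeight, jetWeight, ← h1, ← h2, pow_add, pow_add]
    field_simp
  rw [e1]
  calc _ ≤ R ^ h * S ^ j * (N.choose h * (8 / ((N : ℝ) + 1) ^ 2)) :=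
        mul_le_mul_of_nonneg_left key (by positivity)
    _ = _ := by rw [jetWeight]; ring

theorem abs_conv_le {D E V W : ℕ → ℕ → ℝ} (hD : ∀ h j, |D h j| ≤ V h j)
    (hE : ∀ h j, |E h j| ≤ W h j) (h j : ℕ) : |conv D E h j| ≤ conv V W h j := by
  refine (Finset.abs_sum_le_sum_abs _ _).trans (Finset.sum_le_sum fun q _ => ?_)
  refine (Finset.abs_sum_le_sum_abs _ _).trans (Finset.sum_le_sum fun r _ => ?_)
  rw [abs_mul]
  exact mul_le_mul (hD _ _) (hE _ _) (abs_nonneg _) ((abs_nonneg _).trans (hD _ _))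

theorem abs_convPow_le {D : ℕ → ℕ → ℝ} {R S M : ℝ} (hR : 0 ≤ R) (hS : 0 ≤ S) (hM : 0 ≤ M)
    (hD : ∀ h j, |D h j| ≤ M * jetWeight R S h j) (ν h j : ℕ) :
    |convPow D ν h j| ≤ M ^ (ν + 1) * 8 ^ ν * jetWeight R S h j := by
  induction ν generalizing h j with
  | zero => simpa [convPow] using hD h j
  | succ ν ih =>
    refine (abs_conv_le hD ih h j).trans ?_
    have e1 : conv (fun h j => M * jetWeight R S h j)
        (fun h j => M ^ (ν + 1) * 8 ^ ν * jetWeight R S h j) h j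
        = M ^ (ν + 2) * 8 ^ ν * conv (jetWeight R S) (jetWeight R S) h j := by
      simp only [conv, Finset.mul_sum]
      refine Finset.sum_congr rfl fun q _ => Finset.sum_congr rfl fun r _ => ?_
      ring
    rw [e1]
    calc _ ≤ M ^ (ν + 2) * 8 ^ ν * (8 * jetWeight R S h j) :=
          mul_le_mul_of_nonneg_left (conv_jetWeight_le hR hS h j) (by positivity)
      _ = _ := by ring

/-- The Leibniz rule for sums over antidiagonals. -/
theorem sum_antidiagonal_leibniz (F : ℕ → ℕ → ℝ) (n : ℕ) :
    ∑ q ∈ Finset.HasAntidiagonal.antidiagonal n,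
      (((q.1 : ℝ) + 1) * F (q.1 + 1) q.2 + ((q.2 : ℝ) + 1) * F q.1 (q.2 + 1))
      = (n + 1) * ∑ q ∈ Finset.HasAntidiagonal.antidiagonal (n + 1), F q.1 q.2 := by
  have h1 : ∀ q ∈ Finset.HasAntidiagonal.antidiagonal (n + 1),
      ((n : ℝ) + 1) * F q.1 q.2 = q.1 * F q.1 q.2 + q.2 * F q.1 q.2 := fun q hq => by
    rw [Finset.HasAntidiagonal.mem_antidiagonal] at hq
    have : ((q.1 : ℝ) + q.2) = n + 1 := by exact_mod_cast hq
    rw [← this]; ring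
  rw [Finset.mul_sum, Finset.sum_congr rfl h1, Finset.sum_add_distrib, Finset.sum_add_distrib,
    Finset.Nat.sum_antidiagonal_succ, Finset.Nat.sum_antidiagonal_succ']
  simp

end Convolution

/-! ### Jets of functions on a strip -/

section Jets

/-- `d t x h j`, `h ≤ n`, are the normalized derivatives `∂_t^h ∂_x^j / (h! j!)` of a function on
`[0,T] × ℝ`. -/
structure IsJet (T : ℝ) (n : ℕ) (d : ℝ → ℝ → ℕ → ℕ → ℝ) : Prop where
  continuousOn : ∀ h ≤ n, ∀ j, ContinuousOn (fun p : ℝ × ℝ => d p.1 p.2 h j) (Icc 0 T ×ˢ univ)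
  hasDerivAt_space : ∀ h ≤ n, ∀ j, ∀ t ∈ Icc 0 T, ∀ x,
    HasDerivAt (fun y => d t y h j) ((j + 1) * d t x h (j + 1)) x
  hasDerivAt_time : ∀ h < n, ∀ j, ∀ t ∈ Ioo 0 T, ∀ x,
    HasDerivAt (fun s => d s x h j) ((h + 1) * d t x (h + 1) j) t

variable {T : ℝ} {n : ℕ}

theorem IsJet.congr {d e : ℝ → ℝ → ℕ → ℕ → ℝ} (hd : IsJet T n d)
    (h : ∀ t x, ∀ h ≤ n, ∀ j, e t x h j = d t x h j) : IsJet T n e where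
  continuousOn k hk j := (hd.continuousOn k hk j).congr fun p _ => h _ _ k hk j
  hasDerivAt_space k hk j t ht x := by
    rw [h t x k hk]
    refine (hd.hasDerivAt_space k hk j t ht x).congr_of_eventuallyEq ?_
    exact Eventually.of_forall fun y => h t y k hk j
  hasDerivAt_time k hk j t ht x := by
    rw [h t x (k + 1) hk]
    refine (hd.hasDerivAt_time k hk j t ht x).congr_of_eventuallyEq ?_
    exact Eventually.of_forall fun s => h s x k hk.le j

theorem IsJet.sub {d e : ℝ → ℝ → ℕ → ℕ → ℝ} (hd : IsJet T n d) (he : IsJet T n e) :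
    IsJet T n fun t x h j => d t x h j - e t x h j where
  continuousOn h hh j := (hd.continuousOn h hh j).sub (he.continuousOn h hh j)
  hasDerivAt_space h hh j t ht x :=
    ((hd.hasDerivAt_space h hh j t ht x).sub (he.hasDerivAt_space h hh j t ht x)).congr_deriv
      (by ring)
  hasDerivAt_time h hh j t ht x :=
    ((hd.hasDerivAt_time h hh j t ht x).sub (he.hasDerivAt_time h hh j t ht x)).congr_deriv
      (by ring)

theorem IsJet.const_mul {d : ℝ → ℝ → ℕ → ℕ → ℝ} (hd : IsJet T n d) (c : ℝ) :
    IsJet T n fun t x h j => c * d t x h j where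
  continuousOn h hh j := continuousOn_const.mul (hd.continuousOn h hh j)
  hasDerivAt_space h hh j t ht x :=
    ((hd.hasDerivAt_space h hh j t ht x).const_mul c).congr_deriv (by ring)
  hasDerivAt_time h hh j t ht x :=
    ((hd.hasDerivAt_time h hh j t ht x).const_mul c).congr_deriv (by ring)

theorem IsJet.finset_sum {ι : Type*} {s : Finset ι} {d : ι → ℝ → ℝ → ℕ → ℕ → ℝ}
    (hd : ∀ i ∈ s, IsJet T n (d i)) : IsJet T n fun t x h j => ∑ i ∈ s, d i t x h j where
  continuousOn h hh j := continuousOn_finsetSum _ fun i hi => (hd i hi).continuousOn h hh j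
  hasDerivAt_space h hh j t ht x := by
    rw [Finset.mul_sum]
    exact HasDerivAt.fun_sum fun i hi => (hd i hi).hasDerivAt_space h hh j t ht x
  hasDerivAt_time h hh j t ht x := by
    rw [Finset.mul_sum]
    exact HasDerivAt.fun_sum fun i hi => (hd i hi).hasDerivAt_time h hh j t ht x

theorem IsJet.tsum {d : ℕ → ℝ → ℝ → ℕ → ℕ → ℝ} {U : ℕ → ℕ → ℕ → ℝ} (hd : ∀ ν, IsJet T n (d ν))
    (hU : ∀ h j, Summable fun ν => U ν h j)
    (hdU : ∀ ν, ∀ t ∈ Icc 0 T, ∀ x h j, |d ν t x h j| ≤ U ν h j) :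
    IsJet T n fun t x h j => ∑' ν, d ν t x h j where
  continuousOn h hh j := continuousOn_tsum (fun ν => (hd ν).continuousOn h hh j) (hU h j)
    fun ν p hp => hdU ν p.1 hp.1 p.2 h j
  hasDerivAt_space h hh j t ht x := by
    rw [← tsum_mul_left]
    refine hasDerivAt_tsum (u := fun ν => (j + 1) * U ν h (j + 1)) ((hU h (j + 1)).mul_left _)
      (fun ν y => (hd ν).hasDerivAt_space h hh j t ht y) (fun ν y => ?_) (y₀ := x)
      (.of_norm_bounded (hU h j) fun ν => hdU ν t ht x h j) x
    rw [norm_mul, Real.norm_of_nonneg (by positivity)]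
    exact mul_le_mul_of_nonneg_left (hdU ν t ht y h (j + 1)) (by positivity)
  hasDerivAt_time h hh j t ht x := by
    rw [← tsum_mul_left]
    refine hasDerivAt_tsum_of_isPreconnected (u := fun ν => (h + 1) * U ν (h + 1) j)
      ((hU (h + 1) j).mul_left _) isOpen_Ioo isPreconnected_Ioo
      (fun ν s hs => (hd ν).hasDerivAt_time h hh j s hs x) (fun ν s hs => ?_) ht
      (.of_norm_bounded (hU h j) fun ν => hdU ν t (Ioo_subset_Icc_self ht) x h j) ht
    rw [norm_mul, Real.norm_of_nonneg (by positivity)]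
    exact mul_le_mul_of_nonneg_left (hdU ν s (Ioo_subset_Icc_self hs) x (h + 1) j) (by positivity)

theorem IsJet.conv {d e : ℝ → ℝ → ℕ → ℕ → ℝ} (hd : IsJet T n d) (he : IsJet T n e) :
    IsJet T n fun t x => conv (d t x) (e t x) where
  continuousOn h hh j := by
    refine continuousOn_finsetSum _ fun q hq => continuousOn_finsetSum _ fun r _ => ?_
    rw [Finset.HasAntidiagonal.mem_antidiagonal] at hq
    exact (hd.continuousOn _ (by omega) _).mul (he.continuousOn _ (by omega) _)
  hasDerivAt_space h hh j t ht x := by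
    have h1 : HasDerivAt (fun y => SemilinearHyperbolic.conv (d t y) (e t y) h j)
        (∑ q ∈ Finset.HasAntidiagonal.antidiagonal h, ∑ r ∈ Finset.HasAntidiagonal.antidiagonal j,
          ((((r.1 : ℝ) + 1) * d t x q.1 (r.1 + 1)) * e t x q.2 r.2
            + d t x q.1 r.1 * (((r.2 : ℝ) + 1) * e t x q.2 (r.2 + 1)))) x := by
      refine HasDerivAt.fun_sum fun q hq => HasDerivAt.fun_sum fun r _ => ?_
      rw [Finset.HasAntidiagonal.mem_antidiagonal] at hq
      exact (hd.hasDerivAt_space _ (by omega) _ t ht x).mul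
        (he.hasDerivAt_space _ (by omega) _ t ht x)
    refine h1.congr_deriv ?_
    rw [SemilinearHyperbolic.conv, Finset.mul_sum]
    refine Finset.sum_congr rfl fun q _ => ?_
    rw [← sum_antidiagonal_leibniz (fun p r => d t x q.1 p * e t x q.2 r)]
    exact Finset.sum_congr rfl fun r _ => by ring
  hasDerivAt_time h hh j t ht x := by
    have h1 : HasDerivAt (fun s => SemilinearHyperbolic.conv (d s x) (e s x) h j)
        (∑ q ∈ Finset.HasAntidiagonal.antidiagonal h, ∑ r ∈ Finset.HasAntidiagonal.antidiagonal j,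
          ((((q.1 : ℝ) + 1) * d t x (q.1 + 1) r.1) * e t x q.2 r.2
            + d t x q.1 r.1 * (((q.2 : ℝ) + 1) * e t x (q.2 + 1) r.2))) t := by
      refine HasDerivAt.fun_sum fun q hq => HasDerivAt.fun_sum fun r _ => ?_
      rw [Finset.HasAntidiagonal.mem_antidiagonal] at hq
      exact (hd.hasDerivAt_time _ (by omega) _ t ht x).mul
        (he.hasDerivAt_time _ (by omega) _ t ht x)
    refine h1.congr_deriv ?_
    rw [SemilinearHyperbolic.conv, ← sum_antidiagonal_leibniz
      (fun p q => ∑ r ∈ Finset.HasAntidiagonal.antidiagonal j, d t x p r.1 * e t x q r.2)]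
    refine Finset.sum_congr rfl fun q _ => ?_
    rw [Finset.sum_add_distrib, Finset.mul_sum, Finset.mul_sum]
    congr 1 <;> exact Finset.sum_congr rfl fun r _ => by ring

theorem IsJet.convPow {d : ℝ → ℝ → ℕ → ℕ → ℝ} (hd : IsJet T n d) (ν : ℕ) :
    IsJet T n fun t x => convPow (d t x) ν := by
  induction ν with
  | zero => exact hd
  | succ ν ih => exact hd.conv ih

/-- The factorial quotients renormalize the jet: the result is the jet of the derivative of order
`l` in time and `k` in space. -/
theorem IsJet.shift {d : ℝ → ℝ → ℕ → ℕ → ℝ} {l : ℕ} (hd : IsJet T (n + l) d) (k : ℕ) :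
    IsJet T n fun t x h j =>
      ((h + l)! / h ! : ℝ) * ((j + k)! / j ! : ℝ) * d t x (h + l) (j + k) where
  continuousOn h hh j := continuousOn_const.mul (hd.continuousOn _ (by omega) _)
  hasDerivAt_space h hh j t ht x := by
    refine ((hd.hasDerivAt_space (h + l) (by omega) (j + k) t ht x).const_mul _).congr_deriv ?_
    rw [show j + 1 + k = j + k + 1 by ring, Nat.factorial_succ (j + k), Nat.factorial_succ j]
    push_cast
    field_simp
  hasDerivAt_time h hh j t ht x := by
    refine ((hd.hasDerivAt_time (h + l) (by omega) (j + k) t ht x).const_mul _).congr_deriv ?_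
    rw [show h + 1 + l = h + l + 1 by ring, Nat.factorial_succ (h + l), Nat.factorial_succ h]
    push_cast
    field_simp

/-- The jet of a function of time only. -/
noncomputable def timeJet (T : ℝ) (g : ℝ → ℝ) (t : ℝ) (h j : ℕ) : ℝ :=
  if j = 0 then iteratedDerivWithin h g (Icc 0 T) t / h ! else 0

theorem isJet_timeJet (hT : 0 < T) {g : ℝ → ℝ} (hg : AnalyticOn ℝ g (Icc 0 T)) (n : ℕ) :
    IsJet T n fun t _ => timeJet T g t where
  continuousOn h _ j := by
    have hcd : ContDiffOn ℝ h g (Icc 0 T) := hg.contDiffOn (uniqueDiffOn_Icc hT)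
    have h1 := hcd.continuousOn_iteratedDerivWithin le_rfl (uniqueDiffOn_Icc hT)
    have h2 : ContinuousOn (fun p : ℝ × ℝ => iteratedDerivWithin h g (Icc 0 T) p.1)
        (Icc 0 T ×ˢ univ) := h1.comp continuousOn_fst fun p hp => hp.1
    unfold timeJet
    split_ifs
    · exact h2.div_const _
    · exact continuousOn_const
  hasDerivAt_space h _ j t _ x := by
    simp only [timeJet, Nat.add_eq_zero_iff, one_ne_zero, and_false, if_false, mul_zero]
    exact hasDerivAt_const _ _
  hasDerivAt_time h _ j t ht x := by
    unfold timeJet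
    split_ifs
    · have hcd : ContDiffOn ℝ (h + 1 : ℕ) g (Icc 0 T) := hg.contDiffOn (uniqueDiffOn_Icc hT)
      have h1 := hcd.differentiableOn_iteratedDerivWithin (m := h) (by exact_mod_cast h.lt_succ_self)
        (uniqueDiffOn_Icc hT) t (Ioo_subset_Icc_self ht)
      have h2 := (h1.hasDerivWithinAt.hasDerivAt (Icc_mem_nhds ht.1 ht.2)).div_const (h ! : ℝ)
      refine h2.congr_deriv ?_
      rw [iteratedDerivWithin_succ, Nat.factorial_succ]
      push_cast
      field_simp
    · rw [mul_zero]; exact hasDerivAt_const _ _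

theorem conv_timeJet (g : ℝ → ℝ) (t : ℝ) (E : ℕ → ℕ → ℝ) (h j : ℕ) :
    conv (timeJet T g t) E h j = ∑ q ∈ Finset.HasAntidiagonal.antidiagonal h,
      iteratedDerivWithin q.1 g (Icc 0 T) t / q.1 ! * E q.2 j := by
  refine Finset.sum_congr rfl fun q _ => ?_
  rw [Finset.sum_eq_single (0, j)]
  · simp [timeJet]
  · rintro ⟨r, s⟩ hr hne
    rw [Finset.HasAntidiagonal.mem_antidiagonal] at hr
    have : r ≠ 0 := by
      rintro rfl
      simp only [zero_add] at hr
      exact hne (by rw [hr])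
    simp [timeJet, this]
  · intro hh
    exact absurd (Finset.HasAntidiagonal.mem_antidiagonal.2 (zero_add j)) hh

/-- Interchange of the derivatives in space and time. -/
theorem hasDerivAt_time_of_space {g₀ g₁ k₀ k₁ : ℝ → ℝ → ℝ} {K : ℝ}
    (hk₀ : ContinuousOn (fun p : ℝ × ℝ => k₀ p.1 p.2) (Icc 0 T ×ˢ univ))
    (hk₁ : ContinuousOn (fun p : ℝ × ℝ => k₁ p.1 p.2) (Icc 0 T ×ˢ univ))
    (hgt : ∀ t ∈ Ioo 0 T, ∀ x, HasDerivAt (fun s => g₀ s x) (k₀ t x) t)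
    (hgx : ∀ t ∈ Ioo 0 T, ∀ x, HasDerivAt (g₀ t) (g₁ t x) x)
    (hkx : ∀ t ∈ Ioo 0 T, ∀ x, HasDerivAt (k₀ t) (k₁ t x) x)
    (hK : ∀ t ∈ Ioo 0 T, ∀ x, |k₁ t x| ≤ K) {t : ℝ} (ht : t ∈ Ioo 0 T) (x : ℝ) :
    HasDerivAt (fun s => g₁ s x) (k₁ t x) t := by
  have hslice : ∀ {k : ℝ → ℝ → ℝ}, ContinuousOn (fun p : ℝ × ℝ => k p.1 p.2) (Icc 0 T ×ˢ univ) →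
      ∀ y, ContinuousOn (fun s => k s y) (Ioo 0 T) := fun {k} hk y =>
    hk.comp (f := fun s => (s, y)) (Continuous.continuousOn (by fun_prop))
      fun s hs => ⟨Ioo_subset_Icc_self hs, mem_univ _⟩
  have hsub : ∀ s ∈ Ioo 0 T, uIcc t s ⊆ Ioo 0 T := fun s hs =>
    ordConnected_Ioo.uIcc_subset ht hs
  have hInt : ∀ {k : ℝ → ℝ → ℝ}, ContinuousOn (fun p : ℝ × ℝ => k p.1 p.2) (Icc 0 T ×ˢ univ) →
      ∀ y, ∀ s ∈ Ioo 0 T, IntervalIntegrable (fun r => k r y) volume t s := fun {k} hk y s hs =>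
    ((hslice hk y).mono (hsub s hs)).intervalIntegrable
  have key : ∀ s ∈ Ioo 0 T, g₁ s x = g₁ t x + ∫ r in t..s, k₁ r x := by
    intro s hs
    have h1 : ∀ y, g₀ s y = g₀ t y + ∫ r in t..s, k₀ r y := fun y => by
      rw [intervalIntegral.integral_eq_sub_of_hasDerivAt (f := fun s => g₀ s y)
        (fun r hr => hgt r (hsub s hs hr) y) (hInt hk₀ y s hs)]
      ring
    have h2 := (intervalIntegral.hasDerivAt_integral_of_dominated_loc_of_deriv_le
      (μ := volume) (a := t) (b := s) (F := fun y r => k₀ r y) (F' := fun y r => k₁ r y) (x₀ := x)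
      (bound := fun _ => K) univ_mem (Eventually.of_forall fun y => ?_) (hInt hk₀ x s hs) ?_ ?_
      intervalIntegrable_const ?_).2
    · have h3 : HasDerivAt (g₀ s) (g₁ t x + ∫ r in t..s, k₁ r x) x := by
        refine ((hgx t ht x).add h2).congr_of_eventuallyEq (Eventually.of_forall fun y => ?_)
        exact h1 y
      exact (hgx s hs x).unique h3
    · exact (intervalIntegrable_iff.1 (hInt hk₀ y s hs)).aestronglyMeasurable
    · exact (intervalIntegrable_iff.1 (hInt hk₁ x s hs)).aestronglyMeasurable
    · exact Eventually.of_forall fun r hr y _ => hK r (hsub s hs (uIoc_subset_uIcc hr)) y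
    · exact Eventually.of_forall fun r hr y _ => hkx r (hsub s hs (uIoc_subset_uIcc hr)) y
  have h4 : HasDerivAt (fun s => ∫ r in t..s, k₁ r x) (k₁ t x) t := by
    refine intervalIntegral.integral_hasDerivAt_right (hInt hk₁ x t ht) ?_ ?_
    · exact (hslice hk₁ x).stronglyMeasurableAtFilter isOpen_Ioo t ht
    · exact (hslice hk₁ x).continuousAt (isOpen_Ioo.mem_nhds ht)
  refine (h4.const_add (g₁ t x)).congr_of_eventuallyEq ?_
  filter_upwards [isOpen_Ioo.mem_nhds ht] with s hs
  exact key s hs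

/-- Time differentiability is known only for the row without space derivatives. Interchanging
derivatives passes it from `j` to `j + 1`. -/
theorem hasDerivAt_time_of_space_jet {d e : ℕ → ℝ → ℝ → ℝ} {K : ℕ → ℝ}
    (he : ∀ j, ContinuousOn (fun p : ℝ × ℝ => e j p.1 p.2) (Icc 0 T ×ˢ univ))
    (hdx : ∀ j : ℕ, ∀ t ∈ Icc 0 T, ∀ x, HasDerivAt (d j t) ((j + 1) * d (j + 1) t x) x)
    (hex : ∀ j : ℕ, ∀ t ∈ Icc 0 T, ∀ x, HasDerivAt (e j t) ((j + 1) * e (j + 1) t x) x)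
    (hK : ∀ j, ∀ t ∈ Icc 0 T, ∀ x, |e j t x| ≤ K j)
    (h0 : ∀ t ∈ Ioo 0 T, ∀ x, HasDerivAt (fun s => d 0 s x) (e 0 t x) t) (j : ℕ) {t : ℝ}
    (ht : t ∈ Ioo 0 T) (x : ℝ) : HasDerivAt (fun s => d j s x) (e j t x) t := by
  induction j generalizing t x with
  | zero => exact h0 t ht x
  | succ j ih =>
    have h1 := hasDerivAt_time_of_space (g₁ := fun t x => ((j : ℝ) + 1) * d (j + 1) t x)
      (k₁ := fun t x => ((j : ℝ) + 1) * e (j + 1) t x) (K := ((j : ℝ) + 1) * K (j + 1)) (he j)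
      (continuousOn_const.mul (he (j + 1))) (fun t ht x => ih ht x)
      (fun t ht x => hdx j t (Ioo_subset_Icc_self ht) x)
      (fun t ht x => hex j t (Ioo_subset_Icc_self ht) x) (fun t ht x => ?_) ht x
    · have hj : ((j : ℝ) + 1) ≠ 0 := by positivity
      have h2 := h1.const_mul ((j : ℝ) + 1)⁻¹
      simp only [inv_mul_cancel_left₀ hj] at h2
      exact h2
    · rw [abs_mul, abs_of_nonneg (by positivity)]
      exact mul_le_mul_of_nonneg_left (hK (j + 1) t (Ioo_subset_Icc_self ht) x) (by positivity)

theorem IsJet.mono {d : ℝ → ℝ → ℕ → ℕ → ℝ} {l : ℕ} (hd : IsJet T n d) (hl : l ≤ n) :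
    IsJet T l d where
  continuousOn h hh := hd.continuousOn h (hh.trans hl)
  hasDerivAt_space h hh := hd.hasDerivAt_space h (hh.trans hl)
  hasDerivAt_time h hh := hd.hasDerivAt_time h (hh.trans_le hl)

end Jets

/-! ### The recursion for the jets of a solution -/

section Recursion

/-- The normalized derivatives of `f(u) - ∑ a_k ∂_t^{m-k} ∂_x^k u` in terms of those, `D`, of
`u`. -/
noncomputable def rhsJet (m : ℕ) (T : ℝ) (a : ℕ → ℝ → ℝ) (c : ℕ → ℝ) (t : ℝ) (D : ℕ → ℕ → ℝ)
    (h j : ℕ) : ℝ :=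
  ∑' ν, c (ν + 1) * convPow D ν h j - ∑ k ∈ Finset.Icc 1 m, conv (timeJet T (a k) t)
    (fun h j => ((h + (m - k))! / h ! : ℝ) * ((j + k)! / j ! : ℝ) * D (h + (m - k)) (j + k)) h j

theorem convPow_congr {D D' : ℕ → ℕ → ℝ} {n : ℕ} (hD : ∀ h ≤ n, ∀ j, D h j = D' h j) (ν : ℕ) :
    ∀ h ≤ n, ∀ j, convPow D ν h j = convPow D' ν h j := by
  induction ν with
  | zero => exact hD
  | succ ν ih =>
    intro h hh j
    simp only [convPow, conv]
    refine Finset.sum_congr rfl fun q hq => Finset.sum_congr rfl fun r _ => ?_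
    rw [Finset.HasAntidiagonal.mem_antidiagonal] at hq
    rw [hD _ (by omega), ih _ (by omega)]

variable {m : ℕ} {T : ℝ} {a : ℕ → ℝ → ℝ} {c : ℕ → ℝ}

/-- The right side at time order `n` involves only time orders below `n + m`, so the recursion for
the jets is well founded. -/
theorem rhsJet_congr (hm : 1 ≤ m) {D D' : ℕ → ℕ → ℝ} {n : ℕ}
    (hD : ∀ h < n + m, ∀ j, D h j = D' h j) (t : ℝ) (j : ℕ) :
    rhsJet m T a c t D n j = rhsJet m T a c t D' n j := by
  unfold rhsJet
  congr 1
  · refine tsum_congr fun ν => ?_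
    rw [convPow_congr (n := n) (fun h hh => hD h (by omega)) ν n le_rfl]
  · refine Finset.sum_congr rfl fun k hk => ?_
    rw [Finset.mem_Icc] at hk
    refine Finset.sum_congr rfl fun q hq => Finset.sum_congr rfl fun r _ => ?_
    rw [Finset.HasAntidiagonal.mem_antidiagonal] at hq
    simp only [hD (q.2 + (m - k)) (by omega)]

/-- The bound for `(h+m)!/h!` times the jet of order `h + m`. -/
noncomputable def shiftWeight (m : ℕ) (R S : ℝ) (h j : ℕ) : ℝ :=
  ((h + m)! / h ! : ℝ) * jetWeight R S (h + m) j

theorem jetWeight_eq (R S : ℝ) (h j : ℕ) :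
    jetWeight R S h j = R ^ h * S ^ j * ((h + j)! / (h ! * j !) / ((h + j : ℕ) + 1) ^ 2) := by
  rw [jetWeight, Nat.cast_choose ℝ (Nat.le_add_right h j), Nat.add_sub_cancel_left]

theorem shiftWeight_nonneg {R S : ℝ} (hR : 0 ≤ R) (hS : 0 ≤ S) (h j : ℕ) :
    0 ≤ shiftWeight m R S h j := mul_nonneg (by positivity) (jetWeight_nonneg hR hS _ _)

/-- Replacing `k` time derivatives by `k` space derivatives keeps the total order and changes the
majorant only by `(S/R)^k`. Taking `R` large makes the linear terms small. -/
theorem shift_jetWeight_eq {R S : ℝ} (hR : 0 < R) {k : ℕ} (hk : k ≤ m) (h j : ℕ) :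
    ((h + (m - k))! / h ! : ℝ) * ((j + k)! / j ! : ℝ) * jetWeight R S (h + (m - k)) (j + k)
      = (S / R) ^ k * shiftWeight m R S h j := by
  rw [shiftWeight, jetWeight_eq, jetWeight_eq,
    show h + (m - k) + (j + k) = h + m + j by omega]
  have e1 : R ^ (h + m) = R ^ (h + (m - k)) * R ^ k := by rw [← pow_add]; congr 1; omega
  rw [e1, pow_add S j k, div_pow]
  field_simp

/-- Each missing time order gains a factor `4/R`. This beats the geometric growth of the Taylor
coefficients of the `a k`, so their Cauchy product with a jet costs only a geometric series. -/
theorem shiftWeight_le_succ {R S : ℝ} (hR : 0 < R) (hS : 0 ≤ S) (h j : ℕ) :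
    shiftWeight m R S h j ≤ 4 / R * shiftWeight m R S (h + 1) j := by
  rw [shiftWeight, shiftWeight, jetWeight_eq, jetWeight_eq]
  set N := h + m + j with hN
  rw [show h + 1 + m + j = N + 1 by omega, show h + 1 + m = h + m + 1 by omega,
    Nat.factorial_succ N, Nat.factorial_succ h, pow_succ R]
  have e1 : ((h + m)! / h ! : ℝ) * (R ^ (h + m) * S ^ j
      * ((N)! / ((h + m)! * j !) / ((N : ℝ) + 1) ^ 2))
      = R ^ (h + m) * S ^ j * ((N)! / (h ! * j !)) * (1 / ((N : ℝ) + 1) ^ 2) := by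
    field_simp
  have e2 : 4 / R * (((h + m + 1)! / ((h + 1) * h ! : ℕ) : ℝ) * (R ^ (h + m) * R * S ^ j
      * (((N + 1) * (N)! : ℕ) / ((h + m + 1)! * j !) / (((N + 1 : ℕ) : ℝ) + 1) ^ 2)))
      = R ^ (h + m) * S ^ j * ((N)! / (h ! * j !)) * (((N : ℝ) + 1) / (h + 1)
        * (4 / ((N : ℝ) + 2) ^ 2)) := by
    push_cast
    field_simp
    ring
  rw [e1, e2]
  refine mul_le_mul_of_nonneg_left ?_ (by positivity)
  have h1 : 1 ≤ ((N : ℝ) + 1) / (h + 1) := by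
    rw [one_le_div (by positivity)]
    have : (h : ℝ) ≤ N := by exact_mod_cast (by omega : h ≤ N)
    linarith
  have h2 : 1 / ((N : ℝ) + 1) ^ 2 ≤ 4 / ((N : ℝ) + 2) ^ 2 := by
    rw [div_le_div_iff₀ (by positivity) (by positivity)]
    nlinarith [(by positivity : (0 : ℝ) ≤ N)]
  calc _ ≤ 4 / ((N : ℝ) + 2) ^ 2 := h2
    _ ≤ _ := le_mul_of_one_le_left (by positivity) h1

theorem shiftWeight_le_add {R S : ℝ} (hR : 0 < R) (hS : 0 ≤ S) (i h j : ℕ) :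
    shiftWeight m R S h j ≤ (4 / R) ^ i * shiftWeight m R S (i + h) j := by
  induction i with
  | zero => simp
  | succ i ih =>
    refine ih.trans ?_
    rw [pow_succ, mul_assoc, show i + 1 + h = i + h + 1 by ring]
    exact mul_le_mul_of_nonneg_left (shiftWeight_le_succ hR hS _ _) (by positivity)

/-- The nonlinear term is `m` orders below the principal part, a gain of `R^(-m)`. -/
theorem jetWeight_le_shiftWeight {R S : ℝ} (hR : 1 ≤ R) (hS : 0 ≤ S) (h j : ℕ) :
    jetWeight R S h j ≤ ((m : ℝ) + 1) ^ 2 / R ^ m * shiftWeight m R S h j := by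
  have hR0 : 0 < R := by linarith
  rw [shiftWeight, jetWeight_eq, jetWeight_eq, pow_add]
  set N := h + j with hN
  rw [show h + m + j = N + m by omega]
  have e2 : ((m : ℝ) + 1) ^ 2 / R ^ m * (((h + m)! / h ! : ℝ) * (R ^ h * R ^ m * S ^ j
      * ((N + m)! / ((h + m)! * j !) / (((N + m : ℕ) : ℝ) + 1) ^ 2)))
      = R ^ h * S ^ j * (((N + m)! / (h ! * j !)) * (((m : ℝ) + 1) ^ 2 / (N + m + 1) ^ 2)) := by
    push_cast
    field_simp
  rw [e2]
  refine mul_le_mul_of_nonneg_left ?_ (by positivity)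
  rw [div_eq_mul_one_div _ (((N : ℝ) + 1) ^ 2)]
  refine mul_le_mul ?_ ?_ (by positivity) (by positivity)
  · have : ((N)! : ℝ) ≤ (N + m)! := by exact_mod_cast Nat.factorial_le (Nat.le_add_right N m)
    gcongr
  · rw [div_le_div_iff₀ (by positivity) (by positivity), one_mul, ← mul_pow]
    refine pow_le_pow_left₀ (by positivity) ?_ 2
    nlinarith [(by positivity : (0 : ℝ) ≤ N), (by positivity : (0 : ℝ) ≤ m),
      (by positivity : (0 : ℝ) ≤ (N : ℝ) * m)]

theorem abs_conv_timeJet_le {g : ℝ → ℝ} {A α R S t B : ℝ} (hA : 0 ≤ A) (hα : 0 ≤ α)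
    (hg : ∀ i : ℕ, |iteratedDerivWithin i g (Icc 0 T) t / i !| ≤ A * α ^ i) (hR : 0 < R)
    (hS : 0 ≤ S) (hRα : 8 * α ≤ R) (hB : 0 ≤ B) {E : ℕ → ℕ → ℝ}
    (hE : ∀ h j, |E h j| ≤ B * shiftWeight m R S h j) (h j : ℕ) :
    |conv (timeJet T g t) E h j| ≤ 2 * A * (B * shiftWeight m R S h j) := by
  rw [conv_timeJet]
  have hW := shiftWeight_nonneg (m := m) hR.le hS h j
  calc _ ≤ ∑ q ∈ Finset.HasAntidiagonal.antidiagonal h,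
        (1 / (2 : ℝ)) ^ q.1 * (A * (B * shiftWeight m R S h j)) := by
        refine (Finset.abs_sum_le_sum_abs _ _).trans (Finset.sum_le_sum fun q hq => ?_)
        rw [Finset.HasAntidiagonal.mem_antidiagonal] at hq
        have h1 := shiftWeight_le_add (m := m) hR hS q.1 q.2 j
        rw [hq] at h1
        have h2 : α * (4 / R) ≤ 1 / 2 := by
          rw [← mul_div_assoc, div_le_div_iff₀ hR two_pos]; linarith
        rw [abs_mul]
        calc _ ≤ A * α ^ q.1 * (B * ((4 / R) ^ q.1 * shiftWeight m R S h j)) :=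
              mul_le_mul (hg _) ((hE _ _).trans (mul_le_mul_of_nonneg_left h1 hB)) (abs_nonneg _)
                (by positivity)
          _ = (α * (4 / R)) ^ q.1 * (A * (B * shiftWeight m R S h j)) := by rw [mul_pow]; ring
          _ ≤ _ := mul_le_mul_of_nonneg_right (pow_le_pow_left₀ (by positivity) h2 _)
              (by positivity)
    _ = (∑ i ∈ Finset.range (h + 1), (1 / (2 : ℝ)) ^ i) * (A * (B * shiftWeight m R S h j)) := by
        rw [← Finset.sum_mul, Finset.Nat.sum_antidiagonal_eq_sum_range_succ_mk]
    _ ≤ 2 * (A * (B * shiftWeight m R S h j)) :=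
        mul_le_mul_of_nonneg_right (sum_geometric_two_le _) (by positivity)
    _ = _ := by ring

/-- Constants for which the recursion preserves the bound `M * jetWeight R S`. -/
structure JetConstants (m : ℕ) (T : ℝ) (a : ℕ → ℝ → ℝ) (c : ℕ → ℝ) (A α M R S : ℝ) : Prop where
  one_le : 1 ≤ m
  A_nonneg : 0 ≤ A
  α_nonneg : 0 ≤ α
  M_pos : 0 < M
  S_nonneg : 0 ≤ S
  one_le_R : 1 ≤ R
  coeff_le : ∀ k ∈ Finset.Icc 1 m, ∀ t ∈ Icc 0 T, ∀ i : ℕ,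
    |iteratedDerivWithin i (a k) (Icc 0 T) t / i !| ≤ A * α ^ i
  summable : Summable fun ν => |c (ν + 1)| * (M ^ (ν + 1) * 8 ^ ν)
  α_le : 8 * α ≤ R
  S_le : S ≤ R
  linear_le : 4 * m * A * S ≤ R
  nonlinear_le : 2 * (((m : ℝ) + 1) ^ 2 * ∑' ν, |c (ν + 1)| * (M ^ (ν + 1) * 8 ^ ν)) ≤ M * R

variable {A α M R S : ℝ}

/-- The nonlinear and the linear part each take half of the bound: the former through the gain in
order, the latter through the small ratio `S/R`. -/
theorem JetConstants.abs_rhsJet_le (J : JetConstants m T a c A α M R S) {D : ℕ → ℕ → ℝ}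
    (hD : ∀ h j, |D h j| ≤ M * jetWeight R S h j) {t : ℝ} (ht : t ∈ Icc 0 T) (h j : ℕ) :
    |rhsJet m T a c t D h j| ≤ M * shiftWeight m R S h j := by
  have hR0 : 0 < R := by linarith [J.one_le_R]
  have hW := shiftWeight_nonneg (m := m) hR0.le J.S_nonneg h j
  have hSR : S / R ≤ 1 := (div_le_one hR0).2 J.S_le
  have hSR0 : 0 ≤ S / R := div_nonneg J.S_nonneg hR0.le
  have hMp := J.M_pos
  have hA := J.A_nonneg
  set Φ := ∑' ν, |c (ν + 1)| * (M ^ (ν + 1) * 8 ^ ν) with hΦ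
  have hΦ0 : 0 ≤ Φ := tsum_nonneg fun ν => by positivity
  have h1 : |∑' ν, c (ν + 1) * convPow D ν h j| ≤ M / 2 * shiftWeight m R S h j := by
    calc _ ≤ Φ * jetWeight R S h j := by
          rw [hΦ, ← tsum_mul_right, ← Real.norm_eq_abs]
          refine tsum_of_norm_bounded (J.summable.mul_right _).hasSum fun ν => ?_
          rw [Real.norm_eq_abs, abs_mul, mul_assoc]
          exact mul_le_mul_of_nonneg_left
            (abs_convPow_le hR0.le J.S_nonneg J.M_pos.le hD ν h j) (abs_nonneg _)
      _ ≤ Φ * (((m : ℝ) + 1) ^ 2 / R ^ m * shiftWeight m R S h j) :=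
          mul_le_mul_of_nonneg_left (jetWeight_le_shiftWeight J.one_le_R J.S_nonneg h j) hΦ0
      _ = Φ * ((m : ℝ) + 1) ^ 2 / R ^ m * shiftWeight m R S h j := by ring
      _ ≤ _ := by
          refine mul_le_mul_of_nonneg_right ?_ hW
          rw [div_le_iff₀ (by positivity)]
          have h2 : R ≤ R ^ m := le_self_pow₀ J.one_le_R (by have := J.one_le; omega)
          have h3 := J.nonlinear_le
          rw [← hΦ] at h3
          have h4 : M * R ≤ M * R ^ m := mul_le_mul_of_nonneg_left h2 J.M_pos.le
          linarith
  have h2 : |∑ k ∈ Finset.Icc 1 m, conv (timeJet T (a k) t) (fun h j => ((h + (m - k))! / h ! : ℝ)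
      * ((j + k)! / j ! : ℝ) * D (h + (m - k)) (j + k)) h j| ≤ M / 2 * shiftWeight m R S h j := by
    calc _ ≤ ∑ k ∈ Finset.Icc 1 m, 2 * A * (M * (S / R) * shiftWeight m R S h j) := by
          refine (Finset.abs_sum_le_sum_abs _ _).trans (Finset.sum_le_sum fun k hk => ?_)
          have hk' := Finset.mem_Icc.1 hk
          refine abs_conv_timeJet_le hA J.α_nonneg (J.coeff_le k hk t ht) hR0 J.S_nonneg J.α_le
            (by positivity) (fun h j => ?_) h j
          rw [abs_mul, abs_of_nonneg (by positivity)]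
          calc _ ≤ ((h + (m - k))! / h ! : ℝ) * ((j + k)! / j ! : ℝ)
                * (M * jetWeight R S (h + (m - k)) (j + k)) :=
                mul_le_mul_of_nonneg_left (hD _ _) (by positivity)
            _ = M * ((S / R) ^ k * shiftWeight m R S h j) := by
                rw [← shift_jetWeight_eq hR0 hk'.2]; ring
            _ ≤ M * (S / R * shiftWeight m R S h j) := by
                have h5 := shiftWeight_nonneg (m := m) hR0.le J.S_nonneg h j
                refine mul_le_mul_of_nonneg_left (mul_le_mul_of_nonneg_right ?_ h5) hMp.le
                exact pow_le_of_le_one hSR0 hSR (by omega)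
            _ = _ := by ring
      _ = 4 * m * A * S / R * (M / 2 * shiftWeight m R S h j) := by
          rw [Finset.sum_const, Nat.card_Icc, nsmul_eq_mul, Nat.add_sub_cancel]
          field_simp
          ring
      _ ≤ 1 * (M / 2 * shiftWeight m R S h j) :=
          mul_le_mul_of_nonneg_right ((div_le_one hR0).2 J.linear_le) (by positivity)
      _ = _ := one_mul _
  calc _ ≤ _ := abs_sub _ _
    _ ≤ M / 2 * shiftWeight m R S h j + M / 2 * shiftWeight m R S h j := add_le_add h1 h2
    _ = _ := by ring

theorem JetConstants.isJet_rhsJet (J : JetConstants m T a c A α M R S) (hT : 0 < T)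
    (ha : ∀ k ∈ Finset.Icc 1 m, AnalyticOn ℝ (a k) (Icc 0 T)) {n : ℕ} {d : ℝ → ℝ → ℕ → ℕ → ℝ}
    (hd : IsJet T (n + (m - 1)) d)
    (hdM : ∀ t ∈ Icc 0 T, ∀ x h j, |d t x h j| ≤ M * jetWeight R S h j) :
    IsJet T n fun t x => rhsJet m T a c t (d t x) := by
  have hR0 : 0 ≤ R := by linarith [J.one_le_R]
  refine IsJet.sub (IsJet.tsum
    (U := fun ν h j => |c (ν + 1)| * (M ^ (ν + 1) * 8 ^ ν) * jetWeight R S h j)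
    (fun ν => ((hd.mono (Nat.le_add_right _ _)).convPow ν).const_mul _)
    (fun h j => J.summable.mul_right _) fun ν t ht x h j => ?_) (IsJet.finset_sum fun k hk => ?_)
  · rw [abs_mul, mul_assoc]
    exact mul_le_mul_of_nonneg_left
      (abs_convPow_le hR0 J.S_nonneg J.M_pos.le (hdM t ht x) ν h j) (abs_nonneg _)
  · have hk' := Finset.mem_Icc.1 hk
    exact (isJet_timeJet hT (ha k hk) n).conv ((hd.mono (by omega)).shift k)

/-- The jets of a solution, of order less than `n + m` in time. -/
noncomputable def jetSeq (m : ℕ) (T : ℝ) (a : ℕ → ℝ → ℝ) (c : ℕ → ℝ) (d : ℝ → ℝ → ℕ → ℕ → ℝ) :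
    ℕ → ℝ → ℝ → ℕ → ℕ → ℝ
  | 0 => d
  | n + 1 => fun t x h j =>
    if h = n + m then (n ! / (n + m)! : ℝ) * rhsJet m T a c t (jetSeq m T a c d n t x) n j
    else jetSeq m T a c d n t x h j

theorem jetSeq_succ_of_ne {d : ℝ → ℝ → ℕ → ℕ → ℝ} {n h : ℕ} (hh : h ≠ n + m) (t x : ℝ) (j : ℕ) :
    jetSeq m T a c d (n + 1) t x h j = jetSeq m T a c d n t x h j := if_neg hh

theorem jetSeq_succ_self {d : ℝ → ℝ → ℕ → ℕ → ℝ} (n : ℕ) (t x : ℝ) (j : ℕ) :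
    jetSeq m T a c d (n + 1) t x (n + m) j
      = (n ! / (n + m)! : ℝ) * rhsJet m T a c t (jetSeq m T a c d n t x) n j := if_pos rfl

theorem jetSeq_succ_self' (hm : 1 ≤ m) {d : ℝ → ℝ → ℕ → ℕ → ℝ} (n : ℕ) (t x : ℝ) (j : ℕ) :
    jetSeq m T a c d (n + 1) t x (n + m) j
      = (n ! / (n + m)! : ℝ) * rhsJet m T a c t (jetSeq m T a c d (n + 1) t x) n j := by
  rw [jetSeq_succ_self, rhsJet_congr hm fun h hh j => jetSeq_succ_of_ne (by omega) t x j]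

theorem jetSeq_eq_of_le (hm : 1 ≤ m) {d : ℝ → ℝ → ℕ → ℕ → ℝ} {h n : ℕ} (hn : h ≤ n) (t x : ℝ)
    (j : ℕ) : jetSeq m T a c d n t x h j = jetSeq m T a c d h t x h j := by
  induction n, hn using Nat.le_induction with
  | base => rfl
  | succ n hn ih => rw [jetSeq_succ_of_ne (by omega), ih]

theorem JetConstants.abs_jetSeq_le (J : JetConstants m T a c A α M R S)
    {d : ℝ → ℝ → ℕ → ℕ → ℝ} (hdM : ∀ t ∈ Icc 0 T, ∀ x h j, |d t x h j| ≤ M * jetWeight R S h j)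
    (n : ℕ) : ∀ t ∈ Icc 0 T, ∀ x h j, |jetSeq m T a c d n t x h j| ≤ M * jetWeight R S h j := by
  induction n with
  | zero => exact hdM
  | succ n ih =>
    intro t ht x h j
    by_cases hh : h = n + m
    · rw [hh, jetSeq_succ_self, abs_mul, abs_of_nonneg (by positivity)]
      calc _ ≤ (n ! / (n + m)! : ℝ) * (M * shiftWeight m R S n j) :=
            mul_le_mul_of_nonneg_left (J.abs_rhsJet_le (ih t ht x) ht n j) (by positivity)
        _ = _ := by rw [shiftWeight]; field_simp
    · rw [jetSeq_succ_of_ne hh]; exact ih t ht x h j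

/-- The new row is defined by the equation and inherits its space derivatives from the right side.
What remains to check is that the preceding row has it as time derivative. -/
theorem JetConstants.isJet_jetSeq (J : JetConstants m T a c A α M R S) (hT : 0 < T)
    (ha : ∀ k ∈ Finset.Icc 1 m, AnalyticOn ℝ (a k) (Icc 0 T)) {d : ℝ → ℝ → ℕ → ℕ → ℝ}
    (hd : IsJet T (m - 1) d) (hdM : ∀ t ∈ Icc 0 T, ∀ x h j, |d t x h j| ≤ M * jetWeight R S h j)
    (heq : ∀ j, ∀ t ∈ Ioo 0 T, ∀ x, HasDerivAt (fun s => d s x (m - 1) j)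
      (rhsJet m T a c t (d t x) 0 j / (m - 1)!) t) (n : ℕ) :
    IsJet T (n + (m - 1)) (jetSeq m T a c d n) := by
  have hm := J.one_le
  induction n with
  | zero => rw [zero_add]; exact hd
  | succ n ih =>
    have hP := J.isJet_rhsJet hT ha ih (J.abs_jetSeq_le hdM n)
    -- For the first new row this is the equation itself. Afterwards the preceding row was also
    -- defined from the right side, so the time derivative of the right side applies.
    have hlast : ∀ j, ∀ t ∈ Ioo 0 T, ∀ x, HasDerivAt
        (fun s => jetSeq m T a c d n s x (n + (m - 1)) j)
        (n ! / (n + (m - 1))! * rhsJet m T a c t (jetSeq m T a c d n t x) n j) t := by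
      intro j t ht x
      rcases n with - | n
      · simp only [zero_add, Nat.factorial_zero, Nat.cast_one, one_div_mul_eq_div]
        exact heq j t ht x
      · have h1 := (hP.hasDerivAt_time n (Nat.lt_succ_self n) j t ht x).const_mul
          (n ! / (n + m)! : ℝ)
        have e1 : n + 1 + (m - 1) = n + m := by omega
        rw [e1]
        have e2 : (fun s => jetSeq m T a c d (n + 1) s x (n + m) j) = fun s =>
            (n ! / (n + m)! : ℝ) * rhsJet m T a c s (jetSeq m T a c d (n + 1) s x) n j :=
          funext fun s => jetSeq_succ_self' hm n s x j
        rw [e2]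
        refine h1.congr_deriv ?_
        rw [Nat.factorial_succ n]; push_cast; ring
    have hrow : ∀ t x j, jetSeq m T a c d (n + 1) t x (n + m) j
      = (n ! / (n + m)! : ℝ) * rhsJet m T a c t (jetSeq m T a c d n t x) n j :=
      fun t x j => jetSeq_succ_self n t x j
    refine ⟨fun h hh j => ?_, fun h hh j t ht x => ?_, fun h hh j t ht x => ?_⟩
    · by_cases hhe : h = n + m
      · subst hhe
        simp only [hrow]
        exact continuousOn_const.mul (hP.continuousOn n le_rfl j)
      · simp only [jetSeq_succ_of_ne hhe]
        exact ih.continuousOn h (by omega) j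
    · by_cases hhe : h = n + m
      · subst hhe
        simp only [hrow]
        refine ((hP.hasDerivAt_space n le_rfl j t ht x).const_mul _).congr_deriv (by ring)
      · simp only [jetSeq_succ_of_ne hhe]
        exact ih.hasDerivAt_space h (by omega) j t ht x
    · have hhe : h ≠ n + m := by omega
      simp only [jetSeq_succ_of_ne hhe]
      by_cases hhl : h = n + (m - 1)
      · have e1 : h + 1 = n + m := by omega
        rw [e1, hrow, hhl]
        refine (hlast j t ht x).congr_deriv ?_
        have e2 : n + m = n + (m - 1) + 1 := by omega
        have e3 : ((n + (m - 1) : ℕ) : ℝ) + 1 ≠ 0 := by positivity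
        rw [e2, Nat.factorial_succ, Nat.cast_mul, Nat.cast_succ]
        field_simp
      · rw [jetSeq_succ_of_ne (by omega)]
        exact ih.hasDerivAt_time h (by omega) j t ht x

/-- A row is never modified after it has been defined, so taking row `h` from stage `h` gives a
single infinite jet. -/
theorem JetConstants.exists_isJet (J : JetConstants m T a c A α M R S) (hT : 0 < T)
    (ha : ∀ k ∈ Finset.Icc 1 m, AnalyticOn ℝ (a k) (Icc 0 T)) {d : ℝ → ℝ → ℕ → ℕ → ℝ}
    (hd : IsJet T (m - 1) d) (hdM : ∀ t ∈ Icc 0 T, ∀ x h j, |d t x h j| ≤ M * jetWeight R S h j)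
    (heq : ∀ j, ∀ t ∈ Ioo 0 T, ∀ x, HasDerivAt (fun s => d s x (m - 1) j)
      (rhsJet m T a c t (d t x) 0 j / (m - 1)!) t) :
    ∃ e : ℝ → ℝ → ℕ → ℕ → ℝ, (∀ n, IsJet T n e) ∧ (∀ t x, e t x 0 0 = d t x 0 0) ∧
      ∀ t ∈ Icc 0 T, ∀ x h j, |e t x h j| ≤ M * jetWeight R S h j := by
  refine ⟨fun t x h j => jetSeq m T a c d h t x h j, fun n => ?_, fun t x => rfl,
    fun t ht x h j => J.abs_jetSeq_le hdM h t ht x h j⟩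
  refine ((J.isJet_jetSeq hT ha hd hdM heq n).mono (Nat.le_add_right _ _)).congr ?_
  exact fun t x h hh j => (jetSeq_eq_of_le J.one_le hh t x j).symm

end Recursion

/-! ### Analyticity of solutions -/

section Analyticity

/-- Expand every row in `x` at the fixed time `t₀`, then expand in `t` at the shifted point.
Absolute summability merges the iterated sums into one double series; one-sided expansions cover `t₀
= 0` and `t₀ = T`. -/
theorem analyticOn_of_isJet {T M Q : ℝ} (hQ : 0 < Q) {e : ℝ → ℝ → ℕ → ℕ → ℝ}
    (he : ∀ n, IsJet T n e)
    (hb : ∀ t ∈ Icc 0 T, ∀ x h j, |e t x h j| ≤ M * Q ^ (h + j)) :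
    AnalyticOn ℝ (fun p : ℝ × ℝ => e p.1 p.2 0 0) (Icc 0 T ×ˢ univ) := by
  rintro ⟨t₀, x₀⟩ ⟨ht₀ : t₀ ∈ Icc 0 T, -⟩
  refine analyticWithinAt_of_hasSum (c := e t₀ x₀) (M := M) (ρ := Q) (δ := 1 / Q)
    ⟨ht₀, mem_univ _⟩ hQ (by positivity) (hb t₀ ht₀ x₀) ?_
  rintro ⟨y₁, y₂⟩ ⟨hy, -⟩ hy₁ hy₂
  have ht₁ : t₀ + y₁ ∈ Icc 0 T := hy
  replace hy₁ : Q * |y₁| < 1 := by rw [mul_comm]; exact (lt_div_iff₀ hQ).1 hy₁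
  replace hy₂ : Q * |y₂| < 1 := by rw [mul_comm]; exact (lt_div_iff₀ hQ).1 hy₂
  have hM : 0 ≤ M := by
    have := hb t₀ ht₀ x₀ 0 0
    simp only [add_zero, pow_zero, mul_one] at this
    exact (abs_nonneg _).trans this
  have hspace : ∀ h, HasSum (fun j => e t₀ x₀ h j * y₂ ^ j) (e t₀ (x₀ + y₂) h 0) := fun h => by
    have := hasSum_taylor (e := fun j x => e t₀ x h j) (a := x₀) (b := x₀ + y₂) (K := M * Q ^ h)
      (ρ := Q)
      (fun j x _ => ((he h).hasDerivAt_space h le_rfl j t₀ ht₀ x).continuousAt.continuousWithinAt)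
      (fun j x _ => (he h).hasDerivAt_space h le_rfl j t₀ ht₀ x)
      (fun j x _ => (hb t₀ ht₀ x h j).trans (le_of_eq (by rw [pow_add]; ring))) hQ.le
      (by rwa [add_sub_cancel_left])
    simpa only [add_sub_cancel_left] using this
  have hsub : uIcc t₀ (t₀ + y₁) ⊆ Icc 0 T := ordConnected_Icc.uIcc_subset ht₀ ht₁
  have htime : HasSum (fun h => e t₀ (x₀ + y₂) h 0 * y₁ ^ h) (e (t₀ + y₁) (x₀ + y₂) 0 0) := by
    have := hasSum_taylor (e := fun h t => e t (x₀ + y₂) h 0) (a := t₀) (b := t₀ + y₁) (K := M)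
      (ρ := Q)
      (fun h => ((he h).continuousOn h le_rfl 0).comp (f := fun t => (t, x₀ + y₂))
        (Continuous.continuousOn (by fun_prop)) fun t ht => ⟨hsub ht, mem_univ _⟩)
      (fun h t ht => (he (h + 1)).hasDerivAt_time h (Nat.lt_succ_self h) 0 t
        ⟨(le_min ht₀.1 ht₁.1).trans_lt ht.1, ht.2.trans_le (max_le ht₀.2 ht₁.2)⟩ _)
      (fun h t ht => hb t (hsub ht) _ h 0) hQ.le (by rwa [add_sub_cancel_left])
    simpa only [add_sub_cancel_left] using this
  have hsum : Summable fun q : ℕ × ℕ => e t₀ x₀ q.1 q.2 * (y₁ ^ q.1 * y₂ ^ q.2) := by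
    have h1 := ((summable_geometric_of_lt_one (by positivity) hy₁).mul_of_nonneg
      (summable_geometric_of_lt_one (by positivity) hy₂) (fun _ => by positivity)
      fun _ => by positivity).mul_left M
    refine .of_norm_bounded h1 fun q => ?_
    rw [Real.norm_eq_abs, abs_mul, abs_mul, abs_pow, abs_pow]
    calc _ ≤ M * Q ^ (q.1 + q.2) * (|y₁| ^ q.1 * |y₂| ^ q.2) :=
          mul_le_mul_of_nonneg_right (hb t₀ ht₀ x₀ _ _) (by positivity)
      _ = _ := by rw [mul_pow, mul_pow, pow_add]; ring
  have h2 := hsum.hasSum.prod_fiberwise fun h => by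
    have := (hspace h).mul_left (y₁ ^ h)
    refine this.congr_fun fun j => ?_
    ring
  have h3 : HasSum (fun h => y₁ ^ h * e t₀ (x₀ + y₂) h 0) (e (t₀ + y₁) (x₀ + y₂) 0 0) := by
    simpa only [mul_comm] using htime
  have h4 := h2.unique h3
  have h5 := hsum.hasSum
  rw [h4] at h5
  exact h5

theorem jetWeight_le {R S : ℝ} (hS : 0 ≤ S) (hSR : S ≤ R) (h j : ℕ) :
    jetWeight R S h j ≤ (2 * R) ^ (h + j) := by
  have hR : 0 ≤ R := hS.trans hSR
  have h1 : ((h + j).choose h : ℝ) / ((h + j : ℕ) + 1) ^ 2 ≤ 2 ^ (h + j) := by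
    refine (div_le_self (by positivity) (one_le_pow₀ (le_add_of_nonneg_left (Nat.cast_nonneg _)))).trans ?_
    exact_mod_cast Nat.choose_le_two_pow _ _
  calc jetWeight R S h j ≤ R ^ h * R ^ j * 2 ^ (h + j) :=
        mul_le_mul (mul_le_mul_of_nonneg_left (pow_le_pow_left₀ hS hSR _) (by positivity)) h1
          (by positivity) (by positivity)
    _ = _ := by rw [mul_pow, pow_add R]; ring

/-- The quadratic denominator is at most `4^(h + j)`. The part `4^j` is absorbed by taking `S = 4
Λ`, while `4^h` is harmless for the finitely many initial rows. -/
theorem geometric_le_jetWeight {Λ R : ℝ} (hΛ : 0 ≤ Λ) (hR : 1 ≤ R) (h j : ℕ) :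
    Λ ^ j ≤ 4 ^ h * jetWeight R (4 * Λ) h j := by
  have h1 : (((h + j : ℕ) : ℝ) + 1) ^ 2 ≤ 4 ^ (h + j) := by
    have h2 : (((h + j : ℕ) : ℝ) + 1) ≤ 2 ^ (h + j) := by
      exact_mod_cast (Nat.lt_two_pow_self : h + j < 2 ^ (h + j))
    calc _ ≤ ((2 : ℝ) ^ (h + j)) ^ 2 := pow_le_pow_left₀ (by positivity) h2 2
      _ = _ := by rw [← pow_mul, mul_comm, pow_mul]; norm_num
  have h3 : (1 : ℝ) ≤ (h + j).choose h := by
    exact_mod_cast Nat.choose_pos (Nat.le_add_right h j)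
  rw [jetWeight, mul_pow]
  have e1 : (4 : ℝ) ^ h * (R ^ h * (4 ^ j * Λ ^ j)
      * ((h + j).choose h / (((h + j : ℕ) : ℝ) + 1) ^ 2))
      = Λ ^ j * (R ^ h * (h + j).choose h * (4 ^ (h + j) / (((h + j : ℕ) : ℝ) + 1) ^ 2)) := by
    rw [pow_add]; ring
  rw [e1]
  refine le_mul_of_one_le_right (by positivity) ?_
  exact one_le_mul_of_one_le_of_one_le (one_le_mul_of_one_le_of_one_le (one_le_pow₀ hR) h3)
    ((one_le_div (by positivity)).2 h1)

theorem HasIntegrableDerivs.abs_iteratedDeriv_le {g : ℝ → ℝ} (hg : HasIntegrableDerivs g)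
    {ρ : ℝ} (hρ : 0 < ρ) {B : ℝ≥0∞} (hB : B < ⊤)
    (hdec : ∫⁻ ξ : ℝ, ENNReal.ofReal (Real.exp (ρ * |ξ|) * ‖ft g ξ‖) ≤ B) (j : ℕ) (x : ℝ) :
    |iteratedDeriv j g x| ≤ B.toReal * (j ! * (2 * Real.pi / ρ) ^ j) := by
  have hgj := hg.of_iteratedDeriv j
  have hInt : Integrable fun ξ => Real.exp (ρ * |ξ|) * ‖ft g ξ‖ := by
    refine ⟨Continuous.aestronglyMeasurable ?_, ?_⟩
    · have := continuous_ft hg.integrable_self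
      fun_prop
    · rw [hasFiniteIntegral_iff_ofReal (Eventually.of_forall fun ξ => by positivity)]
      exact hdec.trans_lt hB
  have h1 : ∫ ξ, Real.exp (ρ * |ξ|) * ‖ft g ξ‖ ≤ B.toReal := by
    rw [integral_eq_lintegral_of_nonneg_ae (Eventually.of_forall fun ξ => by positivity)
      hInt.aestronglyMeasurable]
    exact ENNReal.toReal_mono hB.ne hdec
  refine (abs_le_integral_norm_ft hgj.continuous hgj.integrable_self hgj.integrable_ft x).trans ?_
  calc ∫ ξ, ‖ft (iteratedDeriv j g) ξ‖
      ≤ ∫ ξ, (j ! * (2 * Real.pi / ρ) ^ j) * (Real.exp (ρ * |ξ|) * ‖ft g ξ‖) := by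
        refine integral_mono hgj.integrable_ft.norm (hInt.const_mul _) fun ξ => ?_
        simp only
        rw [norm_ft_iteratedDeriv hg, ← mul_assoc]
        refine mul_le_mul_of_nonneg_right ?_ (norm_nonneg _)
        have h2 := Real.pow_div_factorial_le_exp (ρ * |ξ|) (by positivity) j
        rw [div_le_iff₀ (by positivity)] at h2
        calc (2 * Real.pi * |ξ|) ^ j = (2 * Real.pi / ρ) ^ j * (ρ * |ξ|) ^ j := by
              rw [← mul_pow]; congr 1; field_simp
          _ ≤ (2 * Real.pi / ρ) ^ j * (Real.exp (ρ * |ξ|) * j !) :=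
              mul_le_mul_of_nonneg_left h2 (by positivity)
          _ = _ := by ring
    _ = (j ! * (2 * Real.pi / ρ) ^ j) * ∫ ξ, Real.exp (ρ * |ξ|) * ‖ft g ξ‖ :=
        integral_const_mul _ _
    _ ≤ (j ! * (2 * Real.pi / ρ) ^ j) * B.toReal :=
        mul_le_mul_of_nonneg_left h1 (by positivity)
    _ = _ := by ring

/-- `M` and `S` come from the initial rows, whose bound holds for every `R ≥ 1`. Hence `R` can be
chosen last, as large as all the conditions require. -/
theorem exists_jetConstants {m : ℕ} {T : ℝ} {a : ℕ → ℝ → ℝ} {c : ℕ → ℝ} {f : ℝ → ℝ} {M S : ℝ}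
    (hm : 1 ≤ m) (hT : 0 < T) (ha : ∀ k ∈ Finset.Icc 1 m, AnalyticOn ℝ (a k) (Icc 0 T))
    (hf : ∀ y, HasSum (fun ν => c ν * y ^ ν) (f y)) (hM : 0 < M) (hS : 0 ≤ S) :
    ∃ A α R, JetConstants m T a c A α M R S := by
  have h1 : ∀ k, ∃ A α : ℝ, 0 ≤ A ∧ 0 ≤ α ∧ (k ∈ Finset.Icc 1 m → ∀ t ∈ Icc 0 T, ∀ i : ℕ,
      |iteratedDerivWithin i (a k) (Icc 0 T) t / i !| ≤ A * α ^ i) := fun k => by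
    by_cases hk : k ∈ Finset.Icc 1 m
    · obtain ⟨A, α, hA, hα, h⟩ := exists_abs_iteratedDerivWithin_le hT (ha k hk)
      exact ⟨A, α, hA, hα, fun _ => h⟩
    · exact ⟨0, 0, le_rfl, le_rfl, fun h => absurd h hk⟩
  choose A α hA hα h using h1
  have hsum : Summable fun ν => |c (ν + 1)| * (M ^ (ν + 1) * 8 ^ ν) := by
    have h2 := (summable_abs_coeff hf (r := 8 * M) (by positivity)).mul_left M
    refine .of_nonneg_of_le (fun ν => by positivity) (fun ν => ?_) h2
    calc |c (ν + 1)| * (M ^ (ν + 1) * 8 ^ ν) = M * (|c (ν + 1)| * (1 * (8 * M) ^ ν)) := by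
          rw [mul_pow, pow_succ]; ring
      _ ≤ M * (|c (ν + 1)| * (((ν : ℝ) + 1) * (8 * M) ^ ν)) := by
          gcongr
          linarith [(by positivity : (0 : ℝ) ≤ ν)]
  set A' := ∑ k ∈ Finset.Icc 1 m, A k with hA'
  set α' := ∑ k ∈ Finset.Icc 1 m, α k with hα'
  have hA0 : 0 ≤ A' := Finset.sum_nonneg fun k _ => hA k
  have hα0 : 0 ≤ α' := Finset.sum_nonneg fun k _ => hα k
  set Φ := ((m : ℝ) + 1) ^ 2 * ∑' ν, |c (ν + 1)| * (M ^ (ν + 1) * 8 ^ ν) with hΦ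
  have hΦ0 : 0 ≤ Φ := mul_nonneg (by positivity) (tsum_nonneg fun ν => by positivity)
  have hα8 : 0 ≤ 8 * α' := by positivity
  have hlin : 0 ≤ 4 * m * A' * S := by positivity
  have hΦM : 0 ≤ 2 * Φ / M := by positivity
  refine ⟨A', α', 1 + 8 * α' + S + 4 * m * A' * S + 2 * Φ / M,
    ⟨hm, hA0, hα0, hM, hS, by linarith, fun k hk t ht i => ?_, hsum, by linarith, by linarith,
      by linarith, ?_⟩⟩
  · refine (h k hk t ht i).trans (mul_le_mul ?_ (pow_le_pow_left₀ (hα k) ?_ i)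
      (pow_nonneg (hα k) i) hA0)
    · exact Finset.single_le_sum (fun k _ => hA k) hk
    · exact Finset.single_le_sum (fun k _ => hα k) hk
  · rw [← hΦ]
    have h3 : M * (2 * Φ / M) = 2 * Φ := by field_simp
    nlinarith [mul_nonneg hM.le (by linarith : 0 ≤ 1 + 8 * α' + S + 4 * m * A' * S)]

variable {m : ℕ} {T : ℝ} {a : ℕ → ℝ → ℝ} {f : ℝ → ℝ} {c : ℕ → ℝ} {u : ℝ → ℝ → ℝ}

/-- The normalized derivatives of `u` of order less than `m` in time. -/
noncomputable def baseJet (m : ℕ) (T : ℝ) (u : ℝ → ℝ → ℝ) (t x : ℝ) (h j : ℕ) : ℝ :=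
  if h < m then mixedDeriv T u h j t x / (h ! * j !) else 0

theorem Setting.abs_baseJet_le (S : Setting m T a f c u) {ρ : ℝ} (hρ : 0 < ρ) {B : ℝ≥0∞}
    (hB : B < ⊤) (hdec : ∀ t ∈ Icc 0 T, ExpDecayAt m T u ρ B t) {R : ℝ} (hR : 1 ≤ R) :
    ∀ t ∈ Icc 0 T, ∀ x h j, |baseJet m T u t x h j|
      ≤ (B.toReal + 1) * 4 ^ m * jetWeight R (4 * (2 * Real.pi / ρ)) h j := by
  intro t ht x h j
  have hW := jetWeight_nonneg (R := R) (S := 4 * (2 * Real.pi / ρ)) (by linarith) (by positivity)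
    h j
  unfold baseJet
  split_ifs with hh
  · have h1 := (S.nice hh ht).abs_iteratedDeriv_le hρ hB (hdec t ht h hh) j x
    have h2 := geometric_le_jetWeight (Λ := 2 * Real.pi / ρ) (by positivity) hR h j
    have h3 : (1 : ℝ) ≤ h ! := by exact_mod_cast Nat.factorial_pos h
    rw [abs_div, abs_of_nonneg (by positivity : (0 : ℝ) ≤ h ! * j !), div_le_iff₀ (by positivity)]
    calc _ ≤ B.toReal * (j ! * (2 * Real.pi / ρ) ^ j) := h1
      _ ≤ (B.toReal + 1) * (j ! * (4 ^ m * jetWeight R (4 * (2 * Real.pi / ρ)) h j)) := by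
          refine mul_le_mul (by linarith) (mul_le_mul_of_nonneg_left (h2.trans ?_) (by positivity))
            (by positivity) (by positivity)
          exact mul_le_mul_of_nonneg_right (pow_le_pow_right₀ (by norm_num) hh.le) hW
      _ = (B.toReal + 1) * 4 ^ m * jetWeight R (4 * (2 * Real.pi / ρ)) h j * (1 * j !) := by ring
      _ ≤ _ := by
          refine mul_le_mul_of_nonneg_left ?_ (by positivity)
          exact mul_le_mul_of_nonneg_right h3 (by positivity)
  · rw [abs_zero]; positivity

theorem Setting.hasDerivAt_baseJet_space (S : Setting m T a f c u) {h : ℕ} (hh : h < m) (j : ℕ)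
    {t : ℝ} (ht : t ∈ Icc 0 T) (x : ℝ) :
    HasDerivAt (fun y => baseJet m T u t y h j) ((j + 1) * baseJet m T u t x h (j + 1)) x := by
  simp only [baseJet, if_pos hh]
  have h1 : HasDerivAt (iteratedDeriv j (timeDeriv T u h t))
      (iteratedDeriv (j + 1) (timeDeriv T u h t) x) x := by
    rw [iteratedDeriv_succ]
    exact ((S.solution.contDiff_space h hh t ht).differentiable_iteratedDeriv j
      (by exact_mod_cast ENat.natCast_lt_top j) x).hasDerivAt
  refine (h1.div_const _).congr_deriv ?_
  rw [mixedDeriv, Nat.factorial_succ]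
  push_cast
  field_simp

theorem Setting.continuousOn_baseJet (S : Setting m T a f c u) {h : ℕ} (hh : h < m) (j : ℕ) :
    ContinuousOn (fun p : ℝ × ℝ => baseJet m T u p.1 p.2 h j) (Icc 0 T ×ˢ univ) := by
  simp only [baseJet, if_pos hh]
  exact (S.solution.continuous_mixed h hh j).div_const _

theorem Setting.isJet_baseJet (S : Setting m T a f c u) {W : ℕ → ℕ → ℝ}
    (hW : ∀ t ∈ Icc 0 T, ∀ x h j, |baseJet m T u t x h j| ≤ W h j) :
    IsJet T (m - 1) (baseJet m T u) where
  continuousOn h hh j := S.continuousOn_baseJet (by have := S.one_le; omega) j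
  hasDerivAt_space h hh j t ht x := S.hasDerivAt_baseJet_space (by have := S.one_le; omega) j ht x
  hasDerivAt_time h hh j t ht x := by
    have hh' : h + 1 < m := by omega
    refine hasDerivAt_time_of_space_jet (d := fun j t x => baseJet m T u t x h j)
      (e := fun j t x => ((h : ℝ) + 1) * baseJet m T u t x (h + 1) j)
      (K := fun j => ((h : ℝ) + 1) * W (h + 1) j)
      (fun j => continuousOn_const.mul (S.continuousOn_baseJet hh' j))
      (fun j t ht x => S.hasDerivAt_baseJet_space (by omega) j ht x)
      (fun j t ht x => ((S.hasDerivAt_baseJet_space hh' j ht x).const_mul _).congr_deriv (by ring))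
      (fun j t ht x => ?_) (fun t ht x => ?_) j ht x
    · rw [abs_mul, abs_of_nonneg (by positivity)]
      exact mul_le_mul_of_nonneg_left (hW t ht x _ _) (by positivity)
    · simp only [baseJet, if_pos hh', if_pos (Nat.lt_of_succ_lt hh'), mixedDeriv_zero]
      have h1 := ((S.solution.hasDerivWithinAt S.pos (Nat.lt_of_succ_lt hh')
        (Ioo_subset_Icc_self ht) x).hasDerivAt (Icc_mem_nhds ht.1 ht.2)).div_const
          ((h ! : ℝ) * (0 ! : ℕ))
      refine h1.congr_deriv ?_
      rw [Nat.factorial_succ]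
      push_cast
      field_simp

theorem convPow_zero_zero (D : ℕ → ℕ → ℝ) (ν : ℕ) : convPow D ν 0 0 = D 0 0 ^ (ν + 1) := by
  induction ν with
  | zero => simp [convPow]
  | succ ν ih =>
    rw [pow_succ', ← ih]
    simp [convPow, conv]

theorem Setting.rhsJet_baseJet (S : Setting m T a f c u) {t : ℝ} (ht : t ∈ Icc 0 T) (x : ℝ) :
    rhsJet m T a c t (baseJet m T u t x) 0 0 = timeDeriv T u m t x := by
  have hm : 0 < m := S.one_le
  rw [eq_sub_of_add_eq (S.solution.equation t ht x), rhsJet]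
  congr 1
  · have h1 : baseJet m T u t x 0 0 = u t x := by
      simp [baseJet, hm, mixedDeriv_zero, timeDeriv_zero]
    simp only [convPow_zero_zero, h1]
    have h2 := S.hasSum (u t x)
    rw [← hasSum_nat_add_iff' 1] at h2
    simpa [S.coeff_zero] using h2.tsum_eq
  · refine Finset.sum_congr rfl fun k hk => ?_
    rw [Finset.mem_Icc] at hk
    rw [conv_timeJet]
    simp only [Finset.HasAntidiagonal.antidiagonal_zero, Finset.sum_singleton, iteratedDerivWithin_zero, baseJet,
      Nat.factorial_zero, Nat.cast_one, div_one, zero_add, if_pos (by omega : m - k < m)]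
    field_simp

/-- The equation gives the time derivative of the last initial row only for `j = 0`. Space
smoothness of the right side and the interchange of derivatives extend it to all `j`. -/
theorem Setting.hasDerivAt_baseJet_last (S : Setting m T a f c u) {A α M R S' : ℝ}
    (J : JetConstants m T a c A α M R S')
    (ha : ∀ k ∈ Finset.Icc 1 m, AnalyticOn ℝ (a k) (Icc 0 T))
    (hb : ∀ t ∈ Icc 0 T, ∀ x h j, |baseJet m T u t x h j| ≤ M * jetWeight R S' h j) (j : ℕ)
    {t : ℝ} (ht : t ∈ Ioo 0 T) (x : ℝ) :
    HasDerivAt (fun s => baseJet m T u s x (m - 1) j)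
      (rhsJet m T a c t (baseJet m T u t x) 0 j / (m - 1)!) t := by
  have hm : m - 1 < m := by have := S.one_le; omega
  have hP : IsJet T 0 fun t x => rhsJet m T a c t (baseJet m T u t x) :=
    J.isJet_rhsJet S.pos ha (by rw [zero_add]; exact S.isJet_baseJet hb) hb
  refine hasDerivAt_time_of_space_jet (d := fun j t x => baseJet m T u t x (m - 1) j)
    (e := fun j t x => rhsJet m T a c t (baseJet m T u t x) 0 j / (m - 1)!)
    (K := fun j => M * shiftWeight m R S' 0 j / (m - 1)!)
    (fun j => (hP.continuousOn 0 le_rfl j).div_const _)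
    (fun j t ht x => S.hasDerivAt_baseJet_space hm j ht x)
    (fun j t ht x => ((hP.hasDerivAt_space 0 le_rfl j t ht x).div_const _).congr_deriv (by ring))
    (fun j t ht x => ?_) (fun t ht x => ?_) j ht x
  · rw [abs_div, abs_of_nonneg (by positivity : (0 : ℝ) ≤ (m - 1)!)]
    exact div_le_div_of_nonneg_right (J.abs_rhsJet_le (hb t ht x) ht 0 j) (by positivity)
  · simp only [baseJet, if_pos hm, mixedDeriv_zero, Nat.factorial_zero, Nat.cast_one, mul_one]
    have h1 := ((S.solution.hasDerivWithinAt S.pos hm (Ioo_subset_Icc_self ht) x).hasDerivAt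
      (Icc_mem_nhds ht.1 ht.2)).div_const ((m - 1)! : ℝ)
    rw [Nat.sub_add_cancel S.one_le, ← S.rhsJet_baseJet (Ioo_subset_Icc_self ht) x] at h1
    exact h1

theorem Setting.analyticOn (S : Setting m T a f c u)
    (ha : ∀ k ∈ Finset.Icc 1 m, AnalyticOn ℝ (a k) (Icc 0 T)) {ρ : ℝ} (hρ : 0 < ρ) {B : ℝ≥0∞}
    (hB : B < ⊤) (hdec : ∀ t ∈ Icc 0 T, ExpDecayAt m T u ρ B t) :
    AnalyticOn ℝ (fun p : ℝ × ℝ => u p.1 p.2) (Icc 0 T ×ˢ univ) := by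
  have hM : 0 < (B.toReal + 1) * 4 ^ m := by positivity
  obtain ⟨A, α, R, J⟩ := exists_jetConstants (S := 4 * (2 * Real.pi / ρ)) S.one_le S.pos ha
    S.hasSum hM (by positivity)
  have hb := S.abs_baseJet_le hρ hB hdec J.one_le_R
  obtain ⟨e, he, he0, heb⟩ := J.exists_isJet S.pos ha (S.isJet_baseJet hb) hb
    fun j t ht x => S.hasDerivAt_baseJet_last J ha hb j ht x
  have hR0 : 0 < R := by linarith [J.one_le_R]
  refine (analyticOn_of_isJet (Q := 2 * R) (M := (B.toReal + 1) * 4 ^ m) (by positivity) he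
    fun t ht x h j => (heb t ht x h j).trans ?_).congr fun p _ => ?_
  · exact mul_le_mul_of_nonneg_left (jetWeight_le J.S_nonneg J.S_le h j) hM.le
  · have hm : 0 < m := S.one_le
    simp [he0, baseJet, hm, mixedDeriv_zero, timeDeriv_zero]

end Analyticity

end SemilinearHyperbolic

theorem theorem1 (m : ℕ) (hm : 1 ≤ m) (T : ℝ) (hT : 0 < T)
    (a : ℕ → ℝ → ℝ) (ha : ∀ k ∈ Finset.Icc 1 m, AnalyticOn ℝ (a k) (Set.Icc 0 T))
    (f : ℝ → ℝ) (hf : SemilinearHyperbolic.IsRealEntire f)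
    (lam : Fin m → ℝ → ℝ) (hlam : SemilinearHyperbolic.AreCharRoots m T a lam)
    (M : ℝ)
    (hM : ∀ t ∈ Set.Icc 0 T, ∀ i j : Fin m, i ≠ j →
      lam i t ^ 2 + lam j t ^ 2 ≤ M * (lam i t - lam j t) ^ 2)
    (u : ℝ → ℝ → ℝ) (hu : SemilinearHyperbolic.IsSolution m T a f u)
    (hbound : ∀ h < m, ∀ j : ℕ, ∃ K : ℝ, ∀ t ∈ Set.Icc 0 T,
      MeasureTheory.Integrable (SemilinearHyperbolic.mixedDeriv T u h j t) ∧
      (∫ x : ℝ, |SemilinearHyperbolic.mixedDeriv T u h j t x|) ≤ K)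
    (hdata : ∀ h < m, SemilinearHyperbolic.InAL2 (SemilinearHyperbolic.timeDeriv T u h 0)) :
    SemilinearHyperbolic.IsCkAL2 (m - 1) T u ∧
      AnalyticOn ℝ (fun p : ℝ × ℝ => u p.1 p.2) (Set.Icc 0 T ×ˢ Set.univ) := by
  obtain ⟨c, hc⟩ := hf
  have S : SemilinearHyperbolic.Setting m T a f c u :=
    ⟨hm, hT, fun k hk => (ha k hk).continuousOn, hc, hu, hbound⟩
  obtain ⟨ρ, hρ, B, hB, hdec⟩ := S.exists_expDecayAt ha hlam hM hdata
  obtain ⟨B', hB', hdec'⟩ := S.exists_expDecayAt_succ hρ hB hdec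
  exact ⟨S.isCkAL2 (half_pos hρ) hB' hdec', S.analyticOn ha hρ hB hdec⟩
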